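/- Work over $\mathbb C$. Let $R,R'\in M_n(\mathbb C)\otimes M_n(\mathbb C)$ be invertible, with $R$ obeying the Yang–Baxter equation $R_{12}R_{13}R_{23}=R_{23}R_{13}R_{12}$, and, with $P$ the permutation matrix, (i) $R_{12}R_{13}R'_{23}=R'_{23}R_{13}R_{12}$, $R_{23}R_{13}R'_{12}=R'_{12}R_{13}R_{23}$; (ii) $(PR+1)(PR'-1)=0$; (iii) $R_{21}R'_{12}=R'_{21}R_{12}$. Let $A$ be a dual quasitriangular Hopf algebra generated as an algebra by a matrix $\mathbf t=(t^i{}_j)$ with $\Delta t^i{}_j=\sum_a t^i{}_a\otimes t^a{}_j$, $\epsilon(t^i{}_j)=\delta^i_j$, $R_{12}\mathbf t_1\mathbf t_2=\mathbf t_2\mathbf t_1R_{12}$ and $R'_{12}\mathbf t_1\mathbf t_2=\mathbf t_2\mathbf t_1R'_{12}$, whose dual quasitriangular structure satisfies $\mathcal R(\mathbf t_1\otimes\mathbf t_2)=\lambda R_{12}$ for a constant $\lambda\ne0$. Let $\tilde A=A\otimes\mathbb C\mathbb Z$ be its extension by a central invertible group-like element $g$, with the tensor product dual quasitriangular structure,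 where $\mathcal R(g^a\otimes g^b)=\lambda^{-ab}$. Let $V^*(R')$ be the algebra with generators $x_i$ and relations $\mathbf x_1\mathbf x_2=\mathbf x_2\mathbf x_1R'_{12}$, with the right coaction $\mathbf x\mapsto\mathbf x\,\mathbf t g$ of $\tilde A$, the right action $v\triangleleft a=v^{(1)}\mathcal R(v^{(2)}\otimes a)$ (where $v^{(1)}\otimes v^{(2)}$ denotes the coaction), and the braided coproduct $\underline\Delta\mathbf x=\mathbf x\otimes1+1\otimes\mathbf x$, $\underline\epsilon(\mathbf x)=0$, extended as algebra maps, $\underline\Delta$ with respect to the braiding $\Psi(v\otimes w)=w^{(1)}\otimes v^{(1)}\mathcal R(v^{(2)}\otimes w^{(2)})$. Let $\mathcal P=V^*(R')\rtimes\tilde A$ be the $q$-Poincaré group: the bialgebra generated by the algebra $\tilde A$ and by $p_i$ with $\mathbf p_1\mathbf p_2=\mathbf p_2\mathbf p_1R'_{12}$, $\mathbf p g=\lambda^{-1}g\mathbf p$, $\mathbf p_1\mathbf t_2=\lambda\mathbf t_2\mathbf p_1R_{12}$, $\Delta\mathbf p=\mathbf p\otimes\mathbf tg+1\otimes\mathbf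 p$, $\epsilon(\mathbf p)=0$, and with the coproduct of $\tilde A$. For a Hopf algebra $H$ let $H^\circ$ denote its finite dual, the bialgebra of all linear functionals on $H$ that vanish on a two-sided ideal of finite codimension, with structure maps transposed to those of $H$. Put $\tilde H=\tilde A^\circ$. Then $\mathcal P$ is a Hopf algebra and, via $a\otimes v\mapsto av$, it is a right-handed semidirect product of $\tilde A$ and $V^*(R')$ by the above action and coaction, as an algebra and as a coalgebra. Its dual is a Hopf algebra which is again such a semidirect product, $$\mathcal P^\circ=B\rtimes\tilde H,$$ as an algebra and as a coalgebra. Here $B$ is an algebra and coalgebra dual to $V^*(R')$: there is a pairing $\langle\ ,\ \rangle:B\times V^*(R')\to\mathbb C$, non-degenerate on both sides, for which the product, unit, coproduct, counit of $B$ are the transposes of the coproduct, counit, product, unit of $V^*(R')$, the action and coaction of $\tilde H$ on $B$ are the transposes of the coaction and action of $\tilde A$ on $V^*(R')$, and $\langle hb,av\rangle=\langle h,a\rangle\langle b,v\rangle$ for $h\in\tilde H$, $b\in B$, $a\in\tilde A$, $v\in V^*(R')$. As a space of functionals, $B$ consists of all functionals on $V^*(R')$ that vanish on a two-sided ideal of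 finite codimension stable under the action of $\tilde A$. It contains the graded dual of $V^*(R')$ (the functionals vanishing in all large degrees), and is equal to it if $\lambda$ is not a root of unity. The mirror-image statement holds for the left-handed $q$-Poincaré group, which is generated by $\tilde A$ and $p^i$ with $R'_{12}\mathbf p_1\mathbf p_2=\mathbf p_2\mathbf p_1$, $g\mathbf p=\lambda^{-1}\mathbf pg$, $\mathbf t_2\mathbf p_1=\lambda R_{12}\mathbf p_1\mathbf t_2$ and $\Delta\mathbf p=\mathbf tg\otimes\mathbf p+\mathbf p\otimes1$, and is built from the algebra with generators $x^i$ and relations $R'_{12}\mathbf x_1\mathbf x_2=\mathbf x_2\mathbf x_1$ with left coaction $\mathbf x\mapsto\mathbf tg\otimes\mathbf x$. In particular this applies to $A=SO_q(1,3)$ for all $q\neq0$. Let $R_q$ be the $R$-matrix of $SL_q(2)$, with $\hat R=PR_q$ having eigenvalues $q,-q^{-1}$; let $SL_q(2)\bowtie SL_q(2)$ be generated by two copies of $SL_q(2)$, with matrix generators $\mathbf t,\mathbf s$, and cross relations $R_{q\,12}\mathbf s_1\mathbf t_2=\mathbf t_2\mathbf s_1R_{q\,12}$; let $SO_q(1,3)$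 be its subalgebra generated by the matrix entries $\Lambda^{(i_0,i_1)}{}_{(j_0,j_1)}=t^{i_0}{}_{j_0}s^{i_1}{}_{j_1}$; let $PR=\hat R_{23}^{-1}\hat R_{12}\hat R_{34}\hat R_{23}$, and $R'=P+\mu P(PR-q^{-2})(PR-q^2)$, where $\mu\ne0$ is such that $R'$ is invertible. Then $R$, $R'$, $SO_q(1,3)$ with matrix generator $\Lambda$, and $\lambda=q^{-1}$ are data as above for a suitable dual quasitriangular structure, so that with $\widetilde{U_q(so(1,3))}=\widetilde{SO_q(1,3)}^\circ$ the dual of the $q$-Poincaré group of $q$-Minkowski space is $U_q(p)=B\rtimes\widetilde{U_q(so(1,3))}$, and likewise in the left-handed version. -/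

import Mathlib

open scoped TensorProduct

noncomputable section

universe u

namespace QPoincare

section FiniteDual

open Coalgebra WithConv

/-- A linear functional on an algebra that vanishes on a two-sided ideal of finite codimension. -/
def IsFiniteFunctional {A : Type*} [Ring A] [Algebra ℂ A] (f : A →ₗ[ℂ] ℂ) : Prop :=
  ∃ I : Ideal A, I.IsTwoSided ∧ Module.Finite ℂ (A ⧸ I.restrictScalars ℂ) ∧ ∀ a ∈ I, f a = 0

theorem isFiniteFunctional_comp {A Q : Type*} [Ring A] [Algebra ℂ A] [Ring Q] [Algebra ℂ Q]
    [Module.Finite ℂ Q] (π : A →ₐ[ℂ] Q) (φ : Q →ₗ[ℂ] ℂ) :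
    IsFiniteFunctional (φ ∘ₗ π.toLinearMap) := by
  refine ⟨RingHom.ker π, inferInstance, ?_, ?_⟩
  · have e := π.toLinearMap.quotKerEquivRange
    have h : (RingHom.ker π).restrictScalars ℂ = LinearMap.ker π.toLinearMap := by
      ext x; simp
    rw [h]
    exact Module.Finite.equiv e.symm
  · intro a ha
    have : π a = 0 := ha
    simp [this]

theorem IsFiniteFunctional.exists_algHom {A : Type*} [Ring A] [Algebra ℂ A] {f : A →ₗ[ℂ] ℂ}
    (hf : IsFiniteFunctional f) :
    ∃ (I : Ideal A) (_ : I.IsTwoSided) (_ : Module.Finite ℂ (A ⧸ I)) (φ : (A ⧸ I) →ₗ[ℂ] ℂ),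
      f = φ ∘ₗ (Ideal.Quotient.mkₐ ℂ I).toLinearMap := by
  obtain ⟨I, hI, hfin, h⟩ := hf
  refine ⟨I, hI, ?_, (I.restrictScalars ℂ).liftQ f (fun a ha => h a ha), ?_⟩
  · exact hfin
  · ext a
    rfl

/-- The finite (Sweedler) dual of a bialgebra, as a subalgebra of its linear dual with the
convolution product `(f * g)(a) = f(a₍₁₎) g(a₍₂₎)` and unit the counit. -/
def finiteDual (A : Type*) [Ring A] [Bialgebra ℂ A] : Subalgebra ℂ (WithConv (A →ₗ[ℂ] ℂ)) where
  carrier := {f | IsFiniteFunctional f.ofConv}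
  mul_mem' := by
    intro f g hf hg
    obtain ⟨I, _, _, φ, hφ⟩ := hf.exists_algHom
    obtain ⟨J, _, _, ψ, hψ⟩ := hg.exists_algHom
    have h := isFiniteFunctional_comp
      ((Algebra.TensorProduct.map (Ideal.Quotient.mkₐ ℂ I) (Ideal.Quotient.mkₐ ℂ J)).comp
        (Bialgebra.comulAlgHom ℂ A)) (LinearMap.mul' ℂ ℂ ∘ₗ TensorProduct.map φ ψ)
    have e : (f * g).ofConv = (LinearMap.mul' ℂ ℂ ∘ₗ TensorProduct.map φ ψ) ∘ₗ
      ((Algebra.TensorProduct.map (Ideal.Quotient.mkₐ ℂ I) (Ideal.Quotient.mkₐ ℂ J)).comp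
        (Bialgebra.comulAlgHom ℂ A)).toLinearMap := by
      rw [LinearMap.convMul_def, hφ, hψ, TensorProduct.map_comp]
      rfl
    change IsFiniteFunctional _
    rw [e]; exact h
  one_mem' := by
    exact isFiniteFunctional_comp (Bialgebra.counitAlgHom ℂ A) LinearMap.id
  add_mem' := by
    intro f g hf hg
    obtain ⟨I, _, _, φ, hφ⟩ := hf.exists_algHom
    obtain ⟨J, _, _, ψ, hψ⟩ := hg.exists_algHom
    have h := isFiniteFunctional_comp
      (AlgHom.prod (Ideal.Quotient.mkₐ ℂ I) (Ideal.Quotient.mkₐ ℂ J)) (LinearMap.coprod φ ψ)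
    have e : (f + g).ofConv = (LinearMap.coprod φ ψ) ∘ₗ
      (AlgHom.prod (Ideal.Quotient.mkₐ ℂ I) (Ideal.Quotient.mkₐ ℂ J)).toLinearMap := by
      rw [ofConv_add, hφ, hψ]
      ext a
      simp
    change IsFiniteFunctional _
    rw [e]; exact h
  algebraMap_mem' := by
    intro c
    exact isFiniteFunctional_comp (Bialgebra.counitAlgHom ℂ A) (c • LinearMap.id)

/-- The finite dual `A°` of a bialgebra, as a type. -/
def FiniteDual (A : Type*) [Ring A] [Bialgebra ℂ A] : Type _ := finiteDual A

variable (A : Type*) [Ring A] [Bialgebra ℂ A]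

instance FiniteDual.instRing : Ring (FiniteDual A) := inferInstanceAs (Ring (finiteDual A))

instance FiniteDual.instAlgebra : Algebra ℂ (FiniteDual A) :=
  inferInstanceAs (Algebra ℂ (finiteDual A))

/-- The evaluation pairing of the finite dual with the bialgebra. -/
def FiniteDual.ev : FiniteDual A →ₗ[ℂ] (A →ₗ[ℂ] ℂ) where
  toFun f := f.1.ofConv
  map_add' _ _ := rfl
  map_smul' _ _ := rfl

/-- For linear functionals parametrised by `M` and `N`, the induced pairing of `M ⊗ N` with
`X ⊗ Y`: `⟨m ⊗ n, x ⊗ y⟩ = ⟨m, x⟩⟨n, y⟩`. -/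
def tensorPairing {M N X Y : Type*} [AddCommMonoid M] [Module ℂ M] [AddCommMonoid N] [Module ℂ N]
    [AddCommMonoid X] [Module ℂ X] [AddCommMonoid Y] [Module ℂ Y]
    (p : M →ₗ[ℂ] X →ₗ[ℂ] ℂ) (r : N →ₗ[ℂ] Y →ₗ[ℂ] ℂ) :
    M ⊗[ℂ] N →ₗ[ℂ] X ⊗[ℂ] Y →ₗ[ℂ] ℂ :=
  TensorProduct.dualDistrib ℂ X Y ∘ₗ TensorProduct.map p r

@[simp] theorem tensorPairing_tmul {M N X Y : Type*} [AddCommMonoid M] [Module ℂ M]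
    [AddCommMonoid N] [Module ℂ N]
    [AddCommMonoid X] [Module ℂ X] [AddCommMonoid Y] [Module ℂ Y]
    (p : M →ₗ[ℂ] X →ₗ[ℂ] ℂ) (r : N →ₗ[ℂ] Y →ₗ[ℂ] ℂ) (m : M) (n : N) (x : X) (y : Y) :
    tensorPairing p r (m ⊗ₜ n) (x ⊗ₜ y) = p m x * r n y := by
  simp [tensorPairing]

theorem tensorPairing_injective {M N X Y : Type*} [AddCommGroup M] [Module ℂ M]
    [AddCommGroup N] [Module ℂ N]
    [AddCommMonoid X] [Module ℂ X] [AddCommMonoid Y] [Module ℂ Y]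
    (p : M →ₗ[ℂ] X →ₗ[ℂ] ℂ) (r : N →ₗ[ℂ] Y →ₗ[ℂ] ℂ) (hp : Function.Injective p)
    (hr : Function.Injective r) : Function.Injective (tensorPairing p r) := by
  classical
  rw [injective_iff_map_eq_zero]
  intro z hz
  let b := Module.Basis.ofVectorSpace ℂ M
  obtain ⟨s, hs⟩ := (TensorProduct.equivFinsuppOfBasisLeft b).symm.surjective z
  have key : ∀ y : Y, ∑ i ∈ s.support, r (s i) y • b i = 0 := by
    intro y
    apply hp
    ext x
    have h : tensorPairing p r z (x ⊗ₜ[ℂ] y) = 0 := by rw [hz]; rfl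
    rw [← hs, TensorProduct.equivFinsuppOfBasisLeft_symm_apply, Finsupp.sum] at h
    simp only [map_sum, LinearMap.sum_apply, tensorPairing_tmul] at h
    simp only [map_sum, map_smul, LinearMap.sum_apply, LinearMap.smul_apply, smul_eq_mul,
      map_zero, LinearMap.zero_apply]
    rw [← h]
    exact Finset.sum_congr rfl fun i _ => mul_comm _ _
  have hz0 : s = 0 := by
    ext i
    by_cases hi : i ∈ s.support
    · apply hr
      ext y
      have := (linearIndependent_iff'.mp b.linearIndependent) s.support _ (key y) i hi
      simpa using this
    · simpa using hi
  rw [← hs, hz0, map_zero]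

theorem FiniteDual.ev_injective : Function.Injective (FiniteDual.ev A) := by
  intro f g h
  exact Subtype.ext (ofConv_injective h)

theorem FiniteDual.exists_comul (f : FiniteDual A) :
    ∃ z, tensorPairing (FiniteDual.ev A) (FiniteDual.ev A) z =
      FiniteDual.ev A f ∘ₗ LinearMap.mul' ℂ A := by
  obtain ⟨I, _, hI, φ, hφ⟩ := IsFiniteFunctional.exists_algHom f.2
  let ι₀ : Module.Dual ℂ (A ⧸ I) →ₗ[ℂ] FiniteDual A :=
    { toFun := fun ψ => ⟨toConv (ψ ∘ₗ (Ideal.Quotient.mkₐ ℂ I).toLinearMap),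
        isFiniteFunctional_comp _ _⟩
      map_add' := fun _ _ => rfl
      map_smul' := fun _ _ => rfl }
  let w := (TensorProduct.dualDistribEquiv ℂ (A ⧸ I) (A ⧸ I)).symm (φ ∘ₗ LinearMap.mul' ℂ (A ⧸ I))
  have hw : TensorProduct.dualDistrib ℂ (A ⧸ I) (A ⧸ I) w = φ ∘ₗ LinearMap.mul' ℂ (A ⧸ I) :=
    (TensorProduct.dualDistribEquiv ℂ (A ⧸ I) (A ⧸ I)).apply_symm_apply _
  refine ⟨TensorProduct.map ι₀ ι₀ w, ?_⟩
  have gen : ∀ v, tensorPairing (FiniteDual.ev A) (FiniteDual.ev A) (TensorProduct.map ι₀ ι₀ v) =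
      TensorProduct.dualDistrib ℂ (A ⧸ I) (A ⧸ I) v ∘ₗ
        TensorProduct.map (Ideal.Quotient.mkₐ ℂ I).toLinearMap
          (Ideal.Quotient.mkₐ ℂ I).toLinearMap := by
    intro v
    induction v using TensorProduct.induction_on with
    | zero => simp
    | tmul x y => ext a b; simp; rfl
    | add x y hx hy => rw [map_add, map_add, hx, hy, map_add]; rfl
  rw [gen, hw]
  have hf : FiniteDual.ev A f = φ ∘ₗ (Ideal.Quotient.mkₐ ℂ I).toLinearMap := hφ
  rw [hf]
  ext a b
  simp

/-- The coproduct of the finite dual, `(Δ f)(a ⊗ b) = f(ab)`. -/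
def FiniteDual.comulMap : FiniteDual A →ₗ[ℂ] FiniteDual A ⊗[ℂ] FiniteDual A :=
  (LinearEquiv.ofInjective (tensorPairing (FiniteDual.ev A) (FiniteDual.ev A))
      (tensorPairing_injective _ _ (FiniteDual.ev_injective A)
        (FiniteDual.ev_injective A))).symm.toLinearMap ∘ₗ
    LinearMap.codRestrict _
      ((LinearMap.llcomp ℂ (A ⊗[ℂ] A) A ℂ).flip (LinearMap.mul' ℂ A) ∘ₗ FiniteDual.ev A)
      (fun f => FiniteDual.exists_comul A f)

theorem FiniteDual.pairing_comulMap (f : FiniteDual A) :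
    tensorPairing (FiniteDual.ev A) (FiniteDual.ev A) (FiniteDual.comulMap A f) =
      FiniteDual.ev A f ∘ₗ LinearMap.mul' ℂ A := by
  have := LinearEquiv.ofInjective_symm_apply (f := tensorPairing (FiniteDual.ev A) (FiniteDual.ev A))
    (h := tensorPairing_injective _ _ (FiniteDual.ev_injective A) (FiniteDual.ev_injective A))
  exact this _

theorem FiniteDual.pairing_mul (x y : FiniteDual A) : FiniteDual.ev A (x * y) =
    tensorPairing (FiniteDual.ev A) (FiniteDual.ev A) (x ⊗ₜ y) ∘ₗ comul := by
  change LinearMap.mul' ℂ ℂ ∘ₗ _ = _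
  rw [← LinearMap.comp_assoc]
  congr 1

theorem FiniteDual.pairing_one : FiniteDual.ev A 1 = counit := by
  rfl

theorem FiniteDual.pairing_tmul_mul (x y : FiniteDual A ⊗[ℂ] FiniteDual A) :
    tensorPairing (FiniteDual.ev A) (FiniteDual.ev A) (x * y) =
    tensorPairing (tensorPairing (FiniteDual.ev A) (FiniteDual.ev A))
      (tensorPairing (FiniteDual.ev A) (FiniteDual.ev A)) (x ⊗ₜ y) ∘ₗ comul := by
  induction x using TensorProduct.induction_on with
  | zero => simp
  | add x x' hx hx' => simp only [add_mul, map_add, TensorProduct.add_tmul, hx, hx']; rfl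
  | tmul f g =>
    induction y using TensorProduct.induction_on with
    | zero => simp
    | add x x' hx hx' => simp only [mul_add, map_add, TensorProduct.tmul_add, hx, hx']; rfl
    | tmul f' g' =>
      ext a b
      simp only [Algebra.TensorProduct.tmul_mul_tmul, TensorProduct.AlgebraTensorModule.curry_apply,
        LinearMap.restrictScalars_self, TensorProduct.curry_apply, tensorPairing_tmul,
        FiniteDual.pairing_mul, LinearMap.comp_apply, TensorProduct.comul_tmul]
      generalize comul (R := ℂ) a = u
      generalize comul (R := ℂ) b = v
      induction u using TensorProduct.induction_on with
      | zero => simp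
      | add x x' hx hx' => simp only [TensorProduct.add_tmul, map_add, add_mul, hx, hx']
      | tmul a1 a2 =>
        induction v using TensorProduct.induction_on with
        | zero => simp
        | add x x' hx hx' => simp only [TensorProduct.tmul_add, map_add, mul_add, hx, hx']
        | tmul b1 b2 =>
          simp
          ring

/-- The finite dual is a bialgebra, with structure maps the transposes of those of `A`. -/
instance FiniteDual.instCoalgebra : Coalgebra ℂ (FiniteDual A) where
  comul := FiniteDual.comulMap A
  counit := LinearMap.applyₗ (1 : A) ∘ₗ FiniteDual.ev A
  coassoc := by
    ext f
    apply tensorPairing_injective _ _ (FiniteDual.ev_injective A)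
      (tensorPairing_injective _ _ (FiniteDual.ev_injective A) (FiniteDual.ev_injective A))
    have h1 : ∀ z : FiniteDual A ⊗[ℂ] FiniteDual A, ∀ a b c : A,
        tensorPairing (FiniteDual.ev A) (tensorPairing (FiniteDual.ev A) (FiniteDual.ev A))
          (LinearMap.lTensor _ (FiniteDual.comulMap A) z) (a ⊗ₜ (b ⊗ₜ c)) =
        tensorPairing (FiniteDual.ev A) (FiniteDual.ev A) z (a ⊗ₜ (b * c)) := by
      intro z a b c
      induction z using TensorProduct.induction_on with
      | zero => simp
      | add x y hx hy => simp only [map_add, LinearMap.add_apply, hx, hy]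
      | tmul x y => simp [FiniteDual.pairing_comulMap]
    have h2 : ∀ z : FiniteDual A ⊗[ℂ] FiniteDual A, ∀ a b c : A,
        tensorPairing (FiniteDual.ev A) (tensorPairing (FiniteDual.ev A) (FiniteDual.ev A))
          (TensorProduct.assoc ℂ _ _ _ (LinearMap.rTensor _ (FiniteDual.comulMap A) z))
            (a ⊗ₜ (b ⊗ₜ c)) =
        tensorPairing (FiniteDual.ev A) (FiniteDual.ev A) z ((a * b) ⊗ₜ c) := by
      intro z a b c
      have h3 : ∀ w : FiniteDual A ⊗[ℂ] FiniteDual A, ∀ g : FiniteDual A,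
          tensorPairing (FiniteDual.ev A) (tensorPairing (FiniteDual.ev A) (FiniteDual.ev A))
            (TensorProduct.assoc ℂ _ _ _ (w ⊗ₜ g)) (a ⊗ₜ (b ⊗ₜ c)) =
          tensorPairing (FiniteDual.ev A) (FiniteDual.ev A) w (a ⊗ₜ b) * FiniteDual.ev A g c := by
        intro w g
        induction w using TensorProduct.induction_on with
        | zero => simp
        | add x y hx hy => simp only [map_add, LinearMap.add_apply, TensorProduct.add_tmul, hx, hy,
            add_mul]
        | tmul x y => simp [mul_assoc]
      induction z using TensorProduct.induction_on with
      | zero => simp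
      | add x y hx hy => simp only [map_add, LinearMap.add_apply, hx, hy]
      | tmul x y => simp [h3, FiniteDual.pairing_comulMap]
    ext a b c
    have e1 := h1 (FiniteDual.comulMap A f) a b c
    have e2 := h2 (FiniteDual.comulMap A f) a b c
    rw [FiniteDual.pairing_comulMap] at e1 e2
    exact e2.trans (Eq.trans (by simp [mul_assoc]) e1.symm)
  rTensor_counit_comp_comul := by
    ext f
    have h1 : ∀ z : FiniteDual A ⊗[ℂ] FiniteDual A, ∀ a : A,
        FiniteDual.ev A (TensorProduct.lid ℂ _ (LinearMap.rTensor (FiniteDual A)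
          (LinearMap.applyₗ (1 : A) ∘ₗ FiniteDual.ev A) z)) a =
        tensorPairing (FiniteDual.ev A) (FiniteDual.ev A) z (1 ⊗ₜ a) := by
      intro z a
      induction z using TensorProduct.induction_on with
      | zero => simp
      | add x y hx hy => simp only [map_add, LinearMap.add_apply, hx, hy]
      | tmul x y => simp
    apply (TensorProduct.lid ℂ (FiniteDual A)).injective
    apply FiniteDual.ev_injective
    ext a
    have e1 := h1 (FiniteDual.comulMap A f) a
    rw [FiniteDual.pairing_comulMap] at e1
    exact e1.trans (by simp)
  lTensor_counit_comp_comul := by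
    ext f
    have h1 : ∀ z : FiniteDual A ⊗[ℂ] FiniteDual A, ∀ a : A,
        FiniteDual.ev A (TensorProduct.rid ℂ _ (LinearMap.lTensor (FiniteDual A)
          (LinearMap.applyₗ (1 : A) ∘ₗ FiniteDual.ev A) z)) a =
        tensorPairing (FiniteDual.ev A) (FiniteDual.ev A) z (a ⊗ₜ 1) := by
      intro z a
      induction z using TensorProduct.induction_on with
      | zero => simp
      | add x y hx hy => simp only [map_add, LinearMap.add_apply, hx, hy]
      | tmul x y => simp [mul_comm]
    apply (TensorProduct.rid ℂ (FiniteDual A)).injective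
    apply FiniteDual.ev_injective
    ext a
    have e1 := h1 (FiniteDual.comulMap A f) a
    rw [FiniteDual.pairing_comulMap] at e1
    exact e1.trans (by simp)

instance FiniteDual.instBialgebra : Bialgebra ℂ (FiniteDual A) :=
  Bialgebra.mk' ℂ (FiniteDual A)
    (by exact Bialgebra.counit_one (R := ℂ) (A := A))
    (by
      intro f g
      change FiniteDual.ev A (f * g) 1 = FiniteDual.ev A f 1 * FiniteDual.ev A g 1
      rw [FiniteDual.pairing_mul]
      simp [Algebra.TensorProduct.one_def])
    (by
      apply tensorPairing_injective _ _ (FiniteDual.ev_injective A) (FiniteDual.ev_injective A)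
      refine (FiniteDual.pairing_comulMap A 1).trans ?_
      ext a b
      simp [Algebra.TensorProduct.one_def, FiniteDual.pairing_one])
    (by
      intro f g
      apply tensorPairing_injective _ _ (FiniteDual.ev_injective A) (FiniteDual.ev_injective A)
      refine (FiniteDual.pairing_comulMap A (f * g)).trans ?_
      rw [FiniteDual.pairing_tmul_mul]
      have h : ∀ x y : FiniteDual A ⊗[ℂ] FiniteDual A, ∀ φ ψ : A →ₗ[ℂ] ℂ,
          tensorPairing (FiniteDual.ev A) (FiniteDual.ev A) x = φ ∘ₗ LinearMap.mul' ℂ A →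
          tensorPairing (FiniteDual.ev A) (FiniteDual.ev A) y = ψ ∘ₗ LinearMap.mul' ℂ A →
          ∀ u v : A ⊗[ℂ] A, tensorPairing (tensorPairing (FiniteDual.ev A) (FiniteDual.ev A))
            (tensorPairing (FiniteDual.ev A) (FiniteDual.ev A)) (x ⊗ₜ y)
            (TensorProduct.tensorTensorTensorComm ℂ A A A A (u ⊗ₜ v)) =
          TensorProduct.dualDistrib ℂ A A (φ ⊗ₜ ψ) (u * v) := by
        intro x y φ ψ hx hy u v
        induction u using TensorProduct.induction_on with
        | zero => simp
        | add u u' hu hu' => simp only [TensorProduct.add_tmul, map_add, add_mul, hu, hu']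
        | tmul a1 a2 =>
          induction v using TensorProduct.induction_on with
          | zero => simp
          | add u u' hu hu' => simp only [TensorProduct.tmul_add, map_add, mul_add, hu, hu']
          | tmul b1 b2 => simp [hx, hy]
      ext a b
      have := h _ _ _ _ (FiniteDual.pairing_comulMap A f) (FiniteDual.pairing_comulMap A g)
        (comul (R := ℂ) a) (comul (R := ℂ) b)
      refine Eq.trans ?_ this.symm
      simp [FiniteDual.pairing_mul, tensorPairing])

theorem FiniteDual.pairing_comul (f : FiniteDual A) (a b : A) :
    tensorPairing (FiniteDual.ev A) (FiniteDual.ev A) (comul f) (a ⊗ₜ b) =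
      FiniteDual.ev A f (a * b) := by
  refine (congrArg (fun φ => φ (a ⊗ₜ[ℂ] b)) (FiniteDual.pairing_comulMap A f)).trans ?_
  simp

theorem FiniteDual.counit_apply (f : FiniteDual A) :
    counit (R := ℂ) f = FiniteDual.ev A f 1 := rfl

end FiniteDual

section Structures

open Coalgebra TensorProduct

/-- A bialgebra has an antipode, i.e. it is a Hopf algebra. -/
def HasAntipode (A : Type*) [Ring A] [Bialgebra ℂ A] : Prop :=
  ∃ S : A →ₗ[ℂ] A,
    LinearMap.mul' ℂ A ∘ₗ LinearMap.rTensor A S ∘ₗ comul = Algebra.linearMap ℂ A ∘ₗ counit ∧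
    LinearMap.mul' ℂ A ∘ₗ LinearMap.lTensor A S ∘ₗ comul = Algebra.linearMap ℂ A ∘ₗ counit

/-- A dual quasitriangular structure on a bialgebra: a convolution-invertible functional `r` with
`r(ab ⊗ c) = r(a ⊗ c₍₁₎) r(b ⊗ c₍₂₎)`, `r(a ⊗ bc) = r(a₍₁₎ ⊗ c) r(a₍₂₎ ⊗ b)` and
`b₍₁₎ a₍₁₎ r(a₍₂₎ ⊗ b₍₂₎) = r(a₍₁₎ ⊗ b₍₁₎) a₍₂₎ b₍₂₎`. -/
structure IsDualQuasitriangular {A : Type*} [Ring A] [Bialgebra ℂ A] (r : A ⊗[ℂ] A →ₗ[ℂ] ℂ) :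
    Prop where
  convolution_invertible : IsUnit (WithConv.toConv r)
  mul_left : ∀ a b c : A, r ((a * b) ⊗ₜ c) =
    LinearMap.mul' ℂ ℂ (TensorProduct.map (r ∘ₗ TensorProduct.mk ℂ A A a)
      (r ∘ₗ TensorProduct.mk ℂ A A b) (comul c))
  mul_right : ∀ a b c : A, r (a ⊗ₜ (b * c)) =
    LinearMap.mul' ℂ ℂ (TensorProduct.map (r ∘ₗ (TensorProduct.mk ℂ A A).flip c)
      (r ∘ₗ (TensorProduct.mk ℂ A A).flip b) (comul a))
  quasi_comm :
    (TensorProduct.rid ℂ A).toLinearMap ∘ₗ TensorProduct.map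
      (LinearMap.mul' ℂ A ∘ₗ (TensorProduct.comm ℂ A A).toLinearMap) r ∘ₗ comul =
    (TensorProduct.lid ℂ A).toLinearMap ∘ₗ TensorProduct.map r (LinearMap.mul' ℂ A) ∘ₗ comul

/-- The bialgebra `P` is, as an algebra and as a coalgebra, a (right-handed) semidirect product of
the bialgebra `H` with `B`, where `B` is an algebra and a coalgebra on which `H` acts and coacts
from the right:
* `act` makes `B` a right `H`-module algebra, `coact` makes `B` a right `H`-comodule coalgebra;
* the linear isomorphism `e : H ⊗ B → P` (to be read as `e (h ⊗ b) = h b`) turns the product of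
  `P` into `(h ⊗ b)(k ⊗ c) = h k₍₁₎ ⊗ (b ◁ k₍₂₎) c` (so that `b k = k₍₁₎ (b ◁ k₍₂₎)`), and the
  coproduct of `P` into `Δ(h ⊗ b) = (h₍₁₎ ⊗ b₍₁₎⁽¹⁾) ⊗ (h₍₂₎ b₍₁₎⁽²⁾ ⊗ b₍₂₎)`, where
  `b⁽¹⁾ ⊗ b⁽²⁾` denotes the coaction. -/
structure RightSemidirectProduct (H B P : Type*) [Ring H] [Bialgebra ℂ H]
    [Ring B] [Algebra ℂ B] [Coalgebra ℂ B] [Ring P] [Bialgebra ℂ P] where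
  act : B ⊗[ℂ] H →ₗ[ℂ] B
  coact : B →ₗ[ℂ] B ⊗[ℂ] H
  act_one : ∀ b, act (b ⊗ₜ 1) = b
  act_mul : ∀ b h k, act (b ⊗ₜ (h * k)) = act (act (b ⊗ₜ h) ⊗ₜ k)
  one_act : ∀ h, act (1 ⊗ₜ h) = counit (R := ℂ) h • (1 : B)
  mul_act : ∀ b c h, act ((b * c) ⊗ₜ h) =
    LinearMap.mul' ℂ B (TensorProduct.map (act ∘ₗ TensorProduct.mk ℂ B H b)
      (act ∘ₗ TensorProduct.mk ℂ B H c) (comul h))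
  coact_counit : ∀ b, TensorProduct.rid ℂ B (LinearMap.lTensor B counit (coact b)) = b
  coact_comul : ∀ b, TensorProduct.assoc ℂ B H H (LinearMap.rTensor H coact (coact b)) =
    LinearMap.lTensor B comul (coact b)
  counit_coact : ∀ b, TensorProduct.lid ℂ H (LinearMap.rTensor H counit (coact b)) =
    counit (R := ℂ) b • (1 : H)
  comul_coact : ∀ b, LinearMap.rTensor H comul (coact b) =
    LinearMap.lTensor (B ⊗[ℂ] B) (LinearMap.mul' ℂ H)
      (TensorProduct.tensorTensorTensorComm ℂ B H B H (TensorProduct.map coact coact (comul b)))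
  e : H ⊗[ℂ] B ≃ₗ[ℂ] P
  e_one : e (1 ⊗ₜ 1) = 1
  e_mul : ∀ h b k c, e (h ⊗ₜ b) * e (k ⊗ₜ c) =
    e (TensorProduct.map (LinearMap.mulLeft ℂ h)
      (LinearMap.mulRight ℂ c ∘ₗ act ∘ₗ TensorProduct.mk ℂ B H b) (comul k))
  e_counit : ∀ h b, counit (R := ℂ) (e (h ⊗ₜ b)) = counit (R := ℂ) h * counit (R := ℂ) b
  e_comul : ∀ h b, comul (R := ℂ) (e (h ⊗ₜ b)) =
    TensorProduct.map e.toLinearMap e.toLinearMap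
      (TensorProduct.assoc ℂ (H ⊗[ℂ] B) H B
        (LinearMap.rTensor B (LinearMap.lTensor (H ⊗[ℂ] B) (LinearMap.mul' ℂ H) ∘ₗ
            (TensorProduct.tensorTensorTensorComm ℂ H H B H).toLinearMap)
          ((TensorProduct.assoc ℂ (H ⊗[ℂ] H) (B ⊗[ℂ] H) B).symm
            (comul h ⊗ₜ LinearMap.rTensor B coact (comul b)))))

/-- Two right-handed semidirect products are dual to each other, with respect to pairings of the
factors and of the products: the structure maps of `B` are the transposes of those of `V` (the
product and the coproduct, the unit and the counit, and the action and the coaction being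
interchanged), and `⟨h b, a v⟩ = ⟨h, a⟩⟨b, v⟩`. -/
structure RightSemidirectProduct.IsDual {H B D A V P : Type*} [Ring H] [Bialgebra ℂ H]
    [Ring B] [Algebra ℂ B] [Coalgebra ℂ B] [Ring D] [Bialgebra ℂ D]
    [Ring A] [Bialgebra ℂ A] [Ring V] [Algebra ℂ V] [Coalgebra ℂ V] [Ring P] [Bialgebra ℂ P]
    (T : RightSemidirectProduct H B D) (S : RightSemidirectProduct A V P)
    (pH : H →ₗ[ℂ] A →ₗ[ℂ] ℂ) (pB : B →ₗ[ℂ] V →ₗ[ℂ] ℂ) (pD : D →ₗ[ℂ] P →ₗ[ℂ] ℂ) : Prop where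
  mul : ∀ b c v, pB (b * c) v = tensorPairing pB pB (b ⊗ₜ c) (comul v)
  one : ∀ v, pB 1 v = counit v
  comul : ∀ b v w, tensorPairing pB pB (comul b) (v ⊗ₜ w) = pB b (v * w)
  counit : ∀ b, counit b = pB b 1
  act : ∀ b h v, pB (T.act (b ⊗ₜ h)) v = tensorPairing pB pH (b ⊗ₜ h) (S.coact v)
  coact : ∀ b v a, tensorPairing pB pH (T.coact b) (v ⊗ₜ a) = pB b (S.act (v ⊗ₜ a))
  pairing : ∀ h b a v, pD (T.e (h ⊗ₜ b)) (S.e (a ⊗ₜ v)) = pH h a * pB b v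

/-- The mirror image of a right-handed semidirect product: `H` acts and coacts on `B` from the
left, the isomorphism `e : B ⊗ H → P` is to be read as `e (b ⊗ h) = b h`, the product is
`(b ⊗ h)(c ⊗ k) = b (h₍₁₎ ▷ c) ⊗ h₍₂₎ k` and the coproduct is
`Δ(b ⊗ h) = (b₍₁₎ ⊗ b₍₂₎⁽¹⁾ h₍₁₎) ⊗ (b₍₂₎⁽²⁾ ⊗ h₍₂₎)`. -/
structure LeftSemidirectProduct (H B P : Type*) [Ring H] [Bialgebra ℂ H]
    [Ring B] [Algebra ℂ B] [Coalgebra ℂ B] [Ring P] [Bialgebra ℂ P] where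
  act : H ⊗[ℂ] B →ₗ[ℂ] B
  coact : B →ₗ[ℂ] H ⊗[ℂ] B
  one_act : ∀ b, act (1 ⊗ₜ b) = b
  mul_act : ∀ b h k, act ((h * k) ⊗ₜ b) = act (h ⊗ₜ act (k ⊗ₜ b))
  act_one : ∀ h, act (h ⊗ₜ 1) = counit (R := ℂ) h • (1 : B)
  act_mul : ∀ b c h, act (h ⊗ₜ (b * c)) =
    LinearMap.mul' ℂ B (TensorProduct.map (act ∘ₗ (TensorProduct.mk ℂ H B).flip b)
      (act ∘ₗ (TensorProduct.mk ℂ H B).flip c) (comul h))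
  coact_counit : ∀ b, TensorProduct.lid ℂ B (LinearMap.rTensor B counit (coact b)) = b
  coact_comul : ∀ b, LinearMap.lTensor H coact (coact b) =
    TensorProduct.assoc ℂ H H B (LinearMap.rTensor B comul (coact b))
  counit_coact : ∀ b, TensorProduct.rid ℂ H (LinearMap.lTensor H counit (coact b)) =
    counit (R := ℂ) b • (1 : H)
  comul_coact : ∀ b, LinearMap.lTensor H comul (coact b) =
    LinearMap.rTensor (B ⊗[ℂ] B) (LinearMap.mul' ℂ H)
      (TensorProduct.tensorTensorTensorComm ℂ H B H B (TensorProduct.map coact coact (comul b)))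
  e : B ⊗[ℂ] H ≃ₗ[ℂ] P
  e_one : e (1 ⊗ₜ 1) = 1
  e_mul : ∀ b h c k, e (b ⊗ₜ h) * e (c ⊗ₜ k) =
    e (TensorProduct.map (LinearMap.mulLeft ℂ b ∘ₗ act ∘ₗ (TensorProduct.mk ℂ H B).flip c)
      (LinearMap.mulRight ℂ k) (comul h))
  e_counit : ∀ b h, counit (R := ℂ) (e (b ⊗ₜ h)) = counit (R := ℂ) b * counit (R := ℂ) h
  e_comul : ∀ b h, comul (R := ℂ) (e (b ⊗ₜ h)) =
    TensorProduct.map e.toLinearMap e.toLinearMap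
      ((TensorProduct.assoc ℂ B H (B ⊗[ℂ] H)).symm
        (LinearMap.lTensor B (LinearMap.rTensor (B ⊗[ℂ] H) (LinearMap.mul' ℂ H) ∘ₗ
            (TensorProduct.tensorTensorTensorComm ℂ H B H H).toLinearMap)
          (TensorProduct.assoc ℂ B (H ⊗[ℂ] B) (H ⊗[ℂ] H)
            (LinearMap.lTensor B coact (comul b) ⊗ₜ comul h))))

/-- Two left-handed semidirect products are dual to each other, with respect to pairings of the
factors and of the products. -/
structure LeftSemidirectProduct.IsDual {H B D A V P : Type*} [Ring H] [Bialgebra ℂ H]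
    [Ring B] [Algebra ℂ B] [Coalgebra ℂ B] [Ring D] [Bialgebra ℂ D]
    [Ring A] [Bialgebra ℂ A] [Ring V] [Algebra ℂ V] [Coalgebra ℂ V] [Ring P] [Bialgebra ℂ P]
    (T : LeftSemidirectProduct H B D) (S : LeftSemidirectProduct A V P)
    (pH : H →ₗ[ℂ] A →ₗ[ℂ] ℂ) (pB : B →ₗ[ℂ] V →ₗ[ℂ] ℂ) (pD : D →ₗ[ℂ] P →ₗ[ℂ] ℂ) : Prop where
  mul : ∀ b c v, pB (b * c) v = tensorPairing pB pB (b ⊗ₜ c) (comul v)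
  one : ∀ v, pB 1 v = counit v
  comul : ∀ b v w, tensorPairing pB pB (comul b) (v ⊗ₜ w) = pB b (v * w)
  counit : ∀ b, counit b = pB b 1
  act : ∀ b h v, pB (T.act (h ⊗ₜ b)) v = tensorPairing pH pB (h ⊗ₜ b) (S.coact v)
  coact : ∀ b v a, tensorPairing pH pB (T.coact b) (a ⊗ₜ v) = pB b (S.act (a ⊗ₜ v))
  pairing : ∀ h b a v, pD (T.e (b ⊗ₜ h)) (S.e (v ⊗ₜ a)) = pB b v * pH h a

end Structures

section RMatrices

variable {ι : Type*}

/- A matrix `M` in `M_n ⊗ M_n` with entries `M^i_j^k_l` is written as a matrix indexed by pairs,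
`M (i, k) (j, l)`. -/

/-- The permutation matrix `P`. -/
def permMatrix (ι : Type*) [DecidableEq ι] : Matrix (ι × ι) (ι × ι) ℂ :=
  fun x y => if x.1 = y.2 ∧ x.2 = y.1 then 1 else 0

/-- `M₂₁`. -/
def flipLegs (M : Matrix (ι × ι) (ι × ι) ℂ) : Matrix (ι × ι) (ι × ι) ℂ :=
  M.submatrix Prod.swap Prod.swap

/-- `M₁₂` in `M_n ⊗ M_n ⊗ M_n`. -/
def leg12 [DecidableEq ι] (M : Matrix (ι × ι) (ι × ι) ℂ) : Matrix (ι × ι × ι) (ι × ι × ι) ℂ :=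
  fun x y => if x.2.2 = y.2.2 then M (x.1, x.2.1) (y.1, y.2.1) else 0

/-- `M₁₃` in `M_n ⊗ M_n ⊗ M_n`. -/
def leg13 [DecidableEq ι] (M : Matrix (ι × ι) (ι × ι) ℂ) : Matrix (ι × ι × ι) (ι × ι × ι) ℂ :=
  fun x y => if x.2.1 = y.2.1 then M (x.1, x.2.2) (y.1, y.2.2) else 0

/-- `M₂₃` in `M_n ⊗ M_n ⊗ M_n`. -/
def leg23 [DecidableEq ι] (M : Matrix (ι × ι) (ι × ι) ℂ) : Matrix (ι × ι × ι) (ι × ι × ι) ℂ :=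
  fun x y => if x.1 = y.1 then M (x.2.1, x.2.2) (y.2.1, y.2.2) else 0

variable [Fintype ι] {S : Type*} [Ring S] [Algebra ℂ S]

/-- For matrices `s`, `t` with entries in an algebra, the relations `M₁₂ s₁ t₂ = t₂ s₁ M₁₂`. -/
def MatrixRelation (M : Matrix (ι × ι) (ι × ι) ℂ) (s t : ι → ι → S) : Prop :=
  ∀ i k j l, ∑ a, ∑ b, M (i, k) (a, b) • (s a j * t b l) =
    ∑ a, ∑ b, M (a, b) (j, l) • (t k b * s i a)

/-- Row vectors: `x₁ x₂ = x₂ x₁ M₁₂`, i.e. `x_j x_l = x_k x_i M^i_j^k_l`. -/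
def CovectorRelation (M : Matrix (ι × ι) (ι × ι) ℂ) (x : ι → S) : Prop :=
  ∀ j l, x j * x l = ∑ k, ∑ i, M (i, k) (j, l) • (x k * x i)

/-- Column vectors: `M₁₂ x₁ x₂ = x₂ x₁`. -/
def VectorRelation (M : Matrix (ι × ι) (ι × ι) ℂ) (x : ι → S) : Prop :=
  ∀ i k, ∑ a, ∑ b, M (i, k) (a, b) • (x a * x b) = x k * x i

end RMatrices

section Sums

variable {ι : Type*} [Fintype ι]

theorem sum_swap {N : Type*} [AddCommMonoid N] (F : ι → ι → ι → ι → N) :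
    ∑ a, ∑ b, ∑ c, ∑ d, F a b c d = ∑ c, ∑ d, ∑ a, ∑ b, F a b c d := by
  have h1 : ∑ a, ∑ b, ∑ c, ∑ d, F a b c d =
      ∑ p : ι × ι, ∑ q : ι × ι, F p.1 p.2 q.1 q.2 := by
    simp only [Fintype.sum_prod_type]
  have h2 : ∑ c, ∑ d, ∑ a, ∑ b, F a b c d =
      ∑ q : ι × ι, ∑ p : ι × ι, F p.1 p.2 q.1 q.2 := by
    simp only [Fintype.sum_prod_type]
  rw [h1, h2, Finset.sum_comm]

variable {S Q : Type*} [Ring S] [Algebra ℂ S] [Ring Q] [Algebra ℂ Q]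

theorem MatrixRelation.map {M : Matrix (ι × ι) (ι × ι) ℂ} {s t : ι → ι → S}
    (h : MatrixRelation M s t) (φ : S →ₐ[ℂ] Q) :
    MatrixRelation M (fun i j => φ (s i j)) (fun i j => φ (t i j)) := by
  intro i k j l
  have := congrArg φ (h i k j l)
  simpa only [map_sum, map_smul, map_mul] using this

theorem MatrixRelation.tmul {M : Matrix (ι × ι) (ι × ι) ℂ} {s t : ι → ι → S} {s' t' : ι → ι → Q}
    (h : MatrixRelation M s t) (h' : MatrixRelation M s' t') :
    MatrixRelation M (fun i j => ∑ a, s i a ⊗ₜ[ℂ] s' a j) (fun i j => ∑ a, t i a ⊗ₜ[ℂ] t' a j) := by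
  intro i k j l
  have e1 : ∀ a b, (∑ c, s a c ⊗ₜ[ℂ] s' c j) * (∑ d, t b d ⊗ₜ[ℂ] t' d l) =
      ∑ c, ∑ d, (s a c * t b d) ⊗ₜ[ℂ] (s' c j * t' d l) := by
    intro a b
    simp only [Finset.sum_mul, Finset.mul_sum, Algebra.TensorProduct.tmul_mul_tmul]
    rw [Finset.sum_comm]
  have e2 : ∀ a b, (∑ c, t k c ⊗ₜ[ℂ] t' c b) * (∑ d, s i d ⊗ₜ[ℂ] s' d a) =
      ∑ d, ∑ c, (t k c * s i d) ⊗ₜ[ℂ] (t' c b * s' d a) := by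
    intro a b
    simp only [Finset.sum_mul, Finset.mul_sum, Algebra.TensorProduct.tmul_mul_tmul]
  simp only [e1, e2, Finset.smul_sum]
  rw [sum_swap]
  calc _ = ∑ c, ∑ d, (∑ a, ∑ b, M (i, k) (a, b) • (s a c * t b d)) ⊗ₜ[ℂ] (s' c j * t' d l) := by
        simp only [TensorProduct.sum_tmul, TensorProduct.smul_tmul']
    _ = ∑ c, ∑ d, ∑ a, ∑ b, M (a, b) (c, d) • (t k b * s i a) ⊗ₜ[ℂ] (s' c j * t' d l) := by
        simp only [h i k, TensorProduct.sum_tmul, TensorProduct.smul_tmul']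
    _ = ∑ a, ∑ b, (t k b * s i a) ⊗ₜ[ℂ] ∑ c, ∑ d, M (a, b) (c, d) • (s' c j * t' d l) := by
        rw [sum_swap]
        simp only [TensorProduct.tmul_sum, TensorProduct.tmul_smul]
    _ = _ := by
        simp only [h' _ _ j l, TensorProduct.tmul_sum, TensorProduct.tmul_smul]
        rw [sum_swap]

theorem CovectorRelation.tmul {M : Matrix (ι × ι) (ι × ι) ℂ} {x : ι → S} {t : ι → ι → Q}
    (h : CovectorRelation M x) (h' : MatrixRelation M t t) :
    CovectorRelation M (fun j => ∑ a, x a ⊗ₜ[ℂ] t a j) := by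
  intro j l
  have e1 : ∀ j l, (∑ c, x c ⊗ₜ[ℂ] t c j) * (∑ d, x d ⊗ₜ[ℂ] t d l) =
      ∑ c, ∑ d, (x c * x d) ⊗ₜ[ℂ] (t c j * t d l) := by
    intro a b
    simp only [Finset.sum_mul, Finset.mul_sum, Algebra.TensorProduct.tmul_mul_tmul]
    rw [Finset.sum_comm]
  simp only [e1, Finset.smul_sum]
  calc _ = ∑ c, ∑ d, ∑ k, ∑ i, M (i, k) (c, d) • (x k * x i) ⊗ₜ[ℂ] (t c j * t d l) := by
        refine Finset.sum_congr rfl fun c _ => Finset.sum_congr rfl fun d _ => ?_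
        rw [h c d]
        simp only [TensorProduct.sum_tmul, TensorProduct.smul_tmul']
    _ = ∑ k, ∑ i, (x k * x i) ⊗ₜ[ℂ] ∑ c, ∑ d, M (i, k) (c, d) • (t c j * t d l) := by
        rw [sum_swap]
        simp only [TensorProduct.tmul_sum, TensorProduct.tmul_smul]
    _ = ∑ k, ∑ i, ∑ a, ∑ b, M (a, b) (j, l) • (x k * x i) ⊗ₜ[ℂ] (t k b * t i a) := by
        simp only [h' _ _ j l, TensorProduct.tmul_sum, TensorProduct.tmul_smul]
    _ = _ := by
        rw [sum_swap, Finset.sum_comm]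

theorem VectorRelation.tmul {M : Matrix (ι × ι) (ι × ι) ℂ} {x : ι → S} {t : ι → ι → Q}
    (h : VectorRelation M x) (h' : MatrixRelation M t t) :
    VectorRelation M (fun i => ∑ a, t i a ⊗ₜ[ℂ] x a) := by
  intro i k
  have e1 : ∀ j l, (∑ c, t j c ⊗ₜ[ℂ] x c) * (∑ d, t l d ⊗ₜ[ℂ] x d) =
      ∑ c, ∑ d, (t j c * t l d) ⊗ₜ[ℂ] (x c * x d) := by
    intro a b
    simp only [Finset.sum_mul, Finset.mul_sum, Algebra.TensorProduct.tmul_mul_tmul]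
    rw [Finset.sum_comm]
  simp only [e1, Finset.smul_sum]
  calc _ = ∑ c, ∑ d, (∑ a, ∑ b, M (i, k) (a, b) • (t a c * t b d)) ⊗ₜ[ℂ] (x c * x d) := by
        rw [sum_swap]
        simp only [TensorProduct.sum_tmul, TensorProduct.smul_tmul']
    _ = ∑ c, ∑ d, ∑ a, ∑ b, M (a, b) (c, d) • (t k b * t i a) ⊗ₜ[ℂ] (x c * x d) := by
        simp only [h' i k, TensorProduct.sum_tmul, TensorProduct.smul_tmul']
    _ = ∑ a, ∑ b, (t k b * t i a) ⊗ₜ[ℂ] (x b * x a) := by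
        rw [sum_swap]
        refine Finset.sum_congr rfl fun a _ => Finset.sum_congr rfl fun b _ => ?_
        rw [← h a b]
        simp only [TensorProduct.tmul_sum, TensorProduct.tmul_smul]
    _ = _ := by
        rw [Finset.sum_comm]

end Sums

section Cross

variable {ι : Type*} [Fintype ι] {S : Type*} [Ring S] [Algebra ℂ S]

theorem CovectorRelation.coproduct [DecidableEq ι] {M M' : Matrix (ι × ι) (ι × ι) ℂ} {x : ι → S}
    {T : ι → ι → S}
    (hM : ∀ c d j l, ∑ k, ∑ i, M (c, d) (k, i) * M' (i, k) (j, l) + M' (c, d) (j, l) =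
      M (c, d) (j, l) + if c = l ∧ d = j then 1 else 0)
    (h : CovectorRelation M' x) (hT : MatrixRelation M' T T)
    (hx : ∀ j b l, x j * T b l = ∑ a, ∑ c, M (c, a) (j, l) • (T b a * x c)) :
    CovectorRelation M' (fun j => ∑ a, x a ⊗ₜ[ℂ] T a j + (1 : S) ⊗ₜ[ℂ] x j) := by
  intro j l
  have hu := h.tmul hT
  set u : ι → S ⊗[ℂ] S := fun j => ∑ a, x a ⊗ₜ[ℂ] T a j with hu_def
  set v : ι → S ⊗[ℂ] S := fun j => (1 : S) ⊗ₜ[ℂ] x j with hv_def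
  let w : ι → ι → S ⊗[ℂ] S := fun d c => ∑ a, x a ⊗ₜ[ℂ] (T a d * x c)
  have huv : ∀ j l, u j * v l = w j l := by
    intro j l
    simp only [hu_def, hv_def, w, Finset.sum_mul, Algebra.TensorProduct.tmul_mul_tmul, mul_one]
  have hvu : ∀ j l, v j * u l = ∑ a, ∑ c, M (c, a) (j, l) • w a c := by
    intro j l
    simp only [hu_def, hv_def, w, Finset.mul_sum, Algebra.TensorProduct.tmul_mul_tmul, one_mul, hx,
      TensorProduct.tmul_sum, TensorProduct.tmul_smul, Finset.smul_sum]
    rw [Finset.sum_comm]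
    exact Finset.sum_congr rfl fun a _ => Finset.sum_comm
  have hv : ∀ j l, v j * v l = ∑ k, ∑ i, M' (i, k) (j, l) • (v k * v i) := by
    intro j l
    simp only [hv_def, Algebra.TensorProduct.tmul_mul_tmul, h j l, one_mul, TensorProduct.tmul_sum,
      TensorProduct.tmul_smul]
  have key : w j l + ∑ a, ∑ c, M (c, a) (j, l) • w a c =
      ∑ k, ∑ i, M' (i, k) (j, l) • (w k i + ∑ a, ∑ c, M (c, a) (k, i) • w a c) := by
    have e1 : w j l = ∑ a, ∑ c, (if c = l ∧ a = j then (1 : ℂ) else 0) • w a c := by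
      simp [ite_and, Finset.sum_ite_eq', ite_smul]
    have e2 : ∑ k, ∑ i, M' (i, k) (j, l) • ∑ a, ∑ c, M (c, a) (k, i) • w a c =
        ∑ a, ∑ c, (∑ k, ∑ i, M (c, a) (k, i) * M' (i, k) (j, l)) • w a c := by
      simp only [Finset.smul_sum, Finset.sum_smul, smul_smul]
      rw [sum_swap]
      simp only [mul_comm]
    simp only [smul_add, Finset.sum_add_distrib, e2]
    rw [e1]
    simp only [← Finset.sum_add_distrib, ← add_smul]
    refine Finset.sum_congr rfl fun a _ => Finset.sum_congr rfl fun c _ => ?_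
    congr 1
    rw [add_comm, ← hM c a j l, add_comm]
  have hu' : u j * u l = ∑ k, ∑ i, M' (i, k) (j, l) • (u k * u i) := hu j l
  calc (u j + v j) * (u l + v l) = u j * u l + (u j * v l + v j * u l) + v j * v l := by
        noncomm_ring
    _ = ∑ k, ∑ i, M' (i, k) (j, l) • (u k * u i) +
        ∑ k, ∑ i, M' (i, k) (j, l) • (u k * v i + v k * u i) +
        ∑ k, ∑ i, M' (i, k) (j, l) • (v k * v i) := by
        rw [hu', hv j l, huv, hvu, key]
        simp only [huv, hvu]
    _ = ∑ k, ∑ i, M' (i, k) (j, l) • ((u k + v k) * (u i + v i)) := by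
        simp only [← Finset.sum_add_distrib, ← smul_add]
        refine Finset.sum_congr rfl fun k _ => Finset.sum_congr rfl fun i _ => ?_
        congr 1
        noncomm_ring

theorem VectorRelation.coproduct [DecidableEq ι] {M M' : Matrix (ι × ι) (ι × ι) ℂ} {x : ι → S}
    {T : ι → ι → S}
    (hM : ∀ j l c d, ∑ k, ∑ i, M' (j, l) (k, i) * M (i, k) (c, d) + M' (j, l) (c, d) =
      M (j, l) (c, d) + if j = d ∧ l = c then 1 else 0)
    (h : VectorRelation M' x) (hT : MatrixRelation M' T T)
    (hx : ∀ a c b, T a c * x b = ∑ d, ∑ e, M (b, a) (d, e) • (x d * T e c)) :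
    VectorRelation M' (fun i => ∑ a, T i a ⊗ₜ[ℂ] x a + x i ⊗ₜ[ℂ] (1 : S)) := by
  intro i k
  have hu := h.tmul hT
  set u : ι → S ⊗[ℂ] S := fun i => ∑ a, T i a ⊗ₜ[ℂ] x a with hu_def
  set v : ι → S ⊗[ℂ] S := fun i => x i ⊗ₜ[ℂ] (1 : S) with hv_def
  let w : ι → ι → S ⊗[ℂ] S := fun a b => ∑ c, (x a * T b c) ⊗ₜ[ℂ] x c
  have hvu : ∀ a b, v a * u b = w a b := by
    intro j l
    simp only [hu_def, hv_def, w, Finset.mul_sum, Algebra.TensorProduct.tmul_mul_tmul, one_mul]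
  have huv : ∀ a b, u a * v b = ∑ d, ∑ e, M (b, a) (d, e) • w d e := by
    intro j l
    simp only [hu_def, hv_def, w, Finset.sum_mul, Algebra.TensorProduct.tmul_mul_tmul, mul_one, hx,
      TensorProduct.sum_tmul, TensorProduct.smul_tmul', Finset.smul_sum]
    rw [Finset.sum_comm]
    exact Finset.sum_congr rfl fun a _ => Finset.sum_comm
  have hv : ∑ a, ∑ b, M' (i, k) (a, b) • (v a * v b) = v k * v i := by
    simp only [hv_def, Algebra.TensorProduct.tmul_mul_tmul, ← h i k, one_mul,
      TensorProduct.sum_tmul, TensorProduct.smul_tmul']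
  have key : ∑ a, ∑ b, M' (i, k) (a, b) • (∑ d, ∑ e, M (b, a) (d, e) • w d e + w a b) =
      ∑ d, ∑ e, M (i, k) (d, e) • w d e + w k i := by
    have e1 : w k i = ∑ d, ∑ e, (if i = e ∧ k = d then (1 : ℂ) else 0) • w d e := by
      simp [ite_and, ite_smul]
    have e2 : ∑ a, ∑ b, M' (i, k) (a, b) • ∑ d, ∑ e, M (b, a) (d, e) • w d e =
        ∑ d, ∑ e, (∑ a, ∑ b, M' (i, k) (a, b) * M (b, a) (d, e)) • w d e := by
      simp only [Finset.smul_sum, Finset.sum_smul, smul_smul]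
      rw [sum_swap]
    simp only [smul_add, Finset.sum_add_distrib, e2]
    rw [e1]
    simp only [← Finset.sum_add_distrib, ← add_smul]
    refine Finset.sum_congr rfl fun d _ => Finset.sum_congr rfl fun e _ => ?_
    congr 1
    exact hM i k d e
  have hu' : ∑ a, ∑ b, M' (i, k) (a, b) • (u a * u b) = u k * u i := hu i k
  calc ∑ a, ∑ b, M' (i, k) (a, b) • ((u a + v a) * (u b + v b)) =
        ∑ a, ∑ b, M' (i, k) (a, b) • (u a * u b) +
        ∑ a, ∑ b, M' (i, k) (a, b) • (u a * v b + v a * u b) +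
        ∑ a, ∑ b, M' (i, k) (a, b) • (v a * v b) := by
        simp only [← Finset.sum_add_distrib, ← smul_add]
        refine Finset.sum_congr rfl fun k _ => Finset.sum_congr rfl fun i _ => ?_
        congr 1
        noncomm_ring
    _ = u k * u i + (u k * v i + v k * u i) + v k * v i := by
        rw [hu', hv]
        simp only [huv, hvu]
        rw [key]
    _ = (u k + v k) * (u i + v i) := by noncomm_ring

theorem cross_coproduct {M : Matrix (ι × ι) (ι × ι) ℂ} {c : ℂ} {x : ι → S} {T t : ι → ι → S}
    (hT : MatrixRelation M T t)
    (hx : ∀ i k l, x i * t k l = c • ∑ b, ∑ a, M (b, a) (i, l) • (t k a * x b)) (i k l : ι) :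
    (∑ a, x a ⊗ₜ[ℂ] T a i + (1 : S) ⊗ₜ[ℂ] x i) * (∑ m, t k m ⊗ₜ[ℂ] t m l) =
      c • ∑ b, ∑ a, M (b, a) (i, l) • ((∑ m, t k m ⊗ₜ[ℂ] t m a) *
        (∑ n, x n ⊗ₜ[ℂ] T n b + (1 : S) ⊗ₜ[ℂ] x b)) := by
  have h1 : (∑ a, x a ⊗ₜ[ℂ] T a i) * (∑ m, t k m ⊗ₜ[ℂ] t m l) =
      c • ∑ b, ∑ a, M (b, a) (i, l) • ((∑ m, t k m ⊗ₜ[ℂ] t m a) * (∑ n, x n ⊗ₜ[ℂ] T n b)) := by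
    calc _ = ∑ a, ∑ m, (x a * t k m) ⊗ₜ[ℂ] (T a i * t m l) := by
          simp only [Finset.sum_mul, Finset.mul_sum, Algebra.TensorProduct.tmul_mul_tmul]
          rw [Finset.sum_comm]
      _ = c • ∑ a, ∑ m, ∑ d, ∑ n, M (d, n) (a, m) • (t k n * x d) ⊗ₜ[ℂ] (T a i * t m l) := by
          simp only [hx, Finset.smul_sum, TensorProduct.sum_tmul, TensorProduct.smul_tmul']
      _ = c • ∑ d, ∑ n, (t k n * x d) ⊗ₜ[ℂ] (∑ a, ∑ m, M (d, n) (a, m) • (T a i * t m l)) := by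
          rw [sum_swap]
          simp only [TensorProduct.tmul_sum, TensorProduct.tmul_smul]
      _ = c • ∑ d, ∑ n, ∑ b, ∑ a, M (b, a) (i, l) • ((t k n * x d) ⊗ₜ[ℂ] (t n a * T d b)) := by
          simp only [hT _ _ i l, TensorProduct.tmul_sum, TensorProduct.tmul_smul]
      _ = _ := by
          rw [sum_swap]
          simp only [Finset.sum_mul, Finset.mul_sum, Algebra.TensorProduct.tmul_mul_tmul,
            Finset.smul_sum]
  have h2 : ((1 : S) ⊗ₜ[ℂ] x i) * (∑ m, t k m ⊗ₜ[ℂ] t m l) =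
      c • ∑ b, ∑ a, M (b, a) (i, l) • ((∑ m, t k m ⊗ₜ[ℂ] t m a) * ((1 : S) ⊗ₜ[ℂ] x b)) := by
    calc _ = ∑ m, t k m ⊗ₜ[ℂ] (x i * t m l) := by
          simp only [Finset.mul_sum, Algebra.TensorProduct.tmul_mul_tmul, one_mul]
      _ = c • ∑ m, ∑ b, ∑ a, M (b, a) (i, l) • (t k m ⊗ₜ[ℂ] (t m a * x b)) := by
          simp only [hx, Finset.smul_sum, TensorProduct.tmul_sum, TensorProduct.tmul_smul]
      _ = _ := by
          simp only [Finset.sum_mul, Algebra.TensorProduct.tmul_mul_tmul, mul_one,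
            Finset.smul_sum]
          rw [Finset.sum_comm]
          exact Finset.sum_congr rfl fun _ _ => Finset.sum_comm
  rw [add_mul, h1, h2]
  simp only [mul_add, smul_add, Finset.sum_add_distrib]

theorem cross_coproduct' {M : Matrix (ι × ι) (ι × ι) ℂ} {c : ℂ} {x : ι → S} {T t : ι → ι → S}
    (hT : MatrixRelation M T t)
    (hx : ∀ i k l, t k l * x i = c • ∑ b, ∑ a, M (i, k) (b, a) • (x b * t a l)) (i k l : ι) :
    (∑ m, t k m ⊗ₜ[ℂ] t m l) * (∑ a, T i a ⊗ₜ[ℂ] x a + x i ⊗ₜ[ℂ] (1 : S)) =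
      c • ∑ b, ∑ a, M (i, k) (b, a) • ((∑ n, T b n ⊗ₜ[ℂ] x n + x b ⊗ₜ[ℂ] (1 : S)) *
        (∑ m, t a m ⊗ₜ[ℂ] t m l)) := by
  have h1 : (∑ m, t k m ⊗ₜ[ℂ] t m l) * (∑ a, T i a ⊗ₜ[ℂ] x a) =
      c • ∑ b, ∑ a, M (i, k) (b, a) • ((∑ n, T b n ⊗ₜ[ℂ] x n) * (∑ m, t a m ⊗ₜ[ℂ] t m l)) := by
    calc _ = ∑ a, ∑ m, (t k m * T i a) ⊗ₜ[ℂ] (t m l * x a) := by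
          simp only [Finset.sum_mul, Finset.mul_sum, Algebra.TensorProduct.tmul_mul_tmul]
      _ = c • ∑ a, ∑ m, ∑ d, ∑ n, M (a, m) (d, n) • (t k m * T i a) ⊗ₜ[ℂ] (x d * t n l) := by
          simp only [hx, Finset.smul_sum, TensorProduct.tmul_sum, TensorProduct.tmul_smul,
            TensorProduct.smul_tmul']
      _ = c • ∑ d, ∑ n, (∑ a, ∑ m, M (a, m) (d, n) • (t k m * T i a)) ⊗ₜ[ℂ] (x d * t n l) := by
          rw [sum_swap]
          simp only [TensorProduct.sum_tmul, TensorProduct.smul_tmul']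
      _ = c • ∑ d, ∑ n, ∑ b, ∑ a, M (i, k) (b, a) • ((T b d * t a n) ⊗ₜ[ℂ] (x d * t n l)) := by
          simp only [← hT i k, TensorProduct.sum_tmul, TensorProduct.smul_tmul']
      _ = _ := by
          rw [sum_swap]
          simp only [Finset.sum_mul, Finset.mul_sum, Algebra.TensorProduct.tmul_mul_tmul,
            Finset.smul_sum]
          refine Finset.sum_congr rfl fun _ _ => Finset.sum_congr rfl fun _ _ => Finset.sum_comm
  have h2 : (∑ m, t k m ⊗ₜ[ℂ] t m l) * (x i ⊗ₜ[ℂ] (1 : S)) =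
      c • ∑ b, ∑ a, M (i, k) (b, a) • ((x b ⊗ₜ[ℂ] (1 : S)) * (∑ m, t a m ⊗ₜ[ℂ] t m l)) := by
    calc _ = ∑ m, (t k m * x i) ⊗ₜ[ℂ] t m l := by
          simp only [Finset.sum_mul, Algebra.TensorProduct.tmul_mul_tmul, mul_one]
      _ = c • ∑ m, ∑ b, ∑ a, M (i, k) (b, a) • ((x b * t a m) ⊗ₜ[ℂ] t m l) := by
          simp only [hx, Finset.smul_sum, TensorProduct.sum_tmul, TensorProduct.smul_tmul']
      _ = _ := by
          simp only [Finset.mul_sum, Algebra.TensorProduct.tmul_mul_tmul, one_mul,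
            Finset.smul_sum]
          rw [Finset.sum_comm]
          exact Finset.sum_congr rfl fun _ _ => Finset.sum_comm
  rw [mul_add, h1, h2]
  simp only [add_mul, smul_add, Finset.sum_add_distrib]

end Cross

section Extension

open LaurentPolynomial

/-- The extension `Ã = A ⊗ ℂℤ` of `A` by a central invertible group-like element `g`. -/
def Extended (A : Type*) [Ring A] [Bialgebra ℂ A] : Type _ := A ⊗[ℂ] ℂ[T;T⁻¹]

variable {A : Type*} [Ring A] [Bialgebra ℂ A]

instance Extended.instRing : Ring (Extended A) := inferInstanceAs (Ring (A ⊗[ℂ] ℂ[T;T⁻¹]))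

instance Extended.instBialgebra : Bialgebra ℂ (Extended A) :=
  inferInstanceAs (Bialgebra ℂ (A ⊗[ℂ] ℂ[T;T⁻¹]))

/-- The element `a gᵐ` of `Ã`. -/
def Extended.elt (a : A) (m : ℤ) : Extended A := a ⊗ₜ[ℂ] (T m : ℂ[T;T⁻¹])

theorem Extended.elt_mul (a b : A) (m n : ℤ) :
    Extended.elt a m * Extended.elt b n = Extended.elt (a * b) (m + n) := by
  rw [Extended.elt, Extended.elt, Extended.elt, LaurentPolynomial.T_add]
  exact Algebra.TensorProduct.tmul_mul_tmul _ _ _ _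

theorem Extended.elt_one : Extended.elt (1 : A) 0 = 1 := rfl

theorem Extended.elt_smul (c : ℂ) (a : A) (m : ℤ) :
    Extended.elt (c • a) m = c • Extended.elt a m := rfl

theorem Extended.elt_sum {κ : Type*} (s : Finset κ) (f : κ → A) (m : ℤ) :
    Extended.elt (∑ i ∈ s, f i) m = ∑ i ∈ s, Extended.elt (f i) m :=
  TensorProduct.sum_tmul _ _ _

theorem Extended.comul_elt {κ : Type*} (s : Finset κ) (a : A) (x y : κ → A) (m : ℤ)
    (h : Coalgebra.comul (R := ℂ) a = ∑ i ∈ s, x i ⊗ₜ[ℂ] y i) :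
    Coalgebra.comul (R := ℂ) (Extended.elt a m) =
      ∑ i ∈ s, Extended.elt (x i) m ⊗ₜ[ℂ] Extended.elt (y i) m := by
  have := TensorProduct.comul_tmul (R := ℂ) (S := ℂ) a (T m : ℂ[T;T⁻¹])
  refine this.trans ?_
  rw [h, LaurentPolynomial.comul_T, TensorProduct.sum_tmul, map_sum]
  rfl

theorem Extended.counit_elt (a : A) (m : ℤ) :
    Coalgebra.counit (R := ℂ) (Extended.elt a m) = Coalgebra.counit (R := ℂ) a := by
  have := TensorProduct.counit_tmul (R := ℂ) (S := ℂ) a (T m : ℂ[T;T⁻¹])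
  refine this.trans ?_
  rw [LaurentPolynomial.counit_T]
  simp

/-- The dual quasitriangular structure `gᵐ ⊗ gⁿ ↦ λ^(-mn)` of `ℂℤ`. -/
def scalingForm (lam : ℂ) : ℂ[T;T⁻¹] ⊗[ℂ] ℂ[T;T⁻¹] →ₗ[ℂ] ℂ :=
  TensorProduct.lift ((AddMonoidAlgebra.basis ℤ ℂ).constr ℂ fun m =>
    (AddMonoidAlgebra.basis ℤ ℂ).constr ℂ fun n => lam ^ (-(m * n)))

/-- The tensor product dual quasitriangular structure on `Ã = A ⊗ ℂℤ`. -/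
def extendedForm (r : A ⊗[ℂ] A →ₗ[ℂ] ℂ) (lam : ℂ) : Extended A ⊗[ℂ] Extended A →ₗ[ℂ] ℂ :=
  LinearMap.mul' ℂ ℂ ∘ₗ TensorProduct.map r (scalingForm lam) ∘ₗ
    (TensorProduct.tensorTensorTensorComm ℂ A ℂ[T;T⁻¹] A ℂ[T;T⁻¹]).toLinearMap

end Extension

section InclCoalgebra

variable {H P : Type*} [Ring H] [Bialgebra ℂ H] [Ring P] [Algebra ℂ P] (φ : H →ₐ[ℂ] P)

theorem incl_coassoc (d : P →ₐ[ℂ] P ⊗[ℂ] P) (hd : ∀ a, d (φ a) =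
    Algebra.TensorProduct.map φ φ (Coalgebra.comul (R := ℂ) a)) (a : H) :
    (Algebra.TensorProduct.assoc ℂ ℂ ℂ P P P) ((Algebra.TensorProduct.map d (AlgHom.id ℂ P))
      (Algebra.TensorProduct.map φ φ (Coalgebra.comul (R := ℂ) a))) =
    (Algebra.TensorProduct.map (AlgHom.id ℂ P) d)
      (Algebra.TensorProduct.map φ φ (Coalgebra.comul (R := ℂ) a)) := by
  have h := congrArg (Algebra.TensorProduct.map φ (Algebra.TensorProduct.map φ φ))
    (Coalgebra.coassoc_apply (R := ℂ) a)
  have e1 : ∀ z : H ⊗[ℂ] H,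
      (Algebra.TensorProduct.map (AlgHom.id ℂ P) d) (Algebra.TensorProduct.map φ φ z) =
      (Algebra.TensorProduct.map φ (Algebra.TensorProduct.map φ φ))
        (LinearMap.lTensor _ Coalgebra.comul z) := by
    intro z
    induction z using TensorProduct.induction_on with
    | zero => simp
    | add x y hx hy => simp only [map_add, hx, hy]
    | tmul x y => simp [hd]
  have e2 : ∀ z : H ⊗[ℂ] H,
      (Algebra.TensorProduct.assoc ℂ ℂ ℂ P P P) ((Algebra.TensorProduct.map d (AlgHom.id ℂ P))
        (Algebra.TensorProduct.map φ φ z)) =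
      (Algebra.TensorProduct.map φ (Algebra.TensorProduct.map φ φ))
        (TensorProduct.assoc ℂ _ _ _ (LinearMap.rTensor _ Coalgebra.comul z)) := by
    intro z
    have e3 : ∀ (w : H ⊗[ℂ] H) (b : H),
        (Algebra.TensorProduct.assoc ℂ ℂ ℂ P P P) (Algebra.TensorProduct.map φ φ w ⊗ₜ φ b) =
        (Algebra.TensorProduct.map φ (Algebra.TensorProduct.map φ φ))
          (TensorProduct.assoc ℂ _ _ _ (w ⊗ₜ b)) := by
      intro w b
      induction w using TensorProduct.induction_on with
      | zero => simp
      | add x y hx hy => simp only [map_add, TensorProduct.add_tmul, hx, hy]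
      | tmul x y => simp
    induction z using TensorProduct.induction_on with
    | zero => simp
    | add x y hx hy => simp only [map_add, hx, hy]
    | tmul x y => simp [hd, e3]
  exact (e2 _).trans (h.trans (e1 _).symm)

theorem incl_rTensor (c : P →ₐ[ℂ] ℂ) (hc : ∀ a, c (φ a) = Coalgebra.counit (R := ℂ) a) (a : H) :
    (Algebra.TensorProduct.map c (AlgHom.id ℂ P))
      (Algebra.TensorProduct.map φ φ (Coalgebra.comul (R := ℂ) a)) = 1 ⊗ₜ φ a := by
  have h := congrArg (Algebra.TensorProduct.map (AlgHom.id ℂ ℂ) φ)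
    (Coalgebra.rTensor_counit_comul (R := ℂ) a)
  have e1 : ∀ z : H ⊗[ℂ] H,
      (Algebra.TensorProduct.map c (AlgHom.id ℂ P)) (Algebra.TensorProduct.map φ φ z) =
      (Algebra.TensorProduct.map (AlgHom.id ℂ ℂ) φ)
        (LinearMap.rTensor _ Coalgebra.counit z) := by
    intro z
    induction z using TensorProduct.induction_on with
    | zero => simp
    | add x y hx hy => simp only [map_add, hx, hy]
    | tmul x y => simp [hc]
  exact (e1 _).trans (h.trans (by simp))

theorem incl_lTensor (c : P →ₐ[ℂ] ℂ) (hc : ∀ a, c (φ a) = Coalgebra.counit (R := ℂ) a) (a : H) :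
    (Algebra.TensorProduct.map (AlgHom.id ℂ P) c)
      (Algebra.TensorProduct.map φ φ (Coalgebra.comul (R := ℂ) a)) = φ a ⊗ₜ 1 := by
  have h := congrArg (Algebra.TensorProduct.map φ (AlgHom.id ℂ ℂ))
    (Coalgebra.lTensor_counit_comul (R := ℂ) a)
  have e1 : ∀ z : H ⊗[ℂ] H,
      (Algebra.TensorProduct.map (AlgHom.id ℂ P) c) (Algebra.TensorProduct.map φ φ z) =
      (Algebra.TensorProduct.map φ (AlgHom.id ℂ ℂ))
        (LinearMap.lTensor _ Coalgebra.counit z) := by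
    intro z
    induction z using TensorProduct.induction_on with
    | zero => simp
    | add x y hx hy => simp only [map_add, hx, hy]
    | tmul x y => simp [hc]
  exact (e1 _).trans (h.trans (by simp))

end InclCoalgebra

section Braided

/-- The product `(a ⊗ b)(c ⊗ d) = a Ψ(b ⊗ c) d` of the braided tensor product algebra `V ⊗ V`. -/
def braidedMul {V : Type*} [Ring V] [Algebra ℂ V] (Ψ : V ⊗[ℂ] V →ₗ[ℂ] V ⊗[ℂ] V) :
    (V ⊗[ℂ] V) ⊗[ℂ] (V ⊗[ℂ] V) →ₗ[ℂ] V ⊗[ℂ] V :=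
  TensorProduct.map (LinearMap.mul' ℂ V) (LinearMap.mul' ℂ V) ∘ₗ
    (TensorProduct.assoc ℂ V V (V ⊗[ℂ] V)).symm.toLinearMap ∘ₗ
    LinearMap.lTensor V ((TensorProduct.assoc ℂ V V V).toLinearMap ∘ₗ
      LinearMap.rTensor V Ψ ∘ₗ (TensorProduct.assoc ℂ V V V).symm.toLinearMap) ∘ₗ
    (TensorProduct.assoc ℂ V V (V ⊗[ℂ] V)).toLinearMap

/-- The comultiplication and counit of `V` are the linear braided ones: `Δ x = x ⊗ 1 + 1 ⊗ x` and
`ε(x) = 0` on the generators `x`, extended multiplicatively, `Δ` with respect to the braided tensor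
product. -/
structure IsBraidedLinearCoproduct {κ V : Type*} [Ring V] [Algebra ℂ V] [Coalgebra ℂ V]
    (Ψ : V ⊗[ℂ] V →ₗ[ℂ] V ⊗[ℂ] V) (x : κ → V) : Prop where
  comul_one : Coalgebra.comul (R := ℂ) (1 : V) = 1 ⊗ₜ 1
  comul_generator : ∀ i, Coalgebra.comul (R := ℂ) (x i) = x i ⊗ₜ 1 + 1 ⊗ₜ x i
  comul_mul : ∀ v w : V, Coalgebra.comul (R := ℂ) (v * w) =
    braidedMul Ψ (Coalgebra.comul v ⊗ₜ Coalgebra.comul w)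
  counit_one : Coalgebra.counit (R := ℂ) (1 : V) = 1
  counit_generator : ∀ i, Coalgebra.counit (R := ℂ) (x i) = 0
  counit_mul : ∀ v w : V, Coalgebra.counit (R := ℂ) (v * w) =
    Coalgebra.counit (R := ℂ) v * Coalgebra.counit (R := ℂ) w

/-- The graded dual of an algebra `V` generated in degree one by `x`: the functionals that vanish
on the products of `d` generators for all large `d`. -/
def gradedDual {κ V : Type*} [Ring V] [Algebra ℂ V] (x : κ → V) : Set (V →ₗ[ℂ] ℂ) :=
  {b | ∃ N : ℕ, ∀ d ≥ N, ∀ v ∈ Submodule.span ℂ (Set.range x) ^ d, b v = 0}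

end Braided

section Data

/-- The data of the construction: matrices `R`, `R'`, a matrix quantum group `A` (a dual
quasitriangular Hopf algebra which is a quotient of the bialgebra `A(R)`, with matrix generator `t`
and dual quasitriangular structure `r`), and the normalisation constant `λ`. -/
structure QuantumGroupData (ι : Type u) [Fintype ι] [DecidableEq ι]
    (A : Type*) [Ring A] [Bialgebra ℂ A] where
  R : Matrix (ι × ι) (ι × ι) ℂ
  R' : Matrix (ι × ι) (ι × ι) ℂ
  isUnit_R : IsUnit R
  isUnit_R' : IsUnit R'
  yangBaxter : leg12 R * leg13 R * leg23 R = leg23 R * leg13 R * leg12 R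
  mixed_left : leg12 R * leg13 R * leg23 R' = leg23 R' * leg13 R * leg12 R
  mixed_right : leg23 R * leg13 R * leg12 R' = leg12 R' * leg13 R * leg23 R
  hecke : (permMatrix ι * R + 1) * (permMatrix ι * R' - 1) = 0
  flip_comm : flipLegs R * R' = flipLegs R' * R
  hasAntipode : HasAntipode A
  t : ι → ι → A
  generates : Algebra.adjoin ℂ (Set.range fun p : ι × ι => t p.1 p.2) = ⊤
  comul_t : ∀ i j, Coalgebra.comul (R := ℂ) (t i j) = ∑ a, t i a ⊗ₜ[ℂ] t a j
  counit_t : ∀ i j, Coalgebra.counit (R := ℂ) (t i j) = if i = j then 1 else 0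
  relation_R : MatrixRelation R t t
  /-- The relations `R'₁₂ t₁ t₂ = t₂ t₁ R'₁₂`, which express that the braided covectors are
  covariant under `A`. -/
  relation_R' : MatrixRelation R' t t
  r : A ⊗[ℂ] A →ₗ[ℂ] ℂ
  dualQuasitriangular : IsDualQuasitriangular r
  lam : ℂ
  lam_ne_zero : lam ≠ 0
  r_t : ∀ i j k l, r (t i j ⊗ₜ t k l) = lam * R (i, k) (j, l)

namespace QuantumGroupData

variable {ι : Type u} [Fintype ι] [DecidableEq ι] {A : Type*} [Ring A] [Bialgebra ℂ A]
  (D : QuantumGroupData ι A)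

/-- The group-like element `g`. -/
def g (_ : QuantumGroupData ι A) : Extended A := Extended.elt 1 1

/-- The matrix entry `t^i_j` in `Ã`. -/
def text (i j : ι) : Extended A := Extended.elt (D.t i j) 0

/-- The matrix entry `t^i_j g` in `Ã`. -/
def tg (i j : ι) : Extended A := Extended.elt (D.t i j) 1

/-- The dual quasitriangular structure of `Ã`. -/
def form : Extended A ⊗[ℂ] Extended A →ₗ[ℂ] ℂ := extendedForm D.r D.lam

theorem relation_elt {M : Matrix (ι × ι) (ι × ι) ℂ} (h : MatrixRelation M D.t D.t) (m n : ℤ) :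
    MatrixRelation M (fun i j => Extended.elt (D.t i j) m)
      (fun i j => Extended.elt (D.t i j) n) := by
  intro i k j l
  have := congrArg (fun a => Extended.elt a (m + n)) (h i k j l)
  simp only [Extended.elt_sum, Extended.elt_smul] at this
  simp only [Extended.elt_mul]
  rw [this]
  simp only [add_comm n m]

theorem hecke_apply (c d j l : ι) :
    ∑ k, ∑ i, D.R (c, d) (k, i) * D.R' (i, k) (j, l) + D.R' (c, d) (j, l) =
      D.R (c, d) (j, l) + if c = l ∧ d = j then 1 else 0 := by
  have h := congrFun (congrFun D.hecke (d, c)) (j, l)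
  simp only [add_mul, mul_sub, mul_one, one_mul, Matrix.add_apply, Matrix.sub_apply,
    Matrix.zero_apply] at h
  have hP : ∀ (M : Matrix (ι × ι) (ι × ι) ℂ) (x y : ι) (z : ι × ι),
      (permMatrix ι * M) (x, y) z = M (y, x) z := by
    intro M x y z
    rw [Matrix.mul_apply, Finset.sum_eq_single (y, x)]
    · simp [permMatrix]
    · rintro ⟨a, b⟩ _ hne
      have : ¬ (x = b ∧ y = a) := by rintro ⟨rfl, rfl⟩; exact hne rfl
      simp [permMatrix, this]
    · simp
  rw [Matrix.mul_apply, Fintype.sum_prod_type] at h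
  simp only [hP, Matrix.one_apply, Prod.mk.injEq] at h
  have e : (if c = l ∧ d = j then (1 : ℂ) else 0) = if d = j ∧ c = l then 1 else 0 := by
    simp only [and_comm]
  rw [e]
  linear_combination h

/-- The same with the two factors in the opposite order. -/
theorem hecke_apply' (j l c d : ι) :
    ∑ k, ∑ i, D.R' (j, l) (k, i) * D.R (i, k) (c, d) + D.R' (j, l) (c, d) =
      D.R (j, l) (c, d) + if j = d ∧ l = c then 1 else 0 := by
  rw [← D.hecke_apply j l c d]
  congr 1
  have h := congrFun (congrFun D.flip_comm (l, j)) (c, d)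
  simp only [Matrix.mul_apply, flipLegs, Matrix.submatrix_apply, Prod.swap_prod_mk,
    Fintype.sum_prod_type] at h
  rw [Finset.sum_comm, Finset.sum_comm (γ := ι) (s := Finset.univ) (t := Finset.univ)
    (f := fun k i => D.R (j, l) (k, i) * D.R' (i, k) (c, d))]
  exact h.symm

theorem relation_tg {M : Matrix (ι × ι) (ι × ι) ℂ} (h : MatrixRelation M D.t D.t) :
    MatrixRelation M D.tg D.tg := D.relation_elt h 1 1

theorem text_mul_g (i j : ι) : D.text i j * D.g = D.tg i j := by
  rw [text, g, tg, Extended.elt_mul, mul_one, zero_add]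

theorem g_mul_text (i j : ι) : D.g * D.text i j = D.tg i j := by
  rw [text, g, tg, Extended.elt_mul, one_mul, add_zero]

theorem g_mul_tg (i j : ι) : D.g * D.tg i j = D.tg i j * D.g := by
  rw [g, tg, Extended.elt_mul, Extended.elt_mul, mul_one, one_mul]

theorem comul_text (i j : ι) : Coalgebra.comul (R := ℂ) (D.text i j) =
    ∑ a, D.text i a ⊗ₜ[ℂ] D.text a j :=
  Extended.comul_elt _ _ _ _ _ (D.comul_t i j)

theorem comul_tg (i j : ι) : Coalgebra.comul (R := ℂ) (D.tg i j) =
    ∑ a, D.tg i a ⊗ₜ[ℂ] D.tg a j :=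
  Extended.comul_elt _ _ _ _ _ (D.comul_t i j)

theorem counit_text (i j : ι) : Coalgebra.counit (R := ℂ) (D.text i j) = if i = j then 1 else 0 :=
  (Extended.counit_elt _ _).trans (D.counit_t i j)

theorem counit_tg (i j : ι) : Coalgebra.counit (R := ℂ) (D.tg i j) = if i = j then 1 else 0 :=
  (Extended.counit_elt _ _).trans (D.counit_t i j)

theorem comul_g : Coalgebra.comul (R := ℂ) D.g = D.g ⊗ₜ[ℂ] D.g := by
  have := Extended.comul_elt (Finset.univ : Finset Unit) (1 : A) (fun _ => 1) (fun _ => 1) 1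
    (by simp [Algebra.TensorProduct.one_def])
  simp only [Finset.univ_unique, Finset.sum_singleton] at this
  exact this

theorem counit_g : Coalgebra.counit (R := ℂ) D.g = 1 :=
  (Extended.counit_elt _ _).trans (by simp)

/-- The relations `x₁ x₂ = x₂ x₁ R'₁₂`. -/
inductive CovectorRel : FreeAlgebra ℂ ι → FreeAlgebra ℂ ι → Prop
  | mk (j l : ι) : CovectorRel (FreeAlgebra.ι ℂ j * FreeAlgebra.ι ℂ l)
      (∑ k, ∑ i, D.R' (i, k) (j, l) • (FreeAlgebra.ι ℂ k * FreeAlgebra.ι ℂ i))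

/-- The algebra `V*(R')` of braided covectors: generators `x_i`, relations `x₁ x₂ = x₂ x₁ R'₁₂`. -/
def Covector : Type _ := RingQuot D.CovectorRel

instance : Ring D.Covector := inferInstanceAs (Ring (RingQuot D.CovectorRel))
instance : Algebra ℂ D.Covector := inferInstanceAs (Algebra ℂ (RingQuot D.CovectorRel))

/-- The generators `x_i`. -/
def x (i : ι) : D.Covector := RingQuot.mkAlgHom ℂ D.CovectorRel (FreeAlgebra.ι ℂ i)

theorem x_relation : CovectorRelation D.R' D.x := by
  intro j l
  have h := RingQuot.mkAlgHom_rel ℂ (CovectorRel.mk (D := D) j l)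
  simp only [map_mul, map_sum, map_smul] at h
  exact h

/-- Algebra maps out of `V*(R')`. -/
def covectorLift {S : Type*} [Ring S] [Algebra ℂ S] (f : ι → S) (hf : CovectorRelation D.R' f) :
    D.Covector →ₐ[ℂ] S :=
  RingQuot.liftAlgHom ℂ ⟨FreeAlgebra.lift ℂ f, by
    rintro _ _ ⟨j, l⟩
    simp only [map_mul, map_sum, map_smul, FreeAlgebra.lift_ι_apply]
    exact hf j l⟩

theorem covectorLift_x {S : Type*} [Ring S] [Algebra ℂ S] (f : ι → S)
    (hf : CovectorRelation D.R' f) (i : ι) : D.covectorLift f hf (D.x i) = f i :=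
  (RingQuot.liftAlgHom_mkAlgHom_apply _ _ _ _).trans (FreeAlgebra.lift_ι_apply _ _)

/-- The right coaction of `Ã` on `V*(R')`, the algebra map with `x_j ↦ x_i ⊗ t^i_j g`. -/
def coaction : D.Covector →ₐ[ℂ] D.Covector ⊗[ℂ] Extended A :=
  D.covectorLift (fun j => ∑ a, D.x a ⊗ₜ[ℂ] D.tg a j)
    (D.x_relation.tmul (D.relation_tg D.relation_R'))

/-- The right action of `Ã` on `V*(R')` given by the coaction and the dual quasitriangular
structure: `v ◁ a = v⁽¹⁾ r(v⁽²⁾ ⊗ a)`. -/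
def action : D.Covector ⊗[ℂ] Extended A →ₗ[ℂ] D.Covector :=
  (TensorProduct.rid ℂ D.Covector).toLinearMap ∘ₗ LinearMap.lTensor D.Covector D.form ∘ₗ
    (TensorProduct.assoc ℂ D.Covector (Extended A) (Extended A)).toLinearMap ∘ₗ
    LinearMap.rTensor (Extended A) D.coaction.toLinearMap

/-- The braiding `Ψ(v ⊗ w) = w⁽¹⁾ ⊗ v⁽¹⁾ r(v⁽²⁾ ⊗ w⁽²⁾)`, so that
`Ψ(x₁ ⊗ x₂) = x₂ ⊗ x₁ R₁₂`. -/
def braiding : D.Covector ⊗[ℂ] D.Covector →ₗ[ℂ] D.Covector ⊗[ℂ] D.Covector :=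
  (TensorProduct.rid ℂ _).toLinearMap ∘ₗ
    TensorProduct.map (TensorProduct.comm ℂ D.Covector D.Covector).toLinearMap D.form ∘ₗ
    (TensorProduct.tensorTensorTensorComm ℂ D.Covector (Extended A) D.Covector
      (Extended A)).toLinearMap ∘ₗ
    TensorProduct.map D.coaction.toLinearMap D.coaction.toLinearMap

/-- The generators-and-relations presentation of the `q`-Poincaré group: generators `a ∈ Ã` (of
which `Ã` is a subalgebra) and `p_i`, with `p₁ p₂ = p₂ p₁ R'₁₂`, `p g = λ⁻¹ g p` and
`p₁ t₂ = λ t₂ p₁ R₁₂`. -/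
inductive PoincareRel :
    FreeAlgebra ℂ (Extended A ⊕ ι) → FreeAlgebra ℂ (Extended A ⊕ ι) → Prop
  | scalar (c : ℂ) : PoincareRel (FreeAlgebra.ι ℂ (Sum.inl (algebraMap ℂ (Extended A) c)))
      (algebraMap ℂ _ c)
  | add (a b : Extended A) : PoincareRel (FreeAlgebra.ι ℂ (Sum.inl (a + b)))
      (FreeAlgebra.ι ℂ (Sum.inl a) + FreeAlgebra.ι ℂ (Sum.inl b))
  | mul (a b : Extended A) : PoincareRel (FreeAlgebra.ι ℂ (Sum.inl (a * b)))
      (FreeAlgebra.ι ℂ (Sum.inl a) * FreeAlgebra.ι ℂ (Sum.inl b))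
  | covector (j l : ι) :
      PoincareRel (FreeAlgebra.ι ℂ (Sum.inr j) * FreeAlgebra.ι ℂ (Sum.inr l))
        (∑ k, ∑ i, D.R' (i, k) (j, l) •
          (FreeAlgebra.ι ℂ (Sum.inr k) * FreeAlgebra.ι ℂ (Sum.inr i)))
  | cross_g (i : ι) :
      PoincareRel (FreeAlgebra.ι ℂ (Sum.inr i) * FreeAlgebra.ι ℂ (Sum.inl D.g))
        (D.lam⁻¹ • (FreeAlgebra.ι ℂ (Sum.inl D.g) * FreeAlgebra.ι ℂ (Sum.inr i)))
  | cross_t (i k l : ι) :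
      PoincareRel (FreeAlgebra.ι ℂ (Sum.inr i) * FreeAlgebra.ι ℂ (Sum.inl (D.text k l)))
        (D.lam • ∑ b, ∑ a, D.R (b, a) (i, l) •
          (FreeAlgebra.ι ℂ (Sum.inl (D.text k a)) * FreeAlgebra.ι ℂ (Sum.inr b)))

/-- The `q`-Poincaré group `V*(R') ⋊ Ã`. -/
def Poincare : Type _ := RingQuot D.PoincareRel

instance : Ring D.Poincare := inferInstanceAs (Ring (RingQuot D.PoincareRel))
instance : Algebra ℂ D.Poincare := inferInstanceAs (Algebra ℂ (RingQuot D.PoincareRel))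

/-- The map `Ã → P`. -/
def incl : Extended A →ₐ[ℂ] D.Poincare :=
  .ofLinearMap
    { toFun := fun a => RingQuot.mkAlgHom ℂ D.PoincareRel (FreeAlgebra.ι ℂ (Sum.inl a))
      map_add' := fun a b => by
        rw [RingQuot.mkAlgHom_rel ℂ (PoincareRel.add (D := D) a b), map_add]
        rfl
      map_smul' := fun c a => by
        rw [Algebra.smul_def, RingQuot.mkAlgHom_rel ℂ (PoincareRel.mul (D := D) _ a), map_mul,
          RingQuot.mkAlgHom_rel ℂ (PoincareRel.scalar (D := D) c), AlgHom.commutes,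
          ← Algebra.smul_def]
        rfl }
    (by
      have := RingQuot.mkAlgHom_rel ℂ (PoincareRel.scalar (D := D) 1)
      simp only [map_one] at this
      exact this)
    (fun a b => by
      have := RingQuot.mkAlgHom_rel ℂ (PoincareRel.mul (D := D) a b)
      simp only [map_mul] at this
      exact this)

/-- The generators `p_i`. -/
def p (i : ι) : D.Poincare := RingQuot.mkAlgHom ℂ D.PoincareRel (FreeAlgebra.ι ℂ (Sum.inr i))

theorem p_relation : CovectorRelation D.R' D.p := by
  intro j l
  have h := RingQuot.mkAlgHom_rel ℂ (PoincareRel.covector (D := D) j l)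
  simp only [map_mul, map_sum, map_smul] at h
  exact h

theorem p_mul_g (i : ι) : D.p i * D.incl D.g = D.lam⁻¹ • (D.incl D.g * D.p i) := by
  have h := RingQuot.mkAlgHom_rel ℂ (PoincareRel.cross_g (D := D) i)
  simp only [map_mul, map_smul] at h
  exact h

theorem p_mul_t (i k l : ι) : D.p i * D.incl (D.text k l) =
    D.lam • ∑ b, ∑ a, D.R (b, a) (i, l) • (D.incl (D.text k a) * D.p b) := by
  have h := RingQuot.mkAlgHom_rel ℂ (PoincareRel.cross_t (D := D) i k l)
  simp only [map_mul, map_sum, map_smul] at h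
  exact h

theorem p_mul_tg (i k l : ι) : D.p i * D.incl (D.tg k l) =
    ∑ a, ∑ b, D.R (b, a) (i, l) • (D.incl (D.tg k a) * D.p b) := by
  rw [← D.text_mul_g, map_mul, ← mul_assoc, p_mul_t]
  simp only [smul_mul_assoc, Finset.sum_mul, mul_assoc, p_mul_g, mul_smul_comm, Finset.smul_sum]
  rw [Finset.sum_comm]
  refine Finset.sum_congr rfl fun a _ => Finset.sum_congr rfl fun b _ => ?_
  rw [smul_comm (D.R _ _), smul_smul, mul_inv_cancel₀ D.lam_ne_zero, one_smul, ← mul_assoc,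
    ← map_mul, text_mul_g]

/-- Algebra maps out of `P`. -/
def poincareLift {S : Type*} [Ring S] [Algebra ℂ S] (φ : Extended A →ₐ[ℂ] S) (f : ι → S)
    (hf : CovectorRelation D.R' f) (hg : ∀ i, f i * φ D.g = D.lam⁻¹ • (φ D.g * f i))
    (ht : ∀ i k l, f i * φ (D.text k l) =
      D.lam • ∑ b, ∑ a, D.R (b, a) (i, l) • (φ (D.text k a) * f b)) :
    D.Poincare →ₐ[ℂ] S :=
  RingQuot.liftAlgHom ℂ ⟨FreeAlgebra.lift ℂ (Sum.elim φ f), by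
    rintro _ _ (c | ⟨a, b⟩ | ⟨a, b⟩ | ⟨j, l⟩ | i | ⟨i, k, l⟩) <;>
    simp only [map_mul, map_add, map_sum, map_smul, FreeAlgebra.lift_ι_apply, Sum.elim_inl,
      Sum.elim_inr, AlgHom.commutes]
    · exact hf j l
    · exact hg i
    · exact ht i k l⟩

section Lift

variable {S : Type*} [Ring S] [Algebra ℂ S] (φ : Extended A →ₐ[ℂ] S) (f : ι → S)
    (hf : CovectorRelation D.R' f) (hg : ∀ i, f i * φ D.g = D.lam⁻¹ • (φ D.g * f i))
    (ht : ∀ i k l, f i * φ (D.text k l) =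
      D.lam • ∑ b, ∑ a, D.R (b, a) (i, l) • (φ (D.text k a) * f b))

theorem poincareLift_incl (a : Extended A) :
    D.poincareLift φ f hf hg ht (D.incl a) = φ a :=
  (RingQuot.liftAlgHom_mkAlgHom_apply _ _ _ _).trans (FreeAlgebra.lift_ι_apply _ _)

theorem poincareLift_p (i : ι) : D.poincareLift φ f hf hg ht (D.p i) = f i :=
  (RingQuot.liftAlgHom_mkAlgHom_apply _ _ _ _).trans (FreeAlgebra.lift_ι_apply _ _)

end Lift

theorem poincare_ext {S : Type*} [Semiring S] [Algebra ℂ S] {F G : D.Poincare →ₐ[ℂ] S}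
    (h1 : ∀ a, F (D.incl a) = G (D.incl a)) (h2 : ∀ i, F (D.p i) = G (D.p i)) : F = G := by
  apply RingQuot.ringQuot_ext'
  apply FreeAlgebra.hom_ext
  funext y
  rcases y with a | i
  · exact h1 a
  · exact h2 i

/-- The coproduct of `P`: on `Ã` it is that of `Ã`, and `Δ p = p ⊗ t g + 1 ⊗ p`. -/
def poincareComul : D.Poincare →ₐ[ℂ] D.Poincare ⊗[ℂ] D.Poincare :=
  D.poincareLift ((Algebra.TensorProduct.map D.incl D.incl).comp
      (Bialgebra.comulAlgHom ℂ (Extended A)))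
    (fun j => ∑ a, D.p a ⊗ₜ[ℂ] D.incl (D.tg a j) + (1 : D.Poincare) ⊗ₜ[ℂ] D.p j)
    (CovectorRelation.coproduct D.hecke_apply D.p_relation
      (T := fun i j => D.incl (D.tg i j)) ((D.relation_tg D.relation_R').map D.incl)
      (fun j b l => D.p_mul_tg j b l))
    (by
      intro i
      have e : ((Algebra.TensorProduct.map D.incl D.incl).comp
          (Bialgebra.comulAlgHom ℂ (Extended A))) D.g = D.incl D.g ⊗ₜ[ℂ] D.incl D.g := by
        simp [comul_g]
      rw [e]
      simp only [add_mul, mul_add, Finset.sum_mul, Finset.mul_sum,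
        Algebra.TensorProduct.tmul_mul_tmul, p_mul_g, one_mul, mul_one, smul_add,
        Finset.smul_sum, TensorProduct.smul_tmul', TensorProduct.tmul_smul, ← map_mul, g_mul_tg])
    (by
      intro i k l
      have e : ∀ k l, ((Algebra.TensorProduct.map D.incl D.incl).comp
          (Bialgebra.comulAlgHom ℂ (Extended A))) (D.text k l) =
          ∑ m, D.incl (D.text k m) ⊗ₜ[ℂ] D.incl (D.text m l) := by
        intro k l
        simp [comul_text]
      simp only [e]
      exact cross_coproduct (T := fun i j => D.incl (D.tg i j))
        (t := fun i j => D.incl (D.text i j)) ((D.relation_elt D.relation_R 1 0).map D.incl)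
        D.p_mul_t i k l)

/-- The counit of `P`: `ε(p) = 0`. -/
def poincareCounit : D.Poincare →ₐ[ℂ] ℂ :=
  D.poincareLift (Bialgebra.counitAlgHom ℂ (Extended A)) (fun _ => 0)
    (by intro j l; simp) (by simp) (by simp)

theorem poincareComul_incl (a : Extended A) : D.poincareComul (D.incl a) =
    Algebra.TensorProduct.map D.incl D.incl (Coalgebra.comul (R := ℂ) a) :=
  D.poincareLift_incl _ _ _ _ _ a

theorem poincareComul_p (j : ι) : D.poincareComul (D.p j) =
    ∑ a, D.p a ⊗ₜ[ℂ] D.incl (D.tg a j) + (1 : D.Poincare) ⊗ₜ[ℂ] D.p j :=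
  D.poincareLift_p _ _ _ _ _ j

theorem poincareComul_tg (i j : ι) : D.poincareComul (D.incl (D.tg i j)) =
    ∑ a, D.incl (D.tg i a) ⊗ₜ[ℂ] D.incl (D.tg a j) := by
  rw [poincareComul_incl, comul_tg]
  simp

theorem poincareCounit_incl (a : Extended A) : D.poincareCounit (D.incl a) =
    Coalgebra.counit (R := ℂ) a :=
  D.poincareLift_incl _ _ _ _ _ a

theorem poincareCounit_p (j : ι) : D.poincareCounit (D.p j) = 0 :=
  D.poincareLift_p _ _ _ _ _ j

instance : Bialgebra ℂ D.Poincare :=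
  Bialgebra.ofAlgHom D.poincareComul D.poincareCounit
    (by
      apply D.poincare_ext
      · intro a
        have h := incl_coassoc D.incl D.poincareComul D.poincareComul_incl a
        simp only [AlgHom.comp_apply, poincareComul_incl]
        exact h
      · intro j
        simp [poincareComul_p, poincareComul_tg, TensorProduct.sum_tmul, TensorProduct.tmul_sum,
          TensorProduct.add_tmul, TensorProduct.tmul_add, Algebra.TensorProduct.one_def]
        rw [Finset.sum_add_distrib, add_assoc, Finset.sum_comm])
    (by
      apply D.poincare_ext
      · intro a
        have h := incl_rTensor D.incl D.poincareCounit D.poincareCounit_incl a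
        simp only [AlgHom.comp_apply, poincareComul_incl]
        exact h.trans (by simp)
      · intro j
        simp [poincareComul_p, poincareCounit_p])
    (by
      apply D.poincare_ext
      · intro a
        have h := incl_lTensor D.incl D.poincareCounit D.poincareCounit_incl a
        simp only [AlgHom.comp_apply, poincareComul_incl]
        exact h.trans (by simp)
      · intro j
        simp [poincareComul_p, poincareCounit_p, poincareCounit_incl, counit_tg,
          TensorProduct.tmul_ite, Finset.sum_ite_eq'])

/-- The map of algebras `V*(R') → P`, `x_i ↦ p_i`. -/
def ofCovector : D.Covector →ₐ[ℂ] D.Poincare := D.covectorLift D.p D.p_relation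

/-- The relations `R'₁₂ x₁ x₂ = x₂ x₁`. -/
inductive LeftVectorRel : FreeAlgebra ℂ ι → FreeAlgebra ℂ ι → Prop
  | mk (i k : ι) : LeftVectorRel
      (∑ a, ∑ b, D.R' (i, k) (a, b) • (FreeAlgebra.ι ℂ a * FreeAlgebra.ι ℂ b))
      (FreeAlgebra.ι ℂ k * FreeAlgebra.ι ℂ i)

/-- The left-handed version of the algebra of braided covectors: generators `x^i`, relations
`R'₁₂ x₁ x₂ = x₂ x₁`. -/
def LeftVector : Type _ := RingQuot D.LeftVectorRel

instance : Ring D.LeftVector := inferInstanceAs (Ring (RingQuot D.LeftVectorRel))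
instance : Algebra ℂ D.LeftVector := inferInstanceAs (Algebra ℂ (RingQuot D.LeftVectorRel))

/-- The generators `x^i`. -/
def leftX (i : ι) : D.LeftVector := RingQuot.mkAlgHom ℂ D.LeftVectorRel (FreeAlgebra.ι ℂ i)

theorem leftX_relation : VectorRelation D.R' D.leftX := by
  intro i k
  have h := RingQuot.mkAlgHom_rel ℂ (LeftVectorRel.mk (D := D) i k)
  simp only [map_mul, map_sum, map_smul] at h
  exact h

/-- Algebra maps out of the left-handed vector algebra. -/
def leftVectorLift {S : Type*} [Ring S] [Algebra ℂ S] (f : ι → S) (hf : VectorRelation D.R' f) :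
    D.LeftVector →ₐ[ℂ] S :=
  RingQuot.liftAlgHom ℂ ⟨FreeAlgebra.lift ℂ f, by
    rintro _ _ ⟨i, k⟩
    simp only [map_mul, map_sum, map_smul, FreeAlgebra.lift_ι_apply]
    exact hf i k⟩

theorem leftVectorLift_x {S : Type*} [Ring S] [Algebra ℂ S] (f : ι → S)
    (hf : VectorRelation D.R' f) (i : ι) : D.leftVectorLift f hf (D.leftX i) = f i :=
  (RingQuot.liftAlgHom_mkAlgHom_apply _ _ _ _).trans (FreeAlgebra.lift_ι_apply _ _)

/-- The left coaction of `Ã`, the algebra map with `x^i ↦ t^i_a g ⊗ x^a`. -/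
def leftCoaction : D.LeftVector →ₐ[ℂ] Extended A ⊗[ℂ] D.LeftVector :=
  D.leftVectorLift (fun i => ∑ a, D.tg i a ⊗ₜ[ℂ] D.leftX a)
    (D.leftX_relation.tmul (D.relation_tg D.relation_R'))

/-- The left action of `Ã` given by the coaction and the dual quasitriangular structure:
`a ▷ v = r(v⁽¹⁾ ⊗ a) v⁽²⁾`. -/
def leftAction : Extended A ⊗[ℂ] D.LeftVector →ₗ[ℂ] D.LeftVector :=
  (TensorProduct.lid ℂ D.LeftVector).toLinearMap ∘ₗ
    LinearMap.rTensor D.LeftVector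
      (D.form ∘ₗ (TensorProduct.comm ℂ (Extended A) (Extended A)).toLinearMap) ∘ₗ
    (TensorProduct.assoc ℂ (Extended A) (Extended A) D.LeftVector).symm.toLinearMap ∘ₗ
    LinearMap.lTensor (Extended A) D.leftCoaction.toLinearMap

/-- The braiding `Ψ(v ⊗ w) = (v⁽¹⁾ ▷ w) ⊗ v⁽²⁾ = r(w⁽¹⁾ ⊗ v⁽¹⁾) w⁽²⁾ ⊗ v⁽²⁾`. -/
def leftBraiding : D.LeftVector ⊗[ℂ] D.LeftVector →ₗ[ℂ] D.LeftVector ⊗[ℂ] D.LeftVector :=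
  (TensorProduct.lid ℂ _).toLinearMap ∘ₗ
    TensorProduct.map
      (D.form ∘ₗ (TensorProduct.comm ℂ (Extended A) (Extended A)).toLinearMap)
      (TensorProduct.comm ℂ D.LeftVector D.LeftVector).toLinearMap ∘ₗ
    (TensorProduct.tensorTensorTensorComm ℂ (Extended A) D.LeftVector (Extended A)
      D.LeftVector).toLinearMap ∘ₗ
    TensorProduct.map D.leftCoaction.toLinearMap D.leftCoaction.toLinearMap

/-- The generators-and-relations presentation of the left-handed `q`-Poincaré group: generators
`a ∈ Ã` (of which `Ã` is a subalgebra) and `p^i`, with `R'₁₂ p₁ p₂ = p₂ p₁`, `g p = λ⁻¹ p g` and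
`t₂ p₁ = λ R₁₂ p₁ t₂`. -/
inductive LeftPoincareRel :
    FreeAlgebra ℂ (Extended A ⊕ ι) → FreeAlgebra ℂ (Extended A ⊕ ι) → Prop
  | scalar (c : ℂ) : LeftPoincareRel (FreeAlgebra.ι ℂ (Sum.inl (algebraMap ℂ (Extended A) c)))
      (algebraMap ℂ _ c)
  | add (a b : Extended A) : LeftPoincareRel (FreeAlgebra.ι ℂ (Sum.inl (a + b)))
      (FreeAlgebra.ι ℂ (Sum.inl a) + FreeAlgebra.ι ℂ (Sum.inl b))
  | mul (a b : Extended A) : LeftPoincareRel (FreeAlgebra.ι ℂ (Sum.inl (a * b)))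
      (FreeAlgebra.ι ℂ (Sum.inl a) * FreeAlgebra.ι ℂ (Sum.inl b))
  | vector (i k : ι) :
      LeftPoincareRel
        (∑ a, ∑ b, D.R' (i, k) (a, b) •
          (FreeAlgebra.ι ℂ (Sum.inr a) * FreeAlgebra.ι ℂ (Sum.inr b)))
        (FreeAlgebra.ι ℂ (Sum.inr k) * FreeAlgebra.ι ℂ (Sum.inr i))
  | cross_g (i : ι) :
      LeftPoincareRel (FreeAlgebra.ι ℂ (Sum.inl D.g) * FreeAlgebra.ι ℂ (Sum.inr i))
        (D.lam⁻¹ • (FreeAlgebra.ι ℂ (Sum.inr i) * FreeAlgebra.ι ℂ (Sum.inl D.g)))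
  | cross_t (i k l : ι) :
      LeftPoincareRel (FreeAlgebra.ι ℂ (Sum.inl (D.text k l)) * FreeAlgebra.ι ℂ (Sum.inr i))
        (D.lam • ∑ b, ∑ a, D.R (i, k) (b, a) •
          (FreeAlgebra.ι ℂ (Sum.inr b) * FreeAlgebra.ι ℂ (Sum.inl (D.text a l))))

/-- The left-handed `q`-Poincaré group. -/
def LeftPoincare : Type _ := RingQuot D.LeftPoincareRel

instance : Ring D.LeftPoincare := inferInstanceAs (Ring (RingQuot D.LeftPoincareRel))
instance : Algebra ℂ D.LeftPoincare := inferInstanceAs (Algebra ℂ (RingQuot D.LeftPoincareRel))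

/-- The map `Ã → P`. -/
def leftIncl : Extended A →ₐ[ℂ] D.LeftPoincare :=
  .ofLinearMap
    { toFun := fun a => RingQuot.mkAlgHom ℂ D.LeftPoincareRel (FreeAlgebra.ι ℂ (Sum.inl a))
      map_add' := fun a b => by
        rw [RingQuot.mkAlgHom_rel ℂ (LeftPoincareRel.add (D := D) a b), map_add]
        rfl
      map_smul' := fun c a => by
        rw [Algebra.smul_def, RingQuot.mkAlgHom_rel ℂ (LeftPoincareRel.mul (D := D) _ a), map_mul,
          RingQuot.mkAlgHom_rel ℂ (LeftPoincareRel.scalar (D := D) c), AlgHom.commutes,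
          ← Algebra.smul_def]
        rfl }
    (by
      have := RingQuot.mkAlgHom_rel ℂ (LeftPoincareRel.scalar (D := D) 1)
      simp only [map_one] at this
      exact this)
    (fun a b => by
      have := RingQuot.mkAlgHom_rel ℂ (LeftPoincareRel.mul (D := D) a b)
      simp only [map_mul] at this
      exact this)

/-- The generators `p^i`. -/
def leftP (i : ι) : D.LeftPoincare :=
  RingQuot.mkAlgHom ℂ D.LeftPoincareRel (FreeAlgebra.ι ℂ (Sum.inr i))

theorem leftP_relation : VectorRelation D.R' D.leftP := by
  intro i k
  have h := RingQuot.mkAlgHom_rel ℂ (LeftPoincareRel.vector (D := D) i k)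
  simp only [map_mul, map_sum, map_smul] at h
  exact h

theorem g_mul_leftP (i : ι) :
    D.leftIncl D.g * D.leftP i = D.lam⁻¹ • (D.leftP i * D.leftIncl D.g) := by
  have h := RingQuot.mkAlgHom_rel ℂ (LeftPoincareRel.cross_g (D := D) i)
  simp only [map_mul, map_smul] at h
  exact h

theorem t_mul_leftP (i k l : ι) : D.leftIncl (D.text k l) * D.leftP i =
    D.lam • ∑ b, ∑ a, D.R (i, k) (b, a) • (D.leftP b * D.leftIncl (D.text a l)) := by
  have h := RingQuot.mkAlgHom_rel ℂ (LeftPoincareRel.cross_t (D := D) i k l)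
  simp only [map_mul, map_sum, map_smul] at h
  exact h

theorem tg_mul_leftP (k l i : ι) : D.leftIncl (D.tg k l) * D.leftP i =
    ∑ b, ∑ a, D.R (i, k) (b, a) • (D.leftP b * D.leftIncl (D.tg a l)) := by
  have e : D.leftIncl (D.tg k l) * D.leftP i =
      D.leftIncl D.g * (D.leftIncl (D.text k l) * D.leftP i) := by
    rw [← mul_assoc, ← map_mul, g_mul_text]
  rw [e, t_mul_leftP]
  simp only [mul_smul_comm, Finset.mul_sum, Finset.smul_sum]
  refine Finset.sum_congr rfl fun b _ => Finset.sum_congr rfl fun a _ => ?_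
  rw [← mul_assoc, g_mul_leftP, smul_mul_assoc, mul_assoc, ← map_mul, g_mul_text,
    smul_comm (D.R _ _), smul_smul, mul_inv_cancel₀ D.lam_ne_zero, one_smul]

/-- Algebra maps out of the left-handed `P`. -/
def leftPoincareLift {S : Type*} [Ring S] [Algebra ℂ S] (φ : Extended A →ₐ[ℂ] S) (f : ι → S)
    (hf : VectorRelation D.R' f) (hg : ∀ i, φ D.g * f i = D.lam⁻¹ • (f i * φ D.g))
    (ht : ∀ i k l, φ (D.text k l) * f i =
      D.lam • ∑ b, ∑ a, D.R (i, k) (b, a) • (f b * φ (D.text a l))) :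
    D.LeftPoincare →ₐ[ℂ] S :=
  RingQuot.liftAlgHom ℂ ⟨FreeAlgebra.lift ℂ (Sum.elim φ f), by
    rintro _ _ (c | ⟨a, b⟩ | ⟨a, b⟩ | ⟨j, l⟩ | i | ⟨i, k, l⟩) <;>
    simp only [map_mul, map_add, map_sum, map_smul, FreeAlgebra.lift_ι_apply, Sum.elim_inl,
      Sum.elim_inr, AlgHom.commutes]
    · exact hf j l
    · exact hg i
    · exact ht i k l⟩

section LeftLift

variable {S : Type*} [Ring S] [Algebra ℂ S] (φ : Extended A →ₐ[ℂ] S) (f : ι → S)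
    (hf : VectorRelation D.R' f) (hg : ∀ i, φ D.g * f i = D.lam⁻¹ • (f i * φ D.g))
    (ht : ∀ i k l, φ (D.text k l) * f i =
      D.lam • ∑ b, ∑ a, D.R (i, k) (b, a) • (f b * φ (D.text a l)))

theorem leftPoincareLift_incl (a : Extended A) :
    D.leftPoincareLift φ f hf hg ht (D.leftIncl a) = φ a :=
  (RingQuot.liftAlgHom_mkAlgHom_apply _ _ _ _).trans (FreeAlgebra.lift_ι_apply _ _)

theorem leftPoincareLift_p (i : ι) : D.leftPoincareLift φ f hf hg ht (D.leftP i) = f i :=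
  (RingQuot.liftAlgHom_mkAlgHom_apply _ _ _ _).trans (FreeAlgebra.lift_ι_apply _ _)

end LeftLift

theorem leftPoincare_ext {S : Type*} [Semiring S] [Algebra ℂ S] {F G : D.LeftPoincare →ₐ[ℂ] S}
    (h1 : ∀ a, F (D.leftIncl a) = G (D.leftIncl a)) (h2 : ∀ i, F (D.leftP i) = G (D.leftP i)) :
    F = G := by
  apply RingQuot.ringQuot_ext'
  apply FreeAlgebra.hom_ext
  funext y
  rcases y with a | i
  · exact h1 a
  · exact h2 i

/-- The coproduct of the left-handed `P`: on `Ã` it is that of `Ã`, and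
`Δ p = t g ⊗ p + p ⊗ 1`. -/
def leftPoincareComul : D.LeftPoincare →ₐ[ℂ] D.LeftPoincare ⊗[ℂ] D.LeftPoincare :=
  D.leftPoincareLift ((Algebra.TensorProduct.map D.leftIncl D.leftIncl).comp
      (Bialgebra.comulAlgHom ℂ (Extended A)))
    (fun i => ∑ a, D.leftIncl (D.tg i a) ⊗ₜ[ℂ] D.leftP a + D.leftP i ⊗ₜ[ℂ] (1 : D.LeftPoincare))
    (VectorRelation.coproduct D.hecke_apply' D.leftP_relation
      (T := fun i j => D.leftIncl (D.tg i j)) ((D.relation_tg D.relation_R').map D.leftIncl)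
      (fun a c b => D.tg_mul_leftP a c b))
    (by
      intro i
      have e : ((Algebra.TensorProduct.map D.leftIncl D.leftIncl).comp
          (Bialgebra.comulAlgHom ℂ (Extended A))) D.g = D.leftIncl D.g ⊗ₜ[ℂ] D.leftIncl D.g := by
        simp [comul_g]
      rw [e]
      simp only [add_mul, mul_add, Finset.sum_mul, Finset.mul_sum,
        Algebra.TensorProduct.tmul_mul_tmul, g_mul_leftP, one_mul, mul_one, smul_add,
        Finset.smul_sum, TensorProduct.smul_tmul', TensorProduct.tmul_smul, ← map_mul, g_mul_tg])
    (by
      intro i k l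
      have e : ∀ k l, ((Algebra.TensorProduct.map D.leftIncl D.leftIncl).comp
          (Bialgebra.comulAlgHom ℂ (Extended A))) (D.text k l) =
          ∑ m, D.leftIncl (D.text k m) ⊗ₜ[ℂ] D.leftIncl (D.text m l) := by
        intro k l
        simp [comul_text]
      simp only [e]
      exact cross_coproduct' (T := fun i j => D.leftIncl (D.tg i j))
        (t := fun i j => D.leftIncl (D.text i j)) ((D.relation_elt D.relation_R 1 0).map D.leftIncl)
        D.t_mul_leftP i k l)

/-- The counit of the left-handed `P`: `ε(p) = 0`. -/
def leftPoincareCounit : D.LeftPoincare →ₐ[ℂ] ℂ :=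
  D.leftPoincareLift (Bialgebra.counitAlgHom ℂ (Extended A)) (fun _ => 0)
    (by intro j l; simp) (by simp) (by simp)

theorem leftPoincareComul_incl (a : Extended A) : D.leftPoincareComul (D.leftIncl a) =
    Algebra.TensorProduct.map D.leftIncl D.leftIncl (Coalgebra.comul (R := ℂ) a) :=
  D.leftPoincareLift_incl _ _ _ _ _ a

theorem leftPoincareComul_p (i : ι) : D.leftPoincareComul (D.leftP i) =
    ∑ a, D.leftIncl (D.tg i a) ⊗ₜ[ℂ] D.leftP a + D.leftP i ⊗ₜ[ℂ] (1 : D.LeftPoincare) :=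
  D.leftPoincareLift_p _ _ _ _ _ i

theorem leftPoincareComul_tg (i j : ι) : D.leftPoincareComul (D.leftIncl (D.tg i j)) =
    ∑ a, D.leftIncl (D.tg i a) ⊗ₜ[ℂ] D.leftIncl (D.tg a j) := by
  rw [leftPoincareComul_incl, comul_tg]
  simp

theorem leftPoincareCounit_incl (a : Extended A) : D.leftPoincareCounit (D.leftIncl a) =
    Coalgebra.counit (R := ℂ) a :=
  D.leftPoincareLift_incl _ _ _ _ _ a

theorem leftPoincareCounit_p (j : ι) : D.leftPoincareCounit (D.leftP j) = 0 :=
  D.leftPoincareLift_p _ _ _ _ _ j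

instance : Bialgebra ℂ D.LeftPoincare :=
  Bialgebra.ofAlgHom D.leftPoincareComul D.leftPoincareCounit
    (by
      apply D.leftPoincare_ext
      · intro a
        have h := incl_coassoc D.leftIncl D.leftPoincareComul D.leftPoincareComul_incl a
        simp only [AlgHom.comp_apply, leftPoincareComul_incl]
        exact h
      · intro j
        simp [leftPoincareComul_p, leftPoincareComul_tg, TensorProduct.sum_tmul,
          TensorProduct.tmul_sum, TensorProduct.add_tmul, TensorProduct.tmul_add,
          Algebra.TensorProduct.one_def]
        rw [Finset.sum_add_distrib, add_assoc, Finset.sum_comm])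
    (by
      apply D.leftPoincare_ext
      · intro a
        have h := incl_rTensor D.leftIncl D.leftPoincareCounit D.leftPoincareCounit_incl a
        simp only [AlgHom.comp_apply, leftPoincareComul_incl]
        exact h.trans (by simp)
      · intro j
        simp [leftPoincareComul_p, leftPoincareCounit_p, leftPoincareCounit_incl, counit_tg,
          TensorProduct.ite_tmul, Finset.sum_ite_eq])
    (by
      apply D.leftPoincare_ext
      · intro a
        have h := incl_lTensor D.leftIncl D.leftPoincareCounit D.leftPoincareCounit_incl a
        simp only [AlgHom.comp_apply, leftPoincareComul_incl]
        exact h.trans (by simp)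
      · intro j
        simp [leftPoincareComul_p, leftPoincareCounit_p])

/-- The map of algebras from the left-handed vector algebra to the left-handed `P`,
`x^i ↦ p^i`. -/
def ofLeftVector : D.LeftVector →ₐ[ℂ] D.LeftPoincare := D.leftVectorLift D.leftP D.leftP_relation

/-- The finite dual of `V*(R')` as an algebra with an action of `Ã`: the functionals that vanish on
a two-sided ideal of finite codimension which is stable under the action of `Ã`. -/
def covectorDual : Set (D.Covector →ₗ[ℂ] ℂ) :=
  {b | ∃ K : Ideal D.Covector, K.IsTwoSided ∧
    Module.Finite ℂ (D.Covector ⧸ K.restrictScalars ℂ) ∧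
    (∀ v ∈ K, ∀ a : Extended A, D.action (v ⊗ₜ a) ∈ K) ∧ ∀ v ∈ K, b v = 0}

/-- The same for the left-handed vector algebra. -/
def leftVectorDual : Set (D.LeftVector →ₗ[ℂ] ℂ) :=
  {b | ∃ K : Ideal D.LeftVector, K.IsTwoSided ∧
    Module.Finite ℂ (D.LeftVector ⧸ K.restrictScalars ℂ) ∧
    (∀ v ∈ K, ∀ a : Extended A, D.leftAction (a ⊗ₜ v) ∈ K) ∧ ∀ v ∈ K, b v = 0}

/-- The `q`-Poincaré group `P = V*(R') ⋊ Ã` is a semidirect product of `Ã` with `V*(R')` (with the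
linear braided coproduct, the coaction of `Ã`, and the action obtained from it), and its dual is a
semidirect product of `H̃`, the dual of `Ã`, with an algebra and coalgebra `B` dual to `V*(R')`, as
an algebra and as a coalgebra, all structure maps being the transposes of those of `P`. -/
def DualIsSemidirect : Prop :=
  ∃ (_ : Coalgebra ℂ D.Covector)
    (S : RightSemidirectProduct (Extended A) D.Covector D.Poincare)
    (B : Type u) (_ : Ring B) (_ : Algebra ℂ B) (_ : Coalgebra ℂ B)
    (T : RightSemidirectProduct (FiniteDual (Extended A)) B (FiniteDual D.Poincare))
    (pB : B →ₗ[ℂ] D.Covector →ₗ[ℂ] ℂ),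
    IsBraidedLinearCoproduct D.braiding D.x ∧
    S.act = D.action ∧ S.coact = D.coaction.toLinearMap ∧
    (∀ a v, S.e (a ⊗ₜ v) = D.incl a * D.ofCovector v) ∧
    Function.Injective pB ∧ (∀ v, (∀ b, pB b v = 0) → v = 0) ∧
    Set.range pB = D.covectorDual ∧ gradedDual D.x ⊆ Set.range pB ∧
    ((∀ m : ℕ, 0 < m → D.lam ^ m ≠ 1) → Set.range pB = gradedDual D.x) ∧
    T.IsDual S (FiniteDual.ev (Extended A)) pB (FiniteDual.ev D.Poincare) ∧
    HasAntipode D.Poincare ∧ HasAntipode (FiniteDual D.Poincare)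

/-- The same for the left-handed `q`-Poincaré group. -/
def LeftDualIsSemidirect : Prop :=
  ∃ (_ : Coalgebra ℂ D.LeftVector)
    (S : LeftSemidirectProduct (Extended A) D.LeftVector D.LeftPoincare)
    (B : Type u) (_ : Ring B) (_ : Algebra ℂ B) (_ : Coalgebra ℂ B)
    (T : LeftSemidirectProduct (FiniteDual (Extended A)) B (FiniteDual D.LeftPoincare))
    (pB : B →ₗ[ℂ] D.LeftVector →ₗ[ℂ] ℂ),
    IsBraidedLinearCoproduct D.leftBraiding D.leftX ∧
    S.act = D.leftAction ∧ S.coact = D.leftCoaction.toLinearMap ∧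
    (∀ a v, S.e (v ⊗ₜ a) = D.ofLeftVector v * D.leftIncl a) ∧
    Function.Injective pB ∧ (∀ v, (∀ b, pB b v = 0) → v = 0) ∧
    Set.range pB = D.leftVectorDual ∧ gradedDual D.leftX ⊆ Set.range pB ∧
    ((∀ m : ℕ, 0 < m → D.lam ^ m ≠ 1) → Set.range pB = gradedDual D.leftX) ∧
    T.IsDual S (FiniteDual.ev (Extended A)) pB (FiniteDual.ev D.LeftPoincare) ∧
    HasAntipode D.LeftPoincare ∧ HasAntipode (FiniteDual D.LeftPoincare)

end QuantumGroupData

end Data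

section SubBialgebra

variable {H : Type*} [Ring H] [Bialgebra ℂ H] (C : Subalgebra ℂ H)

theorem tensor_val_injective :
    Function.Injective (Algebra.TensorProduct.map C.val C.val) :=
  TensorProduct.map_injective_of_flat_flat _ _ Subtype.val_injective Subtype.val_injective

/-- The coproduct of a subalgebra `C` of a bialgebra with `Δ C ⊆ C ⊗ C`. -/
def subComul (hC : ∀ x ∈ C, Coalgebra.comul (R := ℂ) x ∈
    (Algebra.TensorProduct.map C.val C.val).range) : C →ₐ[ℂ] C ⊗[ℂ] C :=
  (AlgEquiv.ofInjective _ (tensor_val_injective C)).symm.toAlgHom.comp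
    (((Bialgebra.comulAlgHom ℂ H).comp C.val).codRestrict _ fun x => hC x x.2)

theorem map_subComul (hC : ∀ x ∈ C, Coalgebra.comul (R := ℂ) x ∈
    (Algebra.TensorProduct.map C.val C.val).range) (x : C) :
    Algebra.TensorProduct.map C.val C.val (subComul C hC x) =
      Coalgebra.comul (R := ℂ) (x : H) := by
  have := AlgEquiv.apply_symm_apply (AlgEquiv.ofInjective _ (tensor_val_injective C))
    ((((Bialgebra.comulAlgHom ℂ H).comp C.val).codRestrict _ fun x => hC x x.2) x)
  exact congrArg Subtype.val this

/-- A subalgebra `C` of a bialgebra with `Δ C ⊆ C ⊗ C` is a bialgebra. -/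
abbrev subBialgebra (hC : ∀ x ∈ C, Coalgebra.comul (R := ℂ) x ∈
    (Algebra.TensorProduct.map C.val C.val).range) : Bialgebra ℂ C :=
  Bialgebra.ofAlgHom (subComul C hC) ((Bialgebra.counitAlgHom ℂ H).comp C.val)
    (by
      ext x
      have inj : Function.Injective (TensorProduct.map C.val.toLinearMap
          (TensorProduct.map C.val.toLinearMap C.val.toLinearMap)) :=
        TensorProduct.map_injective_of_flat_flat _ _ Subtype.val_injective
          (tensor_val_injective C)
      apply inj
      have e1 : ∀ z : C ⊗[ℂ] C, TensorProduct.map C.val.toLinearMap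
          (TensorProduct.map C.val.toLinearMap C.val.toLinearMap)
            (Algebra.TensorProduct.map (AlgHom.id ℂ C) (subComul C hC) z) =
          LinearMap.lTensor _ Coalgebra.comul (Algebra.TensorProduct.map C.val C.val z) := by
        intro z
        induction z using TensorProduct.induction_on with
        | zero => simp
        | add x y hx hy => simp only [map_add, hx, hy]
        | tmul x y =>
          simp only [Algebra.TensorProduct.map_tmul, AlgHom.id_apply, TensorProduct.map_tmul,
            LinearMap.lTensor_tmul]
          congr 1
          exact map_subComul C hC y
      have e2 : ∀ z : C ⊗[ℂ] C, TensorProduct.map C.val.toLinearMap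
          (TensorProduct.map C.val.toLinearMap C.val.toLinearMap)
            ((Algebra.TensorProduct.assoc ℂ ℂ ℂ C C C)
              (Algebra.TensorProduct.map (subComul C hC) (AlgHom.id ℂ C) z)) =
          TensorProduct.assoc ℂ _ _ _
            (LinearMap.rTensor _ Coalgebra.comul (Algebra.TensorProduct.map C.val C.val z)) := by
        intro z
        have e3 : ∀ (w : C ⊗[ℂ] C) (b : C), TensorProduct.map C.val.toLinearMap
            (TensorProduct.map C.val.toLinearMap C.val.toLinearMap)
              ((Algebra.TensorProduct.assoc ℂ ℂ ℂ C C C) (w ⊗ₜ b)) =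
            TensorProduct.assoc ℂ _ _ _
              (Algebra.TensorProduct.map C.val C.val w ⊗ₜ (b : H)) := by
          intro w b
          induction w using TensorProduct.induction_on with
          | zero => simp
          | add x y hx hy => simp only [map_add, TensorProduct.add_tmul, hx, hy]
          | tmul x y => simp
        induction z using TensorProduct.induction_on with
        | zero => simp
        | add x y hx hy => simp only [map_add, hx, hy]
        | tmul x y =>
          simp only [Algebra.TensorProduct.map_tmul, AlgHom.id_apply, e3, map_subComul,
            LinearMap.rTensor_tmul]
          rfl
      refine (e2 _).trans (Eq.trans ?_ (e1 _).symm)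
      change TensorProduct.assoc ℂ H H H (LinearMap.rTensor H Coalgebra.comul
          (Algebra.TensorProduct.map C.val C.val (subComul C hC x))) =
        LinearMap.lTensor H Coalgebra.comul
          (Algebra.TensorProduct.map C.val C.val (subComul C hC x))
      rw [map_subComul]
      exact Coalgebra.coassoc_apply (x : H))
    (by
      ext x
      have inj : Function.Injective (TensorProduct.map (LinearMap.id (R := ℂ) (M := ℂ))
          C.val.toLinearMap) :=
        TensorProduct.map_injective_of_flat_flat _ _ (fun _ _ h => h) Subtype.val_injective
      apply inj
      have e1 : ∀ z : C ⊗[ℂ] C, TensorProduct.map (LinearMap.id (R := ℂ) (M := ℂ))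
          C.val.toLinearMap (Algebra.TensorProduct.map ((Bialgebra.counitAlgHom ℂ H).comp C.val)
            (AlgHom.id ℂ C) z) =
          LinearMap.rTensor _ Coalgebra.counit (Algebra.TensorProduct.map C.val C.val z) := by
        intro z
        induction z using TensorProduct.induction_on with
        | zero => simp
        | add x y hx hy => simp only [map_add, hx, hy]
        | tmul x y => simp
      refine (e1 _).trans ?_
      change LinearMap.rTensor H Coalgebra.counit
          (Algebra.TensorProduct.map C.val C.val (subComul C hC x)) = _
      rw [map_subComul, Coalgebra.rTensor_counit_comul]
      rfl)
    (by
      ext x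
      have inj : Function.Injective (TensorProduct.map C.val.toLinearMap
          (LinearMap.id (R := ℂ) (M := ℂ))) :=
        TensorProduct.map_injective_of_flat_flat _ _ Subtype.val_injective (fun _ _ h => h)
      apply inj
      have e1 : ∀ z : C ⊗[ℂ] C, TensorProduct.map C.val.toLinearMap
          (LinearMap.id (R := ℂ) (M := ℂ)) (Algebra.TensorProduct.map (AlgHom.id ℂ C)
            ((Bialgebra.counitAlgHom ℂ H).comp C.val) z) =
          LinearMap.lTensor _ Coalgebra.counit (Algebra.TensorProduct.map C.val C.val z) := by
        intro z
        induction z using TensorProduct.induction_on with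
        | zero => simp
        | add x y hx hy => simp only [map_add, hx, hy]
        | tmul x y => simp
      refine (e1 _).trans ?_
      change LinearMap.lTensor H Coalgebra.counit
          (Algebra.TensorProduct.map C.val C.val (subComul C hC x)) = _
      rw [map_subComul, Coalgebra.lTensor_counit_comul]
      rfl)

end SubBialgebra

section Lorentz

/-- The `R`-matrix of `SL_q(2)`. -/
def slR (q : ℂ) : Matrix (Fin 2 × Fin 2) (Fin 2 × Fin 2) ℂ := fun x y =>
  if x = y then (if x.1 = x.2 then q else 1)
  else if x = (0, 1) ∧ y = (1, 0) then q - q⁻¹ else 0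

/-- The quantum determinant relation of `SL_q(2)`. -/
def DetRelation {S : Type*} [Ring S] [Algebra ℂ S] (q : ℂ) (t : Fin 2 → Fin 2 → S) : Prop :=
  t 0 0 * t 1 1 - q⁻¹ • (t 0 1 * t 1 0) = 1

theorem slR_relations {S : Type*} [Ring S] [Algebra ℂ S] {q : ℂ}
    {t : Fin 2 → Fin 2 → S} (h : MatrixRelation (slR q) t t) :
    t 0 1 * t 0 0 = q • (t 0 0 * t 0 1) ∧ t 1 1 * t 1 0 = q • (t 1 0 * t 1 1) ∧
    t 1 0 * t 0 1 = t 0 1 * t 1 0 ∧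
    t 1 1 * t 0 0 = t 0 0 * t 1 1 + (q - q⁻¹) • (t 0 1 * t 1 0) := by
  have h1 := h 0 0 0 1
  have h2 := h 1 1 0 1
  have h3 := h 1 0 0 1
  have h4 := h 0 1 0 1
  simp [slR, Fin.sum_univ_two] at h1 h2 h3 h4
  refine ⟨h1.symm, h2.symm, h3, ?_⟩
  rw [← h4, h3]

theorem DetRelation.tmul {S Q : Type*} [Ring S] [Algebra ℂ S] [Ring Q] [Algebra ℂ Q] {q : ℂ}
    (hq : q ≠ 0) {t : Fin 2 → Fin 2 → S} {t' : Fin 2 → Fin 2 → Q}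
    (hR : MatrixRelation (slR q) t' t') (h : DetRelation q t) (h' : DetRelation q t') :
    DetRelation q (fun i j => ∑ a, t i a ⊗ₜ[ℂ] t' a j) := by
  obtain ⟨r1, r2, r3, r4⟩ := slR_relations hR
  have d' : t' 0 0 * t' 1 1 = 1 + q⁻¹ • (t' 0 1 * t' 1 0) := by
    rw [← h']; abel
  have d : t 0 0 * t 1 1 = 1 + q⁻¹ • (t 0 1 * t 1 0) := by
    rw [← h]; abel
  have r5 : t' 1 1 * t' 0 0 = 1 + q • (t' 0 1 * t' 1 0) := by
    rw [r4, d', add_assoc, ← add_smul]; congr 2; ring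
  unfold DetRelation
  simp only [Fin.sum_univ_two, add_mul, mul_add, Algebra.TensorProduct.tmul_mul_tmul, r1, r2, r3,
    r5, d', d, TensorProduct.tmul_add, TensorProduct.tmul_smul, smul_add, smul_smul,
    inv_mul_cancel₀ hq, one_smul, TensorProduct.add_tmul, TensorProduct.smul_tmul',
    Algebra.TensorProduct.one_def]
  abel

/-- The relations of `SL_q(2) ⋈ SL_q(2)`: two copies of `SL_q(2)` with matrix generators `t` (left
summand) and `s` (right summand), and the cross relations `R₁₂ s₁ t₂ = t₂ s₁ R₁₂`. -/
inductive SpinRel (q : ℂ) : FreeAlgebra ℂ (Fin 2 × Fin 2 ⊕ Fin 2 × Fin 2) →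
    FreeAlgebra ℂ (Fin 2 × Fin 2 ⊕ Fin 2 × Fin 2) → Prop
  | tt (i k j l : Fin 2) : SpinRel q
      (∑ a, ∑ b, slR q (i, k) (a, b) •
        (FreeAlgebra.ι ℂ (Sum.inl (a, j)) * FreeAlgebra.ι ℂ (Sum.inl (b, l))))
      (∑ a, ∑ b, slR q (a, b) (j, l) •
        (FreeAlgebra.ι ℂ (Sum.inl (k, b)) * FreeAlgebra.ι ℂ (Sum.inl (i, a))))
  | ss (i k j l : Fin 2) : SpinRel q
      (∑ a, ∑ b, slR q (i, k) (a, b) •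
        (FreeAlgebra.ι ℂ (Sum.inr (a, j)) * FreeAlgebra.ι ℂ (Sum.inr (b, l))))
      (∑ a, ∑ b, slR q (a, b) (j, l) •
        (FreeAlgebra.ι ℂ (Sum.inr (k, b)) * FreeAlgebra.ι ℂ (Sum.inr (i, a))))
  | st (i k j l : Fin 2) : SpinRel q
      (∑ a, ∑ b, slR q (i, k) (a, b) •
        (FreeAlgebra.ι ℂ (Sum.inr (a, j)) * FreeAlgebra.ι ℂ (Sum.inl (b, l))))
      (∑ a, ∑ b, slR q (a, b) (j, l) •
        (FreeAlgebra.ι ℂ (Sum.inl (k, b)) * FreeAlgebra.ι ℂ (Sum.inr (i, a))))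
  | det_t : SpinRel q
      (FreeAlgebra.ι ℂ (Sum.inl (0, 0)) * FreeAlgebra.ι ℂ (Sum.inl (1, 1)) -
        q⁻¹ • (FreeAlgebra.ι ℂ (Sum.inl (0, 1)) * FreeAlgebra.ι ℂ (Sum.inl (1, 0)))) 1
  | det_s : SpinRel q
      (FreeAlgebra.ι ℂ (Sum.inr (0, 0)) * FreeAlgebra.ι ℂ (Sum.inr (1, 1)) -
        q⁻¹ • (FreeAlgebra.ι ℂ (Sum.inr (0, 1)) * FreeAlgebra.ι ℂ (Sum.inr (1, 0)))) 1

/-- The double cross product `SL_q(2) ⋈ SL_q(2)`, the spin cover of the `q`-Lorentz group. -/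
def SpinLorentz (q : ℂ) : Type := RingQuot (SpinRel q)

namespace SpinLorentz

variable (q : ℂ)

instance : Ring (SpinLorentz q) := inferInstanceAs (Ring (RingQuot (SpinRel q)))
instance : Algebra ℂ (SpinLorentz q) := inferInstanceAs (Algebra ℂ (RingQuot (SpinRel q)))

/-- The matrix generator `t` of the first copy of `SL_q(2)`. -/
def t (i j : Fin 2) : SpinLorentz q :=
  RingQuot.mkAlgHom ℂ (SpinRel q) (FreeAlgebra.ι ℂ (Sum.inl (i, j)))

/-- The matrix generator `s` of the second copy of `SL_q(2)`. -/
def s (i j : Fin 2) : SpinLorentz q :=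
  RingQuot.mkAlgHom ℂ (SpinRel q) (FreeAlgebra.ι ℂ (Sum.inr (i, j)))

theorem relation_tt : MatrixRelation (slR q) (t q) (t q) := by
  intro i k j l
  have h := RingQuot.mkAlgHom_rel ℂ (SpinRel.tt (q := q) i k j l)
  simp only [map_mul, map_sum, map_smul] at h
  exact h

theorem relation_ss : MatrixRelation (slR q) (s q) (s q) := by
  intro i k j l
  have h := RingQuot.mkAlgHom_rel ℂ (SpinRel.ss (q := q) i k j l)
  simp only [map_mul, map_sum, map_smul] at h
  exact h

theorem relation_st : MatrixRelation (slR q) (s q) (t q) := by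
  intro i k j l
  have h := RingQuot.mkAlgHom_rel ℂ (SpinRel.st (q := q) i k j l)
  simp only [map_mul, map_sum, map_smul] at h
  exact h

theorem det_t : DetRelation q (t q) := by
  have h := RingQuot.mkAlgHom_rel ℂ (SpinRel.det_t (q := q))
  simp only [map_mul, map_sub, map_smul, map_one] at h
  exact h

theorem det_s : DetRelation q (s q) := by
  have h := RingQuot.mkAlgHom_rel ℂ (SpinRel.det_s (q := q))
  simp only [map_mul, map_sub, map_smul, map_one] at h
  exact h

variable {q}

/-- Algebra maps out of `SL_q(2) ⋈ SL_q(2)`. -/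
def lift {S : Type*} [Ring S] [Algebra ℂ S] (u v : Fin 2 → Fin 2 → S)
    (huu : MatrixRelation (slR q) u u) (hvv : MatrixRelation (slR q) v v)
    (hvu : MatrixRelation (slR q) v u) (hu : DetRelation q u) (hv : DetRelation q v) :
    SpinLorentz q →ₐ[ℂ] S :=
  RingQuot.liftAlgHom ℂ ⟨FreeAlgebra.lift ℂ
    (Sum.elim (fun x => u x.1 x.2) (fun x => v x.1 x.2)), by
      rintro _ _ (⟨i, k, j, l⟩ | ⟨i, k, j, l⟩ | ⟨i, k, j, l⟩ | _ | _) <;>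
      simp only [map_mul, map_sub, map_one, map_sum, map_smul, FreeAlgebra.lift_ι_apply,
        Sum.elim_inl, Sum.elim_inr]
      · exact huu i k j l
      · exact hvv i k j l
      · exact hvu i k j l
      · exact hu
      · exact hv⟩

section Lift

variable {S : Type*} [Ring S] [Algebra ℂ S] (u v : Fin 2 → Fin 2 → S)
    (huu : MatrixRelation (slR q) u u) (hvv : MatrixRelation (slR q) v v)
    (hvu : MatrixRelation (slR q) v u) (hu : DetRelation q u) (hv : DetRelation q v)

theorem lift_t (i j : Fin 2) : lift u v huu hvv hvu hu hv (t q i j) = u i j :=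
  (RingQuot.liftAlgHom_mkAlgHom_apply _ _ _ _).trans (FreeAlgebra.lift_ι_apply _ _)

theorem lift_s (i j : Fin 2) : lift u v huu hvv hvu hu hv (s q i j) = v i j :=
  (RingQuot.liftAlgHom_mkAlgHom_apply _ _ _ _).trans (FreeAlgebra.lift_ι_apply _ _)

end Lift

theorem hom_ext {S : Type*} [Semiring S] [Algebra ℂ S] {F G : SpinLorentz q →ₐ[ℂ] S}
    (h1 : ∀ i j, F (t q i j) = G (t q i j)) (h2 : ∀ i j, F (s q i j) = G (s q i j)) : F = G := by
  apply RingQuot.ringQuot_ext'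
  apply FreeAlgebra.hom_ext
  funext y
  rcases y with ⟨i, j⟩ | ⟨i, j⟩
  · exact h1 i j
  · exact h2 i j

theorem delta_relation (M : Matrix (Fin 2 × Fin 2) (Fin 2 × Fin 2) ℂ) :
    MatrixRelation M (fun i j : Fin 2 => if i = j then (1 : ℂ) else 0)
      (fun i j => if i = j then 1 else 0) := by
  intro i k j l
  simp

theorem delta_det : DetRelation q (fun i j : Fin 2 => if i = j then (1 : ℂ) else 0) := by
  simp [DetRelation]

/-- The counit, `ε(t) = ε(s) = 1`. -/
def counitHom : SpinLorentz q →ₐ[ℂ] ℂ :=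
  lift (fun i j => if i = j then 1 else 0) (fun i j => if i = j then 1 else 0)
    (delta_relation _) (delta_relation _) (delta_relation _) delta_det delta_det

/-- The coproduct for `q ≠ 0`, `Δ t = t ⊗ t` and `Δ s = s ⊗ s`. -/
def comulHom (hq : q ≠ 0) : SpinLorentz q →ₐ[ℂ] SpinLorentz q ⊗[ℂ] SpinLorentz q :=
  lift (fun i j => ∑ a, t q i a ⊗ₜ t q a j) (fun i j => ∑ a, s q i a ⊗ₜ s q a j)
    ((relation_tt q).tmul (relation_tt q)) ((relation_ss q).tmul (relation_ss q))
    ((relation_st q).tmul (relation_st q)) ((det_t q).tmul hq (relation_tt q) (det_t q))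
    ((det_s q).tmul hq (relation_ss q) (det_s q))

variable [NeZero q]

instance : Bialgebra ℂ (SpinLorentz q) :=
  Bialgebra.ofAlgHom (comulHom (NeZero.ne q)) counitHom
    (by
      apply hom_ext <;> intro i j <;>
      simp [comulHom, lift_t, lift_s, TensorProduct.sum_tmul, TensorProduct.tmul_sum,
        -Fin.sum_univ_two] <;>
      rw [Finset.sum_comm])
    (by
      apply hom_ext <;> intro i j <;>
      simp [comulHom, counitHom, lift_t, lift_s, TensorProduct.ite_tmul, Finset.sum_ite_eq,
        -Fin.sum_univ_two])
    (by
      apply hom_ext <;> intro i j <;>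
      simp [comulHom, counitHom, lift_t, lift_s, TensorProduct.tmul_ite, Finset.sum_ite_eq',
        -Fin.sum_univ_two])

theorem comul_t (i j : Fin 2) :
    Coalgebra.comul (R := ℂ) (t q i j) = ∑ a, t q i a ⊗ₜ[ℂ] t q a j := lift_t _ _ _ _ _ _ _ i j

theorem comul_s (i j : Fin 2) :
    Coalgebra.comul (R := ℂ) (s q i j) = ∑ a, s q i a ⊗ₜ[ℂ] s q a j := lift_s _ _ _ _ _ _ _ i j

end SpinLorentz

/-- The vector matrix `Λ^{(i₀,i₁)}_{(j₀,j₁)} = t^{i₀}_{j₀} s^{i₁}_{j₁}` of the `q`-Lorentz group. -/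
def vectorMatrix (q : ℂ) (i j : Fin 2 × Fin 2) : SpinLorentz q :=
  SpinLorentz.t q i.1 j.1 * SpinLorentz.s q i.2 j.2

/-- The `q`-Lorentz group `SO_q(1,3)` as a subalgebra of `SL_q(2) ⋈ SL_q(2)`: the subalgebra
generated by the entries of the vector matrix `Λ`. -/
def lorentzSubalgebra (q : ℂ) : Subalgebra ℂ (SpinLorentz q) :=
  Algebra.adjoin ℂ (Set.range fun p : (Fin 2 × Fin 2) × (Fin 2 × Fin 2) =>
    vectorMatrix q p.1 p.2)

/-- The `q`-Lorentz group `SO_q(1,3)`. -/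
abbrev LorentzGroup (q : ℂ) : Type := lorentzSubalgebra q

/-- The entries of `Λ`, as elements of `SO_q(1,3)`. -/
def lorentzMatrix (q : ℂ) (i j : Fin 2 × Fin 2) : LorentzGroup q :=
  ⟨vectorMatrix q i j, Algebra.subset_adjoin ⟨(i, j), rfl⟩⟩

theorem comul_vectorMatrix (q : ℂ) [NeZero q] (i j : Fin 2 × Fin 2) :
    Coalgebra.comul (R := ℂ) (vectorMatrix q i j) =
      ∑ a, vectorMatrix q i a ⊗ₜ[ℂ] vectorMatrix q a j := by
  rw [vectorMatrix, Bialgebra.comul_mul, SpinLorentz.comul_t, SpinLorentz.comul_s,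
    Fintype.sum_prod_type]
  simp only [Finset.sum_mul_sum, Algebra.TensorProduct.tmul_mul_tmul, vectorMatrix]

theorem comul_mem_lorentz (q : ℂ) [NeZero q] (x : SpinLorentz q) (hx : x ∈ lorentzSubalgebra q) :
    Coalgebra.comul (R := ℂ) x ∈ (Algebra.TensorProduct.map (lorentzSubalgebra q).val
      (lorentzSubalgebra q).val).range := by
  have h : lorentzSubalgebra q ≤ (Algebra.TensorProduct.map (lorentzSubalgebra q).val
      (lorentzSubalgebra q).val).range.comap (Bialgebra.comulAlgHom ℂ (SpinLorentz q)) := by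
    refine Algebra.adjoin_le ?_
    rintro _ ⟨⟨i, j⟩, rfl⟩
    refine ⟨∑ a, lorentzMatrix q i a ⊗ₜ lorentzMatrix q a j, ?_⟩
    simp [comul_vectorMatrix, lorentzMatrix]
  exact h hx

instance (q : ℂ) [NeZero q] : Bialgebra ℂ (LorentzGroup q) :=
  subBialgebra (lorentzSubalgebra q) (comul_mem_lorentz q)

/-- The `R`-matrix of `SO_q(1,3)` in the normalisation in which `P R` has the eigenvalues `q²`,
`-1`, `q⁻²`: with `4`-vector indices `(i₀, i₁)` written as pairs of spinor indices,
`P R = R̂₂₃⁻¹ R̂₁₂ R̂₃₄ R̂₂₃` where `R̂` is `P` times the `R`-matrix of `SL_q(2)`. -/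
def lorentzR (q : ℂ) :
    Matrix ((Fin 2 × Fin 2) × (Fin 2 × Fin 2)) ((Fin 2 × Fin 2) × (Fin 2 × Fin 2)) ℂ :=
  fun x y => ∑ a, ∑ b, ∑ c, ∑ d, (slR q)⁻¹ (x.2.2, x.1.1) (a, b) *
    slR q (b, x.2.1) (y.1.1, d) * slR q (x.1.2, a) (c, y.2.2) * slR q (c, d) (y.1.2, y.2.1)

/-- `R' = P + μ P (P R - q⁻²)(P R - q²)`. -/
def lorentzR' (q μ : ℂ) :
    Matrix ((Fin 2 × Fin 2) × (Fin 2 × Fin 2)) ((Fin 2 × Fin 2) × (Fin 2 × Fin 2)) ℂ :=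
  permMatrix (Fin 2 × Fin 2) + μ • (permMatrix (Fin 2 × Fin 2) *
    (permMatrix (Fin 2 × Fin 2) * lorentzR q - (q ^ 2)⁻¹ • 1) *
    (permMatrix (Fin 2 × Fin 2) * lorentzR q - q ^ 2 • 1))

end Lorentz

end QPoincare

end

noncomputable section

namespace QPoincare

open Coalgebra TensorProduct

/-- An algebra `B` inside a bialgebra `D`, together with a linear retraction `π : D → B` that makes
`B` a quotient coalgebra of `D`. -/
structure CoalgebraRetract (B D : Type*) [Ring B] [Algebra ℂ B] [Ring D] [Bialgebra ℂ D] where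
  j : B →ₐ[ℂ] D
  π : D →ₗ[ℂ] B
  π_j : ∀ b, π (j b) = b
  map_π_comul_j_π : ∀ x, map π π (comul (R := ℂ) (j (π x))) = map π π (comul (R := ℂ) x)
  counit_j_π : ∀ x, counit (R := ℂ) (j (π x)) = counit (R := ℂ) x

section Transpose

theorem tensorPairing_map {M N X Y M' N' X' Y' : Type*}
    [AddCommMonoid M] [Module ℂ M] [AddCommMonoid N] [Module ℂ N]
    [AddCommMonoid X] [Module ℂ X] [AddCommMonoid Y] [Module ℂ Y]
    [AddCommMonoid M'] [Module ℂ M'] [AddCommMonoid N'] [Module ℂ N']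
    [AddCommMonoid X'] [Module ℂ X'] [AddCommMonoid Y'] [Module ℂ Y']
    {p : M →ₗ[ℂ] X →ₗ[ℂ] ℂ} {r : N →ₗ[ℂ] Y →ₗ[ℂ] ℂ}
    {p' : M' →ₗ[ℂ] X' →ₗ[ℂ] ℂ} {r' : N' →ₗ[ℂ] Y' →ₗ[ℂ] ℂ}
    {φ : X' →ₗ[ℂ] X} {ψ : Y' →ₗ[ℂ] Y} {φ' : M →ₗ[ℂ] M'} {ψ' : N →ₗ[ℂ] N'}
    (hφ : ∀ m x, p' (φ' m) x = p m (φ x)) (hψ : ∀ n y, r' (ψ' n) y = r n (ψ y))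
    (z : M ⊗[ℂ] N) (w : X' ⊗[ℂ] Y') :
    tensorPairing p' r' (map φ' ψ' z) w = tensorPairing p r z (map φ ψ w) := by
  induction z using TensorProduct.induction_on with
  | zero => simp
  | add a b ha hb => simp only [map_add, LinearMap.add_apply, ha, hb]
  | tmul m n =>
    induction w using TensorProduct.induction_on with
    | zero => simp
    | add a b ha hb => simp only [map_add, ha, hb]
    | tmul x y => simp [hφ, hψ]

theorem FiniteDual.ext_ev {A : Type*} [Ring A] [Bialgebra ℂ A] {f g : FiniteDual A}
    (h : ∀ a, FiniteDual.ev A f a = FiniteDual.ev A g a) : f = g :=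
  FiniteDual.ev_injective A (LinearMap.ext h)

theorem FiniteDual.isFiniteFunctional {A : Type*} [Ring A] [Bialgebra ℂ A] (f : FiniteDual A) :
    IsFiniteFunctional (FiniteDual.ev A f) := f.2

/-- A finite functional as an element of the finite dual. -/
def FiniteDual.of {A : Type*} [Ring A] [Bialgebra ℂ A] (f : A →ₗ[ℂ] ℂ)
    (hf : IsFiniteFunctional f) : FiniteDual A := ⟨WithConv.toConv f, hf⟩

theorem FiniteDual.ext_tensor {A A' : Type*} [Ring A] [Bialgebra ℂ A] [Ring A'] [Bialgebra ℂ A']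
    {z w : FiniteDual A ⊗[ℂ] FiniteDual A'}
    (h : ∀ x y, tensorPairing (FiniteDual.ev A) (FiniteDual.ev A') z (x ⊗ₜ y) =
      tensorPairing (FiniteDual.ev A) (FiniteDual.ev A') w (x ⊗ₜ y)) : z = w :=
  tensorPairing_injective _ _ (FiniteDual.ev_injective A) (FiniteDual.ev_injective A')
    (TensorProduct.ext' h)

theorem FiniteDual.ev_mul' {A : Type*} [Ring A] [Bialgebra ℂ A]
    (z : FiniteDual A ⊗[ℂ] FiniteDual A) (x : A) :
    FiniteDual.ev A (LinearMap.mul' ℂ _ z) x =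
      tensorPairing (FiniteDual.ev A) (FiniteDual.ev A) z (comul x) := by
  induction z using TensorProduct.induction_on with
  | zero => simp
  | add a b ha hb => simp only [map_add, LinearMap.add_apply, ha, hb]
  | tmul f g => rw [LinearMap.mul'_apply, FiniteDual.pairing_mul]; rfl

theorem IsFiniteFunctional.comp_algHom {X Y : Type*} [Ring X] [Algebra ℂ X] [Ring Y] [Algebra ℂ Y]
    {f : Y →ₗ[ℂ] ℂ} (hf : IsFiniteFunctional f) (φ : X →ₐ[ℂ] Y) :
    IsFiniteFunctional (f ∘ₗ φ.toLinearMap) := by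
  obtain ⟨I, _, _, ψ, rfl⟩ := hf.exists_algHom
  exact isFiniteFunctional_comp ((Ideal.Quotient.mkₐ ℂ I).comp φ) ψ

variable {X Y : Type*} [Ring X] [Bialgebra ℂ X] [Ring Y] [Bialgebra ℂ Y]

/-- The transpose of a map of bialgebras. -/
def FiniteDual.comap (φ : X →ₐ[ℂ] Y)
    (hΔ : ∀ x, comul (R := ℂ) (φ x) = map φ.toLinearMap φ.toLinearMap (comul x))
    (hε : ∀ x, counit (R := ℂ) (φ x) = counit (R := ℂ) x) : FiniteDual Y →ₐ[ℂ] FiniteDual X :=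
  AlgHom.ofLinearMap
    { toFun := fun f => FiniteDual.of (FiniteDual.ev Y f ∘ₗ φ.toLinearMap)
        (f.isFiniteFunctional.comp_algHom φ)
      map_add' := fun _ _ => rfl
      map_smul' := fun _ _ => rfl }
    (FiniteDual.ext_ev fun a => hε a)
    (fun f g => FiniteDual.ext_ev fun a => by
      change FiniteDual.ev Y (f * g) (φ a) = _
      rw [FiniteDual.pairing_mul, FiniteDual.pairing_mul, LinearMap.comp_apply, hΔ]
      exact (tensorPairing_map (φ' := LinearMap.mk _ _) (fun _ _ => rfl) (fun _ _ => rfl)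
        (f ⊗ₜ g) (comul a)).symm)

variable (φ : X →ₐ[ℂ] Y)
    (hΔ : ∀ x, comul (R := ℂ) (φ x) = map φ.toLinearMap φ.toLinearMap (comul x))
    (hε : ∀ x, counit (R := ℂ) (φ x) = counit (R := ℂ) x)

@[simp] theorem FiniteDual.ev_comap (f : FiniteDual Y) (x : X) :
    FiniteDual.ev X (FiniteDual.comap φ hΔ hε f) x = FiniteDual.ev Y f (φ x) := rfl

theorem FiniteDual.comul_comap (f : FiniteDual Y) :
    comul (R := ℂ) (FiniteDual.comap φ hΔ hε f) =
      map (FiniteDual.comap φ hΔ hε).toLinearMap (FiniteDual.comap φ hΔ hε).toLinearMap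
        (comul f) :=
  FiniteDual.ext_tensor fun x y => by
    rw [FiniteDual.pairing_comul, tensorPairing_map (φ := φ.toLinearMap) (ψ := φ.toLinearMap)
      (p := FiniteDual.ev Y) (r := FiniteDual.ev Y) (fun _ _ => rfl) (fun _ _ => rfl)]
    simp [FiniteDual.pairing_comul]

theorem FiniteDual.counit_comap (f : FiniteDual Y) :
    counit (R := ℂ) (FiniteDual.comap φ hΔ hε f) = counit (R := ℂ) f := by
  rw [FiniteDual.counit_apply, FiniteDual.counit_apply, FiniteDual.ev_comap, map_one]

theorem FiniteDual.mul_apply (f g : FiniteDual X) (x : X) : FiniteDual.ev X (f * g) x =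
    tensorPairing (FiniteDual.ev X) (FiniteDual.ev X) (f ⊗ₜ g) (comul x) :=
  FiniteDual.ev_mul' (f ⊗ₜ g) x

end Transpose

namespace CoalgebraRetract

variable {B D : Type*} [Ring B] [Algebra ℂ B] [Ring D] [Bialgebra ℂ D] (M : CoalgebraRetract B D)

/-- The coproduct of `B`, regarded as a quotient coalgebra of `D`. -/
def comulB : B →ₗ[ℂ] B ⊗[ℂ] B := map M.π M.π ∘ₗ comul ∘ₗ M.j.toLinearMap

theorem comulB_apply (b : B) : M.comulB b = map M.π M.π (comul (R := ℂ) (M.j b)) := rfl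

theorem comulB_π (x : D) : M.comulB (M.π x) = map M.π M.π (comul (R := ℂ) x) :=
  M.map_π_comul_j_π x

theorem comulB_comp_π : M.comulB ∘ₗ M.π = map M.π M.π ∘ₗ comul :=
  LinearMap.ext M.comulB_π

/-- The coalgebra structure of the coinvariants, for which `π` is a map of coalgebras. -/
abbrev coalgebra : Coalgebra ℂ B where
  comul := M.comulB
  counit := counit ∘ₗ M.j.toLinearMap
  coassoc := by
    ext b
    have h := congrArg (map M.π (map M.π M.π)) (coassoc_apply (R := ℂ) (M.j b))
    simp only [LinearMap.comp_apply, LinearEquiv.coe_coe, comulB_apply]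
    have e1 : ∀ z : D ⊗[ℂ] D, LinearMap.lTensor B M.comulB (map M.π M.π z) =
        map M.π (map M.π M.π) (LinearMap.lTensor D comul z) := by
      intro z
      rw [← LinearMap.comp_apply, LinearMap.lTensor_comp_map, comulB_comp_π,
        ← LinearMap.comp_apply, LinearMap.map_comp_lTensor]
    have e2 : ∀ z : D ⊗[ℂ] D, TensorProduct.assoc ℂ B B B
        (LinearMap.rTensor B M.comulB (map M.π M.π z)) =
        map M.π (map M.π M.π) (TensorProduct.assoc ℂ D D D (LinearMap.rTensor D comul z)) := by
      intro z
      rw [← LinearMap.comp_apply (LinearMap.rTensor B M.comulB), LinearMap.rTensor_comp_map,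
        comulB_comp_π, TensorProduct.map_map_assoc,
        ← LinearMap.comp_apply (map (map _ _) _), LinearMap.map_comp_rTensor]
    rw [e1, e2, h]
  rTensor_counit_comp_comul := by
    ext b
    simp only [LinearMap.comp_apply, comulB_apply]
    have h := congrArg (map (LinearMap.id (R := ℂ) (M := ℂ)) M.π)
      (rTensor_counit_comul (R := ℂ) (M.j b))
    have e : (counit (R := ℂ) ∘ₗ M.j.toLinearMap) ∘ₗ M.π = counit :=
      LinearMap.ext M.counit_j_π
    rw [← LinearMap.comp_apply, LinearMap.map_comp_rTensor] at h
    rw [← LinearMap.comp_apply (LinearMap.rTensor _ _), LinearMap.rTensor_comp_map, e]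
    refine h.trans ?_
    simp [M.π_j]
  lTensor_counit_comp_comul := by
    ext b
    simp only [LinearMap.comp_apply, comulB_apply]
    have h := congrArg (map M.π (LinearMap.id (R := ℂ) (M := ℂ)))
      (lTensor_counit_comul (R := ℂ) (M.j b))
    have e : (counit (R := ℂ) ∘ₗ M.j.toLinearMap) ∘ₗ M.π = counit :=
      LinearMap.ext M.counit_j_π
    rw [← LinearMap.comp_apply, LinearMap.map_comp_lTensor] at h
    rw [← LinearMap.comp_apply (LinearMap.lTensor _ _), LinearMap.lTensor_comp_map, e]
    refine h.trans ?_
    simp [M.π_j]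

/-- The functionals on `B` whose pull-back along `π` is finite, as an algebra with
the convolution product. -/
def dualSubalgebra : letI := M.coalgebra; Subalgebra ℂ (WithConv (B →ₗ[ℂ] ℂ)) :=
  letI := M.coalgebra
  { carrier := {b | IsFiniteFunctional (b.ofConv ∘ₗ M.π)}
    mul_mem' := by
      intro b c hb hc
      have h := (finiteDual D).mul_mem (x := WithConv.toConv (b.ofConv ∘ₗ M.π))
        (y := WithConv.toConv (c.ofConv ∘ₗ M.π)) hb hc
      have e : (b * c).ofConv ∘ₗ M.π = (WithConv.toConv (b.ofConv ∘ₗ M.π) *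
          WithConv.toConv (c.ofConv ∘ₗ M.π)).ofConv := by
        rw [LinearMap.convMul_def, LinearMap.convMul_def, WithConv.ofConv_toConv,
          WithConv.ofConv_toConv, LinearMap.comp_assoc, LinearMap.comp_assoc]
        change LinearMap.mul' ℂ ℂ ∘ₗ map b.ofConv c.ofConv ∘ₗ M.comulB ∘ₗ M.π = _
        rw [comulB_comp_π, map_comp, LinearMap.comp_assoc]
      change IsFiniteFunctional _
      rw [e]
      exact h
    one_mem' := by
      change IsFiniteFunctional ((counit ∘ₗ M.j.toLinearMap) ∘ₗ M.π)
      rw [LinearMap.ext (f := (counit (R := ℂ) ∘ₗ M.j.toLinearMap) ∘ₗ M.π) M.counit_j_π]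
      exact (finiteDual D).one_mem
    add_mem' := by
      intro b c hb hc
      exact (finiteDual D).add_mem (x := WithConv.toConv (b.ofConv ∘ₗ M.π))
        (y := WithConv.toConv (c.ofConv ∘ₗ M.π)) hb hc
    algebraMap_mem' := by
      intro c
      have h := (finiteDual D).algebraMap_mem c
      have e : (algebraMap ℂ (WithConv (B →ₗ[ℂ] ℂ)) c).ofConv ∘ₗ M.π =
          (algebraMap ℂ (WithConv (D →ₗ[ℂ] ℂ)) c).ofConv := by
        ext x
        change c • counit (R := ℂ) (M.j (M.π x)) = c • counit (R := ℂ) x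
        rw [counit_j_π]
      change IsFiniteFunctional _
      rw [e]
      exact h }

/-- The dual of `B`. -/
def CoinvDual : Type _ := letI := M.coalgebra; M.dualSubalgebra

instance : Ring M.CoinvDual := letI := M.coalgebra; inferInstanceAs (Ring M.dualSubalgebra)

instance : Algebra ℂ M.CoinvDual :=
  letI := M.coalgebra; inferInstanceAs (Algebra ℂ M.dualSubalgebra)

/-- The pairing of the dual of `B` with `B`. -/
def pair : M.CoinvDual →ₗ[ℂ] B →ₗ[ℂ] ℂ where
  toFun b := b.1.ofConv
  map_add' _ _ := rfl
  map_smul' _ _ := rfl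

theorem pair_injective : Function.Injective M.pair := by
  intro b c h
  exact Subtype.ext (WithConv.ofConv_injective h)

theorem ext_pair {b c : M.CoinvDual} (h : ∀ v, M.pair b v = M.pair c v) : b = c :=
  M.pair_injective (LinearMap.ext h)

theorem range_pair : Set.range M.pair = {b | IsFiniteFunctional (b ∘ₗ M.π)} := by
  ext b
  constructor
  · rintro ⟨c, rfl⟩
    exact c.2
  · intro h
    exact ⟨⟨WithConv.toConv b, h⟩, rfl⟩

theorem pair_mul (b c : M.CoinvDual) (v : B) :
    M.pair (b * c) v = tensorPairing M.pair M.pair (b ⊗ₜ c) (M.comulB v) := by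
  change LinearMap.mul' ℂ ℂ (map _ _ (M.comulB v)) = _
  generalize M.comulB v = z
  induction z using TensorProduct.induction_on with
  | zero => simp
  | add a b ha hb => simp only [map_add, ha, hb]
  | tmul x y => rfl

theorem pair_one (v : B) : M.pair 1 v = counit (R := ℂ) (M.j v) := rfl

/-- The transpose of `π`. -/
def transposeπ : M.CoinvDual →ₐ[ℂ] FiniteDual D :=
  AlgHom.ofLinearMap
    { toFun := fun b => FiniteDual.of (M.pair b ∘ₗ M.π) b.2
      map_add' := fun _ _ => rfl
      map_smul' := fun _ _ => rfl }
    (FiniteDual.ext_ev M.counit_j_π)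
    (fun b c => FiniteDual.ext_ev fun x => by
      change M.pair (b * c) (M.π x) = _
      rw [pair_mul, FiniteDual.mul_apply, comulB_π]
      exact (tensorPairing_map (φ' := LinearMap.mk _ _) (fun _ _ => rfl) (fun _ _ => rfl)
        (b ⊗ₜ c) (comul x)).symm)

theorem ev_transposeπ (b : M.CoinvDual) (x : D) :
    FiniteDual.ev D (M.transposeπ b) x = M.pair b (M.π x) := rfl

variable (hfin : ∀ f : D →ₗ[ℂ] ℂ, IsFiniteFunctional f →
  IsFiniteFunctional (f ∘ₗ M.j.toLinearMap ∘ₗ M.π))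

/-- The transpose of `j`. -/
def transposej : FiniteDual D →ₗ[ℂ] M.CoinvDual where
  toFun f := ⟨WithConv.toConv (FiniteDual.ev D f ∘ₗ M.j.toLinearMap), hfin _ f.2⟩
  map_add' _ _ := rfl
  map_smul' _ _ := rfl

theorem pair_transposej (f : FiniteDual D) (b : B) :
    M.pair (M.transposej hfin f) b = FiniteDual.ev D f (M.j b) := rfl

end CoalgebraRetract

end QPoincare
end

noncomputable section

namespace QPoincare

open Coalgebra TensorProduct

/-- Data exhibiting a bialgebra `D` as a right-handed bosonization of `B` by the bialgebra `H`:
a bialgebra `D` with a split projection `σ` onto `H`, the subalgebra `B` of coinvariants, and the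
projection `π` of `D` onto its quotient right module `B`. -/
structure Bosonization (H B D : Type*) [Ring H] [Bialgebra ℂ H] [Ring B] [Algebra ℂ B]
    [Ring D] [Bialgebra ℂ D] where
  i : H →ₐ[ℂ] D
  σ : D →ₐ[ℂ] H
  j : B →ₐ[ℂ] D
  π : D →ₗ[ℂ] B
  comul_i : ∀ h, comul (R := ℂ) (i h) = map i.toLinearMap i.toLinearMap (comul h)
  counit_i : ∀ h, counit (R := ℂ) (i h) = counit (R := ℂ) h
  comul_σ : ∀ x, comul (R := ℂ) (σ x) = map σ.toLinearMap σ.toLinearMap (comul x)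
  counit_σ : ∀ x, counit (R := ℂ) (σ x) = counit (R := ℂ) x
  σ_i : ∀ h, σ (i h) = h
  π_j : ∀ b, π (j b) = b
  π_i_mul : ∀ h x, π (i h * x) = counit (R := ℂ) h • π x
  π_mul : ∀ x y, π (j (π x) * y) = π (x * y)
  coinv : ∀ b, map σ.toLinearMap LinearMap.id (comul (j b)) = 1 ⊗ₜ[ℂ] j b
  coideal : ∀ b, map (j.toLinearMap ∘ₗ π) LinearMap.id (comul (j b)) = comul (R := ℂ) (j b)
  factor : ∀ x, LinearMap.mul' ℂ D (map (i.toLinearMap ∘ₗ σ.toLinearMap)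
    (j.toLinearMap ∘ₗ π) (comul x)) = x

namespace Bosonization

variable {H B D : Type*} [Ring H] [Bialgebra ℂ H] [Ring B] [Algebra ℂ B]
    [Ring D] [Bialgebra ℂ D] (M : Bosonization H B D)

theorem π_one : M.π 1 = 1 := by
  rw [← map_one M.j, M.π_j]

theorem π_mul_j (x : D) (b : B) : M.π (x * M.j b) = M.π x * b := by
  rw [← M.π_mul, ← map_mul, M.π_j]

theorem π_i (h : H) : M.π (M.i h) = counit (R := ℂ) h • (1 : B) := by
  rw [← mul_one (M.i h), M.π_i_mul, π_one]

theorem sum_factor {κ : Type*} {x : D} (r : Coalgebra.Repr ℂ x κ) :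
    ∑ k ∈ r.index, M.i (M.σ (r.left k)) * M.j (M.π (r.right k)) = x := by
  have h := M.factor x
  rw [← r.eq] at h
  simpa using h

theorem counit_j_π (x : D) : counit (R := ℂ) (M.j (M.π x)) = counit (R := ℂ) x := by
  have h := M.sum_factor (ℛ ℂ x)
  have h' := congrArg (counit (R := ℂ)) h
  simp only [map_sum, Bialgebra.counit_mul, counit_i, counit_σ] at h'
  rw [← h']
  have := congrArg (fun y => counit (R := ℂ) (M.j (M.π y))) (sum_counit_smul (ℛ ℂ x))
  simpa using this.symm

theorem map_π_comul_i_mul (h : H) (y : D ⊗[ℂ] D) :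
    map M.π M.π (comul (R := ℂ) (M.i h) * y) = counit (R := ℂ) h • map M.π M.π y := by
  have key : ∀ (w : H ⊗[ℂ] H) (y : D ⊗[ℂ] D),
      map M.π M.π (map M.i.toLinearMap M.i.toLinearMap w * y) =
      (LinearMap.mul' ℂ ℂ (map counit counit w)) • map M.π M.π y := by
    intro w y
    induction w using TensorProduct.induction_on with
    | zero => simp
    | add a b ha hb => simp only [map_add, add_mul, ha, hb, add_smul]
    | tmul a b =>
      induction y using TensorProduct.induction_on with
      | zero => simp
      | add a b ha hb => simp only [map_add, mul_add, ha, hb, smul_add]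
      | tmul x y => simp [π_i_mul, smul_tmul', tmul_smul, smul_smul, mul_comm]
  rw [comul_i, key]
  congr 1
  rw [← (ℛ ℂ h).eq]
  simp
theorem map_π_comul_j_π (x : D) :
    map M.π M.π (comul (R := ℂ) (M.j (M.π x))) = map M.π M.π (comul (R := ℂ) x) := by
  have h := M.sum_factor (ℛ ℂ x)
  have h' := congrArg (fun y => map M.π M.π (comul (R := ℂ) y)) h
  simp only [map_sum, Bialgebra.comul_mul, map_π_comul_i_mul, counit_σ] at h'
  rw [← h']
  have := congrArg (fun y => map M.π M.π (comul (R := ℂ) (M.j (M.π y))))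
    (sum_counit_smul (ℛ ℂ x))
  simpa using this.symm

/-- The coinvariants as a quotient coalgebra. -/
def retract : CoalgebraRetract B D where
  j := M.j
  π := M.π
  π_j := M.π_j
  map_π_comul_j_π := M.map_π_comul_j_π
  counit_j_π := M.counit_j_π

@[simp] theorem retract_j : M.retract.j = M.j := rfl

@[simp] theorem retract_π : M.retract.π = M.π := rfl

/-- The coalgebra structure of the coinvariants. -/
abbrev coalgebra : Coalgebra ℂ B := M.retract.coalgebra

/-- The coproduct of the coinvariants. -/
abbrev comulB : B →ₗ[ℂ] B ⊗[ℂ] B := M.retract.comulB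

theorem comulB_apply (b : B) : M.comulB b = map M.π M.π (comul (R := ℂ) (M.j b)) := rfl

theorem comulB_comp_π : M.comulB ∘ₗ M.π = map M.π M.π ∘ₗ comul := M.retract.comulB_comp_π

/-- The action of `H` on the coinvariants, `b ◁ h = π(b h)`. -/
def act : B ⊗[ℂ] H →ₗ[ℂ] B :=
  M.π ∘ₗ LinearMap.mul' ℂ D ∘ₗ map M.j.toLinearMap M.i.toLinearMap

@[simp] theorem act_tmul (b : B) (h : H) : M.act (b ⊗ₜ h) = M.π (M.j b * M.i h) := rfl

/-- The coaction of `H` on the coinvariants. -/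
def coact : B →ₗ[ℂ] B ⊗[ℂ] H := map M.π M.σ.toLinearMap ∘ₗ comul ∘ₗ M.j.toLinearMap

theorem coact_apply (b : B) : M.coact b = map M.π M.σ.toLinearMap (comul (M.j b)) := rfl

/-- The cross relation `b h = h₍₁₎ (b ◁ h₍₂₎)`. -/
theorem j_mul_i (b : B) (h : H) : M.j b * M.i h =
    LinearMap.mul' ℂ D (map M.i.toLinearMap
      (M.j.toLinearMap ∘ₗ M.act ∘ₗ TensorProduct.mk ℂ B H b) (comul h)) := by
  have h1 := M.factor (M.j b * M.i h)
  have key : ∀ (z : D ⊗[ℂ] D) (w : H ⊗[ℂ] H),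
      map (M.i.toLinearMap ∘ₗ M.σ.toLinearMap) (M.j.toLinearMap ∘ₗ M.π)
        (z * map M.i.toLinearMap M.i.toLinearMap w) =
      map M.i.toLinearMap (M.j.toLinearMap ∘ₗ M.π)
        (map M.σ.toLinearMap LinearMap.id z * map LinearMap.id M.i.toLinearMap w) := by
    intro z w
    induction z using TensorProduct.induction_on with
    | zero => simp
    | add a b ha hb => simp only [map_add, add_mul, ha, hb]
    | tmul a b =>
      induction w using TensorProduct.induction_on with
      | zero => simp
      | add a b ha hb => simp only [map_add, mul_add, ha, hb]
      | tmul x y => simp [σ_i]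
  rw [Bialgebra.comul_mul, comul_i, key, M.coinv] at h1
  rw [← h1]
  congr 1
  generalize comul (R := ℂ) h = w
  induction w using TensorProduct.induction_on with
  | zero => simp
  | add a b ha hb => simp only [map_add, mul_add, ha, hb]
  | tmul x y => simp

theorem σ_j (b : B) : M.σ (M.j b) = counit (R := ℂ) (M.j b) • (1 : H) := by
  have h := congrArg (LinearMap.lTensor H (counit (R := ℂ) (A := D))) (M.coinv b)
  rw [← LinearMap.comp_apply, LinearMap.lTensor_comp_map, LinearMap.comp_id] at h
  have h2 := congrArg (map M.σ.toLinearMap (LinearMap.id (R := ℂ) (M := ℂ)))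
    (lTensor_counit_comul (R := ℂ) (M.j b))
  rw [← LinearMap.comp_apply, LinearMap.map_comp_lTensor, LinearMap.id_comp] at h2
  have h3 := congrArg (TensorProduct.rid ℂ H) (h2.symm.trans h)
  simpa using h3

theorem map_j_π_comul {X Y : Type*} [AddCommMonoid X] [Module ℂ X] [AddCommMonoid Y] [Module ℂ Y]
    (F : D →ₗ[ℂ] X) (G : D →ₗ[ℂ] Y) (b : B) :
    map (F ∘ₗ M.j.toLinearMap ∘ₗ M.π) G (comul (M.j b)) = map F G (comul (R := ℂ) (M.j b)) := by
  conv_rhs => rw [← M.coideal b]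
  rw [← LinearMap.comp_apply (map F G), ← map_comp, LinearMap.comp_id]

theorem coact_comp_π : M.coact ∘ₗ M.π =
    (map M.π M.σ.toLinearMap ∘ₗ comul) ∘ₗ M.j.toLinearMap ∘ₗ M.π := rfl

theorem coact_counit (b : B) : TensorProduct.rid ℂ B (LinearMap.lTensor B counit (M.coact b)) = b := by
  have h := congrArg (map M.π (LinearMap.id (R := ℂ) (M := ℂ)))
    (lTensor_counit_comul (R := ℂ) (M.j b))
  have e : (counit (R := ℂ) (A := H)) ∘ₗ M.σ.toLinearMap = counit :=
    LinearMap.ext (M.counit_σ)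
  rw [← LinearMap.comp_apply, LinearMap.map_comp_lTensor] at h
  rw [coact_apply, ← LinearMap.comp_apply (LinearMap.lTensor _ _), LinearMap.lTensor_comp_map, e,
    ← LinearMap.id_comp (counit (R := ℂ) (A := D)), h]
  simp [M.π_j]

theorem coact_comul (b : B) :
    TensorProduct.assoc ℂ B H H (LinearMap.rTensor H M.coact (M.coact b)) =
      LinearMap.lTensor B comul (M.coact b) := by
  have e : (comul (R := ℂ) (A := H)) ∘ₗ M.σ.toLinearMap =
      map M.σ.toLinearMap M.σ.toLinearMap ∘ₗ comul := LinearMap.ext (M.comul_σ)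
  rw [coact_apply, ← LinearMap.comp_apply (LinearMap.rTensor _ _), LinearMap.rTensor_comp_map,
    coact_comp_π, map_j_π_comul, ← LinearMap.comp_apply (LinearMap.lTensor _ _),
    LinearMap.lTensor_comp_map, e, ← LinearMap.map_comp_rTensor, LinearMap.comp_apply,
    ← TensorProduct.map_map_assoc, coassoc_apply, ← LinearMap.comp_apply (map _ _),
    LinearMap.map_comp_lTensor]

theorem counit_coact (b : B) :
    TensorProduct.lid ℂ H (LinearMap.rTensor H (counit ∘ₗ M.j.toLinearMap) (M.coact b)) =
      counit (R := ℂ) (M.j b) • (1 : H) := by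
  have h := congrArg (map (LinearMap.id (R := ℂ) (M := ℂ)) M.σ.toLinearMap)
    (rTensor_counit_comul (R := ℂ) (M.j b))
  have e : (counit (R := ℂ) ∘ₗ M.j.toLinearMap) ∘ₗ M.π = counit :=
    LinearMap.ext M.counit_j_π
  rw [← LinearMap.comp_apply, LinearMap.map_comp_rTensor] at h
  rw [coact_apply, ← LinearMap.comp_apply (LinearMap.rTensor _ _), LinearMap.rTensor_comp_map, e,
    ← LinearMap.id_comp (counit (R := ℂ) (A := D)), h]
  simp [M.σ_j]

theorem map_π_σ_comul_i_mul (h : H) (y : D ⊗[ℂ] D) :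
    map M.π M.σ.toLinearMap (comul (R := ℂ) (M.i h) * y) =
      LinearMap.lTensor B (LinearMap.mulLeft ℂ h) (map M.π M.σ.toLinearMap y) := by
  have key : ∀ (w : H ⊗[ℂ] H) (y : D ⊗[ℂ] D),
      map M.π M.σ.toLinearMap (map M.i.toLinearMap M.i.toLinearMap w * y) =
      LinearMap.lTensor B (LinearMap.mulLeft ℂ
        (TensorProduct.lid ℂ H (LinearMap.rTensor H counit w))) (map M.π M.σ.toLinearMap y) := by
    intro w y
    induction w using TensorProduct.induction_on with
    | zero => simp
    | add a b ha hb =>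
      have e : ∀ p q : H, LinearMap.mulLeft ℂ (p + q) = LinearMap.mulLeft ℂ p +
          LinearMap.mulLeft ℂ q := fun p q => by ext; simp [add_mul]
      simp only [map_add, add_mul, ha, hb, e, LinearMap.lTensor_add, LinearMap.add_apply]
    | tmul a b =>
      induction y using TensorProduct.induction_on with
      | zero => simp
      | add a b ha hb => simp only [map_add, mul_add, ha, hb]
      | tmul x y => simp [π_i_mul, smul_tmul', tmul_smul, σ_i]
  rw [comul_i, key]
  simp

theorem map_π_σ_comul (x : D) :
    map M.π M.σ.toLinearMap (comul (R := ℂ) x) =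
      TensorProduct.lift ((LinearMap.lTensorHom B ∘ₗ LinearMap.mul ℂ H ∘ₗ M.σ.toLinearMap).compl₂
        (M.coact ∘ₗ M.π)) (comul (R := ℂ) x) := by
  have h := M.sum_factor (ℛ ℂ x)
  have h' := congrArg (fun y => map M.π M.σ.toLinearMap (comul (R := ℂ) y)) h
  simp only [map_sum, Bialgebra.comul_mul, map_π_σ_comul_i_mul] at h'
  rw [← h', ← (ℛ ℂ x).eq, map_sum]
  rfl

theorem comul_coact (b : B) : LinearMap.rTensor H M.comulB (M.coact b) =
    LinearMap.lTensor (B ⊗[ℂ] B) (LinearMap.mul' ℂ H)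
      (TensorProduct.tensorTensorTensorComm ℂ B H B H (map M.coact M.coact (M.comulB b))) := by
  set Ω : D ⊗[ℂ] D →ₗ[ℂ] B ⊗[ℂ] H :=
    TensorProduct.lift ((LinearMap.lTensorHom B ∘ₗ LinearMap.mul ℂ H ∘ₗ M.σ.toLinearMap).compl₂
        (M.coact ∘ₗ M.π)) with hΩ
  have eΩ : map M.π M.σ.toLinearMap ∘ₗ comul = Ω ∘ₗ comul := LinearMap.ext M.map_π_σ_comul
  have e1 : LinearMap.rTensor H M.comulB (M.coact b) =
      (TensorProduct.assoc ℂ B B H).symm (map M.π Ω (LinearMap.lTensor D comul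
        (comul (R := ℂ) (M.j b)))) := by
    rw [coact_apply, ← LinearMap.comp_apply (LinearMap.rTensor _ _), LinearMap.rTensor_comp_map,
      comulB_comp_π, ← LinearMap.comp_apply (map M.π Ω), LinearMap.map_comp_lTensor, ← eΩ,
      ← LinearMap.map_comp_lTensor, LinearMap.comp_apply, ← coassoc_apply,
      TensorProduct.map_map_assoc, LinearEquiv.symm_apply_apply,
      ← LinearMap.comp_apply (map (map _ _) _), LinearMap.map_comp_rTensor]
  have key : ∀ z : D ⊗[ℂ] D, LinearMap.lTensor (B ⊗[ℂ] B) (LinearMap.mul' ℂ H)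
      (TensorProduct.tensorTensorTensorComm ℂ B H B H
        (map (map M.π M.σ.toLinearMap ∘ₗ comul) (M.coact ∘ₗ M.π) z)) =
      (TensorProduct.assoc ℂ B B H).symm (map M.π Ω (TensorProduct.assoc ℂ D D D
        (LinearMap.rTensor D comul z))) := by
    intro z
    induction z using TensorProduct.induction_on with
    | zero => simp
    | add a b ha hb => simp only [map_add, ha, hb]
    | tmul a c =>
      simp only [TensorProduct.map_tmul, LinearMap.comp_apply, LinearMap.rTensor_tmul]
      generalize comul (R := ℂ) a = w
      induction w using TensorProduct.induction_on with
      | zero => simp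
      | add a b ha hb => simp only [map_add, add_tmul, ha, hb]
      | tmul x y =>
        simp only [TensorProduct.map_tmul, TensorProduct.assoc_tmul, hΩ, lift.tmul, LinearMap.compl₂_apply,
          LinearMap.comp_apply, LinearMap.coe_lTensorHom]
        generalize M.coact (M.π c) = u
        induction u using TensorProduct.induction_on with
        | zero => simp
        | add a b ha hb => simp only [map_add, tmul_add, ha, hb]
        | tmul p q => simp
  rw [e1, comulB_apply, ← LinearMap.comp_apply (map M.coact M.coact), ← map_comp, M.coact_comp_π,
    map_j_π_comul, ← M.coact_comp_π, key, coassoc_apply]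

/-- The linear map `h ⊗ b ↦ h b`. -/
def mulMap : H ⊗[ℂ] B →ₗ[ℂ] D := LinearMap.mul' ℂ D ∘ₗ map M.i.toLinearMap M.j.toLinearMap

@[simp] theorem mulMap_tmul (h : H) (b : B) : M.mulMap (h ⊗ₜ b) = M.i h * M.j b := rfl

/-- The decomposition `H ⊗ B ≅ D`. -/
def equiv : H ⊗[ℂ] B ≃ₗ[ℂ] D :=
  LinearEquiv.ofLinearMap M.mulMap (map M.σ.toLinearMap M.π ∘ₗ comul)
    (by
      ext x
      have h := M.factor x
      rw [map_comp] at h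
      exact h)
    (by
      ext h b
      have key : ∀ (w : H ⊗[ℂ] H) (z : D ⊗[ℂ] D),
          map M.σ.toLinearMap M.π (map M.i.toLinearMap M.i.toLinearMap w * z) =
          map LinearMap.id M.π
            (map LinearMap.id M.i.toLinearMap w * map M.σ.toLinearMap LinearMap.id z) := by
        intro w z
        induction z using TensorProduct.induction_on with
        | zero => simp
        | add a b ha hb => simp only [map_add, mul_add, ha, hb]
        | tmul a b =>
          induction w using TensorProduct.induction_on with
          | zero => simp
          | add a b ha hb => simp only [map_add, add_mul, ha, hb]
          | tmul x y => simp [σ_i]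
      have key2 : ∀ w : H ⊗[ℂ] H, map LinearMap.id M.π
          (map LinearMap.id M.i.toLinearMap w * 1 ⊗ₜ[ℂ] M.j b) =
          TensorProduct.rid ℂ H (LinearMap.lTensor H counit w) ⊗ₜ b := by
        intro w
        induction w using TensorProduct.induction_on with
        | zero => simp
        | add a b ha hb => simp only [map_add, add_mul, ha, hb, add_tmul]
        | tmul x y => simp [π_i_mul, π_j, smul_tmul']
      simp only [AlgebraTensorModule.curry_apply, LinearMap.restrictScalars_self, curry_apply,
        LinearMap.comp_apply, mulMap_tmul, Bialgebra.comul_mul, LinearMap.id_apply]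
      rw [comul_i, key, M.coinv, key2]
      simp)

@[simp] theorem equiv_tmul (h : H) (b : B) : M.equiv (h ⊗ₜ b) = M.i h * M.j b := rfl

theorem comul_j (b : B) : comul (R := ℂ) (M.j b) =
    LinearMap.lTensor D (LinearMap.mul' ℂ D) (TensorProduct.assoc ℂ D D D
      (map (map M.j.toLinearMap M.i.toLinearMap) M.j.toLinearMap
        (LinearMap.rTensor B M.coact (M.comulB b)))) := by
  rw [comulB_apply, ← LinearMap.comp_apply (LinearMap.rTensor _ _), LinearMap.rTensor_comp_map,
    coact_comp_π, map_j_π_comul, ← LinearMap.comp_apply (map (map _ _) _), ← map_comp,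
    ← LinearMap.comp_assoc, ← map_comp, ← LinearMap.map_comp_rTensor, LinearMap.comp_apply,
    ← TensorProduct.map_map_assoc, coassoc_apply, ← LinearMap.comp_apply (map _ (map _ _)),
    LinearMap.map_comp_lTensor, ← LinearMap.comp_apply (LinearMap.lTensor _ _),
    LinearMap.lTensor_comp_map]
  have e : LinearMap.mul' ℂ D ∘ₗ map (M.i.toLinearMap ∘ₗ M.σ.toLinearMap)
      (M.j.toLinearMap ∘ₗ M.π) ∘ₗ comul = LinearMap.id := LinearMap.ext M.factor
  rw [e, M.coideal]

set_option synthInstance.maxHeartbeats 200000 in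
/-- The bialgebra `D` is a semidirect product of `H` and the coinvariants. -/
def semidirect : letI := M.coalgebra; RightSemidirectProduct H B D :=
  letI := M.coalgebra
  { act := M.act
    coact := M.coact
    act_one := fun b => by simp [π_j]
    act_mul := fun b h k => by rw [act_tmul, act_tmul, act_tmul, π_mul, map_mul M.i, mul_assoc]
    one_act := fun h => by rw [act_tmul, map_one, one_mul, π_i]
    mul_act := fun b c h => by
      rw [act_tmul, map_mul M.j, mul_assoc, j_mul_i]
      generalize comul (R := ℂ) h = w
      induction w using TensorProduct.induction_on with
      | zero => simp
      | add a b ha hb => simp only [map_add, mul_add, ha, hb]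
      | tmul x y =>
        simp only [TensorProduct.map_tmul, LinearMap.mul'_apply, LinearMap.comp_apply,
          AlgHom.toLinearMap_apply, TensorProduct.mk_apply, act_tmul]
        rw [← mul_assoc, π_mul_j]
    coact_counit := M.coact_counit
    coact_comul := M.coact_comul
    counit_coact := M.counit_coact
    comul_coact := M.comul_coact
    e := M.equiv
    e_one := by simp
    e_mul := fun h b k c => by
      rw [equiv_tmul, equiv_tmul, mul_assoc, ← mul_assoc (M.j b), j_mul_i]
      generalize comul (R := ℂ) k = w
      induction w using TensorProduct.induction_on with
      | zero => simp
      | add a b ha hb => simp only [map_add, mul_add, add_mul, ha, hb]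
      | tmul x y =>
        simp only [TensorProduct.map_tmul, LinearMap.mul'_apply, LinearMap.comp_apply,
          AlgHom.toLinearMap_apply, TensorProduct.mk_apply, equiv_tmul, LinearMap.mulLeft_apply,
          LinearMap.mulRight_apply, map_mul, mul_assoc]
    e_counit := fun h b => by
      rw [equiv_tmul, Bialgebra.counit_mul, counit_i]
      rfl
    e_comul := fun h b => by
      rw [equiv_tmul, Bialgebra.comul_mul, comul_i, comul_j]
      change _ = TensorProduct.map _ _ (TensorProduct.assoc ℂ (H ⊗[ℂ] B) H B (LinearMap.rTensor B _
        ((TensorProduct.assoc ℂ (H ⊗[ℂ] H) (B ⊗[ℂ] H) B).symm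
          (comul h ⊗ₜ LinearMap.rTensor B M.coact (M.comulB b)))))
      generalize comul (R := ℂ) h = w
      generalize LinearMap.rTensor B M.coact (M.comulB b) = z
      induction w using TensorProduct.induction_on with
      | zero => simp
      | add a b ha hb => simp only [map_add, add_tmul, add_mul, ha, hb]
      | tmul x y =>
        induction z using TensorProduct.induction_on with
        | zero => simp
        | add a b ha hb => simp only [map_add, tmul_add, mul_add, ha, hb]
        | tmul u c =>
          induction u using TensorProduct.induction_on with
          | zero => simp
          | add a b ha hb => simp only [map_add, tmul_add, add_tmul, mul_add, ha, hb]
          | tmul p q => simp [mul_assoc] }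

/-- The coproduct of the coinvariants is multiplicative with respect to the braiding
`v ⊗ w ↦ w⁽¹⁾ ⊗ (v ◁ w⁽²⁾)`. -/
theorem comulB_mul (Ψ : B ⊗[ℂ] B →ₗ[ℂ] B ⊗[ℂ] B)
    (hΨ : ∀ v w, Ψ (v ⊗ₜ w) = LinearMap.lTensor B (M.act ∘ₗ TensorProduct.mk ℂ B H v) (M.coact w))
    (v w : B) : M.comulB (v * w) = braidedMul Ψ (M.comulB v ⊗ₜ M.comulB w) := by
  have h1 : ∀ x y : D ⊗[ℂ] D, map M.π M.π (x * y) =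
      map M.π M.π (map M.j.toLinearMap M.j.toLinearMap (map M.π M.π x) * y) := by
    intro x y
    induction x using TensorProduct.induction_on with
    | zero => simp
    | add a b ha hb => simp only [map_add, add_mul, ha, hb]
    | tmul a b =>
      induction y using TensorProduct.induction_on with
      | zero => simp
      | add a b ha hb => simp only [map_add, mul_add, ha, hb]
      | tmul x y => simp [π_mul]
  rw [comulB_apply, map_mul, Bialgebra.comul_mul, h1, ← comulB_apply, M.comul_j w]
  generalize M.comulB v = p
  generalize M.comulB w = q
  induction p using TensorProduct.induction_on with
  | zero => simp
  | add a b ha hb => simp only [map_add, add_mul, add_tmul, ha, hb]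
  | tmul a b =>
    induction q using TensorProduct.induction_on with
    | zero => simp
    | add a b ha hb => simp only [map_add, mul_add, tmul_add, ha, hb]
    | tmul c d =>
      simp only [braidedMul, LinearMap.comp_apply, LinearEquiv.coe_coe, TensorProduct.assoc_tmul,
        LinearMap.lTensor_tmul, TensorProduct.assoc_symm_tmul, LinearMap.rTensor_tmul, hΨ]
      generalize M.coact c = u
      induction u using TensorProduct.induction_on with
      | zero => simp
      | add a b ha hb => simp only [map_add, mul_add, tmul_add, add_tmul, ha, hb]
      | tmul x y => simp [← mul_assoc, ← map_mul, π_mul_j, π_j]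

variable (hfin : ∀ f : D →ₗ[ℂ] ℂ, IsFiniteFunctional f →
  IsFiniteFunctional (f ∘ₗ M.retract.j.toLinearMap ∘ₗ M.retract.π))

/-- The finite dual of a bosonization is again a bosonization. -/
def dual : Bosonization (FiniteDual H) M.retract.CoinvDual (FiniteDual D) where
  i := FiniteDual.comap M.σ M.comul_σ M.counit_σ
  σ := FiniteDual.comap M.i M.comul_i M.counit_i
  j := M.retract.transposeπ
  π := M.retract.transposej hfin
  comul_i := FiniteDual.comul_comap _ _ _
  counit_i := FiniteDual.counit_comap _ _ _
  comul_σ := FiniteDual.comul_comap _ _ _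
  counit_σ := FiniteDual.counit_comap _ _ _
  σ_i h := FiniteDual.ext_ev fun x => by simp [σ_i]
  π_j b := M.retract.ext_pair fun v => by rw [CoalgebraRetract.pair_transposej, CoalgebraRetract.ev_transposeπ, retract_j, retract_π, π_j]
  π_i_mul h f := M.retract.ext_pair fun v => by
    rw [CoalgebraRetract.pair_transposej, FiniteDual.mul_apply, ← LinearMap.id_apply (R := ℂ) f,
      ← AlgHom.toLinearMap_apply, ← TensorProduct.map_tmul,
      tensorPairing_map (p := FiniteDual.ev H) (φ := M.σ.toLinearMap) (ψ := LinearMap.id)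
        (r := FiniteDual.ev D) (fun _ _ => rfl) (fun _ _ => rfl), retract_j, M.coinv]
    simp [FiniteDual.counit_apply, CoalgebraRetract.pair_transposej]
  π_mul f g := M.retract.ext_pair fun v => by
    rw [CoalgebraRetract.pair_transposej, CoalgebraRetract.pair_transposej, FiniteDual.mul_apply, FiniteDual.mul_apply,
      ← LinearMap.id_apply (R := ℂ) g, ← AlgHom.toLinearMap_apply,
      ← LinearMap.comp_apply M.retract.transposeπ.toLinearMap, ← TensorProduct.map_tmul,
      tensorPairing_map (p := FiniteDual.ev D) (φ := M.j.toLinearMap ∘ₗ M.π) (ψ := LinearMap.id)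
        (r := FiniteDual.ev D) (fun _ _ => rfl) (fun _ _ => rfl), retract_j, M.coideal]
    rfl
  coinv b := FiniteDual.ext_tensor fun x y => by
    rw [tensorPairing_map (p := FiniteDual.ev D) (φ := M.i.toLinearMap)
      (ψ := LinearMap.id) (r := FiniteDual.ev D) (fun _ _ => rfl) (fun _ _ => rfl)]
    simp [FiniteDual.pairing_comul, CoalgebraRetract.ev_transposeπ, π_i_mul, FiniteDual.pairing_one]
  coideal b := FiniteDual.ext_tensor fun x y => by
    rw [tensorPairing_map (p := FiniteDual.ev D) (φ := M.j.toLinearMap ∘ₗ M.π)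
      (ψ := LinearMap.id) (r := FiniteDual.ev D) (fun _ _ => rfl) (fun _ _ => rfl),
      FiniteDual.pairing_comul]
    simp [FiniteDual.pairing_comul, CoalgebraRetract.ev_transposeπ, π_mul]
  factor f := FiniteDual.ext_ev fun x => by
    rw [FiniteDual.ev_mul', tensorPairing_map (p := FiniteDual.ev D) (r := FiniteDual.ev D)
      (φ := M.i.toLinearMap ∘ₗ M.σ.toLinearMap) (ψ := M.j.toLinearMap ∘ₗ M.π)
      (fun _ _ => rfl) (fun _ _ => rfl)]
    refine (LinearMap.congr_fun (FiniteDual.pairing_comulMap D f) _).trans ?_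
    rw [LinearMap.comp_apply, M.factor]

theorem isDual : letI := M.coalgebra; letI := (M.dual hfin).coalgebra
    RightSemidirectProduct.IsDual (M.dual hfin).semidirect M.semidirect (FiniteDual.ev H) M.retract.pair
      (FiniteDual.ev D) :=
  letI := M.coalgebra
  letI := (M.dual hfin).coalgebra
  { mul := M.retract.pair_mul
    one := M.retract.pair_one
    comul := fun b v w => by
      refine (tensorPairing_map (p := FiniteDual.ev D) (r := FiniteDual.ev D)
        (φ := M.j.toLinearMap) (ψ := M.j.toLinearMap)
        (fun _ _ => rfl) (fun _ _ => rfl) (comul (M.retract.transposeπ b)) (v ⊗ₜ w)).trans ?_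
      rw [TensorProduct.map_tmul, FiniteDual.pairing_comul, CoalgebraRetract.ev_transposeπ,
        AlgHom.toLinearMap_apply, AlgHom.toLinearMap_apply, ← map_mul M.j, retract_π, π_j]
    counit := fun b => by
      change M.retract.pair b (M.π 1) = _
      rw [π_one]
    act := fun b h v => by
      refine (FiniteDual.mul_apply (M.retract.transposeπ b) ((M.dual hfin).i h) (M.j v)).trans ?_
      exact tensorPairing_map (φ' := M.retract.transposeπ.toLinearMap)
        (ψ' := (M.dual hfin).i.toLinearMap) (φ := M.π) (ψ := M.σ.toLinearMap)
        (fun _ _ => rfl) (fun _ _ => rfl) (b ⊗ₜ h) (comul (M.j v))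
    coact := fun b v a => by
      refine (tensorPairing_map (p := FiniteDual.ev D) (r := FiniteDual.ev D)
        (φ := M.j.toLinearMap) (ψ := M.i.toLinearMap)
        (fun _ _ => rfl) (fun _ _ => rfl) (comul (M.retract.transposeπ b)) (v ⊗ₜ a)).trans ?_
      rw [TensorProduct.map_tmul, FiniteDual.pairing_comul]
      rfl
    pairing := fun h b a v => by
      refine (FiniteDual.mul_apply ((M.dual hfin).i h) (M.retract.transposeπ b) _).trans ?_
      refine (tensorPairing_map (φ' := (M.dual hfin).i.toLinearMap)
        (ψ' := M.retract.transposeπ.toLinearMap) (φ := M.σ.toLinearMap) (ψ := M.π)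
        (fun _ _ => rfl) (fun _ _ => rfl) (h ⊗ₜ b) (comul (M.equiv (a ⊗ₜ v)))).trans ?_
      have e : map M.σ.toLinearMap M.π (comul (M.equiv (a ⊗ₜ v))) = a ⊗ₜ[ℂ] v :=
        M.equiv.symm_apply_apply _
      rw [e, tensorPairing_tmul] }

end Bosonization

end QPoincare
end

noncomputable section

namespace QPoincare

open Coalgebra TensorProduct

/-- The mirror image of `Bosonization`: a bialgebra `D` with a split projection `σ` onto `H`, the
subalgebra `B` of right coinvariants, and the projection `π` of `D` onto its quotient left
module `B`. -/
structure LeftBosonization (H B D : Type*) [Ring H] [Bialgebra ℂ H] [Ring B] [Algebra ℂ B]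
    [Ring D] [Bialgebra ℂ D] where
  i : H →ₐ[ℂ] D
  σ : D →ₐ[ℂ] H
  j : B →ₐ[ℂ] D
  π : D →ₗ[ℂ] B
  comul_i : ∀ h, comul (R := ℂ) (i h) = map i.toLinearMap i.toLinearMap (comul h)
  counit_i : ∀ h, counit (R := ℂ) (i h) = counit (R := ℂ) h
  comul_σ : ∀ x, comul (R := ℂ) (σ x) = map σ.toLinearMap σ.toLinearMap (comul x)
  counit_σ : ∀ x, counit (R := ℂ) (σ x) = counit (R := ℂ) x
  σ_i : ∀ h, σ (i h) = h
  π_j : ∀ b, π (j b) = b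
  π_mul_i : ∀ x h, π (x * i h) = counit (R := ℂ) h • π x
  π_mul : ∀ x y, π (x * j (π y)) = π (x * y)
  coinv : ∀ b, map LinearMap.id σ.toLinearMap (comul (j b)) = j b ⊗ₜ[ℂ] 1
  coideal : ∀ b, map LinearMap.id (j.toLinearMap ∘ₗ π) (comul (j b)) = comul (R := ℂ) (j b)
  factor : ∀ x, LinearMap.mul' ℂ D (map (j.toLinearMap ∘ₗ π) (i.toLinearMap ∘ₗ σ.toLinearMap)
    (comul x)) = x

theorem sum_smul_counit {C : Type*} [AddCommMonoid C] [Module ℂ C] [Coalgebra ℂ C] {κ : Type*}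
    {x : C} (r : Coalgebra.Repr ℂ x κ) :
    ∑ k ∈ r.index, counit (R := ℂ) (r.right k) • r.left k = x := by
  have h := congrArg (TensorProduct.rid ℂ C) (sum_tmul_counit_eq r)
  rw [map_sum] at h
  simpa only [TensorProduct.rid_tmul, one_smul] using h

namespace LeftBosonization

variable {H B D : Type*} [Ring H] [Bialgebra ℂ H] [Ring B] [Algebra ℂ B]
    [Ring D] [Bialgebra ℂ D] (M : LeftBosonization H B D)

theorem π_one : M.π 1 = 1 := by
  rw [← map_one M.j, M.π_j]

theorem π_j_mul (b : B) (x : D) : M.π (M.j b * x) = b * M.π x := by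
  rw [← M.π_mul, ← map_mul, M.π_j]

theorem π_i (h : H) : M.π (M.i h) = counit (R := ℂ) h • (1 : B) := by
  rw [← one_mul (M.i h), M.π_mul_i, π_one]

theorem sum_factor {κ : Type*} {x : D} (r : Coalgebra.Repr ℂ x κ) :
    ∑ k ∈ r.index, M.j (M.π (r.left k)) * M.i (M.σ (r.right k)) = x := by
  have h := M.factor x
  rw [← r.eq] at h
  simpa using h

theorem counit_j_π (x : D) : counit (R := ℂ) (M.j (M.π x)) = counit (R := ℂ) x := by
  have h := M.sum_factor (ℛ ℂ x)
  have h' := congrArg (counit (R := ℂ)) h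
  simp only [map_sum, Bialgebra.counit_mul, counit_i, counit_σ] at h'
  rw [← h']
  have := congrArg (fun y => counit (R := ℂ) (M.j (M.π y))) (sum_smul_counit (ℛ ℂ x))
  simpa [mul_comm] using this.symm

theorem map_π_mul_comul_i (y : D ⊗[ℂ] D) (h : H) :
    map M.π M.π (y * comul (R := ℂ) (M.i h)) = counit (R := ℂ) h • map M.π M.π y := by
  have key : ∀ (w : H ⊗[ℂ] H) (y : D ⊗[ℂ] D),
      map M.π M.π (y * map M.i.toLinearMap M.i.toLinearMap w) =
      (LinearMap.mul' ℂ ℂ (map counit counit w)) • map M.π M.π y := by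
    intro w y
    induction w using TensorProduct.induction_on with
    | zero => simp
    | add a b ha hb => simp only [map_add, mul_add, ha, hb, add_smul]
    | tmul a b =>
      induction y using TensorProduct.induction_on with
      | zero => simp
      | add a b ha hb => simp only [map_add, add_mul, ha, hb, smul_add]
      | tmul x y => simp [π_mul_i, smul_tmul', tmul_smul, smul_smul, mul_comm]
  rw [comul_i, key]
  congr 1
  rw [← (ℛ ℂ h).eq]
  simp

theorem map_π_comul_j_π (x : D) :
    map M.π M.π (comul (R := ℂ) (M.j (M.π x))) = map M.π M.π (comul (R := ℂ) x) := by
  have h := M.sum_factor (ℛ ℂ x)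
  have h' := congrArg (fun y => map M.π M.π (comul (R := ℂ) y)) h
  simp only [map_sum, Bialgebra.comul_mul, map_π_mul_comul_i, counit_σ] at h'
  rw [← h']
  have := congrArg (fun y => map M.π M.π (comul (R := ℂ) (M.j (M.π y))))
    (sum_smul_counit (ℛ ℂ x))
  simpa using this.symm

/-- The coinvariants as a quotient coalgebra. -/
def retract : CoalgebraRetract B D where
  j := M.j
  π := M.π
  π_j := M.π_j
  map_π_comul_j_π := M.map_π_comul_j_π
  counit_j_π := M.counit_j_π

@[simp] theorem retract_j : M.retract.j = M.j := rfl

@[simp] theorem retract_π : M.retract.π = M.π := rfl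

/-- The coalgebra structure of the coinvariants. -/
abbrev coalgebra : Coalgebra ℂ B := M.retract.coalgebra

/-- The coproduct of the coinvariants. -/
abbrev comulB : B →ₗ[ℂ] B ⊗[ℂ] B := M.retract.comulB

theorem comulB_apply (b : B) : M.comulB b = map M.π M.π (comul (R := ℂ) (M.j b)) := rfl

theorem comulB_comp_π : M.comulB ∘ₗ M.π = map M.π M.π ∘ₗ comul := M.retract.comulB_comp_π

/-- The action of `H` on the coinvariants, `h ▷ b = π(h b)`. -/
def act : H ⊗[ℂ] B →ₗ[ℂ] B :=
  M.π ∘ₗ LinearMap.mul' ℂ D ∘ₗ map M.i.toLinearMap M.j.toLinearMap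

@[simp] theorem act_tmul (h : H) (b : B) : M.act (h ⊗ₜ b) = M.π (M.i h * M.j b) := rfl

/-- The coaction of `H` on the coinvariants. -/
def coact : B →ₗ[ℂ] H ⊗[ℂ] B := map M.σ.toLinearMap M.π ∘ₗ comul ∘ₗ M.j.toLinearMap

theorem coact_apply (b : B) : M.coact b = map M.σ.toLinearMap M.π (comul (M.j b)) := rfl

/-- The cross relation `h b = (h₍₁₎ ▷ b) h₍₂₎`. -/
theorem i_mul_j (b : B) (h : H) : M.i h * M.j b =
    LinearMap.mul' ℂ D (map (M.j.toLinearMap ∘ₗ M.act ∘ₗ (TensorProduct.mk ℂ H B).flip b)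
      M.i.toLinearMap (comul h)) := by
  have h1 := M.factor (M.i h * M.j b)
  have key : ∀ (z : D ⊗[ℂ] D) (w : H ⊗[ℂ] H),
      map (M.j.toLinearMap ∘ₗ M.π) (M.i.toLinearMap ∘ₗ M.σ.toLinearMap)
        (map M.i.toLinearMap M.i.toLinearMap w * z) =
      map (M.j.toLinearMap ∘ₗ M.π) M.i.toLinearMap
        (map M.i.toLinearMap LinearMap.id w * map LinearMap.id M.σ.toLinearMap z) := by
    intro z w
    induction z using TensorProduct.induction_on with
    | zero => simp
    | add a b ha hb => simp only [map_add, mul_add, ha, hb]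
    | tmul a b =>
      induction w using TensorProduct.induction_on with
      | zero => simp
      | add a b ha hb => simp only [map_add, add_mul, ha, hb]
      | tmul x y => simp [σ_i]
  rw [Bialgebra.comul_mul, comul_i, key, M.coinv] at h1
  rw [← h1]
  congr 1
  generalize comul (R := ℂ) h = w
  induction w using TensorProduct.induction_on with
  | zero => simp
  | add a b ha hb => simp only [map_add, add_mul, ha, hb]
  | tmul x y => simp

theorem σ_j (b : B) : M.σ (M.j b) = counit (R := ℂ) (M.j b) • (1 : H) := by
  have h := congrArg (LinearMap.rTensor H (counit (R := ℂ) (A := D))) (M.coinv b)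
  rw [← LinearMap.comp_apply, LinearMap.rTensor_comp_map, LinearMap.comp_id] at h
  have h2 := congrArg (map (LinearMap.id (R := ℂ) (M := ℂ)) M.σ.toLinearMap)
    (rTensor_counit_comul (R := ℂ) (M.j b))
  rw [← LinearMap.comp_apply, LinearMap.map_comp_rTensor, LinearMap.id_comp] at h2
  have h3 := congrArg (TensorProduct.lid ℂ H) (h2.symm.trans h)
  simpa using h3

theorem map_comul_j_π {X Y : Type*} [AddCommMonoid X] [Module ℂ X] [AddCommMonoid Y] [Module ℂ Y]
    (F : D →ₗ[ℂ] X) (G : D →ₗ[ℂ] Y) (b : B) :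
    map G (F ∘ₗ M.j.toLinearMap ∘ₗ M.π) (comul (M.j b)) = map G F (comul (R := ℂ) (M.j b)) := by
  conv_rhs => rw [← M.coideal b]
  rw [← LinearMap.comp_apply (map G F), ← map_comp, LinearMap.comp_id]

theorem coact_comp_π : M.coact ∘ₗ M.π =
    (map M.σ.toLinearMap M.π ∘ₗ comul) ∘ₗ M.j.toLinearMap ∘ₗ M.π := rfl

theorem coact_counit (b : B) : TensorProduct.lid ℂ B (LinearMap.rTensor B counit (M.coact b)) = b := by
  have h := congrArg (map (LinearMap.id (R := ℂ) (M := ℂ)) M.π)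
    (rTensor_counit_comul (R := ℂ) (M.j b))
  have e : (counit (R := ℂ) (A := H)) ∘ₗ M.σ.toLinearMap = counit :=
    LinearMap.ext M.counit_σ
  rw [← LinearMap.comp_apply, LinearMap.map_comp_rTensor] at h
  rw [coact_apply, ← LinearMap.comp_apply (LinearMap.rTensor _ _), LinearMap.rTensor_comp_map, e,
    ← LinearMap.id_comp (counit (R := ℂ) (A := D)), h]
  simp [M.π_j]

theorem coact_comul (b : B) : LinearMap.lTensor H M.coact (M.coact b) =
    TensorProduct.assoc ℂ H H B (LinearMap.rTensor B comul (M.coact b)) := by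
  have e : (comul (R := ℂ) (A := H)) ∘ₗ M.σ.toLinearMap =
      map M.σ.toLinearMap M.σ.toLinearMap ∘ₗ comul := LinearMap.ext M.comul_σ
  rw [coact_apply, ← LinearMap.comp_apply (LinearMap.lTensor _ _), LinearMap.lTensor_comp_map,
    coact_comp_π, map_comul_j_π, ← LinearMap.comp_apply (LinearMap.rTensor _ _),
    LinearMap.rTensor_comp_map, e, ← LinearMap.map_comp_rTensor, LinearMap.comp_apply (map _ _),
    ← TensorProduct.map_map_assoc, coassoc_apply, ← LinearMap.comp_apply (map _ (map _ _)),
    LinearMap.map_comp_lTensor]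

theorem counit_coact (b : B) :
    TensorProduct.rid ℂ H (LinearMap.lTensor H (counit ∘ₗ M.j.toLinearMap) (M.coact b)) =
      counit (R := ℂ) (M.j b) • (1 : H) := by
  have h := congrArg (map M.σ.toLinearMap (LinearMap.id (R := ℂ) (M := ℂ)))
    (lTensor_counit_comul (R := ℂ) (M.j b))
  have e : (counit (R := ℂ) ∘ₗ M.j.toLinearMap) ∘ₗ M.π = counit :=
    LinearMap.ext M.counit_j_π
  rw [← LinearMap.comp_apply, LinearMap.map_comp_lTensor] at h
  rw [coact_apply, ← LinearMap.comp_apply (LinearMap.lTensor _ _), LinearMap.lTensor_comp_map, e,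
    ← LinearMap.id_comp (counit (R := ℂ) (A := D)), h]
  simp [M.σ_j]

theorem map_σ_π_mul_comul_i (y : D ⊗[ℂ] D) (h : H) :
    map M.σ.toLinearMap M.π (y * comul (R := ℂ) (M.i h)) =
      LinearMap.rTensor B (LinearMap.mulRight ℂ h) (map M.σ.toLinearMap M.π y) := by
  have key : ∀ (w : H ⊗[ℂ] H) (y : D ⊗[ℂ] D),
      map M.σ.toLinearMap M.π (y * map M.i.toLinearMap M.i.toLinearMap w) =
      LinearMap.rTensor B (LinearMap.mulRight ℂ
        (TensorProduct.rid ℂ H (LinearMap.lTensor H counit w))) (map M.σ.toLinearMap M.π y) := by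
    intro w y
    induction w using TensorProduct.induction_on with
    | zero => simp
    | add a b ha hb =>
      have e : ∀ p q : H, LinearMap.mulRight ℂ (p + q) = LinearMap.mulRight ℂ p +
          LinearMap.mulRight ℂ q := fun p q => by ext; simp [mul_add]
      simp only [map_add, mul_add, ha, hb, e, LinearMap.rTensor_add, LinearMap.add_apply]
    | tmul a b =>
      induction y using TensorProduct.induction_on with
      | zero => simp
      | add a b ha hb => simp only [map_add, add_mul, ha, hb]
      | tmul x y => simp [π_mul_i, smul_tmul', tmul_smul, σ_i]
  rw [comul_i, key]
  simp

theorem map_σ_π_comul (x : D) :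
    map M.σ.toLinearMap M.π (comul (R := ℂ) x) =
      TensorProduct.lift ((LinearMap.rTensorHom B ∘ₗ (LinearMap.mul ℂ H).flip ∘ₗ
        M.σ.toLinearMap).compl₂ (M.coact ∘ₗ M.π)).flip (comul (R := ℂ) x) := by
  have h := M.sum_factor (ℛ ℂ x)
  have h' := congrArg (fun y => map M.σ.toLinearMap M.π (comul (R := ℂ) y)) h
  simp only [map_sum, Bialgebra.comul_mul, map_σ_π_mul_comul_i] at h'
  rw [← h', ← (ℛ ℂ x).eq, map_sum]
  rfl

theorem comul_coact (b : B) : LinearMap.lTensor H M.comulB (M.coact b) =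
    LinearMap.rTensor (B ⊗[ℂ] B) (LinearMap.mul' ℂ H)
      (TensorProduct.tensorTensorTensorComm ℂ H B H B (map M.coact M.coact (M.comulB b))) := by
  set Ω : D ⊗[ℂ] D →ₗ[ℂ] H ⊗[ℂ] B :=
    TensorProduct.lift ((LinearMap.rTensorHom B ∘ₗ (LinearMap.mul ℂ H).flip ∘ₗ
        M.σ.toLinearMap).compl₂ (M.coact ∘ₗ M.π)).flip with hΩ
  have eΩ : map M.σ.toLinearMap M.π ∘ₗ comul = Ω ∘ₗ comul := LinearMap.ext M.map_σ_π_comul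
  have e1 : LinearMap.lTensor H M.comulB (M.coact b) =
      TensorProduct.assoc ℂ H B B (map Ω M.π (LinearMap.rTensor D comul
        (comul (R := ℂ) (M.j b)))) := by
    rw [coact_apply, ← LinearMap.comp_apply (LinearMap.lTensor _ _), LinearMap.lTensor_comp_map,
      comulB_comp_π, ← LinearMap.comp_apply (map Ω M.π), LinearMap.map_comp_rTensor, ← eΩ,
      ← LinearMap.map_comp_rTensor, LinearMap.comp_apply, ← TensorProduct.map_map_assoc,
      coassoc_apply, ← LinearMap.comp_apply (map _ (map _ _)), LinearMap.map_comp_lTensor]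
  have key : ∀ z : D ⊗[ℂ] D, LinearMap.rTensor (B ⊗[ℂ] B) (LinearMap.mul' ℂ H)
      (TensorProduct.tensorTensorTensorComm ℂ H B H B
        (map (M.coact ∘ₗ M.π) (map M.σ.toLinearMap M.π ∘ₗ comul) z)) =
      TensorProduct.assoc ℂ H B B (map Ω M.π ((TensorProduct.assoc ℂ D D D).symm
        (LinearMap.lTensor D comul z))) := by
    intro z
    induction z using TensorProduct.induction_on with
    | zero => simp
    | add a b ha hb => simp only [map_add, ha, hb]
    | tmul c a =>
      simp only [TensorProduct.map_tmul, LinearMap.comp_apply, LinearMap.lTensor_tmul]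
      generalize comul (R := ℂ) a = w
      induction w using TensorProduct.induction_on with
      | zero => simp
      | add a b ha hb => simp only [map_add, tmul_add, ha, hb]
      | tmul x y =>
        simp only [TensorProduct.map_tmul, TensorProduct.assoc_symm_tmul, hΩ, lift.tmul,
          LinearMap.flip_apply, LinearMap.compl₂_apply,
          LinearMap.comp_apply, LinearMap.coe_rTensorHom]
        generalize M.coact (M.π c) = u
        induction u using TensorProduct.induction_on with
        | zero => simp
        | add a b ha hb => simp only [map_add, add_tmul, ha, hb]
        | tmul p q => simp
  rw [e1, comulB_apply, ← LinearMap.comp_apply (map M.coact M.coact), ← map_comp]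
  nth_rewrite 2 [M.coact_comp_π]
  rw [map_comul_j_π, key, coassoc_symm_apply]

/-- The linear map `b ⊗ h ↦ b h`. -/
def mulMap : B ⊗[ℂ] H →ₗ[ℂ] D := LinearMap.mul' ℂ D ∘ₗ map M.j.toLinearMap M.i.toLinearMap

@[simp] theorem mulMap_tmul (b : B) (h : H) : M.mulMap (b ⊗ₜ h) = M.j b * M.i h := rfl

/-- The decomposition `B ⊗ H ≅ D`. -/
def equiv : B ⊗[ℂ] H ≃ₗ[ℂ] D :=
  LinearEquiv.ofLinearMap M.mulMap (map M.π M.σ.toLinearMap ∘ₗ comul)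
    (by
      ext x
      have h := M.factor x
      rw [map_comp] at h
      exact h)
    (by
      ext b h
      have key : ∀ (w : H ⊗[ℂ] H) (z : D ⊗[ℂ] D),
          map M.π M.σ.toLinearMap (z * map M.i.toLinearMap M.i.toLinearMap w) =
          map M.π LinearMap.id
            (map LinearMap.id M.σ.toLinearMap z * map M.i.toLinearMap LinearMap.id w) := by
        intro w z
        induction z using TensorProduct.induction_on with
        | zero => simp
        | add a b ha hb => simp only [map_add, add_mul, ha, hb]
        | tmul a b =>
          induction w using TensorProduct.induction_on with
          | zero => simp
          | add a b ha hb => simp only [map_add, mul_add, ha, hb]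
          | tmul x y => simp [σ_i]
      have key2 : ∀ w : H ⊗[ℂ] H, map M.π LinearMap.id
          (M.j b ⊗ₜ[ℂ] 1 * map M.i.toLinearMap LinearMap.id w) =
          b ⊗ₜ TensorProduct.lid ℂ H (LinearMap.rTensor H counit w) := by
        intro w
        induction w using TensorProduct.induction_on with
        | zero => simp
        | add a b ha hb => simp only [map_add, mul_add, ha, hb, tmul_add]
        | tmul x y => simp [π_mul_i, π_j, smul_tmul']
      simp only [AlgebraTensorModule.curry_apply, LinearMap.restrictScalars_self, curry_apply,
        LinearMap.comp_apply, mulMap_tmul, Bialgebra.comul_mul, LinearMap.id_apply]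
      rw [comul_i, key, M.coinv, key2]
      simp)

@[simp] theorem equiv_tmul (b : B) (h : H) : M.equiv (b ⊗ₜ h) = M.j b * M.i h := rfl

theorem comul_j (b : B) : comul (R := ℂ) (M.j b) =
    LinearMap.rTensor D (LinearMap.mul' ℂ D) ((TensorProduct.assoc ℂ D D D).symm
      (map M.j.toLinearMap (map M.i.toLinearMap M.j.toLinearMap)
        (LinearMap.lTensor B M.coact (M.comulB b)))) := by
  have e : LinearMap.mul' ℂ D ∘ₗ map (M.j.toLinearMap ∘ₗ M.π)
      (M.i.toLinearMap ∘ₗ M.σ.toLinearMap) ∘ₗ comul = LinearMap.id := LinearMap.ext M.factor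
  rw [comulB_apply, ← LinearMap.comp_apply (LinearMap.lTensor _ _), LinearMap.lTensor_comp_map,
    coact_comp_π, map_comul_j_π, ← LinearMap.comp_apply (map _ (map _ _)), ← map_comp,
    ← LinearMap.comp_assoc, ← map_comp, ← LinearMap.map_comp_lTensor, LinearMap.comp_apply,
    ← coassoc_apply, TensorProduct.map_map_assoc, LinearEquiv.symm_apply_apply,
    ← LinearMap.comp_apply (map (map _ _) _),
    LinearMap.map_comp_rTensor, ← LinearMap.comp_apply (LinearMap.rTensor _ _),
    LinearMap.rTensor_comp_map, e, M.coideal]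

set_option synthInstance.maxHeartbeats 200000 in
/-- The bialgebra `D` is a semidirect product of `H` and the coinvariants. -/
def semidirect : letI := M.coalgebra; LeftSemidirectProduct H B D :=
  letI := M.coalgebra
  { act := M.act
    coact := M.coact
    one_act := fun b => by simp [π_j]
    mul_act := fun b h k => by rw [act_tmul, act_tmul, act_tmul, π_mul, map_mul M.i, mul_assoc]
    act_one := fun h => by rw [act_tmul, map_one, mul_one, π_i]
    act_mul := fun b c h => by
      rw [act_tmul, map_mul M.j, ← mul_assoc, i_mul_j]
      generalize comul (R := ℂ) h = w
      induction w using TensorProduct.induction_on with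
      | zero => simp
      | add a b ha hb => simp only [map_add, add_mul, ha, hb]
      | tmul x y =>
        simp only [TensorProduct.map_tmul, LinearMap.mul'_apply, LinearMap.comp_apply,
          AlgHom.toLinearMap_apply, TensorProduct.mk_apply, LinearMap.flip_apply, act_tmul]
        rw [mul_assoc, π_j_mul]
    coact_counit := M.coact_counit
    coact_comul := M.coact_comul
    counit_coact := M.counit_coact
    comul_coact := M.comul_coact
    e := M.equiv
    e_one := by simp
    e_mul := fun b h c k => by
      rw [equiv_tmul, equiv_tmul, mul_assoc, ← mul_assoc (M.i h), i_mul_j]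
      generalize comul (R := ℂ) h = w
      induction w using TensorProduct.induction_on with
      | zero => simp
      | add a b ha hb => simp only [map_add, mul_add, add_mul, ha, hb]
      | tmul x y =>
        simp only [TensorProduct.map_tmul, LinearMap.mul'_apply, LinearMap.comp_apply,
          AlgHom.toLinearMap_apply, TensorProduct.mk_apply, LinearMap.flip_apply, equiv_tmul,
          LinearMap.mulLeft_apply, LinearMap.mulRight_apply, map_mul, mul_assoc]
    e_counit := fun b h => by
      rw [equiv_tmul, Bialgebra.counit_mul, counit_i]
      rfl
    e_comul := fun b h => by
      rw [equiv_tmul, Bialgebra.comul_mul, comul_i, comul_j]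
      change _ = TensorProduct.map _ _ ((TensorProduct.assoc ℂ B H (B ⊗[ℂ] H)).symm
        (LinearMap.lTensor B _ (TensorProduct.assoc ℂ B (H ⊗[ℂ] B) (H ⊗[ℂ] H)
            (LinearMap.lTensor B M.coact (M.comulB b) ⊗ₜ comul h))))
      generalize comul (R := ℂ) h = w
      generalize LinearMap.lTensor B M.coact (M.comulB b) = z
      induction w using TensorProduct.induction_on with
      | zero => simp
      | add a b ha hb => simp only [map_add, tmul_add, mul_add, ha, hb]
      | tmul x y =>
        induction z using TensorProduct.induction_on with
        | zero => simp
        | add a b ha hb => simp only [map_add, add_tmul, add_mul, ha, hb]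
        | tmul c u =>
          induction u using TensorProduct.induction_on with
          | zero => simp
          | add a b ha hb => simp only [map_add, tmul_add, add_tmul, add_mul, ha, hb]
          | tmul p q => simp [mul_assoc] }

/-- The coproduct of the coinvariants is multiplicative with respect to the braiding
`v ⊗ w ↦ (v⁽¹⁾ ▷ w) ⊗ v⁽²⁾`. -/
theorem comulB_mul (Ψ : B ⊗[ℂ] B →ₗ[ℂ] B ⊗[ℂ] B)
    (hΨ : ∀ v w, Ψ (v ⊗ₜ w) =
      LinearMap.rTensor B (M.act ∘ₗ (TensorProduct.mk ℂ H B).flip w) (M.coact v))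
    (v w : B) : M.comulB (v * w) = braidedMul Ψ (M.comulB v ⊗ₜ M.comulB w) := by
  have h1 : ∀ x y : D ⊗[ℂ] D, map M.π M.π (x * y) =
      map M.π M.π (x * map M.j.toLinearMap M.j.toLinearMap (map M.π M.π y)) := by
    intro x y
    induction x using TensorProduct.induction_on with
    | zero => simp
    | add a b ha hb => simp only [map_add, add_mul, ha, hb]
    | tmul a b =>
      induction y using TensorProduct.induction_on with
      | zero => simp
      | add a b ha hb => simp only [map_add, mul_add, ha, hb]
      | tmul x y => simp [π_mul]
  rw [comulB_apply, map_mul, Bialgebra.comul_mul, h1, ← comulB_apply, M.comul_j v]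
  generalize M.comulB v = p
  generalize M.comulB w = q
  induction p using TensorProduct.induction_on with
  | zero => simp
  | add a b ha hb => simp only [map_add, add_mul, add_tmul, ha, hb]
  | tmul a b =>
    induction q using TensorProduct.induction_on with
    | zero => simp
    | add a b ha hb => simp only [map_add, mul_add, tmul_add, ha, hb]
    | tmul c d =>
      simp only [braidedMul, LinearMap.comp_apply, LinearEquiv.coe_coe, TensorProduct.assoc_tmul,
        LinearMap.lTensor_tmul, TensorProduct.assoc_symm_tmul, LinearMap.rTensor_tmul, hΨ]
      generalize M.coact b = u
      induction u using TensorProduct.induction_on with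
      | zero => simp
      | add a b ha hb => simp only [map_add, add_mul, tmul_add, add_tmul, ha, hb]
      | tmul x y => simp [mul_assoc, ← map_mul, π_j_mul, π_j]

variable (hfin : ∀ f : D →ₗ[ℂ] ℂ, IsFiniteFunctional f →
  IsFiniteFunctional (f ∘ₗ M.retract.j.toLinearMap ∘ₗ M.retract.π))

/-- The finite dual of a bosonization is again a bosonization. -/
def dual : LeftBosonization (FiniteDual H) M.retract.CoinvDual (FiniteDual D) where
  i := FiniteDual.comap M.σ M.comul_σ M.counit_σ
  σ := FiniteDual.comap M.i M.comul_i M.counit_i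
  j := M.retract.transposeπ
  π := M.retract.transposej hfin
  comul_i := FiniteDual.comul_comap _ _ _
  counit_i := FiniteDual.counit_comap _ _ _
  comul_σ := FiniteDual.comul_comap _ _ _
  counit_σ := FiniteDual.counit_comap _ _ _
  σ_i h := FiniteDual.ext_ev fun x => by simp [σ_i]
  π_j b := M.retract.ext_pair fun v => by
    rw [CoalgebraRetract.pair_transposej, CoalgebraRetract.ev_transposeπ, retract_j, retract_π, π_j]
  π_mul_i f h := M.retract.ext_pair fun v => by
    rw [CoalgebraRetract.pair_transposej, FiniteDual.mul_apply, ← LinearMap.id_apply (R := ℂ) f,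
      ← AlgHom.toLinearMap_apply, ← TensorProduct.map_tmul,
      tensorPairing_map (r := FiniteDual.ev H) (ψ := M.σ.toLinearMap) (φ := LinearMap.id)
        (p := FiniteDual.ev D) (fun _ _ => rfl) (fun _ _ => rfl), retract_j, M.coinv]
    simp [FiniteDual.counit_apply, CoalgebraRetract.pair_transposej, mul_comm]
  π_mul f g := M.retract.ext_pair fun v => by
    rw [CoalgebraRetract.pair_transposej, CoalgebraRetract.pair_transposej, FiniteDual.mul_apply,
      FiniteDual.mul_apply, ← LinearMap.id_apply (R := ℂ) f, ← AlgHom.toLinearMap_apply,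
      ← LinearMap.comp_apply M.retract.transposeπ.toLinearMap, ← TensorProduct.map_tmul,
      tensorPairing_map (p := FiniteDual.ev D) (ψ := M.j.toLinearMap ∘ₗ M.π) (φ := LinearMap.id)
        (r := FiniteDual.ev D) (fun _ _ => rfl) (fun _ _ => rfl), retract_j, M.coideal]
    rfl
  coinv b := FiniteDual.ext_tensor fun x y => by
    rw [tensorPairing_map (p := FiniteDual.ev D) (ψ := M.i.toLinearMap)
      (φ := LinearMap.id) (r := FiniteDual.ev D) (fun _ _ => rfl) (fun _ _ => rfl)]
    simp [FiniteDual.pairing_comul, CoalgebraRetract.ev_transposeπ, π_mul_i,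
      FiniteDual.pairing_one, mul_comm]
  coideal b := FiniteDual.ext_tensor fun x y => by
    rw [tensorPairing_map (p := FiniteDual.ev D) (ψ := M.j.toLinearMap ∘ₗ M.π)
      (φ := LinearMap.id) (r := FiniteDual.ev D) (fun _ _ => rfl) (fun _ _ => rfl),
      FiniteDual.pairing_comul]
    simp [FiniteDual.pairing_comul, CoalgebraRetract.ev_transposeπ, π_mul]
  factor f := FiniteDual.ext_ev fun x => by
    rw [FiniteDual.ev_mul', tensorPairing_map (p := FiniteDual.ev D) (r := FiniteDual.ev D)
      (φ := M.j.toLinearMap ∘ₗ M.π) (ψ := M.i.toLinearMap ∘ₗ M.σ.toLinearMap)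
      (fun _ _ => rfl) (fun _ _ => rfl)]
    refine (LinearMap.congr_fun (FiniteDual.pairing_comulMap D f) _).trans ?_
    rw [LinearMap.comp_apply, M.factor]

theorem isDual : letI := M.coalgebra; letI := (M.dual hfin).coalgebra
    LeftSemidirectProduct.IsDual (M.dual hfin).semidirect M.semidirect (FiniteDual.ev H)
      M.retract.pair (FiniteDual.ev D) :=
  letI := M.coalgebra
  letI := (M.dual hfin).coalgebra
  { mul := M.retract.pair_mul
    one := M.retract.pair_one
    comul := fun b v w => by
      refine (tensorPairing_map (p := FiniteDual.ev D) (r := FiniteDual.ev D)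
        (φ := M.j.toLinearMap) (ψ := M.j.toLinearMap)
        (fun _ _ => rfl) (fun _ _ => rfl) (comul (M.retract.transposeπ b)) (v ⊗ₜ w)).trans ?_
      rw [TensorProduct.map_tmul, FiniteDual.pairing_comul, CoalgebraRetract.ev_transposeπ,
        AlgHom.toLinearMap_apply, AlgHom.toLinearMap_apply, ← map_mul M.j, retract_π, π_j]
    counit := fun b => by
      change M.retract.pair b (M.π 1) = _
      rw [π_one]
    act := fun b h v => by
      refine (FiniteDual.mul_apply ((M.dual hfin).i h) (M.retract.transposeπ b) (M.j v)).trans ?_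
      exact tensorPairing_map (ψ' := M.retract.transposeπ.toLinearMap)
        (φ' := (M.dual hfin).i.toLinearMap) (ψ := M.π) (φ := M.σ.toLinearMap)
        (fun _ _ => rfl) (fun _ _ => rfl) (h ⊗ₜ b) (comul (M.j v))
    coact := fun b v a => by
      refine (tensorPairing_map (p := FiniteDual.ev D) (r := FiniteDual.ev D)
        (φ := M.i.toLinearMap) (ψ := M.j.toLinearMap)
        (fun _ _ => rfl) (fun _ _ => rfl) (comul (M.retract.transposeπ b)) (a ⊗ₜ v)).trans ?_
      rw [TensorProduct.map_tmul, FiniteDual.pairing_comul]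
      rfl
    pairing := fun h b a v => by
      refine (FiniteDual.mul_apply (M.retract.transposeπ b) ((M.dual hfin).i h) _).trans ?_
      refine (tensorPairing_map (ψ' := (M.dual hfin).i.toLinearMap)
        (φ' := M.retract.transposeπ.toLinearMap) (ψ := M.σ.toLinearMap) (φ := M.π)
        (fun _ _ => rfl) (fun _ _ => rfl) (b ⊗ₜ h) (comul (M.equiv (v ⊗ₜ a)))).trans ?_
      have e : map M.π M.σ.toLinearMap (comul (M.equiv (v ⊗ₜ a))) = v ⊗ₜ[ℂ] a :=
        M.equiv.symm_apply_apply _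
      rw [e, tensorPairing_tmul] }

end LeftBosonization

end QPoincare
end

noncomputable section

namespace QPoincare

open Coalgebra TensorProduct

section Convolution

open WithConv

variable {C E : Type*} [AddCommMonoid C] [Module ℂ C] [Coalgebra ℂ C] [Ring E] [Algebra ℂ E]

theorem isUnit_one_sub_of_locally_nilpotent (N : WithConv (C →ₗ[ℂ] E))
    (h : ∀ x, ∃ n, ∀ k, n ≤ k → (N ^ k).ofConv x = 0) : IsUnit (1 - N) := by
  choose n hn using h
  have hsum : ∀ x m, n x ≤ m →
      ∑ᶠ k, (N ^ k).ofConv x = (∑ k ∈ Finset.range m, N ^ k).ofConv x := by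
    intro x m hm
    rw [finsum_eq_sum_of_support_subset (s := Finset.range m), ofConv_sum, LinearMap.sum_apply]
    intro k hk
    simp only [Finset.coe_range, Set.mem_Iio]
    by_contra hc
    exact hk (hn x k (hm.trans (not_lt.mp hc)))
  let g : C →ₗ[ℂ] E :=
    { toFun := fun x => ∑ᶠ k, (N ^ k).ofConv x
      map_add' := fun x y => by
        rw [hsum _ (n x + n y + n (x + y)) (by omega), hsum x (n x + n y + n (x + y)) (by omega),
          hsum y (n x + n y + n (x + y)) (by omega), map_add]
      map_smul' := fun c x => by
        rw [hsum _ (n x + n (c • x)) (by omega), hsum x (n x + n (c • x)) (by omega), map_smul]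
        rfl }
  have hg : ∀ x m, n x ≤ m → g x = (∑ k ∈ Finset.range m, N ^ k).ofConv x := hsum
  have hone : ∀ x m, n x ≤ m → (1 - N ^ m).ofConv x = (1 : WithConv (C →ₗ[ℂ] E)).ofConv x := by
    intro x m hm
    rw [ofConv_sub, LinearMap.sub_apply, hn x m hm, sub_zero]
  refine ⟨⟨1 - N, toConv g, ?_, ?_⟩, rfl⟩
  · apply ofConv_injective
    ext x
    let r := ℛ ℂ x
    let m := n x + ∑ i ∈ r.index, n (r.right i)
    have hm : ∀ i ∈ r.index, n (r.right i) ≤ m := fun i hi =>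
      (Finset.single_le_sum (f := fun i => n (r.right i)) (fun _ _ => Nat.zero_le _) hi).trans
        (Nat.le_add_left _ _)
    rw [← hone x m (Nat.le_add_right _ _), ← mul_neg_geom_sum]
    change ((1 - N) * toConv g) x = ((1 - N) * ∑ i ∈ Finset.range m, N ^ i) x
    rw [r.convMul_apply, r.convMul_apply]
    refine Finset.sum_congr rfl fun i hi => ?_
    congr 1
    exact hg _ _ (hm i hi)
  · apply ofConv_injective
    ext x
    let r := ℛ ℂ x
    let m := n x + ∑ i ∈ r.index, n (r.left i)
    have hm : ∀ i ∈ r.index, n (r.left i) ≤ m := fun i hi =>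
      (Finset.single_le_sum (f := fun i => n (r.left i)) (fun _ _ => Nat.zero_le _) hi).trans
        (Nat.le_add_left _ _)
    rw [← hone x m (Nat.le_add_right _ _), ← geom_sum_mul_neg]
    change (toConv g * (1 - N)) x = ((∑ i ∈ Finset.range m, N ^ i) * (1 - N)) x
    rw [r.convMul_apply, r.convMul_apply]
    refine Finset.sum_congr rfl fun i hi => ?_
    congr 1
    exact hg _ _ (hm i hi)

theorem convMul_eq_zero {f g : WithConv (C →ₗ[ℂ] E)} {K L K' L' : Submodule ℂ C}
    (hK : ∀ x ∈ K, f.ofConv x = 0) (hL : ∀ x ∈ L', g.ofConv x = 0) {x : C}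
    (hx : comul (R := ℂ) x ∈ Submodule.map₂ (TensorProduct.mk ℂ C C) K L ⊔
      Submodule.map₂ (TensorProduct.mk ℂ C C) K' L') : (f * g).ofConv x = 0 := by
  have h : Submodule.map₂ (TensorProduct.mk ℂ C C) K L ⊔
      Submodule.map₂ (TensorProduct.mk ℂ C C) K' L' ≤
      LinearMap.ker (LinearMap.mul' ℂ E ∘ₗ map f.ofConv g.ofConv) := by
    refine sup_le (Submodule.map₂_le.mpr fun a ha b _ => ?_)
      (Submodule.map₂_le.mpr fun a _ b hb => ?_)
    · simp [hK a ha]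
    · simp [hL b hb]
  exact h hx

/-- A linear map that agrees with the convolution unit on the first step of a suitable
filtration is convolution invertible. -/
theorem isUnit_of_filtration (F : ℕ → Submodule ℂ C) (hmono : Monotone F)
    (hexh : ∀ x, ∃ n, x ∈ F n)
    (hF : ∀ n, ∀ x ∈ F (n + 1), comul (R := ℂ) x ∈
      Submodule.map₂ (TensorProduct.mk ℂ C C) (F n) ⊤ ⊔
      Submodule.map₂ (TensorProduct.mk ℂ C C) (F (n + 1)) (F 0))
    (f : WithConv (C →ₗ[ℂ] E)) (h0 : ∀ x ∈ F 0, f.ofConv x = algebraMap ℂ E (counit x)) :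
    IsUnit f := by
  rw [← sub_sub_cancel 1 f]
  have h0' : ∀ x ∈ F 0, (1 - f).ofConv x = 0 := fun x hx => by
    rw [ofConv_sub, LinearMap.sub_apply, h0 x hx]
    exact sub_self _
  have key : ∀ n, ∀ x ∈ F n, ((1 - f) ^ (n + 1)).ofConv x = 0 := by
    intro n
    induction n with
    | zero => simpa using h0'
    | succ n ih =>
      intro x hx
      rw [pow_succ]
      exact convMul_eq_zero ih h0' (hF n x hx)
  refine isUnit_one_sub_of_locally_nilpotent _ fun x => ?_
  obtain ⟨n, hn⟩ := hexh x
  refine ⟨n + 1, fun k hk => ?_⟩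
  obtain ⟨m, rfl⟩ := Nat.exists_eq_add_of_le' (show 1 ≤ k by omega)
  exact key m x (hmono (by omega) hn)

theorem isUnit_of_filtration' (F : ℕ → Submodule ℂ C) (hmono : Monotone F)
    (hexh : ∀ x, ∃ n, x ∈ F n)
    (hF : ∀ n, ∀ x ∈ F (n + 1), comul (R := ℂ) x ∈
      Submodule.map₂ (TensorProduct.mk ℂ C C) ⊤ (F n) ⊔
      Submodule.map₂ (TensorProduct.mk ℂ C C) (F 0) (F (n + 1)))
    (f : WithConv (C →ₗ[ℂ] E)) (h0 : ∀ x ∈ F 0, f.ofConv x = algebraMap ℂ E (counit x)) :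
    IsUnit f := by
  rw [← sub_sub_cancel 1 f]
  have h0' : ∀ x ∈ F 0, (1 - f).ofConv x = 0 := fun x hx => by
    rw [ofConv_sub, LinearMap.sub_apply, h0 x hx]
    exact sub_self _
  have key : ∀ n, ∀ x ∈ F n, ((1 - f) ^ (n + 1)).ofConv x = 0 := by
    intro n
    induction n with
    | zero => simpa using h0'
    | succ n ih =>
      intro x hx
      rw [pow_succ']
      exact convMul_eq_zero h0' ih (by rw [sup_comm]; exact hF n x hx)
  refine isUnit_one_sub_of_locally_nilpotent _ fun x => ?_
  obtain ⟨n, hn⟩ := hexh x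
  refine ⟨n + 1, fun k hk => ?_⟩
  obtain ⟨m, rfl⟩ := Nat.exists_eq_add_of_le' (show 1 ≤ k by omega)
  exact key m x (hmono (by omega) hn)

end Convolution

section Antipode

open WithConv

variable {A : Type*} [Ring A] [Bialgebra ℂ A]

/-- A bialgebra with an antipode, as a Hopf algebra. -/
abbrev HasAntipode.hopfAlgebra (h : HasAntipode A) : HopfAlgebra ℂ A where
  antipode := h.choose
  mul_antipode_rTensor_comul := h.choose_spec.1
  mul_antipode_lTensor_comul := h.choose_spec.2

theorem hasAntipode_of_hopfAlgebra (A : Type*) [Ring A] [HopfAlgebra ℂ A] : HasAntipode A :=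
  ⟨HopfAlgebra.antipode ℂ, HopfAlgebra.mul_antipode_rTensor_comul,
    HopfAlgebra.mul_antipode_lTensor_comul⟩

theorem hasAntipode_of_isUnit (h : IsUnit (toConv (LinearMap.id (R := ℂ) (M := A)))) :
    HasAntipode A := by
  obtain ⟨u, hu⟩ := h
  refine ⟨(↑u⁻¹ : WithConv (A →ₗ[ℂ] A)).ofConv, ?_, ?_⟩
  · have h1 := congrArg ofConv u.inv_mul
    rw [hu] at h1
    exact h1
  · have h1 := congrArg ofConv u.mul_inv
    rw [hu] at h1
    exact h1

theorem Extended.hasAntipode (h : HasAntipode A) : HasAntipode (Extended A) := by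
  let := h.hopfAlgebra
  exact hasAntipode_of_hopfAlgebra (A ⊗[ℂ] LaurentPolynomial ℂ)

theorem IsFiniteFunctional.comp_antipode {D : Type*} [Ring D] [HopfAlgebra ℂ D] {f : D →ₗ[ℂ] ℂ}
    (hf : IsFiniteFunctional f) : IsFiniteFunctional (f ∘ₗ HopfAlgebra.antipode ℂ) := by
  obtain ⟨I, _, _, φ, rfl⟩ := hf.exists_algHom
  exact isFiniteFunctional_comp
    ((Ideal.Quotient.mkₐ ℂ I).op.comp (HopfAlgebra.antipodeAlgHomOp ℂ D))
    (φ ∘ₗ (MulOpposite.opLinearEquiv ℂ).symm.toLinearMap)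

theorem FiniteDual.hasAntipode (h : HasAntipode A) : HasAntipode (FiniteDual A) := by
  let := h.hopfAlgebra
  let S := HopfAlgebra.antipode ℂ (A := A)
  let S' : FiniteDual A →ₗ[ℂ] FiniteDual A :=
    { toFun := fun f => FiniteDual.of (FiniteDual.ev A f ∘ₗ S) f.isFiniteFunctional.comp_antipode
      map_add' := fun _ _ => rfl
      map_smul' := fun _ _ => rfl }
  refine ⟨S', LinearMap.ext fun f => FiniteDual.ext_ev fun x => ?_,
    LinearMap.ext fun f => FiniteDual.ext_ev fun x => ?_⟩
  · rw [LinearMap.comp_apply, FiniteDual.ev_mul', LinearMap.comp_apply, LinearMap.rTensor,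
      tensorPairing_map (p := FiniteDual.ev A) (r := FiniteDual.ev A) (φ := S)
      (ψ := LinearMap.id) (fun _ _ => rfl) (fun _ _ => rfl)]
    refine (LinearMap.congr_fun (FiniteDual.pairing_comulMap A f) _).trans ?_
    change FiniteDual.ev A f (LinearMap.mul' ℂ A (LinearMap.rTensor A S (comul x))) =
      FiniteDual.ev A f 1 * counit x
    rw [HopfAlgebra.mul_antipode_rTensor_comul_apply, Algebra.algebraMap_eq_smul_one, map_smul,
      smul_eq_mul, mul_comm]
  · rw [LinearMap.comp_apply, FiniteDual.ev_mul', LinearMap.comp_apply, LinearMap.lTensor,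
      tensorPairing_map (p := FiniteDual.ev A) (r := FiniteDual.ev A) (φ := LinearMap.id)
      (ψ := S) (fun _ _ => rfl) (fun _ _ => rfl)]
    refine (LinearMap.congr_fun (FiniteDual.pairing_comulMap A f) _).trans ?_
    change FiniteDual.ev A f (LinearMap.mul' ℂ A (LinearMap.lTensor A S (comul x))) =
      FiniteDual.ev A f 1 * counit x
    rw [HopfAlgebra.mul_antipode_lTensor_comul_apply, Algebra.algebraMap_eq_smul_one, map_smul,
      smul_eq_mul, mul_comm]

/-- The composite of an antipode with algebra maps is a convolution inverse. -/
theorem isUnit_toConv_comp {H D E : Type*} [Ring H] [Bialgebra ℂ H] [Ring D] [Bialgebra ℂ D]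
    [Ring E] [Algebra ℂ E] (hH : HasAntipode H) (i : H →ₐ[ℂ] E) (σ : D →ₐ[ℂ] H)
    (comul_σ : ∀ x, comul (R := ℂ) (σ x) = map σ.toLinearMap σ.toLinearMap (comul x))
    (counit_σ : ∀ x, counit (R := ℂ) (σ x) = counit (R := ℂ) x) :
    IsUnit (toConv (i.toLinearMap ∘ₗ σ.toLinearMap)) := by
  obtain ⟨S, hS, hS'⟩ := hH
  have e1 : ∀ z : D ⊗[ℂ] D, LinearMap.mul' ℂ E (map (i.toLinearMap ∘ₗ σ.toLinearMap)
      (i.toLinearMap ∘ₗ S ∘ₗ σ.toLinearMap) z) =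
      i (LinearMap.mul' ℂ H (LinearMap.lTensor H S (map σ.toLinearMap σ.toLinearMap z))) := by
    intro z
    induction z using TensorProduct.induction_on with
    | zero => simp
    | add a b ha hb => simp only [map_add, ha, hb]
    | tmul a b => simp
  have e2 : ∀ z : D ⊗[ℂ] D, LinearMap.mul' ℂ E (map (i.toLinearMap ∘ₗ S ∘ₗ σ.toLinearMap)
      (i.toLinearMap ∘ₗ σ.toLinearMap) z) =
      i (LinearMap.mul' ℂ H (LinearMap.rTensor H S (map σ.toLinearMap σ.toLinearMap z))) := by
    intro z
    induction z using TensorProduct.induction_on with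
    | zero => simp
    | add a b ha hb => simp only [map_add, ha, hb]
    | tmul a b => simp
  refine ⟨⟨_, toConv (i.toLinearMap ∘ₗ S ∘ₗ σ.toLinearMap), ?_, ?_⟩, rfl⟩
  · apply ofConv_injective
    ext x
    refine (e1 _).trans ?_
    rw [← comul_σ]
    refine (congrArg i (LinearMap.congr_fun hS' (σ x))).trans ?_
    change i (algebraMap ℂ H (counit (σ x))) = algebraMap ℂ E (counit x)
    rw [counit_σ, AlgHom.commutes]
  · apply ofConv_injective
    ext x
    refine (e2 _).trans ?_
    rw [← comul_σ]
    refine (congrArg i (LinearMap.congr_fun hS (σ x))).trans ?_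
    change i (algebraMap ℂ H (counit (σ x))) = algebraMap ℂ E (counit x)
    rw [counit_σ, AlgHom.commutes]

theorem Bosonization.hasAntipode {H B D : Type*} [Ring H] [Bialgebra ℂ H] [Ring B] [Algebra ℂ B]
    [Ring D] [Bialgebra ℂ D] (M : Bosonization H B D) (hH : HasAntipode H)
    (hj : IsUnit (toConv (M.j.toLinearMap ∘ₗ M.π))) : HasAntipode D := by
  apply hasAntipode_of_isUnit
  have e : toConv (LinearMap.id (R := ℂ) (M := D)) =
      toConv (M.i.toLinearMap ∘ₗ M.σ.toLinearMap) * toConv (M.j.toLinearMap ∘ₗ M.π) :=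
    ofConv_injective (LinearMap.ext fun x => (M.factor x).symm)
  rw [e]
  exact (isUnit_toConv_comp hH M.i M.σ M.comul_σ M.counit_σ).mul hj

theorem LeftBosonization.hasAntipode {H B D : Type*} [Ring H] [Bialgebra ℂ H] [Ring B]
    [Algebra ℂ B] [Ring D] [Bialgebra ℂ D] (M : LeftBosonization H B D) (hH : HasAntipode H)
    (hj : IsUnit (toConv (M.j.toLinearMap ∘ₗ M.π))) : HasAntipode D := by
  apply hasAntipode_of_isUnit
  have e : toConv (LinearMap.id (R := ℂ) (M := D)) =
      toConv (M.j.toLinearMap ∘ₗ M.π) * toConv (M.i.toLinearMap ∘ₗ M.σ.toLinearMap) :=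
    ofConv_injective (LinearMap.ext fun x => (M.factor x).symm)
  rw [e]
  exact hj.mul (isUnit_toConv_comp hH M.i M.σ M.comul_σ M.counit_σ)

end Antipode

section OneSided

variable {D V : Type*} [Ring D] [Algebra ℂ D] [AddCommGroup V] [Module ℂ V]

theorem isFiniteFunctional_of_leftModule (ρ : D →ₐ[ℂ] Module.End ℂ V) (K : Submodule ℂ V)
    [Module.Finite ℂ (V ⧸ K)] (hK : ∀ d, ∀ v ∈ K, ρ d v ∈ K) (b : V →ₗ[ℂ] ℂ)
    (hb : ∀ v ∈ K, b v = 0) (v : V) :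
    IsFiniteFunctional (b ∘ₗ LinearMap.applyₗ v ∘ₗ ρ.toLinearMap) := by
  let ρ' : D →ₐ[ℂ] Module.End ℂ (V ⧸ K) :=
    AlgHom.ofLinearMap
      { toFun := fun d => K.mapQ K (ρ d) (hK d)
        map_add' := fun x y => by ext; simp
        map_smul' := fun x y => by ext; simp }
      (by ext; simp) (fun x y => by ext; simp)
  have h := isFiniteFunctional_comp ρ' (K.liftQ b hb ∘ₗ LinearMap.applyₗ (K.mkQ v))
  convert h using 1
  ext d
  simp [ρ']
  rfl

theorem isFiniteFunctional_of_rightModule (ρ : D →ₐ[ℂ] (Module.End ℂ V)ᵐᵒᵖ) (K : Submodule ℂ V)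
    [Module.Finite ℂ (V ⧸ K)] (hK : ∀ d, ∀ v ∈ K, (ρ d).unop v ∈ K) (b : V →ₗ[ℂ] ℂ)
    (hb : ∀ v ∈ K, b v = 0) (v : V) :
    IsFiniteFunctional (b ∘ₗ LinearMap.applyₗ v ∘ₗ
      (MulOpposite.opLinearEquiv ℂ).symm.toLinearMap ∘ₗ ρ.toLinearMap) := by
  let ρ' : D →ₐ[ℂ] (Module.End ℂ (V ⧸ K))ᵐᵒᵖ :=
    AlgHom.ofLinearMap
      { toFun := fun d => MulOpposite.op (K.mapQ K (ρ d).unop (hK d))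
        map_add' := fun x y => MulOpposite.unop_injective (by ext; simp)
        map_smul' := fun x y => MulOpposite.unop_injective (by ext; simp) }
      (MulOpposite.unop_injective (by ext; simp))
      (fun x y => MulOpposite.unop_injective (by ext; simp))
  have h := isFiniteFunctional_comp ρ' (K.liftQ b hb ∘ₗ LinearMap.applyₗ (K.mkQ v) ∘ₗ
    (MulOpposite.opLinearEquiv ℂ).symm.toLinearMap)
  convert h using 1
  ext d
  simp [ρ']
  rfl

end OneSided

end QPoincare
end

noncomputable section

namespace QPoincare

open Coalgebra TensorProduct

theorem finite_quotient_comap {M N : Type*} [AddCommGroup M] [Module ℂ M] [AddCommGroup N]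
    [Module ℂ N] (f : M →ₗ[ℂ] N) (L : Submodule ℂ N) [Module.Finite ℂ (N ⧸ L)] :
    Module.Finite ℂ (M ⧸ L.comap f) := by
  refine Module.Finite.of_injective ((L.comap f).mapQ L f le_rfl) ?_
  rw [← LinearMap.ker_eq_bot, Submodule.ker_mapQ]
  exact Submodule.mkQ_map_self _

namespace Bosonization

open WithConv

variable {H B D : Type*} [Ring H] [Bialgebra ℂ H] [Ring B] [Algebra ℂ B]
    [Ring D] [Bialgebra ℂ D] (M : Bosonization H B D)

theorem j_act_mem (hH : HasAntipode H) {I : Ideal D} (hI : I.IsTwoSided) {b : B}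
    (hb : M.j b ∈ I) (h : H) : M.j (M.act (b ⊗ₜ h)) ∈ I := by
  obtain ⟨u, hu⟩ := isUnit_toConv_comp hH M.i (AlgHom.id ℂ H) (fun x => by simp) (fun _ => rfl)
  let G : WithConv (H →ₗ[ℂ] D) := toConv (M.j.toLinearMap ∘ₗ M.act ∘ₗ TensorProduct.mk ℂ B H b)
  let F : WithConv (H →ₗ[ℂ] D) := toConv (LinearMap.mulLeft ℂ (M.j b) ∘ₗ M.i.toLinearMap)
  have hF : F = ↑u * G := by
    rw [hu]
    exact ofConv_injective (LinearMap.ext fun x => M.j_mul_i b x)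
  have hG : G = ↑u⁻¹ * F := by rw [hF, ← mul_assoc, u.inv_mul, one_mul]
  change G h ∈ I
  rw [hG, (ℛ ℂ h).convMul_apply]
  exact Ideal.sum_mem _ fun i _ => I.mul_mem_left _ (hI.mul_mem_of_left _ hb)

/-- The right action of `D` on its quotient module `B`. -/
def rightMod : D →ₐ[ℂ] (Module.End ℂ B)ᵐᵒᵖ :=
  AlgHom.ofLinearMap
    { toFun := fun d => MulOpposite.op (M.π ∘ₗ LinearMap.mulRight ℂ d ∘ₗ M.j.toLinearMap)
      map_add' := fun x y => MulOpposite.unop_injective (by ext; simp [mul_add])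
      map_smul' := fun x y => MulOpposite.unop_injective (by ext; simp) }
    (MulOpposite.unop_injective (by ext; simp [M.π_j]))
    (fun x y => MulOpposite.unop_injective (by ext; simp [M.π_mul, mul_assoc]))

theorem rightMod_apply (d : D) (b : B) : (M.rightMod d).unop b = M.π (M.j b * d) := rfl

theorem isFiniteFunctional_comp_π {K : Ideal B} (hK : K.IsTwoSided)
    (hfin : Module.Finite ℂ (B ⧸ K.restrictScalars ℂ))
    (hact : ∀ v ∈ K, ∀ h : H, M.act (v ⊗ₜ h) ∈ K) {b : B →ₗ[ℂ] ℂ} (hb : ∀ v ∈ K, b v = 0) :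
    IsFiniteFunctional (b ∘ₗ M.π) := by
  have h := isFiniteFunctional_of_rightModule M.rightMod (K.restrictScalars ℂ) (fun d v hv => by
      obtain ⟨w, rfl⟩ := M.equiv.surjective d
      change M.π (M.j v * M.equiv w) ∈ K
      induction w using TensorProduct.induction_on with
      | zero => simp
      | add x y hx hy => rw [map_add, mul_add, map_add]; exact K.add_mem hx hy
      | tmul h c =>
        rw [equiv_tmul, ← mul_assoc, π_mul_j]
        exact hK.mul_mem_of_left _ (hact v hv h)) b hb 1
  convert h using 1
  ext d
  simp [rightMod_apply]

theorem exists_ideal_of_isFiniteFunctional (hH : HasAntipode H) {f : D →ₗ[ℂ] ℂ}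
    (hf : IsFiniteFunctional f) :
    ∃ K : Ideal B, K.IsTwoSided ∧ Module.Finite ℂ (B ⧸ K.restrictScalars ℂ) ∧
      (∀ v ∈ K, ∀ h : H, M.act (v ⊗ₜ h) ∈ K) ∧ ∀ v ∈ K, f (M.j v) = 0 := by
  obtain ⟨I, hI, hfin, h⟩ := hf
  refine ⟨I.comap M.j, inferInstance, ?_, fun v hv a => M.j_act_mem hH hI hv a,
    fun v hv => h _ hv⟩
  exact finite_quotient_comap M.j.toLinearMap (I.restrictScalars ℂ)

theorem isFiniteFunctional_comp_j_π (hH : HasAntipode H) (f : D →ₗ[ℂ] ℂ)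
    (hf : IsFiniteFunctional f) :
    IsFiniteFunctional (f ∘ₗ M.retract.j.toLinearMap ∘ₗ M.retract.π) := by
  obtain ⟨K, h1, h2, h3, h4⟩ := M.exists_ideal_of_isFiniteFunctional hH hf
  exact M.isFiniteFunctional_comp_π h1 h2 h3 (b := f ∘ₗ M.j.toLinearMap) h4

theorem range_pair (hH : HasAntipode H) : Set.range M.retract.pair =
    {b | ∃ K : Ideal B, K.IsTwoSided ∧ Module.Finite ℂ (B ⧸ K.restrictScalars ℂ) ∧
      (∀ v ∈ K, ∀ h : H, M.act (v ⊗ₜ h) ∈ K) ∧ ∀ v ∈ K, b v = 0} := by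
  rw [CoalgebraRetract.range_pair]
  ext b
  constructor
  · intro hb
    obtain ⟨K, h1, h2, h3, h4⟩ := M.exists_ideal_of_isFiniteFunctional hH hb
    refine ⟨K, h1, h2, h3, fun v hv => ?_⟩
    have := h4 v hv
    rwa [LinearMap.comp_apply, retract_π, π_j] at this
  · rintro ⟨K, h1, h2, h3, h4⟩
    exact M.isFiniteFunctional_comp_π h1 h2 h3 h4

section Filtration

variable {κ : Type*} (X : κ → B)

/-- The filtration of `D` by the degree in the generators `X`, shifted by one. -/
def filtration : ℕ → Submodule ℂ D
  | 0 => ⊥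
  | n + 1 => LinearMap.range M.i.toLinearMap ⊔
      filtration n * Submodule.span ℂ (Set.range fun k => M.j (X k))

theorem filtration_mono : Monotone (M.filtration X) := by
  refine monotone_nat_of_le_succ fun n => ?_
  induction n with
  | zero => exact bot_le
  | succ n ih => exact sup_le_sup_left (mul_le_mul' ih le_rfl) _

theorem filtration_exhausts (hX : Algebra.adjoin ℂ (Set.range X) = ⊤) (x : D) :
    ∃ n, x ∈ M.filtration X n := by
  have key : ∀ b : B, ∀ n, ∀ y ∈ M.filtration X n, ∃ m, y * M.j b ∈ M.filtration X m := by
    intro b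
    have hb : b ∈ Algebra.adjoin ℂ (Set.range X) := hX ▸ Algebra.mem_top
    induction hb using Algebra.adjoin_induction with
    | mem b hb =>
      obtain ⟨k, rfl⟩ := hb
      exact fun n y hy => ⟨n + 1, Submodule.mem_sup_right
        (Submodule.mul_mem_mul hy (Submodule.subset_span ⟨k, rfl⟩))⟩
    | algebraMap c =>
      intro n y hy
      refine ⟨n, ?_⟩
      rw [AlgHom.commutes, ← Algebra.commutes, ← Algebra.smul_def]
      exact Submodule.smul_mem _ _ hy
    | add b c _ _ hb hc =>
      intro n y hy
      obtain ⟨m, hm⟩ := hb n y hy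
      obtain ⟨l, hl⟩ := hc n y hy
      refine ⟨max m l, ?_⟩
      rw [map_add, mul_add]
      exact Submodule.add_mem _ (M.filtration_mono X (le_max_left _ _) hm)
        (M.filtration_mono X (le_max_right _ _) hl)
    | mul b c _ _ hb hc =>
      intro n y hy
      obtain ⟨m, hm⟩ := hb n y hy
      obtain ⟨l, hl⟩ := hc m _ hm
      refine ⟨l, ?_⟩
      rwa [map_mul, ← mul_assoc]
  obtain ⟨w, rfl⟩ := M.equiv.surjective x
  induction w using TensorProduct.induction_on with
  | zero => exact ⟨0, by simp⟩
  | add x y hx hy =>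
    obtain ⟨m, hm⟩ := hx
    obtain ⟨l, hl⟩ := hy
    refine ⟨max m l, ?_⟩
    rw [map_add]
    exact Submodule.add_mem _ (M.filtration_mono X (le_max_left _ _) hm)
      (M.filtration_mono X (le_max_right _ _) hl)
  | tmul h b => exact key b 1 _ (Submodule.mem_sup_left ⟨h, rfl⟩)

theorem comul_filtration [Fintype κ] (T : κ → κ → H)
    (hΔ : ∀ k, comul (R := ℂ) (M.j (X k)) =
      ∑ a, M.j (X a) ⊗ₜ[ℂ] M.i (T a k) + 1 ⊗ₜ[ℂ] M.j (X k))
    (n : ℕ) : ∀ x ∈ M.filtration X (n + 1), comul (R := ℂ) x ∈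
      Submodule.map₂ (TensorProduct.mk ℂ D D) (M.filtration X n) ⊤ ⊔
      Submodule.map₂ (TensorProduct.mk ℂ D D) (M.filtration X (n + 1))
        (LinearMap.range M.i.toLinearMap) := by
  have hi : ∀ n, LinearMap.range M.i.toLinearMap ≤ M.filtration X (n + 1) := fun n => le_sup_left
  induction n with
  | zero =>
    rintro x hx
    have hx' : x ∈ LinearMap.range M.i.toLinearMap := by simpa [filtration] using hx
    obtain ⟨h, rfl⟩ := hx'
    rw [AlgHom.toLinearMap_apply, M.comul_i]
    refine Submodule.mem_sup_right ?_
    generalize comul (R := ℂ) h = w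
    induction w using TensorProduct.induction_on with
    | zero => simp
    | add x y hx hy => rw [map_add]; exact Submodule.add_mem _ hx hy
    | tmul x y => exact Submodule.apply_mem_map₂ _ (hi 0 ⟨x, rfl⟩) ⟨y, rfl⟩
  | succ n ih =>
    have hmono := M.filtration_mono X
    have hY : ∀ k, ∀ z ∈ Submodule.map₂ (TensorProduct.mk ℂ D D) (M.filtration X n) ⊤ ⊔
        Submodule.map₂ (TensorProduct.mk ℂ D D) (M.filtration X (n + 1))
          (LinearMap.range M.i.toLinearMap), z * comul (R := ℂ) (M.j (X k)) ∈
        Submodule.map₂ (TensorProduct.mk ℂ D D) (M.filtration X (n + 1)) ⊤ ⊔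
        Submodule.map₂ (TensorProduct.mk ℂ D D) (M.filtration X (n + 1 + 1))
          (LinearMap.range M.i.toLinearMap) := by
      intro k
      suffices h : Submodule.map₂ (TensorProduct.mk ℂ D D) (M.filtration X n) ⊤ ⊔
        Submodule.map₂ (TensorProduct.mk ℂ D D) (M.filtration X (n + 1))
          (LinearMap.range M.i.toLinearMap) ≤
        (Submodule.map₂ (TensorProduct.mk ℂ D D) (M.filtration X (n + 1)) ⊤ ⊔
        Submodule.map₂ (TensorProduct.mk ℂ D D) (M.filtration X (n + 1 + 1))
          (LinearMap.range M.i.toLinearMap)).comap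
            (LinearMap.mulRight ℂ (comul (R := ℂ) (M.j (X k)))) from fun z hz => h hz
      have hmem : ∀ n a, ∀ y ∈ M.filtration X n, y * M.j (X a) ∈ M.filtration X (n + 1) :=
        fun n a y hy => Submodule.mem_sup_right
          (Submodule.mul_mem_mul hy (Submodule.subset_span ⟨a, rfl⟩))
      refine sup_le (Submodule.map₂_le.mpr fun y hy z _ => ?_)
        (Submodule.map₂_le.mpr fun y hy z hz => ?_)
      · rw [Submodule.mem_comap, LinearMap.mulRight_apply, hΔ, mul_add, Finset.mul_sum]
        refine Submodule.mem_sup_left (Submodule.add_mem _ (Submodule.sum_mem _ fun a _ => ?_) ?_)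
        · rw [TensorProduct.mk_apply, Algebra.TensorProduct.tmul_mul_tmul]
          exact Submodule.apply_mem_map₂ (TensorProduct.mk ℂ D D) (hmem n a y hy)
            (Submodule.mem_top (x := z * M.i (T a k)))
        · rw [TensorProduct.mk_apply, Algebra.TensorProduct.tmul_mul_tmul, mul_one]
          exact Submodule.apply_mem_map₂ (TensorProduct.mk ℂ D D) (hmono n.le_succ hy)
            (Submodule.mem_top (x := z * M.j (X k)))
      · obtain ⟨h, rfl⟩ := hz
        rw [Submodule.mem_comap, LinearMap.mulRight_apply, hΔ, mul_add, Finset.mul_sum]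
        refine Submodule.add_mem _ (Submodule.mem_sup_right (Submodule.sum_mem _ fun a _ => ?_))
          (Submodule.mem_sup_left ?_)
        · rw [TensorProduct.mk_apply, Algebra.TensorProduct.tmul_mul_tmul]
          exact Submodule.apply_mem_map₂ (TensorProduct.mk ℂ D D) (hmem (n + 1) a y hy)
            (show M.i h * M.i (T a k) ∈ LinearMap.range M.i.toLinearMap from
              ⟨h * T a k, map_mul M.i _ _⟩)
        · rw [TensorProduct.mk_apply, Algebra.TensorProduct.tmul_mul_tmul, mul_one]
          exact Submodule.apply_mem_map₂ (TensorProduct.mk ℂ D D) hy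
            (Submodule.mem_top (x := M.i h * M.j (X k)))
    intro x hx
    obtain ⟨y, hy, z, hz, rfl⟩ := Submodule.mem_sup.mp hx
    rw [map_add]
    refine Submodule.add_mem _ ?_ ?_
    · have h := sup_le_sup
        (Submodule.map₂_le_map₂_left (f := TensorProduct.mk ℂ D D) (q := ⊤) (hmono n.le_succ))
        (Submodule.map₂_le_map₂_left (f := TensorProduct.mk ℂ D D)
          (q := LinearMap.range M.i.toLinearMap) (hmono (n + 1).le_succ))
      exact h (ih y (hi n hy))
    · refine Submodule.mul_induction_on hz (fun m hm y hy => ?_) fun a b ha hb => ?_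
      · rw [Bialgebra.comul_mul]
        refine Submodule.span_induction (fun y hy => ?_) ?_ (fun a b _ _ ha hb => ?_)
          (fun c a _ ha => ?_) hy
        · obtain ⟨k, rfl⟩ := hy
          exact hY k _ (ih m hm)
        · simp
        · rw [map_add, mul_add]
          exact Submodule.add_mem _ ha hb
        · rw [map_smul, mul_smul_comm]
          exact Submodule.smul_mem _ _ ha
      · rw [map_add]
        exact Submodule.add_mem _ ha hb

theorem isUnit_toConv_j_π [Fintype κ] (hX : Algebra.adjoin ℂ (Set.range X) = ⊤) (T : κ → κ → H)
    (hΔ : ∀ k, comul (R := ℂ) (M.j (X k)) =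
      ∑ a, M.j (X a) ⊗ₜ[ℂ] M.i (T a k) + 1 ⊗ₜ[ℂ] M.j (X k)) :
    IsUnit (toConv (M.j.toLinearMap ∘ₗ M.π)) := by
  have h0 : M.filtration X (0 + 1) = LinearMap.range M.i.toLinearMap := by simp [filtration]
  refine isUnit_of_filtration (fun n => M.filtration X (n + 1))
    (fun m n h => M.filtration_mono X (Nat.succ_le_succ h)) (fun x => ?_) (fun n x hx => ?_) _
    fun x hx => ?_
  · obtain ⟨n, hn⟩ := M.filtration_exhausts X hX x
    exact ⟨n, M.filtration_mono X n.le_succ hn⟩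
  · simp only [h0]
    exact M.comul_filtration X T hΔ (n + 1) x hx
  · simp only [h0] at hx
    obtain ⟨h, rfl⟩ := hx
    simp [π_i, M.counit_i, Algebra.algebraMap_eq_smul_one]

end Filtration

end Bosonization

namespace LeftBosonization

open WithConv

variable {H B D : Type*} [Ring H] [Bialgebra ℂ H] [Ring B] [Algebra ℂ B]
    [Ring D] [Bialgebra ℂ D] (M : LeftBosonization H B D)

theorem j_act_mem (hH : HasAntipode H) {I : Ideal D} (hI : I.IsTwoSided) {b : B}
    (hb : M.j b ∈ I) (h : H) : M.j (M.act (h ⊗ₜ b)) ∈ I := by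
  obtain ⟨u, hu⟩ := isUnit_toConv_comp hH M.i (AlgHom.id ℂ H) (fun x => by simp) (fun _ => rfl)
  let G : WithConv (H →ₗ[ℂ] D) := toConv (M.j.toLinearMap ∘ₗ M.act ∘ₗ (TensorProduct.mk ℂ H B).flip b)
  let F : WithConv (H →ₗ[ℂ] D) := toConv (LinearMap.mulRight ℂ (M.j b) ∘ₗ M.i.toLinearMap)
  have hF : F = G * ↑u := by
    rw [hu]
    exact ofConv_injective (LinearMap.ext fun x => M.i_mul_j b x)
  have hG : G = F * ↑u⁻¹ := by rw [hF, mul_assoc, u.mul_inv, mul_one]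
  change G h ∈ I
  rw [hG, (ℛ ℂ h).convMul_apply]
  exact Ideal.sum_mem _ fun i _ => hI.mul_mem_of_left _ (I.mul_mem_left _ hb)

/-- The left action of `D` on its quotient module `B`. -/
def leftMod : D →ₐ[ℂ] Module.End ℂ B :=
  AlgHom.ofLinearMap
    { toFun := fun d => M.π ∘ₗ LinearMap.mulLeft ℂ d ∘ₗ M.j.toLinearMap
      map_add' := fun x y => by ext; simp [add_mul]
      map_smul' := fun x y => by ext; simp }
    (by ext; simp [M.π_j])
    (fun x y => by ext; simp [M.π_mul])

theorem leftMod_apply (d : D) (b : B) : M.leftMod d b = M.π (d * M.j b) := rfl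

theorem isFiniteFunctional_comp_π {K : Ideal B}
    (hfin : Module.Finite ℂ (B ⧸ K.restrictScalars ℂ))
    (hact : ∀ v ∈ K, ∀ h : H, M.act (h ⊗ₜ v) ∈ K) {b : B →ₗ[ℂ] ℂ} (hb : ∀ v ∈ K, b v = 0) :
    IsFiniteFunctional (b ∘ₗ M.π) := by
  have h := isFiniteFunctional_of_leftModule M.leftMod (K.restrictScalars ℂ) (fun d v hv => by
      obtain ⟨w, rfl⟩ := M.equiv.surjective d
      change M.π (M.equiv w * M.j v) ∈ K
      induction w using TensorProduct.induction_on with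
      | zero => simp
      | add x y hx hy => rw [map_add, add_mul, map_add]; exact K.add_mem hx hy
      | tmul c h =>
        rw [equiv_tmul, mul_assoc, π_j_mul]
        exact K.mul_mem_left _ (hact v hv h)) b hb 1
  convert h using 1
  ext d
  simp [leftMod_apply]

theorem exists_ideal_of_isFiniteFunctional (hH : HasAntipode H) {f : D →ₗ[ℂ] ℂ}
    (hf : IsFiniteFunctional f) :
    ∃ K : Ideal B, K.IsTwoSided ∧ Module.Finite ℂ (B ⧸ K.restrictScalars ℂ) ∧
      (∀ v ∈ K, ∀ h : H, M.act (h ⊗ₜ v) ∈ K) ∧ ∀ v ∈ K, f (M.j v) = 0 := by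
  obtain ⟨I, hI, hfin, h⟩ := hf
  refine ⟨I.comap M.j, inferInstance, ?_, fun v hv a => M.j_act_mem hH hI hv a,
    fun v hv => h _ hv⟩
  exact finite_quotient_comap M.j.toLinearMap (I.restrictScalars ℂ)

theorem isFiniteFunctional_comp_j_π (hH : HasAntipode H) (f : D →ₗ[ℂ] ℂ)
    (hf : IsFiniteFunctional f) :
    IsFiniteFunctional (f ∘ₗ M.retract.j.toLinearMap ∘ₗ M.retract.π) := by
  obtain ⟨K, h1, h2, h3, h4⟩ := M.exists_ideal_of_isFiniteFunctional hH hf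
  exact M.isFiniteFunctional_comp_π h2 h3 (b := f ∘ₗ M.j.toLinearMap) h4

theorem range_pair (hH : HasAntipode H) : Set.range M.retract.pair =
    {b | ∃ K : Ideal B, K.IsTwoSided ∧ Module.Finite ℂ (B ⧸ K.restrictScalars ℂ) ∧
      (∀ v ∈ K, ∀ h : H, M.act (h ⊗ₜ v) ∈ K) ∧ ∀ v ∈ K, b v = 0} := by
  rw [CoalgebraRetract.range_pair]
  ext b
  constructor
  · intro hb
    obtain ⟨K, h1, h2, h3, h4⟩ := M.exists_ideal_of_isFiniteFunctional hH hb
    refine ⟨K, h1, h2, h3, fun v hv => ?_⟩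
    have := h4 v hv
    rwa [LinearMap.comp_apply, retract_π, π_j] at this
  · rintro ⟨K, h1, h2, h3, h4⟩
    exact M.isFiniteFunctional_comp_π h2 h3 h4

section Filtration

variable {κ : Type*} (X : κ → B)

/-- The filtration of `D` by the degree in the generators `X`, shifted by one. -/
def filtration : ℕ → Submodule ℂ D
  | 0 => ⊥
  | n + 1 => LinearMap.range M.i.toLinearMap ⊔
      Submodule.span ℂ (Set.range fun k => M.j (X k)) * filtration n

theorem filtration_mono : Monotone (M.filtration X) := by
  refine monotone_nat_of_le_succ fun n => ?_
  induction n with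
  | zero => exact bot_le
  | succ n ih => exact sup_le_sup_left (mul_le_mul' le_rfl ih) _

theorem filtration_exhausts (hX : Algebra.adjoin ℂ (Set.range X) = ⊤) (x : D) :
    ∃ n, x ∈ M.filtration X n := by
  have key : ∀ b : B, ∀ n, ∀ y ∈ M.filtration X n, ∃ m, M.j b * y ∈ M.filtration X m := by
    intro b
    have hb : b ∈ Algebra.adjoin ℂ (Set.range X) := hX ▸ Algebra.mem_top
    induction hb using Algebra.adjoin_induction with
    | mem b hb =>
      obtain ⟨k, rfl⟩ := hb
      exact fun n y hy => ⟨n + 1, Submodule.mem_sup_right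
        (Submodule.mul_mem_mul (Submodule.subset_span ⟨k, rfl⟩) hy)⟩
    | algebraMap c =>
      intro n y hy
      refine ⟨n, ?_⟩
      rw [AlgHom.commutes, ← Algebra.smul_def]
      exact Submodule.smul_mem _ _ hy
    | add b c _ _ hb hc =>
      intro n y hy
      obtain ⟨m, hm⟩ := hb n y hy
      obtain ⟨l, hl⟩ := hc n y hy
      refine ⟨max m l, ?_⟩
      rw [map_add, add_mul]
      exact Submodule.add_mem _ (M.filtration_mono X (le_max_left _ _) hm)
        (M.filtration_mono X (le_max_right _ _) hl)
    | mul b c _ _ hb hc =>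
      intro n y hy
      obtain ⟨m, hm⟩ := hc n y hy
      obtain ⟨l, hl⟩ := hb m _ hm
      refine ⟨l, ?_⟩
      rwa [map_mul, mul_assoc]
  obtain ⟨w, rfl⟩ := M.equiv.surjective x
  induction w using TensorProduct.induction_on with
  | zero => exact ⟨0, by simp⟩
  | add x y hx hy =>
    obtain ⟨m, hm⟩ := hx
    obtain ⟨l, hl⟩ := hy
    refine ⟨max m l, ?_⟩
    rw [map_add]
    exact Submodule.add_mem _ (M.filtration_mono X (le_max_left _ _) hm)
      (M.filtration_mono X (le_max_right _ _) hl)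
  | tmul b h => exact key b 1 _ (Submodule.mem_sup_left ⟨h, rfl⟩)

theorem comul_filtration [Fintype κ] (T : κ → κ → H)
    (hΔ : ∀ k, comul (R := ℂ) (M.j (X k)) =
      ∑ a, M.i (T k a) ⊗ₜ[ℂ] M.j (X a) + M.j (X k) ⊗ₜ[ℂ] 1)
    (n : ℕ) : ∀ x ∈ M.filtration X (n + 1), comul (R := ℂ) x ∈
      Submodule.map₂ (TensorProduct.mk ℂ D D) ⊤ (M.filtration X n) ⊔
      Submodule.map₂ (TensorProduct.mk ℂ D D) (LinearMap.range M.i.toLinearMap)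
        (M.filtration X (n + 1)) := by
  have hi : ∀ n, LinearMap.range M.i.toLinearMap ≤ M.filtration X (n + 1) := fun n => le_sup_left
  induction n with
  | zero =>
    rintro x hx
    have hx' : x ∈ LinearMap.range M.i.toLinearMap := by simpa [filtration] using hx
    obtain ⟨h, rfl⟩ := hx'
    rw [AlgHom.toLinearMap_apply, M.comul_i]
    refine Submodule.mem_sup_right ?_
    generalize comul (R := ℂ) h = w
    induction w using TensorProduct.induction_on with
    | zero => simp
    | add x y hx hy => rw [map_add]; exact Submodule.add_mem _ hx hy
    | tmul x y => exact Submodule.apply_mem_map₂ _ ⟨x, rfl⟩ (hi 0 ⟨y, rfl⟩)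
  | succ n ih =>
    have hmono := M.filtration_mono X
    have hY : ∀ k, ∀ z ∈ Submodule.map₂ (TensorProduct.mk ℂ D D) ⊤ (M.filtration X n) ⊔
        Submodule.map₂ (TensorProduct.mk ℂ D D) (LinearMap.range M.i.toLinearMap)
          (M.filtration X (n + 1)), comul (R := ℂ) (M.j (X k)) * z ∈
        Submodule.map₂ (TensorProduct.mk ℂ D D) ⊤ (M.filtration X (n + 1)) ⊔
        Submodule.map₂ (TensorProduct.mk ℂ D D) (LinearMap.range M.i.toLinearMap)
          (M.filtration X (n + 1 + 1)) := by
      intro k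
      suffices h : Submodule.map₂ (TensorProduct.mk ℂ D D) ⊤ (M.filtration X n) ⊔
        Submodule.map₂ (TensorProduct.mk ℂ D D) (LinearMap.range M.i.toLinearMap)
          (M.filtration X (n + 1)) ≤
        (Submodule.map₂ (TensorProduct.mk ℂ D D) ⊤ (M.filtration X (n + 1)) ⊔
        Submodule.map₂ (TensorProduct.mk ℂ D D) (LinearMap.range M.i.toLinearMap)
          (M.filtration X (n + 1 + 1))).comap
            (LinearMap.mulLeft ℂ (comul (R := ℂ) (M.j (X k)))) from fun z hz => h hz
      have hmem : ∀ n a, ∀ y ∈ M.filtration X n, M.j (X a) * y ∈ M.filtration X (n + 1) :=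
        fun n a y hy => Submodule.mem_sup_right
          (Submodule.mul_mem_mul (Submodule.subset_span ⟨a, rfl⟩) hy)
      refine sup_le (Submodule.map₂_le.mpr fun z _ y hy => ?_)
        (Submodule.map₂_le.mpr fun z hz y hy => ?_)
      · rw [Submodule.mem_comap, LinearMap.mulLeft_apply, hΔ, add_mul, Finset.sum_mul]
        refine Submodule.mem_sup_left (Submodule.add_mem _ (Submodule.sum_mem _ fun a _ => ?_) ?_)
        · rw [TensorProduct.mk_apply, Algebra.TensorProduct.tmul_mul_tmul]
          exact Submodule.apply_mem_map₂ (TensorProduct.mk ℂ D D) 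
            (Submodule.mem_top (x := M.i (T k a) * z)) (hmem n a y hy)
        · rw [TensorProduct.mk_apply, Algebra.TensorProduct.tmul_mul_tmul, one_mul]
          exact Submodule.apply_mem_map₂ (TensorProduct.mk ℂ D D) 
            (Submodule.mem_top (x := M.j (X k) * z)) (hmono n.le_succ hy)
      · obtain ⟨h, rfl⟩ := hz
        rw [Submodule.mem_comap, LinearMap.mulLeft_apply, hΔ, add_mul, Finset.sum_mul]
        refine Submodule.add_mem _ (Submodule.mem_sup_right (Submodule.sum_mem _ fun a _ => ?_))
          (Submodule.mem_sup_left ?_)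
        · rw [TensorProduct.mk_apply, Algebra.TensorProduct.tmul_mul_tmul]
          exact Submodule.apply_mem_map₂ (TensorProduct.mk ℂ D D) 
            (show M.i (T k a) * M.i h ∈ LinearMap.range M.i.toLinearMap from
              ⟨T k a * h, map_mul M.i _ _⟩) (hmem (n + 1) a y hy)
        · rw [TensorProduct.mk_apply, Algebra.TensorProduct.tmul_mul_tmul, one_mul]
          exact Submodule.apply_mem_map₂ (TensorProduct.mk ℂ D D) 
            (Submodule.mem_top (x := M.j (X k) * M.i h)) hy
    intro x hx
    obtain ⟨y, hy, z, hz, rfl⟩ := Submodule.mem_sup.mp hx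
    rw [map_add]
    refine Submodule.add_mem _ ?_ ?_
    · have h := sup_le_sup
        (Submodule.map₂_le_map₂_right (f := TensorProduct.mk ℂ D D) (p := ⊤) (hmono n.le_succ))
        (Submodule.map₂_le_map₂_right (f := TensorProduct.mk ℂ D D)
          (p := LinearMap.range M.i.toLinearMap) (hmono (n + 1).le_succ))
      exact h (ih y (hi n hy))
    · refine Submodule.mul_induction_on hz (fun y hy m hm => ?_) fun a b ha hb => ?_
      · rw [Bialgebra.comul_mul]
        refine Submodule.span_induction (fun y hy => ?_) ?_ (fun a b _ _ ha hb => ?_)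
          (fun c a _ ha => ?_) hy
        · obtain ⟨k, rfl⟩ := hy
          exact hY k _ (ih m hm)
        · simp
        · rw [map_add, add_mul]
          exact Submodule.add_mem _ ha hb
        · rw [map_smul, smul_mul_assoc]
          exact Submodule.smul_mem _ _ ha
      · rw [map_add]
        exact Submodule.add_mem _ ha hb

theorem isUnit_toConv_j_π [Fintype κ] (hX : Algebra.adjoin ℂ (Set.range X) = ⊤) (T : κ → κ → H)
    (hΔ : ∀ k, comul (R := ℂ) (M.j (X k)) =
      ∑ a, M.i (T k a) ⊗ₜ[ℂ] M.j (X a) + M.j (X k) ⊗ₜ[ℂ] 1) :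
    IsUnit (toConv (M.j.toLinearMap ∘ₗ M.π)) := by
  have h0 : M.filtration X (0 + 1) = LinearMap.range M.i.toLinearMap := by simp [filtration]
  refine isUnit_of_filtration' (fun n => M.filtration X (n + 1))
    (fun m n h => M.filtration_mono X (Nat.succ_le_succ h)) (fun x => ?_) (fun n x hx => ?_) _
    fun x hx => ?_
  · obtain ⟨n, hn⟩ := M.filtration_exhausts X hX x
    exact ⟨n, M.filtration_mono X n.le_succ hn⟩
  · simp only [h0]
    exact M.comul_filtration X T hΔ (n + 1) x hx
  · simp only [h0] at hx
    obtain ⟨h, rfl⟩ := hx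
    simp [π_i, M.counit_i, Algebra.algebraMap_eq_smul_one]

end Filtration

end LeftBosonization

end QPoincare
end

noncomputable section

namespace QPoincare

open Coalgebra TensorProduct

section Graded

variable {κ V : Type*} [Ring V] [Algebra ℂ V] {x : κ → V}

theorem iSup_span_pow_eq_top (hx : Algebra.adjoin ℂ (Set.range x) = ⊤) :
    ⨆ d : ℕ, Submodule.span ℂ (Set.range x) ^ d = ⊤ := by
  rw [← Algebra.top_toSubmodule, ← hx, Algebra.adjoin_eq_span]
  refine le_antisymm (iSup_le fun d => ?_) (Submodule.span_le.mpr fun v hv => ?_)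
  · rw [← Algebra.adjoin_eq_span]
    induction d with
    | zero =>
      rw [pow_zero, Submodule.one_le]
      exact one_mem (Algebra.adjoin ℂ (Set.range x))
    | succ d ih =>
      rw [pow_succ, Submodule.mul_le]
      intro a ha b hb
      refine mul_mem (S := Subalgebra ℂ V) (ih ha) ?_
      exact (Submodule.span_le.mpr Algebra.subset_adjoin :
        _ ≤ (Algebra.adjoin ℂ (Set.range x)).toSubmodule) hb
  · have : ∃ d : ℕ, v ∈ Submodule.span ℂ (Set.range x) ^ d := by
      induction hv using Submonoid.closure_induction with
      | mem v hv => exact ⟨1, by rw [pow_one]; exact Submodule.subset_span hv⟩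
      | one => exact ⟨0, by rw [pow_zero]; exact Submodule.one_le.mp le_rfl⟩
      | mul v w _ _ hv hw =>
        obtain ⟨d, hd⟩ := hv
        obtain ⟨e, he⟩ := hw
        exact ⟨d + e, by rw [pow_add]; exact Submodule.mul_mem_mul hd he⟩
    obtain ⟨d, hd⟩ := this
    exact Submodule.mem_iSup_of_mem d hd

theorem mul_iSup_span_pow (hx : Algebra.adjoin ℂ (Set.range x) = ⊤) (N : ℕ) :
    ⊤ * (⨆ d : ℕ, Submodule.span ℂ (Set.range x) ^ (N + d)) ≤
      ⨆ d : ℕ, Submodule.span ℂ (Set.range x) ^ (N + d) := by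
  rw [← iSup_span_pow_eq_top hx, Submodule.iSup_mul]
  refine iSup_le fun e => ?_
  rw [Submodule.mul_iSup]
  refine iSup_le fun d => ?_
  rw [← pow_add]
  refine le_trans (le_of_eq ?_) (le_iSup _ (e + d))
  congr 1
  omega

theorem iSup_span_pow_mul (hx : Algebra.adjoin ℂ (Set.range x) = ⊤) (N : ℕ) :
    (⨆ d : ℕ, Submodule.span ℂ (Set.range x) ^ (N + d)) * ⊤ ≤
      ⨆ d : ℕ, Submodule.span ℂ (Set.range x) ^ (N + d) := by
  rw [← iSup_span_pow_eq_top hx, Submodule.iSup_mul]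
  refine iSup_le fun e => ?_
  rw [Submodule.mul_iSup]
  refine iSup_le fun d => ?_
  rw [← pow_add]
  refine le_trans (le_of_eq ?_) (le_iSup _ (e + d))
  congr 1
  omega

theorem exists_ideal_of_mem_gradedDual [Finite κ] (hx : Algebra.adjoin ℂ (Set.range x) = ⊤)
    {b : V →ₗ[ℂ] ℂ} (hb : b ∈ gradedDual x) :
    ∃ K : Ideal V, K.IsTwoSided ∧ Module.Finite ℂ (V ⧸ K.restrictScalars ℂ) ∧
      (∀ T : V →ₗ[ℂ] V, (∀ d, ∀ v ∈ Submodule.span ℂ (Set.range x) ^ d,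
        T v ∈ Submodule.span ℂ (Set.range x) ^ d) → ∀ v ∈ K, T v ∈ K) ∧ ∀ v ∈ K, b v = 0 := by
  obtain ⟨N, hN⟩ := hb
  let K₀ : Submodule ℂ V := ⨆ d : ℕ, Submodule.span ℂ (Set.range x) ^ (N + d)
  let K : Ideal V :=
    { carrier := K₀
      add_mem' := K₀.add_mem
      zero_mem' := K₀.zero_mem
      smul_mem' := fun c v hv =>
        mul_iSup_span_pow hx N (Submodule.mul_mem_mul Submodule.mem_top hv) }
  have hK : K.restrictScalars ℂ = K₀ := rfl
  refine ⟨K, ⟨fun {a} c ha =>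
    iSup_span_pow_mul hx N (Submodule.mul_mem_mul ha Submodule.mem_top)⟩, ?_, ?_, ?_⟩
  · rw [hK]
    have hfg : (⨆ d : Fin N, Submodule.span ℂ (Set.range x) ^ (d : ℕ)).FG :=
      Submodule.fg_iSup _ fun d => Submodule.FG.pow (Submodule.fg_span (Set.finite_range x)) _
    have htop : (⨆ d : Fin N, Submodule.span ℂ (Set.range x) ^ (d : ℕ)) ⊔ K₀ = ⊤ := by
      rw [eq_top_iff, ← iSup_span_pow_eq_top hx]
      refine iSup_le fun d => ?_
      by_cases h : d < N
      · exact le_trans (le_iSup (fun d : Fin N => Submodule.span ℂ (Set.range x) ^ (d : ℕ)) ⟨d, h⟩)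
          le_sup_left
      · obtain ⟨e, rfl⟩ := Nat.exists_eq_add_of_le (not_lt.mp h)
        exact le_trans (le_iSup (fun d => Submodule.span ℂ (Set.range x) ^ (N + d)) e) le_sup_right
    refine ⟨?_⟩
    rw [← Submodule.range_mkQ K₀, ← Submodule.map_top, ← htop, Submodule.map_sup,
      Submodule.mkQ_map_self, sup_bot_eq]
    exact hfg.map _
  · intro T hT v hv
    have h : K₀ ≤ K₀.comap T := by
      refine iSup_le fun d v hv => ?_
      exact Submodule.mem_iSup_of_mem d (hT _ v hv)
    exact h hv
  · have h : K₀ ≤ LinearMap.ker b := iSup_le fun d v hv => hN _ (Nat.le_add_right N d) v hv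
    exact fun v hv => h hv

open Polynomial in
theorem exists_mem_gradedDual_ne_zero (hx : Algebra.adjoin ℂ (Set.range x) = ⊤)
    (γ : V →ₐ[ℂ] V[X]) (hγ : ∀ k, γ (x k) = monomial 1 (x k)) {v : V} (hv : v ≠ 0) :
    ∃ b ∈ gradedDual x, b v ≠ 0 := by
  have hspan : ∀ w ∈ Submodule.span ℂ (Set.range x), γ w = monomial 1 w := by
    intro w hw
    induction hw using Submodule.span_induction with
    | mem w hw => obtain ⟨k, rfl⟩ := hw; exact hγ k
    | zero => simp
    | add a b _ _ ha hb => rw [map_add, map_add, ha, hb]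
    | smul c a _ ha => rw [map_smul, ha, ← smul_monomial]
  have hpow : ∀ d, ∀ w ∈ Submodule.span ℂ (Set.range x) ^ d, γ w = monomial d w := by
    intro d w hw
    induction hw using Submodule.pow_induction_on_left' with
    | algebraMap c => rw [AlgHom.commutes]; rfl
    | add a b i _ _ ha hb => rw [map_add, map_add, ha, hb]
    | mem_mul m hm i w hw ih =>
      rw [map_mul, hspan m hm, ih, monomial_mul_monomial, add_comm]
  have heval : ∀ w, eval 1 (γ w) = w := by
    intro w
    have hw : w ∈ ⨆ d : ℕ, Submodule.span ℂ (Set.range x) ^ d :=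
      iSup_span_pow_eq_top hx ▸ Submodule.mem_top
    induction hw using Submodule.iSup_induction' with
    | mem d w hw => rw [hpow d w hw]; simp
    | zero => simp
    | add a b _ _ ha hb => rw [map_add, eval_add, ha, hb]
  have hne : γ v ≠ 0 := fun h => hv (by rw [← heval v, h, eval_zero])
  obtain ⟨d, hd⟩ : ∃ d, (γ v).coeff d ≠ 0 := by
    by_contra hc
    push Not at hc
    exact hne (Polynomial.ext fun d => by rw [hc d, coeff_zero])
  obtain ⟨φ, hφ⟩ : ∃ φ : Module.Dual ℂ V, φ ((γ v).coeff d) ≠ 0 := by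
    by_contra hc
    push Not at hc
    exact hd ((Module.forall_dual_apply_eq_zero_iff ℂ _).mp hc)
  refine ⟨φ ∘ₗ (lcoeff V d).restrictScalars ℂ ∘ₗ γ.toLinearMap, ⟨d + 1, fun e he w hw => ?_⟩, hφ⟩
  have h : (γ w).coeff d = 0 := by rw [hpow e w hw, coeff_monomial_of_ne _ (by omega)]
  change φ ((γ w).coeff d) = 0
  rw [h, map_zero]

theorem exists_forall_span_pow_le {W : ℕ → Submodule ℂ V} {c : ℂ} (hc0 : c ≠ 0)
    (hc : ∀ m : ℕ, 0 < m → c ^ m ≠ 1) (G : V →ₗ[ℂ] V) (hG : ∀ d, ∀ v ∈ W d, G v = c ^ d • v)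
    (K : Submodule ℂ V) [Module.Finite ℂ (V ⧸ K)] (hK : ∀ v ∈ K, G v ∈ K) :
    ∃ N, ∀ d ≥ N, W d ≤ K := by
  have hinj : Function.Injective fun d : ℕ => c ^ d := by
    have key : ∀ a b : ℕ, a < b → c ^ a ≠ c ^ b := by
      intro a b hab h
      obtain ⟨m, rfl⟩ := Nat.exists_eq_add_of_lt hab
      refine hc (m + 1) (Nat.succ_pos m) ?_
      rw [add_assoc, pow_add] at h
      exact (mul_left_cancel₀ (pow_ne_zero a hc0) (by rw [mul_one]; exact h)).symm
    intro a b h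
    rcases lt_trichotomy a b with hab | hab | hab
    · exact absurd h (key a b hab)
    · exact hab
    · exact absurd h.symm (key b a hab)
  let G' : Module.End ℂ (V ⧸ K) := K.mapQ K G hK
  have hfin : {d : ℕ | ¬ W d ≤ K}.Finite := by
    refine Set.Finite.of_finite_image (f := fun d : ℕ => c ^ d)
      ((Module.End.finite_hasEigenvalue G').subset ?_) hinj.injOn
    rintro _ ⟨d, hd, rfl⟩
    obtain ⟨v, hv, hvK⟩ := SetLike.not_le_iff_exists.mp hd
    refine Module.End.hasEigenvalue_of_hasEigenvector (x := K.mkQ v) ⟨?_, ?_⟩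
    · rw [Module.End.mem_eigenspace_iff]
      change K.mkQ (G v) = _
      rw [hG d v hv, map_smul]
    · simpa using hvK
  obtain ⟨N, hN⟩ := hfin.bddAbove
  refine ⟨N + 1, fun d hd => ?_⟩
  by_contra h
  exact absurd (hN h) (by omega)

end Graded

section SkewPairing

variable {H : Type*} [Ring H] [Bialgebra ℂ H]

/-- A skew pairing of a bialgebra with itself. -/
structure IsSkewPairing (f : H ⊗[ℂ] H →ₗ[ℂ] ℂ) : Prop where
  one_left : ∀ a, f (1 ⊗ₜ a) = counit (R := ℂ) a
  one_right : ∀ a, f (a ⊗ₜ 1) = counit (R := ℂ) a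
  mul_left : ∀ a b c : H, f ((a * b) ⊗ₜ c) =
    LinearMap.mul' ℂ ℂ (TensorProduct.map (f ∘ₗ TensorProduct.mk ℂ H H a)
      (f ∘ₗ TensorProduct.mk ℂ H H b) (comul c))
  mul_right : ∀ a b c : H, f (a ⊗ₜ (b * c)) =
    LinearMap.mul' ℂ ℂ (TensorProduct.map (f ∘ₗ (TensorProduct.mk ℂ H H).flip c)
      (f ∘ₗ (TensorProduct.mk ℂ H H).flip b) (comul a))

open WithConv in
theorem IsDualQuasitriangular.isSkewPairing {r : H ⊗[ℂ] H →ₗ[ℂ] ℂ}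
    (hr : IsDualQuasitriangular r) : IsSkewPairing r := by
  obtain ⟨u, hu⟩ := hr.convolution_invertible
  have key : ∀ φ : H →ₗc[ℂ] H ⊗[ℂ] H,
      toConv (r ∘ₗ φ.toLinearMap) * toConv (r ∘ₗ φ.toLinearMap) = toConv (r ∘ₗ φ.toLinearMap) →
      toConv (r ∘ₗ φ.toLinearMap) = 1 := by
    intro φ h
    have e : toConv ((↑u⁻¹ : WithConv (H ⊗[ℂ] H →ₗ[ℂ] ℂ)).ofConv ∘ₗ φ.toLinearMap) *
        toConv (r ∘ₗ φ.toLinearMap) = 1 := by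
      have h1 := LinearMap.convMul_comp_coalgHom_distrib (↑u⁻¹ : WithConv (H ⊗[ℂ] H →ₗ[ℂ] ℂ))
        (toConv r) φ
      rw [← hu, u.inv_mul] at h1
      refine Eq.trans ?_ (Eq.trans (congrArg toConv h1.symm) ?_)
      · rw [hu]
      · apply ofConv_injective
        ext x
        exact LinearMap.congr_fun φ.counit_comp x
    calc _ = 1 * toConv (r ∘ₗ φ.toLinearMap) := (one_mul _).symm
      _ = _ := by rw [← e, mul_assoc, h]
  refine ⟨fun a => ?_, fun a => ?_, hr.mul_left, hr.mul_right⟩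
  · let φ : H →ₗc[ℂ] H ⊗[ℂ] H :=
      { TensorProduct.mk ℂ H H 1 with
        counit_comp := by ext; simp
        map_comp_comul := by
          ext x
          simp only [LinearMap.comp_apply, TensorProduct.mk_apply,
            TensorProduct.comul_tmul, Bialgebra.comul_one, Algebra.TensorProduct.one_def]
          generalize comul (R := ℂ) x = w
          induction w using TensorProduct.induction_on with
          | zero => simp
          | add a b ha hb => simp only [map_add, tmul_add, ha, hb]
          | tmul a b => simp }
    have := key φ (by
      apply ofConv_injective
      ext x
      have := hr.mul_left 1 1 x
      rw [mul_one] at this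
      exact this.symm)
    exact LinearMap.congr_fun (congrArg ofConv this) a
  · let φ : H →ₗc[ℂ] H ⊗[ℂ] H :=
      { (TensorProduct.mk ℂ H H).flip 1 with
        counit_comp := by ext; simp
        map_comp_comul := by
          ext x
          simp only [LinearMap.comp_apply, LinearMap.flip_apply, TensorProduct.mk_apply,
            TensorProduct.comul_tmul, Bialgebra.comul_one, Algebra.TensorProduct.one_def]
          generalize comul (R := ℂ) x = w
          induction w using TensorProduct.induction_on with
          | zero => simp
          | add a b ha hb => simp only [map_add, add_tmul, ha, hb]
          | tmul a b => simp }
    have := key φ (by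
      apply ofConv_injective
      ext x
      have := hr.mul_right x 1 1
      rw [mul_one] at this
      exact this.symm)
    exact LinearMap.congr_fun (congrArg ofConv this) a

variable {V : Type*} [Ring V] [Algebra ℂ V] {f : H ⊗[ℂ] H →ₗ[ℂ] ℂ}

/-- The functional `h ↦ f(h ⊗ a)`. -/
def pairWith (f : H ⊗[ℂ] H →ₗ[ℂ] ℂ) : H →ₗ[ℂ] H →ₗ[ℂ] ℂ := (TensorProduct.curry f).flip

@[simp] theorem pairWith_apply (a h : H) : pairWith f a h = f (h ⊗ₜ a) := rfl

theorem IsSkewPairing.pairWith_one (hf : IsSkewPairing f) : pairWith f 1 = counit :=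
  LinearMap.ext hf.one_right

theorem IsSkewPairing.pairWith_mul (hf : IsSkewPairing f) (a b : H) : pairWith f (a * b) =
    LinearMap.mul' ℂ ℂ ∘ₗ map (pairWith f b) (pairWith f a) ∘ₗ comul :=
  LinearMap.ext fun h => hf.mul_right h a b

/-- Contraction of the second factor of `V ⊗ H` with a functional. -/
def rightContract (V : Type*) [Ring V] [Algebra ℂ V] : (H →ₗ[ℂ] ℂ) →ₗ[ℂ] V ⊗[ℂ] H →ₗ[ℂ] V :=
  (LinearMap.llcomp ℂ (V ⊗[ℂ] H) (V ⊗[ℂ] ℂ) V (TensorProduct.rid ℂ V).toLinearMap) ∘ₗ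
    LinearMap.lTensorHom V

@[simp] theorem rightContract_tmul (φ : H →ₗ[ℂ] ℂ) (v : V) (h : H) :
    rightContract V φ (v ⊗ₜ h) = φ h • v := by
  simp [rightContract]

/-- Contraction of the first factor of `H ⊗ V` with a functional. -/
def leftContract (V : Type*) [Ring V] [Algebra ℂ V] : (H →ₗ[ℂ] ℂ) →ₗ[ℂ] H ⊗[ℂ] V →ₗ[ℂ] V :=
  (LinearMap.llcomp ℂ (H ⊗[ℂ] V) (ℂ ⊗[ℂ] V) V (TensorProduct.lid ℂ V).toLinearMap) ∘ₗ
    LinearMap.rTensorHom V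

@[simp] theorem leftContract_tmul (φ : H →ₗ[ℂ] ℂ) (v : V) (h : H) :
    leftContract V φ (h ⊗ₜ v) = φ h • v := by
  simp [leftContract]

theorem rightContract_comp {δ : V →ₗ[ℂ] V ⊗[ℂ] H}
    (hδ : ∀ v, TensorProduct.assoc ℂ V H H (LinearMap.rTensor H δ (δ v)) =
      LinearMap.lTensor V comul (δ v)) (φ ψ : H →ₗ[ℂ] ℂ) (v : V) :
    rightContract V φ (δ (rightContract V ψ (δ v))) =
      rightContract V (LinearMap.mul' ℂ ℂ ∘ₗ map φ ψ ∘ₗ comul) (δ v) := by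
  have h1 : ∀ z : V ⊗[ℂ] H, rightContract V φ (δ (rightContract V ψ z)) =
      TensorProduct.rid ℂ V (LinearMap.lTensor V (LinearMap.mul' ℂ ℂ ∘ₗ map φ ψ)
        (TensorProduct.assoc ℂ V H H (LinearMap.rTensor H δ z))) := by
    intro z
    induction z using TensorProduct.induction_on with
    | zero => simp
    | add a b ha hb => simp only [map_add, ha, hb]
    | tmul v h =>
      rw [rightContract_tmul, map_smul, map_smul, LinearMap.rTensor_tmul]
      generalize δ v = w
      induction w using TensorProduct.induction_on with
      | zero => simp
      | add a b ha hb => simp only [map_add, smul_add, add_tmul, ha, hb]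
      | tmul w k => simp [smul_smul, mul_comm]
  have h2 : ∀ z : V ⊗[ℂ] H, TensorProduct.rid ℂ V (LinearMap.lTensor V
      (LinearMap.mul' ℂ ℂ ∘ₗ map φ ψ) (LinearMap.lTensor V comul z)) =
      rightContract V (LinearMap.mul' ℂ ℂ ∘ₗ map φ ψ ∘ₗ comul) z := by
    intro z
    induction z using TensorProduct.induction_on with
    | zero => simp
    | add a b ha hb => simp only [map_add, ha, hb]
    | tmul v h => simp
  rw [h1, hδ, h2]

theorem leftContract_comp {δ : V →ₗ[ℂ] H ⊗[ℂ] V}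
    (hδ : ∀ v, LinearMap.lTensor H δ (δ v) =
      TensorProduct.assoc ℂ H H V (LinearMap.rTensor V comul (δ v))) (φ ψ : H →ₗ[ℂ] ℂ) (v : V) :
    leftContract V φ (δ (leftContract V ψ (δ v))) =
      leftContract V (LinearMap.mul' ℂ ℂ ∘ₗ map ψ φ ∘ₗ comul) (δ v) := by
  have h1 : ∀ z : H ⊗[ℂ] V, leftContract V φ (δ (leftContract V ψ z)) =
      TensorProduct.lid ℂ V (LinearMap.rTensor V (LinearMap.mul' ℂ ℂ ∘ₗ map ψ φ)
        ((TensorProduct.assoc ℂ H H V).symm (LinearMap.lTensor H δ z))) := by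
    intro z
    induction z using TensorProduct.induction_on with
    | zero => simp
    | add a b ha hb => simp only [map_add, ha, hb]
    | tmul h v =>
      rw [leftContract_tmul, map_smul, map_smul, LinearMap.lTensor_tmul]
      generalize δ v = w
      induction w using TensorProduct.induction_on with
      | zero => simp
      | add a b ha hb => simp only [map_add, smul_add, tmul_add, ha, hb]
      | tmul w k => simp [smul_smul]
  have h2 : ∀ z : H ⊗[ℂ] V, TensorProduct.lid ℂ V (LinearMap.rTensor V
      (LinearMap.mul' ℂ ℂ ∘ₗ map ψ φ) (LinearMap.rTensor V comul z)) =
      leftContract V (LinearMap.mul' ℂ ℂ ∘ₗ map ψ φ ∘ₗ comul) z := by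
    intro z
    induction z using TensorProduct.induction_on with
    | zero => simp
    | add a b ha hb => simp only [map_add, ha, hb]
    | tmul h v => simp
  rw [h1, hδ, LinearEquiv.symm_apply_apply, h2]

theorem IsSkewPairing.rightContract_mul (hf : IsSkewPairing f) (a : H) (z w : V ⊗[ℂ] H) :
    rightContract V (pairWith f a) (z * w) = LinearMap.mul' ℂ V
      (map ((rightContract V ∘ₗ pairWith f).flip z) ((rightContract V ∘ₗ pairWith f).flip w)
        (comul a)) := by
  induction z using TensorProduct.induction_on with
  | zero => simp
  | add x y hx hy => simp only [add_mul, map_add, TensorProduct.map_add_left, LinearMap.add_apply, hx, hy]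
  | tmul v h =>
    induction w using TensorProduct.induction_on with
    | zero => simp
    | add x y hx hy => simp only [mul_add, map_add, TensorProduct.map_add_right, LinearMap.add_apply, hx, hy]
    | tmul w k =>
      rw [Algebra.TensorProduct.tmul_mul_tmul, rightContract_tmul, pairWith_apply, hf.mul_left]
      generalize comul (R := ℂ) a = u
      induction u using TensorProduct.induction_on with
      | zero => simp
      | add x y hx hy => simp only [map_add, add_smul, hx, hy]
      | tmul a b => simp [smul_smul, mul_comm]

theorem IsSkewPairing.leftContract_mul (hf : IsSkewPairing f) (a : H) (z w : H ⊗[ℂ] V) :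
    leftContract V (pairWith f a) (z * w) = LinearMap.mul' ℂ V
      (map ((leftContract V ∘ₗ pairWith f).flip z) ((leftContract V ∘ₗ pairWith f).flip w)
        (comul a)) := by
  induction z using TensorProduct.induction_on with
  | zero => simp
  | add x y hx hy => simp only [add_mul, map_add, TensorProduct.map_add_left, LinearMap.add_apply, hx, hy]
  | tmul h v =>
    induction w using TensorProduct.induction_on with
    | zero => simp
    | add x y hx hy => simp only [mul_add, map_add, TensorProduct.map_add_right, LinearMap.add_apply, hx, hy]
    | tmul k w =>
      rw [Algebra.TensorProduct.tmul_mul_tmul, leftContract_tmul, pairWith_apply, hf.mul_left]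
      generalize comul (R := ℂ) a = u
      induction u using TensorProduct.induction_on with
      | zero => simp
      | add x y hx hy => simp only [map_add, add_smul, hx, hy]
      | tmul a b => simp [smul_smul, mul_comm]

end SkewPairing

section ExtendedForm

open LaurentPolynomial

variable {A : Type*} [Ring A] [Bialgebra ℂ A]

theorem Extended.induction_on {p : Extended A → Prop} (x : Extended A)
    (add : ∀ x y, p x → p y → p (x + y)) (elt : ∀ a m, p (Extended.elt a m)) : p x := by
  have zero : p 0 := by
    have := elt 0 0
    rwa [Extended.elt, TensorProduct.zero_tmul] at this
  induction x using TensorProduct.induction_on with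
  | zero => exact zero
  | add x y hx hy => exact add x y hx hy
  | tmul a f =>
    induction f using LaurentPolynomial.induction_on' with
    | add f g hf hg => rw [TensorProduct.tmul_add]; exact add _ _ hf hg
    | C_mul_T n c =>
      have := elt (c • a) n
      rwa [Extended.elt, TensorProduct.smul_tmul, LaurentPolynomial.smul_eq_C_mul] at this

theorem extendedForm_elt (r : A ⊗[ℂ] A →ₗ[ℂ] ℂ) (lam : ℂ) (a b : A) (m n : ℤ) :
    extendedForm r lam (Extended.elt a m ⊗ₜ Extended.elt b n) = r (a ⊗ₜ b) * lam ^ (-(m * n)) := by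
  have hT : ∀ m : ℤ, (T m : ℂ[T;T⁻¹]) = AddMonoidAlgebra.basis ℤ ℂ m := fun m => rfl
  have : scalingForm lam (T m ⊗ₜ T n) = lam ^ (-(m * n)) := by
    rw [scalingForm, TensorProduct.lift.tmul, hT, hT, Module.Basis.constr_basis,
      Module.Basis.constr_basis]
  rw [← this]
  rfl

theorem IsSkewPairing.extendedForm {r : A ⊗[ℂ] A →ₗ[ℂ] ℂ} (hr : IsSkewPairing r) {lam : ℂ}
    (hlam : lam ≠ 0) : IsSkewPairing (extendedForm r lam) where
  one_left a := by
    induction a using Extended.induction_on with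
    | add x y hx hy => rw [TensorProduct.tmul_add, map_add, map_add, hx, hy]
    | elt a m =>
      rw [← Extended.elt_one, extendedForm_elt, hr.one_left, Extended.counit_elt]
      simp
  one_right a := by
    induction a using Extended.induction_on with
    | add x y hx hy => rw [TensorProduct.add_tmul, map_add, map_add, hx, hy]
    | elt a m =>
      rw [← Extended.elt_one, extendedForm_elt, hr.one_right, Extended.counit_elt]
      simp
  mul_left a b c := by
    induction a using Extended.induction_on with
    | add x y hx hy =>
      simp only [add_mul, add_tmul, map_add, LinearMap.comp_add, TensorProduct.map_add_left,
        LinearMap.add_apply, hx, hy]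
    | elt a m =>
    induction b using Extended.induction_on with
    | add x y hx hy =>
      simp only [mul_add, add_tmul, map_add, LinearMap.comp_add, TensorProduct.map_add_right,
        LinearMap.add_apply, hx, hy]
    | elt b n =>
    induction c using Extended.induction_on with
    | add x y hx hy => simp only [tmul_add, map_add, hx, hy]
    | elt c k =>
      have r := ℛ ℂ c
      rw [Extended.elt_mul, extendedForm_elt, hr.mul_left,
        Extended.comul_elt r.index c r.left r.right k r.eq.symm, ← r.eq]
      simp only [map_sum, TensorProduct.map_tmul, LinearMap.mul'_apply, LinearMap.comp_apply,
        TensorProduct.mk_apply, extendedForm_elt, Finset.sum_mul]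
      refine Finset.sum_congr rfl fun i _ => ?_
      rw [add_mul, neg_add, zpow_add₀ hlam]
      ring
  mul_right a b c := by
    induction a using Extended.induction_on with
    | add x y hx hy => simp only [add_tmul, map_add, hx, hy]
    | elt a m =>
    induction b using Extended.induction_on with
    | add x y hx hy =>
      simp only [add_mul, tmul_add, map_add, LinearMap.comp_add, TensorProduct.map_add_right,
        LinearMap.add_apply, hx, hy]
    | elt b n =>
    induction c using Extended.induction_on with
    | add x y hx hy =>
      simp only [mul_add, tmul_add, map_add, LinearMap.comp_add, TensorProduct.map_add_left,
        LinearMap.add_apply, hx, hy]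
    | elt c k =>
      have r := ℛ ℂ a
      rw [Extended.elt_mul, extendedForm_elt, hr.mul_right,
        Extended.comul_elt r.index a r.left r.right m r.eq.symm, ← r.eq]
      simp only [map_sum, TensorProduct.map_tmul, LinearMap.mul'_apply, LinearMap.comp_apply,
        LinearMap.flip_apply, TensorProduct.mk_apply, extendedForm_elt, Finset.sum_mul]
      refine Finset.sum_congr rfl fun i _ => ?_
      rw [mul_add, neg_add, zpow_add₀ hlam]
      ring

end ExtendedForm

end QPoincare
end

noncomputable section

universe u

namespace QPoincare

open Coalgebra TensorProduct

namespace QuantumGroupData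

variable {ι : Type u} [Fintype ι] [DecidableEq ι] {A : Type*} [Ring A] [Bialgebra ℂ A]
  (D : QuantumGroupData ι A)

theorem isSkewPairing_form : IsSkewPairing D.form :=
  D.dualQuasitriangular.isSkewPairing.extendedForm D.lam_ne_zero

theorem form_elt (a b : A) (m n : ℤ) : D.form (Extended.elt a m ⊗ₜ Extended.elt b n) =
    D.r (a ⊗ₜ b) * D.lam ^ (-(m * n)) := extendedForm_elt _ _ _ _ _ _

theorem form_tg_text (i j k l : ι) : D.form (D.tg i j ⊗ₜ D.text k l) =
    D.lam * D.R (i, k) (j, l) := by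
  rw [tg, text, form_elt, D.r_t]
  simp

theorem form_tg_g (i j : ι) : D.form (D.tg i j ⊗ₜ D.g) = if i = j then D.lam⁻¹ else 0 := by
  rw [tg, g, form_elt, D.dualQuasitriangular.isSkewPairing.one_right, D.counit_t]
  simp

theorem adjoin_x : Algebra.adjoin ℂ (Set.range D.x) = ⊤ := by
  have h : (RingQuot.mkAlgHom ℂ D.CovectorRel).range = ⊤ :=
    (AlgHom.range_eq_top _).mpr (RingQuot.mkAlgHom_surjective ℂ _)
  rw [← Algebra.map_top, ← FreeAlgebra.adjoin_range_ι, AlgHom.map_adjoin, ← Set.range_comp] at h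
  exact h

theorem covector_ext {S : Type*} [Semiring S] [Algebra ℂ S] {F G : D.Covector →ₐ[ℂ] S}
    (h : ∀ i, F (D.x i) = G (D.x i)) : F = G := by
  apply RingQuot.ringQuot_ext'
  apply FreeAlgebra.hom_ext
  funext i
  exact h i

theorem adjoin_poincare :
    Algebra.adjoin ℂ (Set.range D.incl ∪ Set.range D.p) = ⊤ := by
  have h : (RingQuot.mkAlgHom ℂ D.PoincareRel).range = ⊤ :=
    (AlgHom.range_eq_top _).mpr (RingQuot.mkAlgHom_surjective ℂ _)
  rw [← Algebra.map_top, ← FreeAlgebra.adjoin_range_ι, AlgHom.map_adjoin, ← Set.range_comp] at h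
  refine top_le_iff.mp (h.ge.trans (Algebra.adjoin_mono ?_))
  rintro _ ⟨a | i, rfl⟩
  · exact Or.inl ⟨a, rfl⟩
  · exact Or.inr ⟨i, rfl⟩

/-- Induction on `Ã`, generated by the matrix entries and `g`, `g⁻¹`. -/
theorem extended_induction {p : Extended A → Prop} (a : Extended A)
    (algebraMap : ∀ c, p (algebraMap ℂ _ c)) (add : ∀ x y, p x → p y → p (x + y))
    (mul : ∀ x y, p x → p y → p (x * y)) (text : ∀ k l, p (D.text k l)) (hg : p D.g)
    (hg' : p (Extended.elt 1 (-1))) : p a := by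
  have hA : ∀ a : A, p (Extended.elt a 0) := by
    intro a
    have ha : a ∈ Algebra.adjoin ℂ (Set.range fun p : ι × ι => D.t p.1 p.2) :=
      D.generates ▸ Algebra.mem_top
    induction ha using Algebra.adjoin_induction with
    | mem a ha => obtain ⟨x, rfl⟩ := ha; exact text _ _
    | algebraMap c =>
      rw [Algebra.algebraMap_eq_smul_one, Extended.elt_smul, Extended.elt_one,
        ← Algebra.algebraMap_eq_smul_one]
      exact algebraMap c
    | add x y _ _ hx hy =>
      rw [Extended.elt, TensorProduct.add_tmul]
      exact add _ _ hx hy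
    | mul x y _ _ hx hy =>
      have := mul _ _ hx hy
      rwa [Extended.elt_mul, add_zero] at this
  have hT : ∀ m : ℤ, p (Extended.elt 1 m) := by
    intro m
    induction m using Int.induction_on with
    | zero => exact hA 1
    | succ m ih =>
      have := mul _ _ ih hg
      rwa [g, Extended.elt_mul, one_mul] at this
    | pred m ih =>
      have := mul _ _ ih hg'
      rwa [Extended.elt_mul, one_mul] at this
  induction a using Extended.induction_on with
  | add x y hx hy => exact add x y hx hy
  | elt a m =>
    have := mul _ _ (hA a) (hT m)
    rwa [Extended.elt_mul, mul_one, zero_add] at this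

theorem coaction_x (j : ι) : D.coaction (D.x j) = ∑ a, D.x a ⊗ₜ[ℂ] D.tg a j :=
  D.covectorLift_x _ _ j

theorem coaction_coassoc (v : D.Covector) :
    TensorProduct.assoc ℂ D.Covector (Extended A) (Extended A)
      (LinearMap.rTensor (Extended A) D.coaction.toLinearMap (D.coaction v)) =
      LinearMap.lTensor D.Covector comul (D.coaction v) := by
  have h : ((Algebra.TensorProduct.assoc ℂ ℂ ℂ D.Covector (Extended A)
        (Extended A)).toAlgHom.comp
        (Algebra.TensorProduct.map D.coaction (AlgHom.id ℂ (Extended A)))).comp D.coaction =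
      (Algebra.TensorProduct.map (AlgHom.id ℂ D.Covector)
        (Bialgebra.comulAlgHom ℂ (Extended A))).comp D.coaction := by
    apply D.covector_ext
    intro j
    simp only [AlgHom.comp_apply, coaction_x, map_sum, Algebra.TensorProduct.map_tmul,
      AlgHom.id_apply, Bialgebra.comulAlgHom_apply, comul_tg, TensorProduct.sum_tmul,
      TensorProduct.tmul_sum]
    rw [Finset.sum_comm]
    rfl
  exact AlgHom.congr_fun h v

theorem coaction_counit (v : D.Covector) : TensorProduct.rid ℂ D.Covector
    (LinearMap.lTensor D.Covector counit (D.coaction v)) = v := by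
  have h : ((Algebra.TensorProduct.rid ℂ ℂ D.Covector).toAlgHom.comp
        (Algebra.TensorProduct.map (AlgHom.id ℂ D.Covector)
        (Bialgebra.counitAlgHom ℂ (Extended A)))).comp D.coaction = AlgHom.id ℂ _ := by
    apply D.covector_ext
    intro j
    simp [coaction_x, counit_tg]
  exact AlgHom.congr_fun h v

theorem action_tmul (v : D.Covector) (a : Extended A) : D.action (v ⊗ₜ a) =
    rightContract D.Covector (pairWith D.form a) (D.coaction v) := by
  change TensorProduct.rid ℂ D.Covector (LinearMap.lTensor D.Covector D.form
    (TensorProduct.assoc ℂ D.Covector (Extended A) (Extended A) (D.coaction v ⊗ₜ a))) = _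
  generalize D.coaction v = z
  induction z using TensorProduct.induction_on with
  | zero => simp
  | add x y hx hy => simp only [map_add, add_tmul, hx, hy]
  | tmul x y => simp

theorem action_one (v : D.Covector) : D.action (v ⊗ₜ 1) = v := by
  rw [action_tmul, D.isSkewPairing_form.pairWith_one]
  exact D.coaction_counit v

theorem one_action (a : Extended A) : D.action (1 ⊗ₜ a) = counit (R := ℂ) a • (1 : D.Covector) := by
  rw [action_tmul, map_one, Algebra.TensorProduct.one_def, rightContract_tmul, pairWith_apply,
    D.isSkewPairing_form.one_left]

theorem action_action (v : D.Covector) (a b : Extended A) :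
    D.action (v ⊗ₜ (a * b)) = D.action (D.action (v ⊗ₜ a) ⊗ₜ b) := by
  rw [action_tmul, D.isSkewPairing_form.pairWith_mul, action_tmul, action_tmul]
  exact (rightContract_comp (δ := D.coaction.toLinearMap) D.coaction_coassoc _ _ v).symm

theorem mul_action (v w : D.Covector) (a : Extended A) : D.action ((v * w) ⊗ₜ a) =
    LinearMap.mul' ℂ D.Covector (map (D.action ∘ₗ TensorProduct.mk ℂ D.Covector (Extended A) v)
      (D.action ∘ₗ TensorProduct.mk ℂ D.Covector (Extended A) w) (comul a)) := by
  have e : ∀ v, D.action ∘ₗ TensorProduct.mk ℂ D.Covector (Extended A) v =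
      (rightContract D.Covector ∘ₗ pairWith D.form).flip (D.coaction v) :=
    fun v => LinearMap.ext fun a => D.action_tmul v a
  rw [action_tmul, map_mul, D.isSkewPairing_form.rightContract_mul, e, e]

theorem x_action (i : ι) (a : Extended A) :
    D.action (D.x i ⊗ₜ a) = ∑ b, D.form (D.tg b i ⊗ₜ a) • D.x b := by
  simp [action_tmul, coaction_x]

theorem x_action_g (i : ι) : D.action (D.x i ⊗ₜ D.g) = D.lam⁻¹ • D.x i := by
  simp [x_action, form_tg_g]

theorem x_action_text (i k l : ι) : D.action (D.x i ⊗ₜ D.text k l) =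
    D.lam • ∑ b, D.R (b, k) (i, l) • D.x b := by
  simp [x_action, form_tg_text, Finset.smul_sum, smul_smul]

/-- The action as an algebra map to the opposite of the endomorphisms of `V*(R')`. -/
def actionHom : Extended A →ₐ[ℂ] (Module.End ℂ D.Covector)ᵐᵒᵖ :=
  AlgHom.ofLinearMap
    { toFun := fun a => MulOpposite.op
        (D.action ∘ₗ (TensorProduct.mk ℂ D.Covector (Extended A)).flip a)
      map_add' := fun x y => MulOpposite.unop_injective (LinearMap.ext fun v => by
        simp)
      map_smul' := fun x y => MulOpposite.unop_injective (LinearMap.ext fun v => by simp) }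
    (MulOpposite.unop_injective (LinearMap.ext fun v => D.action_one v))
    (fun x y => MulOpposite.unop_injective (LinearMap.ext fun v => D.action_action v x y))

theorem actionHom_apply (a : Extended A) (v : D.Covector) :
    (D.actionHom a).unop v = D.action (v ⊗ₜ a) := rfl

/-- The right module structure of `V*(R')` over the `q`-Poincaré group. -/
def poincareMod : D.Poincare →ₐ[ℂ] (Module.End ℂ D.Covector)ᵐᵒᵖ :=
  D.poincareLift D.actionHom (fun i => MulOpposite.op (LinearMap.mulRight ℂ (D.x i)))
    (fun j l => MulOpposite.unop_injective (LinearMap.ext fun v => by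
      simp only [← MulOpposite.op_mul, MulOpposite.unop_op, Module.End.mul_apply,
        LinearMap.mulRight_apply, mul_assoc, Finset.unop_sum, MulOpposite.unop_smul,
        LinearMap.sum_apply, LinearMap.smul_apply]
      rw [D.x_relation j l]
      simp only [Finset.mul_sum, mul_smul_comm]))
    (fun i => MulOpposite.unop_injective (LinearMap.ext fun v => by
      simp only [MulOpposite.unop_mul, MulOpposite.unop_op, Module.End.mul_apply,
        LinearMap.mulRight_apply, actionHom_apply, MulOpposite.unop_smul, LinearMap.smul_apply]
      rw [mul_action, comul_g]
      simp [x_action_g]))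
    (fun i k l => MulOpposite.unop_injective (LinearMap.ext fun v => by
      simp only [MulOpposite.unop_mul, MulOpposite.unop_op, Module.End.mul_apply,
        LinearMap.mulRight_apply, actionHom_apply, MulOpposite.unop_smul, LinearMap.smul_apply,
        Finset.unop_sum, LinearMap.sum_apply]
      rw [mul_action, comul_text]
      simp only [map_sum, TensorProduct.map_tmul, LinearMap.comp_apply, TensorProduct.mk_apply,
        LinearMap.mul'_apply, x_action_text, mul_smul_comm, Finset.mul_sum, ← Finset.smul_sum]
      rw [Finset.sum_comm]))

theorem poincareMod_incl (a : Extended A) (v : D.Covector) :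
    (D.poincareMod (D.incl a)).unop v = D.action (v ⊗ₜ a) := by
  exact congrArg (fun f : (Module.End ℂ D.Covector)ᵐᵒᵖ => f.unop v) (D.poincareLift_incl _ _ _ _ _ a)

theorem poincareMod_p (i : ι) (v : D.Covector) :
    (D.poincareMod (D.p i)).unop v = v * D.x i := by
  exact congrArg (fun f : (Module.End ℂ D.Covector)ᵐᵒᵖ => f.unop v) (D.poincareLift_p _ _ _ _ _ i)

theorem ofCovector_x (i : ι) : D.ofCovector (D.x i) = D.p i := D.covectorLift_x _ _ i

theorem poincareMod_ofCovector (v w : D.Covector) :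
    (D.poincareMod (D.ofCovector w)).unop v = v * w := by
  have hw : w ∈ Algebra.adjoin ℂ (Set.range D.x) := D.adjoin_x ▸ Algebra.mem_top
  induction hw using Algebra.adjoin_induction generalizing v with
  | mem w hw => obtain ⟨i, rfl⟩ := hw; rw [ofCovector_x, poincareMod_p]
  | algebraMap c =>
    rw [AlgHom.commutes, AlgHom.commutes, ← Algebra.commutes, ← Algebra.smul_def]
    rfl
  | add x y _ _ hx hy => simp [hx, hy, mul_add]
  | mul x y _ _ hx hy => simp [hx, hy, mul_assoc]

/-- The projection of the `q`-Poincaré group onto `V*(R')`. -/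
def covectorProj : D.Poincare →ₗ[ℂ] D.Covector :=
  LinearMap.applyₗ 1 ∘ₗ (MulOpposite.opLinearEquiv ℂ).symm.toLinearMap ∘ₗ
    D.poincareMod.toLinearMap

theorem covectorProj_apply (x : D.Poincare) : D.covectorProj x = (D.poincareMod x).unop 1 := rfl

theorem covectorProj_ofCovector (v : D.Covector) : D.covectorProj (D.ofCovector v) = v := by
  rw [covectorProj_apply, poincareMod_ofCovector, one_mul]

theorem covectorProj_incl_mul (a : Extended A) (x : D.Poincare) :
    D.covectorProj (D.incl a * x) = counit (R := ℂ) a • D.covectorProj x := by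
  rw [covectorProj_apply, map_mul, MulOpposite.unop_mul, Module.End.mul_apply, poincareMod_incl,
    one_action, map_smul]
  rfl

/-- The projection of the `q`-Poincaré group onto `Ã`. -/
def extendedProj : D.Poincare →ₐ[ℂ] Extended A :=
  D.poincareLift (AlgHom.id ℂ _) (fun _ => 0) (fun j l => by simp) (by simp) (by simp)

theorem extendedProj_incl (a : Extended A) : D.extendedProj (D.incl a) = a :=
  D.poincareLift_incl _ _ _ _ _ a

theorem extendedProj_p (i : ι) : D.extendedProj (D.p i) = 0 := D.poincareLift_p _ _ _ _ _ i

theorem comul_incl (a : Extended A) : comul (R := ℂ) (D.incl a) =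
    map D.incl.toLinearMap D.incl.toLinearMap (comul a) := D.poincareComul_incl a

theorem counit_incl (a : Extended A) : counit (R := ℂ) (D.incl a) = counit (R := ℂ) a :=
  D.poincareCounit_incl a

theorem comul_p (j : ι) : comul (R := ℂ) (D.p j) =
    ∑ a, D.p a ⊗ₜ[ℂ] D.incl (D.tg a j) + (1 : D.Poincare) ⊗ₜ[ℂ] D.p j := D.poincareComul_p j

theorem counit_p (j : ι) : counit (R := ℂ) (D.p j) = 0 := D.poincareCounit_p j

theorem comul_extendedProj (x : D.Poincare) : comul (R := ℂ) (D.extendedProj x) =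
    map D.extendedProj.toLinearMap D.extendedProj.toLinearMap (comul x) := by
  have h : (Bialgebra.comulAlgHom ℂ (Extended A)).comp D.extendedProj =
      (Algebra.TensorProduct.map D.extendedProj D.extendedProj).comp
        (Bialgebra.comulAlgHom ℂ D.Poincare) := by
    apply D.poincare_ext
    · intro a
      simp only [AlgHom.comp_apply, Bialgebra.comulAlgHom_apply, comul_incl, extendedProj_incl]
      generalize comul (R := ℂ) a = z
      induction z using TensorProduct.induction_on with
      | zero => simp
      | add x y hx hy => simp only [map_add]; rw [← hx, ← hy]
      | tmul x y => simp [extendedProj_incl]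
    · intro i
      simp [comul_p, extendedProj_p]
  exact AlgHom.congr_fun h x

theorem counit_extendedProj (x : D.Poincare) :
    counit (R := ℂ) (D.extendedProj x) = counit (R := ℂ) x := by
  have h : (Bialgebra.counitAlgHom ℂ (Extended A)).comp D.extendedProj =
      Bialgebra.counitAlgHom ℂ D.Poincare := by
    apply D.poincare_ext
    · intro a
      simp [counit_incl, extendedProj_incl]
    · intro i
      simp [counit_p, extendedProj_p]
  exact AlgHom.congr_fun h x

theorem extendedProj_coinvariant (v : D.Covector) :
    map D.extendedProj.toLinearMap LinearMap.id (comul (D.ofCovector v)) =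
      1 ⊗ₜ[ℂ] D.ofCovector v := by
  have h : ((Algebra.TensorProduct.map D.extendedProj (AlgHom.id ℂ D.Poincare)).comp
      (Bialgebra.comulAlgHom ℂ D.Poincare)).comp D.ofCovector =
      Algebra.TensorProduct.includeRight.comp D.ofCovector := by
    apply D.covector_ext
    intro i
    simp [ofCovector_x, comul_p, extendedProj_p]
  exact AlgHom.congr_fun h v

theorem map_extendedProj_comul_ofCovector (v : D.Covector) :
    map LinearMap.id D.extendedProj.toLinearMap (comul (D.ofCovector v)) =
      map D.ofCovector.toLinearMap LinearMap.id (D.coaction v) := by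
  have h : ((Algebra.TensorProduct.map (AlgHom.id ℂ D.Poincare) D.extendedProj).comp
      (Bialgebra.comulAlgHom ℂ D.Poincare)).comp D.ofCovector =
      (Algebra.TensorProduct.map D.ofCovector (AlgHom.id ℂ (Extended A))).comp D.coaction := by
    apply D.covector_ext
    intro i
    simp [ofCovector_x, comul_p, extendedProj_p, extendedProj_incl, coaction_x]
  exact AlgHom.congr_fun h v

theorem comul_ofCovector_mem (v : D.Covector) : comul (R := ℂ) (D.ofCovector v) ∈
    (Algebra.TensorProduct.map D.ofCovector (AlgHom.id ℂ D.Poincare)).range := by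
  have hv : v ∈ Algebra.adjoin ℂ (Set.range D.x) := D.adjoin_x ▸ Algebra.mem_top
  have h : Algebra.adjoin ℂ (Set.range D.x) ≤
      (Algebra.TensorProduct.map D.ofCovector (AlgHom.id ℂ D.Poincare)).range.comap
        ((Bialgebra.comulAlgHom ℂ D.Poincare).comp D.ofCovector) := by
    refine Algebra.adjoin_le ?_
    rintro _ ⟨i, rfl⟩
    refine ⟨∑ a, D.x a ⊗ₜ[ℂ] D.incl (D.tg a i) + 1 ⊗ₜ[ℂ] D.p i, ?_⟩
    simp [ofCovector_x, comul_p]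
  exact h hv

theorem p_mul_incl_mem (a : Extended A) : ∀ i, D.p i * D.incl a ∈
    Submodule.span ℂ {x | ∃ b k, x = D.incl b * D.p k} := by
  have gen : ∀ b k, D.incl b * D.p k ∈ Submodule.span ℂ {x | ∃ b k, x = D.incl b * D.p k} :=
    fun b k => Submodule.subset_span ⟨b, k, rfl⟩
  refine D.extended_induction (p := fun a => ∀ i, D.p i * D.incl a ∈
    Submodule.span ℂ {x | ∃ b k, x = D.incl b * D.p k}) a (fun c i => ?_) (fun x y hx hy i => ?_) (fun x y hx hy i => ?_)
    (fun k l i => ?_) (fun i => ?_) (fun i => ?_)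
  · rw [AlgHom.commutes, ← Algebra.commutes, ← Algebra.smul_def]
    exact Submodule.smul_mem _ _ (by simpa using gen 1 i)
  · rw [map_add, mul_add]
    exact Submodule.add_mem _ (hx i) (hy i)
  · rw [map_mul, ← mul_assoc]
    refine Submodule.span_induction (p := fun z _ => z * D.incl y ∈ _) ?_ (by simp)
      (fun u v _ _ hu hv => by rw [add_mul]; exact Submodule.add_mem _ hu hv)
      (fun c u _ hu => by rw [smul_mul_assoc]; exact Submodule.smul_mem _ _ hu) (hx i)
    rintro _ ⟨b, k, rfl⟩
    rw [mul_assoc]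
    refine Submodule.span_induction (p := fun z _ => D.incl b * z ∈ _) ?_ (by simp)
      (fun u v _ _ hu hv => by rw [mul_add]; exact Submodule.add_mem _ hu hv)
      (fun c u _ hu => by rw [mul_smul_comm]; exact Submodule.smul_mem _ _ hu) (hy k)
    rintro _ ⟨c, l, rfl⟩
    rw [← mul_assoc, ← map_mul]
    exact gen _ _
  · rw [p_mul_t]
    exact Submodule.smul_mem _ _ (Submodule.sum_mem _ fun b _ => Submodule.sum_mem _ fun a _ =>
      Submodule.smul_mem _ _ (gen _ _))
  · rw [p_mul_g]
    exact Submodule.smul_mem _ _ (gen _ _)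
  · have e : D.p i * D.incl (Extended.elt 1 (-1)) =
        D.lam • (D.incl (Extended.elt 1 (-1)) * D.p i) := by
      have e1 : D.g * Extended.elt 1 (-1) = 1 := by
        rw [g, Extended.elt_mul, one_mul, ← Extended.elt_one]; rfl
      have e2 : Extended.elt 1 (-1) * D.g = 1 := by
        rw [g, Extended.elt_mul, one_mul, ← Extended.elt_one]; rfl
      have h := congrArg (fun z => D.incl (Extended.elt 1 (-1)) * z *
        D.incl (Extended.elt 1 (-1))) (D.p_mul_g i)
      simp only [mul_smul_comm, smul_mul_assoc] at h
      have h1 : D.incl (Extended.elt 1 (-1)) * (D.p i * D.incl D.g) * D.incl (Extended.elt 1 (-1))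
          = D.incl (Extended.elt 1 (-1)) * D.p i := by
        rw [mul_assoc, mul_assoc, ← map_mul D.incl D.g, e1, map_one, mul_one]
      have h2 : D.incl (Extended.elt 1 (-1)) * (D.incl D.g * D.p i) * D.incl (Extended.elt 1 (-1))
          = D.p i * D.incl (Extended.elt 1 (-1)) := by
        rw [← mul_assoc (D.incl _), ← map_mul D.incl _ D.g, e2, map_one, one_mul]
      rw [h1, h2] at h
      rw [h, smul_smul, mul_inv_cancel₀ D.lam_ne_zero, one_smul]
    rw [e]
    exact Submodule.smul_mem _ _ (gen _ _)

theorem span_incl_mul_ofCovector (x : D.Poincare) :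
    x ∈ Submodule.span ℂ {y | ∃ a v, y = D.incl a * D.ofCovector v} := by
  have gen : ∀ b k, D.incl b * D.ofCovector k ∈
      Submodule.span ℂ {y | ∃ a v, y = D.incl a * D.ofCovector v} :=
    fun b k => Submodule.subset_span ⟨b, k, rfl⟩
  have hx : x ∈ Algebra.adjoin ℂ (Set.range D.incl ∪ Set.range D.p) :=
    D.adjoin_poincare ▸ Algebra.mem_top
  suffices h : ∀ y ∈ Submodule.span ℂ {y | ∃ a v, y = D.incl a * D.ofCovector v},
      x * y ∈ Submodule.span ℂ {y | ∃ a v, y = D.incl a * D.ofCovector v} by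
    simpa using h 1 (by simpa using gen 1 1)
  induction hx using Algebra.adjoin_induction with
  | mem x hx =>
    intro y hy
    refine Submodule.span_induction (p := fun z _ => x * z ∈ _) ?_ (by simp)
      (fun u v _ _ hu hv => by rw [mul_add]; exact Submodule.add_mem _ hu hv)
      (fun c u _ hu => by rw [mul_smul_comm]; exact Submodule.smul_mem _ _ hu) hy
    rintro _ ⟨b, v, rfl⟩
    rcases hx with ⟨a, rfl⟩ | ⟨i, rfl⟩
    · rw [← mul_assoc, ← map_mul]
      exact gen _ _
    · rw [← mul_assoc]
      refine Submodule.span_induction (p := fun z _ => z * D.ofCovector v ∈ _) ?_ (by simp)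
        (fun u v _ _ hu hv => by rw [add_mul]; exact Submodule.add_mem _ hu hv)
        (fun c u _ hu => by rw [smul_mul_assoc]; exact Submodule.smul_mem _ _ hu)
        (D.p_mul_incl_mem b i)
      rintro _ ⟨c, l, rfl⟩
      rw [mul_assoc, ← ofCovector_x, ← map_mul]
      exact gen _ _
  | algebraMap c =>
    intro y hy
    rw [← Algebra.smul_def]
    exact Submodule.smul_mem _ _ hy
  | add a b _ _ ha hb =>
    intro y hy
    rw [add_mul]
    exact Submodule.add_mem _ (ha y hy) (hb y hy)
  | mul a b _ _ ha hb =>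
    intro y hy
    rw [mul_assoc]
    exact ha _ (hb y hy)

theorem poincare_factor (x : D.Poincare) : LinearMap.mul' ℂ D.Poincare
    (map (D.incl.toLinearMap ∘ₗ D.extendedProj.toLinearMap)
      (D.ofCovector.toLinearMap ∘ₗ D.covectorProj) (comul x)) = x := by
  have hx := D.span_incl_mul_ofCovector x
  induction hx using Submodule.span_induction with
  | zero => simp
  | add a b _ _ ha hb => simp only [map_add, ha, hb]
  | smul c a _ ha => simp only [map_smul, ha]
  | mem x hx =>
    obtain ⟨a, v, rfl⟩ := hx
    have key : ∀ (w : Extended A ⊗[ℂ] Extended A) (z : D.Poincare ⊗[ℂ] D.Poincare),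
        map (D.incl.toLinearMap ∘ₗ D.extendedProj.toLinearMap)
          (D.ofCovector.toLinearMap ∘ₗ D.covectorProj)
          (map D.incl.toLinearMap D.incl.toLinearMap w * z) =
        (D.incl (TensorProduct.rid ℂ _ (LinearMap.lTensor _ counit w)) ⊗ₜ 1) *
        map D.incl.toLinearMap (D.ofCovector.toLinearMap ∘ₗ D.covectorProj)
          (map D.extendedProj.toLinearMap LinearMap.id z) := by
      intro w z
      induction w using TensorProduct.induction_on with
      | zero => simp
      | add x y hx hy => simp only [map_add, add_mul, add_tmul, hx, hy]
      | tmul x y =>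
        induction z using TensorProduct.induction_on with
        | zero => simp
        | add x y hx hy => simp only [map_add, mul_add, hx, hy]
        | tmul u v => simp [extendedProj_incl, covectorProj_incl_mul, tmul_smul, smul_tmul']
    rw [Bialgebra.comul_mul, comul_incl, key, extendedProj_coinvariant]
    simp [covectorProj_ofCovector]

/-- The `q`-Poincaré group as a bosonization. -/
def bosonization : Bosonization (Extended A) D.Covector D.Poincare where
  i := D.incl
  σ := D.extendedProj
  j := D.ofCovector
  π := D.covectorProj
  comul_i := D.comul_incl
  counit_i := D.counit_incl
  comul_σ := D.comul_extendedProj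
  counit_σ := D.counit_extendedProj
  σ_i := D.extendedProj_incl
  π_j := D.covectorProj_ofCovector
  π_i_mul := D.covectorProj_incl_mul
  π_mul x y := by
    rw [covectorProj_apply, map_mul, MulOpposite.unop_mul, Module.End.mul_apply,
      poincareMod_ofCovector, one_mul, covectorProj_apply, covectorProj_apply, map_mul]
    rfl
  coinv := D.extendedProj_coinvariant
  coideal v := by
    obtain ⟨z, hz⟩ := D.comul_ofCovector_mem v
    rw [← hz]
    clear hz
    change TensorProduct.map _ _ (Algebra.TensorProduct.map _ _ z) = Algebra.TensorProduct.map _ _ z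
    induction z using TensorProduct.induction_on with
    | zero => simp
    | add x y hx hy => simp only [map_add, hx, hy]
    | tmul x y => simp [covectorProj_ofCovector]
  factor := D.poincare_factor

theorem bosonization_act : D.bosonization.act = D.action := by
  apply TensorProduct.ext'
  intro v a
  rw [Bosonization.act_tmul]
  change D.covectorProj (D.ofCovector v * D.incl a) = _
  rw [covectorProj_apply, map_mul, MulOpposite.unop_mul, Module.End.mul_apply,
    poincareMod_ofCovector, one_mul, poincareMod_incl]

theorem bosonization_coact : D.bosonization.coact = D.coaction.toLinearMap := by
  ext v
  rw [Bosonization.coact_apply]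
  change TensorProduct.map D.covectorProj D.extendedProj.toLinearMap (comul (D.ofCovector v)) = _
  have h : TensorProduct.map D.covectorProj D.extendedProj.toLinearMap =
      TensorProduct.map D.covectorProj LinearMap.id ∘ₗ
        TensorProduct.map LinearMap.id D.extendedProj.toLinearMap := by
    rw [← TensorProduct.map_comp, LinearMap.comp_id, LinearMap.id_comp]
  rw [h, LinearMap.comp_apply, map_extendedProj_comul_ofCovector, AlgHom.toLinearMap_apply]
  generalize D.coaction v = z
  induction z using TensorProduct.induction_on with
  | zero => simp
  | add x y hx hy => simp only [map_add, hx, hy]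
  | tmul x y => simp [covectorProj_ofCovector]

theorem braiding_tmul (v w : D.Covector) : D.braiding (v ⊗ₜ w) =
    LinearMap.lTensor D.Covector (D.action ∘ₗ TensorProduct.mk ℂ D.Covector (Extended A) v)
      (D.coaction w) := by
  change TensorProduct.rid ℂ _ (TensorProduct.map
    (TensorProduct.comm ℂ D.Covector D.Covector).toLinearMap D.form
    (TensorProduct.tensorTensorTensorComm ℂ D.Covector (Extended A) D.Covector
      (Extended A) (D.coaction v ⊗ₜ D.coaction w))) = _
  generalize D.coaction w = z
  induction z using TensorProduct.induction_on with
  | zero => simp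
  | add x y hx hy => simp only [map_add, tmul_add, hx, hy]
  | tmul w a =>
    rw [LinearMap.lTensor_tmul, LinearMap.comp_apply, TensorProduct.mk_apply, action_tmul]
    generalize D.coaction v = z
    induction z using TensorProduct.induction_on with
    | zero => simp
    | add x y hx hy => simp only [map_add, tmul_add, add_tmul, hx, hy]
    | tmul v b => simp

theorem isBraidedLinearCoproduct : let := D.bosonization.coalgebra
    IsBraidedLinearCoproduct D.braiding D.x :=
  letI := D.bosonization.coalgebra
  { comul_one := by
      change TensorProduct.map D.covectorProj D.covectorProj (comul (D.ofCovector 1)) = _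
      have h : D.covectorProj 1 = 1 := D.bosonization.π_one
      rw [map_one, Bialgebra.comul_one, Algebra.TensorProduct.one_def, TensorProduct.map_tmul, h]
    comul_generator := fun i => by
      change TensorProduct.map D.covectorProj D.covectorProj (comul (D.ofCovector (D.x i))) = _
      have h : D.covectorProj 1 = 1 := D.bosonization.π_one
      have hp : ∀ j, D.covectorProj (D.p j) = D.x j := fun j => by
        rw [← ofCovector_x, covectorProj_ofCovector]
      have hi : ∀ a, D.covectorProj (D.incl a) = counit (R := ℂ) a • (1 : D.Covector) :=
        D.bosonization.π_i
      rw [ofCovector_x, comul_p]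
      simp [h, hp, hi, counit_tg, ite_smul, tmul_ite]
    comul_mul := D.bosonization.comulB_mul D.braiding fun v w => by
      rw [bosonization_act, bosonization_coact]
      exact D.braiding_tmul v w
    counit_one := by
      change counit (R := ℂ) (D.ofCovector 1) = 1
      rw [map_one, Bialgebra.counit_one]
    counit_generator := fun i => by
      change counit (R := ℂ) (D.ofCovector (D.x i)) = 0
      rw [ofCovector_x, counit_p]
    counit_mul := fun v w => by
      change counit (R := ℂ) (D.ofCovector (v * w)) =
        counit (R := ℂ) (D.ofCovector v) * counit (R := ℂ) (D.ofCovector w)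
      rw [map_mul, Bialgebra.counit_mul] }

open Polynomial in
/-- The grading of `V*(R')`. -/
def covectorGrading : D.Covector →ₐ[ℂ] D.Covector[X] :=
  D.covectorLift (fun i => monomial 1 (D.x i)) (fun j l => by
    simp only [monomial_mul_monomial]
    rw [D.x_relation j l]
    simp only [map_sum, smul_monomial])

theorem covectorGrading_x (i : ι) :
    D.covectorGrading (D.x i) = Polynomial.monomial 1 (D.x i) := D.covectorLift_x _ _ i

theorem action_mem_span_pow (a : Extended A) (d : ℕ) :
    ∀ v ∈ Submodule.span ℂ (Set.range D.x) ^ d,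
      D.action (v ⊗ₜ a) ∈ Submodule.span ℂ (Set.range D.x) ^ d := by
  have h1 : ∀ v ∈ Submodule.span ℂ (Set.range D.x), ∀ a,
      D.action (v ⊗ₜ a) ∈ Submodule.span ℂ (Set.range D.x) := by
    intro v hv a
    induction hv using Submodule.span_induction with
    | mem v hv =>
      obtain ⟨i, rfl⟩ := hv
      rw [x_action]
      exact Submodule.sum_mem _ fun b _ => Submodule.smul_mem _ _ (Submodule.subset_span ⟨b, rfl⟩)
    | zero => simp
    | add x y _ _ hx hy => rw [add_tmul, map_add]; exact Submodule.add_mem _ hx hy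
    | smul c x _ hx => rw [← TensorProduct.smul_tmul', map_smul]; exact Submodule.smul_mem _ _ hx
  intro v hv
  induction hv using Submodule.pow_induction_on_left' generalizing a with
  | algebraMap c =>
    rw [Algebra.algebraMap_eq_smul_one, ← TensorProduct.smul_tmul', map_smul, one_action, pow_zero]
    exact Submodule.smul_mem _ _ (Submodule.smul_mem _ _ (Submodule.one_le.mp le_rfl))
  | add x y i _ _ hx hy => rw [add_tmul, map_add]; exact Submodule.add_mem _ (hx a) (hy a)
  | mem_mul m hm i x _ ih =>
    rw [mul_action, pow_succ']
    generalize comul (R := ℂ) a = z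
    induction z using TensorProduct.induction_on with
    | zero => simp
    | add x y hx hy => rw [map_add, map_add]; exact Submodule.add_mem _ hx hy
    | tmul b c => exact Submodule.mul_mem_mul (h1 m hm b) (ih c)

theorem action_g_of_mem_span_pow (d : ℕ) : ∀ v ∈ Submodule.span ℂ (Set.range D.x) ^ d,
    D.action (v ⊗ₜ D.g) = D.lam⁻¹ ^ d • v := by
  have h1 : ∀ v ∈ Submodule.span ℂ (Set.range D.x), D.action (v ⊗ₜ D.g) = D.lam⁻¹ • v := by
    intro v hv
    induction hv using Submodule.span_induction with
    | mem v hv => obtain ⟨i, rfl⟩ := hv; exact D.x_action_g i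
    | zero => simp
    | add x y _ _ hx hy => rw [add_tmul, map_add, hx, hy, smul_add]
    | smul c x _ hx => rw [← TensorProduct.smul_tmul', map_smul, hx, smul_comm]
  intro v hv
  induction hv using Submodule.pow_induction_on_left' with
  | algebraMap c =>
    rw [Algebra.algebraMap_eq_smul_one, ← TensorProduct.smul_tmul', map_smul, one_action, counit_g,
      pow_zero, one_smul, one_smul]
  | add x y i _ _ hx hy => rw [add_tmul, map_add, hx, hy, smul_add]
  | mem_mul m hm i x _ ih =>
    rw [mul_action, comul_g]
    simp only [TensorProduct.map_tmul, LinearMap.comp_apply, TensorProduct.mk_apply,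
      LinearMap.mul'_apply, h1 m hm, ih, smul_mul_assoc, mul_smul_comm, smul_smul, pow_succ]

theorem gradedDual_subset_covectorDual : gradedDual D.x ⊆ D.covectorDual := by
  intro b hb
  obtain ⟨K, h1, h2, h3, h4⟩ := exists_ideal_of_mem_gradedDual D.adjoin_x hb
  exact ⟨K, h1, h2, fun v hv a => h3 (D.action ∘ₗ (TensorProduct.mk ℂ _ _).flip a)
    (D.action_mem_span_pow a) v hv, h4⟩

theorem covectorDual_subset_gradedDual (h : ∀ m : ℕ, 0 < m → D.lam ^ m ≠ 1) :
    D.covectorDual ⊆ gradedDual D.x := by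
  rintro b ⟨K, _, h2, h3, h4⟩
  obtain ⟨N, hN⟩ := exists_forall_span_pow_le (c := D.lam⁻¹) (inv_ne_zero D.lam_ne_zero)
    (fun m hm => by rw [inv_pow]; exact inv_ne_one.mpr (h m hm))
    (D.action ∘ₗ (TensorProduct.mk ℂ _ _).flip D.g) D.action_g_of_mem_span_pow
    (K.restrictScalars ℂ) (fun v hv => h3 v hv D.g)
  exact ⟨N, fun d hd v hv => h4 v (hN d hd hv)⟩

theorem range_pair : Set.range D.bosonization.retract.pair = D.covectorDual := by
  rw [D.bosonization.range_pair (Extended.hasAntipode D.hasAntipode), bosonization_act]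
  rfl

theorem hasAntipode_poincare : HasAntipode D.Poincare := by
  refine D.bosonization.hasAntipode (Extended.hasAntipode D.hasAntipode)
    (D.bosonization.isUnit_toConv_j_π D.x D.adjoin_x D.tg fun k => ?_)
  change comul (R := ℂ) (D.ofCovector (D.x k)) =
    ∑ a, D.ofCovector (D.x a) ⊗ₜ[ℂ] D.incl (D.tg a k) + 1 ⊗ₜ[ℂ] D.ofCovector (D.x k)
  simp only [ofCovector_x, comul_p]

theorem dualIsSemidirect : D.DualIsSemidirect := by
  have hH := Extended.hasAntipode D.hasAntipode
  have hfin := D.bosonization.isFiniteFunctional_comp_j_π hH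
  refine ⟨D.bosonization.coalgebra, D.bosonization.semidirect, D.bosonization.retract.CoinvDual,
    inferInstance, inferInstance, (D.bosonization.dual hfin).coalgebra,
    (D.bosonization.dual hfin).semidirect, D.bosonization.retract.pair,
    D.isBraidedLinearCoproduct, D.bosonization_act, D.bosonization_coact,
    fun a v => D.bosonization.equiv_tmul a v, D.bosonization.retract.pair_injective, ?_,
    D.range_pair, ?_, ?_, D.bosonization.isDual hfin, D.hasAntipode_poincare,
    FiniteDual.hasAntipode D.hasAntipode_poincare⟩
  · intro v hv
    by_contra hne
    obtain ⟨b, hb, hbv⟩ :=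
      exists_mem_gradedDual_ne_zero D.adjoin_x D.covectorGrading D.covectorGrading_x hne
    obtain ⟨c, rfl⟩ := D.range_pair ▸ D.gradedDual_subset_covectorDual hb
    exact hbv (hv c)
  · rw [range_pair]
    exact D.gradedDual_subset_covectorDual
  · intro h
    rw [range_pair]
    exact (D.covectorDual_subset_gradedDual h).antisymm D.gradedDual_subset_covectorDual

end QuantumGroupData

end QPoincare
end

noncomputable section

universe u

namespace QPoincare

open Coalgebra TensorProduct

namespace QuantumGroupData

variable {ι : Type u} [Fintype ι] [DecidableEq ι] {A : Type*} [Ring A] [Bialgebra ℂ A]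
  (D : QuantumGroupData ι A)

theorem adjoin_leftX : Algebra.adjoin ℂ (Set.range D.leftX) = ⊤ := by
  have h : (RingQuot.mkAlgHom ℂ D.LeftVectorRel).range = ⊤ :=
    (AlgHom.range_eq_top _).mpr (RingQuot.mkAlgHom_surjective ℂ _)
  rw [← Algebra.map_top, ← FreeAlgebra.adjoin_range_ι, AlgHom.map_adjoin, ← Set.range_comp] at h
  exact h

theorem leftVector_ext {S : Type*} [Semiring S] [Algebra ℂ S] {F G : D.LeftVector →ₐ[ℂ] S}
    (h : ∀ i, F (D.leftX i) = G (D.leftX i)) : F = G := by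
  apply RingQuot.ringQuot_ext'
  apply FreeAlgebra.hom_ext
  funext i
  exact h i

theorem adjoin_leftPoincare :
    Algebra.adjoin ℂ (Set.range D.leftIncl ∪ Set.range D.leftP) = ⊤ := by
  have h : (RingQuot.mkAlgHom ℂ D.LeftPoincareRel).range = ⊤ :=
    (AlgHom.range_eq_top _).mpr (RingQuot.mkAlgHom_surjective ℂ _)
  rw [← Algebra.map_top, ← FreeAlgebra.adjoin_range_ι, AlgHom.map_adjoin, ← Set.range_comp] at h
  refine top_le_iff.mp (h.ge.trans (Algebra.adjoin_mono ?_))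
  rintro _ ⟨a | i, rfl⟩
  · exact Or.inl ⟨a, rfl⟩
  · exact Or.inr ⟨i, rfl⟩

theorem leftCoaction_x (i : ι) : D.leftCoaction (D.leftX i) = ∑ a, D.tg i a ⊗ₜ[ℂ] D.leftX a :=
  D.leftVectorLift_x _ _ i

theorem leftCoaction_coassoc (v : D.LeftVector) :
    (TensorProduct.assoc ℂ (Extended A) (Extended A) D.LeftVector).symm
      (LinearMap.lTensor (Extended A) D.leftCoaction.toLinearMap (D.leftCoaction v)) =
      LinearMap.rTensor D.LeftVector comul (D.leftCoaction v) := by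
  have h : ((Algebra.TensorProduct.assoc ℂ ℂ ℂ (Extended A) (Extended A)
        D.LeftVector).symm.toAlgHom.comp
        (Algebra.TensorProduct.map (AlgHom.id ℂ (Extended A)) D.leftCoaction)).comp
          D.leftCoaction =
      (Algebra.TensorProduct.map (Bialgebra.comulAlgHom ℂ (Extended A))
        (AlgHom.id ℂ D.LeftVector)).comp D.leftCoaction := by
    apply D.leftVector_ext
    intro j
    simp only [AlgHom.comp_apply, leftCoaction_x, map_sum, Algebra.TensorProduct.map_tmul,
      AlgHom.id_apply, Bialgebra.comulAlgHom_apply, comul_tg, TensorProduct.sum_tmul,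
      TensorProduct.tmul_sum]
    rw [Finset.sum_comm]
    rfl
  exact AlgHom.congr_fun h v

theorem leftCoaction_counit (v : D.LeftVector) : TensorProduct.lid ℂ D.LeftVector
    (LinearMap.rTensor D.LeftVector counit (D.leftCoaction v)) = v := by
  have h : ((Algebra.TensorProduct.lid ℂ D.LeftVector).toAlgHom.comp
        (Algebra.TensorProduct.map (Bialgebra.counitAlgHom ℂ (Extended A))
        (AlgHom.id ℂ D.LeftVector))).comp D.leftCoaction = AlgHom.id ℂ _ := by
    apply D.leftVector_ext
    intro j
    simp [leftCoaction_x, counit_tg]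
  exact AlgHom.congr_fun h v

theorem leftAction_tmul (a : Extended A) (v : D.LeftVector) : D.leftAction (a ⊗ₜ v) =
    leftContract D.LeftVector (pairWith D.form a) (D.leftCoaction v) := by
  change TensorProduct.lid ℂ D.LeftVector (LinearMap.rTensor D.LeftVector
    (D.form ∘ₗ (TensorProduct.comm ℂ (Extended A) (Extended A)).toLinearMap)
    ((TensorProduct.assoc ℂ (Extended A) (Extended A) D.LeftVector).symm
      (a ⊗ₜ D.leftCoaction v))) = _
  generalize D.leftCoaction v = z
  induction z using TensorProduct.induction_on with
  | zero => simp
  | add x y hx hy => simp only [map_add, tmul_add, hx, hy]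
  | tmul x y => simp

theorem one_leftAction (v : D.LeftVector) : D.leftAction (1 ⊗ₜ v) = v := by
  rw [leftAction_tmul, D.isSkewPairing_form.pairWith_one]
  exact D.leftCoaction_counit v

theorem leftAction_one (a : Extended A) :
    D.leftAction (a ⊗ₜ 1) = counit (R := ℂ) a • (1 : D.LeftVector) := by
  rw [leftAction_tmul, map_one, Algebra.TensorProduct.one_def, leftContract_tmul, pairWith_apply,
    D.isSkewPairing_form.one_left]

theorem leftAction_leftAction (v : D.LeftVector) (a b : Extended A) :
    D.leftAction ((a * b) ⊗ₜ v) = D.leftAction (a ⊗ₜ D.leftAction (b ⊗ₜ v)) := by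
  rw [leftAction_tmul, D.isSkewPairing_form.pairWith_mul, leftAction_tmul, leftAction_tmul]
  exact (leftContract_comp (δ := D.leftCoaction.toLinearMap)
    (fun v => (LinearEquiv.symm_apply_eq _).mp (D.leftCoaction_coassoc v)) _ _ v).symm

theorem leftAction_mul (v w : D.LeftVector) (a : Extended A) : D.leftAction (a ⊗ₜ (v * w)) =
    LinearMap.mul' ℂ D.LeftVector
      (map (D.leftAction ∘ₗ (TensorProduct.mk ℂ (Extended A) D.LeftVector).flip v)
        (D.leftAction ∘ₗ (TensorProduct.mk ℂ (Extended A) D.LeftVector).flip w) (comul a)) := by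
  have e : ∀ v, D.leftAction ∘ₗ (TensorProduct.mk ℂ (Extended A) D.LeftVector).flip v =
      (leftContract D.LeftVector ∘ₗ pairWith D.form).flip (D.leftCoaction v) :=
    fun v => LinearMap.ext fun a => D.leftAction_tmul a v
  rw [leftAction_tmul, map_mul, D.isSkewPairing_form.leftContract_mul, e, e]

theorem leftAction_x (i : ι) (a : Extended A) :
    D.leftAction (a ⊗ₜ D.leftX i) = ∑ b, D.form (D.tg i b ⊗ₜ a) • D.leftX b := by
  simp [leftAction_tmul, leftCoaction_x]

theorem g_leftAction_x (i : ι) : D.leftAction (D.g ⊗ₜ D.leftX i) = D.lam⁻¹ • D.leftX i := by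
  simp [leftAction_x, form_tg_g]

theorem text_leftAction_x (i k l : ι) : D.leftAction (D.text k l ⊗ₜ D.leftX i) =
    D.lam • ∑ b, D.R (i, k) (b, l) • D.leftX b := by
  simp [leftAction_x, form_tg_text, Finset.smul_sum, smul_smul]

/-- The left action as an algebra map to the endomorphisms of the left-handed vector algebra. -/
def leftActionHom : Extended A →ₐ[ℂ] Module.End ℂ D.LeftVector :=
  AlgHom.ofLinearMap
    { toFun := fun a => D.leftAction ∘ₗ TensorProduct.mk ℂ (Extended A) D.LeftVector a
      map_add' := fun x y => LinearMap.ext fun v => by simp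
      map_smul' := fun x y => LinearMap.ext fun v => by simp }
    (LinearMap.ext fun v => D.one_leftAction v)
    (fun x y => LinearMap.ext fun v => D.leftAction_leftAction v x y)

theorem leftActionHom_apply (a : Extended A) (v : D.LeftVector) :
    D.leftActionHom a v = D.leftAction (a ⊗ₜ v) := rfl

/-- The left module structure of the left-handed vector algebra over the left-handed
`q`-Poincaré group. -/
def leftPoincareMod : D.LeftPoincare →ₐ[ℂ] Module.End ℂ D.LeftVector :=
  D.leftPoincareLift D.leftActionHom (fun i => LinearMap.mulLeft ℂ (D.leftX i))
    (fun i k => LinearMap.ext fun v => by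
      simp only [Module.End.mul_apply, LinearMap.mulLeft_apply, ← mul_assoc,
        LinearMap.sum_apply, LinearMap.smul_apply]
      rw [← D.leftX_relation i k]
      simp only [Finset.sum_mul, smul_mul_assoc])
    (fun i => LinearMap.ext fun v => by
      simp only [Module.End.mul_apply, LinearMap.mulLeft_apply, leftActionHom_apply,
        LinearMap.smul_apply]
      rw [leftAction_mul, comul_g]
      simp [g_leftAction_x])
    (fun i k l => LinearMap.ext fun v => by
      simp only [Module.End.mul_apply, LinearMap.mulLeft_apply, leftActionHom_apply,
        LinearMap.smul_apply, LinearMap.sum_apply]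
      rw [leftAction_mul, comul_text]
      simp only [map_sum, TensorProduct.map_tmul, LinearMap.comp_apply, LinearMap.flip_apply,
        TensorProduct.mk_apply, LinearMap.mul'_apply, text_leftAction_x, smul_mul_assoc,
        Finset.sum_mul, ← Finset.smul_sum]
      rw [Finset.sum_comm])

theorem leftPoincareMod_incl (a : Extended A) (v : D.LeftVector) :
    D.leftPoincareMod (D.leftIncl a) v = D.leftAction (a ⊗ₜ v) :=
  LinearMap.congr_fun (D.leftPoincareLift_incl _ _ _ _ _ a) v

theorem leftPoincareMod_p (i : ι) (v : D.LeftVector) :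
    D.leftPoincareMod (D.leftP i) v = D.leftX i * v :=
  LinearMap.congr_fun (D.leftPoincareLift_p _ _ _ _ _ i) v

theorem ofLeftVector_x (i : ι) : D.ofLeftVector (D.leftX i) = D.leftP i :=
  D.leftVectorLift_x _ _ i

theorem leftPoincareMod_ofLeftVector (v w : D.LeftVector) :
    D.leftPoincareMod (D.ofLeftVector w) v = w * v := by
  have hw : w ∈ Algebra.adjoin ℂ (Set.range D.leftX) := D.adjoin_leftX ▸ Algebra.mem_top
  induction hw using Algebra.adjoin_induction generalizing v with
  | mem w hw => obtain ⟨i, rfl⟩ := hw; rw [ofLeftVector_x, leftPoincareMod_p]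
  | algebraMap c =>
    rw [AlgHom.commutes, AlgHom.commutes, ← Algebra.smul_def]
    rfl
  | add x y _ _ hx hy => simp [hx, hy, add_mul]
  | mul x y _ _ hx hy => simp [hx, hy, mul_assoc]

/-- The projection of the left-handed `q`-Poincaré group onto the left-handed vector algebra. -/
def leftVectorProj : D.LeftPoincare →ₗ[ℂ] D.LeftVector :=
  LinearMap.applyₗ 1 ∘ₗ D.leftPoincareMod.toLinearMap

theorem leftVectorProj_apply (x : D.LeftPoincare) :
    D.leftVectorProj x = D.leftPoincareMod x 1 := rfl

theorem leftVectorProj_ofLeftVector (v : D.LeftVector) :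
    D.leftVectorProj (D.ofLeftVector v) = v := by
  rw [leftVectorProj_apply, leftPoincareMod_ofLeftVector, mul_one]

theorem leftVectorProj_mul_incl (x : D.LeftPoincare) (a : Extended A) :
    D.leftVectorProj (x * D.leftIncl a) = counit (R := ℂ) a • D.leftVectorProj x := by
  rw [leftVectorProj_apply, map_mul, Module.End.mul_apply, leftPoincareMod_incl,
    leftAction_one, map_smul]
  rfl

/-- The projection of the left-handed `q`-Poincaré group onto `Ã`. -/
def leftExtendedProj : D.LeftPoincare →ₐ[ℂ] Extended A :=
  D.leftPoincareLift (AlgHom.id ℂ _) (fun _ => 0) (fun j l => by simp) (by simp) (by simp)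

theorem leftExtendedProj_incl (a : Extended A) : D.leftExtendedProj (D.leftIncl a) = a :=
  D.leftPoincareLift_incl _ _ _ _ _ a

theorem leftExtendedProj_p (i : ι) : D.leftExtendedProj (D.leftP i) = 0 :=
  D.leftPoincareLift_p _ _ _ _ _ i

theorem comul_leftIncl (a : Extended A) : comul (R := ℂ) (D.leftIncl a) =
    map D.leftIncl.toLinearMap D.leftIncl.toLinearMap (comul a) := D.leftPoincareComul_incl a

theorem counit_leftIncl (a : Extended A) : counit (R := ℂ) (D.leftIncl a) = counit (R := ℂ) a :=
  D.leftPoincareCounit_incl a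

theorem comul_leftP (j : ι) : comul (R := ℂ) (D.leftP j) =
    ∑ a, D.leftIncl (D.tg j a) ⊗ₜ[ℂ] D.leftP a + D.leftP j ⊗ₜ[ℂ] (1 : D.LeftPoincare) :=
  D.leftPoincareComul_p j

theorem counit_leftP (j : ι) : counit (R := ℂ) (D.leftP j) = 0 := D.leftPoincareCounit_p j

theorem comul_leftExtendedProj (x : D.LeftPoincare) : comul (R := ℂ) (D.leftExtendedProj x) =
    map D.leftExtendedProj.toLinearMap D.leftExtendedProj.toLinearMap (comul x) := by
  have h : (Bialgebra.comulAlgHom ℂ (Extended A)).comp D.leftExtendedProj =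
      (Algebra.TensorProduct.map D.leftExtendedProj D.leftExtendedProj).comp
        (Bialgebra.comulAlgHom ℂ D.LeftPoincare) := by
    apply D.leftPoincare_ext
    · intro a
      simp only [AlgHom.comp_apply, Bialgebra.comulAlgHom_apply, comul_leftIncl,
        leftExtendedProj_incl]
      generalize comul (R := ℂ) a = z
      induction z using TensorProduct.induction_on with
      | zero => simp
      | add x y hx hy => simp only [map_add]; rw [← hx, ← hy]
      | tmul x y => simp [leftExtendedProj_incl]
    · intro i
      simp [comul_leftP, leftExtendedProj_p]
  exact AlgHom.congr_fun h x

theorem counit_leftExtendedProj (x : D.LeftPoincare) :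
    counit (R := ℂ) (D.leftExtendedProj x) = counit (R := ℂ) x := by
  have h : (Bialgebra.counitAlgHom ℂ (Extended A)).comp D.leftExtendedProj =
      Bialgebra.counitAlgHom ℂ D.LeftPoincare := by
    apply D.leftPoincare_ext
    · intro a
      simp [counit_leftIncl, leftExtendedProj_incl]
    · intro i
      simp [counit_leftP, leftExtendedProj_p]
  exact AlgHom.congr_fun h x

theorem leftExtendedProj_coinvariant (v : D.LeftVector) :
    map LinearMap.id D.leftExtendedProj.toLinearMap (comul (D.ofLeftVector v)) =
      D.ofLeftVector v ⊗ₜ[ℂ] 1 := by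
  have h : ((Algebra.TensorProduct.map (AlgHom.id ℂ D.LeftPoincare) D.leftExtendedProj).comp
      (Bialgebra.comulAlgHom ℂ D.LeftPoincare)).comp D.ofLeftVector =
      Algebra.TensorProduct.includeLeft.comp D.ofLeftVector := by
    apply D.leftVector_ext
    intro i
    simp [ofLeftVector_x, comul_leftP, leftExtendedProj_p]
  exact AlgHom.congr_fun h v

theorem map_leftExtendedProj_comul_ofLeftVector (v : D.LeftVector) :
    map D.leftExtendedProj.toLinearMap LinearMap.id (comul (D.ofLeftVector v)) =
      map LinearMap.id D.ofLeftVector.toLinearMap (D.leftCoaction v) := by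
  have h : ((Algebra.TensorProduct.map D.leftExtendedProj (AlgHom.id ℂ D.LeftPoincare)).comp
      (Bialgebra.comulAlgHom ℂ D.LeftPoincare)).comp D.ofLeftVector =
      (Algebra.TensorProduct.map (AlgHom.id ℂ (Extended A)) D.ofLeftVector).comp
        D.leftCoaction := by
    apply D.leftVector_ext
    intro i
    simp [ofLeftVector_x, comul_leftP, leftExtendedProj_p, leftExtendedProj_incl, leftCoaction_x]
  exact AlgHom.congr_fun h v

theorem comul_ofLeftVector_mem (v : D.LeftVector) : comul (R := ℂ) (D.ofLeftVector v) ∈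
    (Algebra.TensorProduct.map (AlgHom.id ℂ D.LeftPoincare) D.ofLeftVector).range := by
  have hv : v ∈ Algebra.adjoin ℂ (Set.range D.leftX) := D.adjoin_leftX ▸ Algebra.mem_top
  have h : Algebra.adjoin ℂ (Set.range D.leftX) ≤
      (Algebra.TensorProduct.map (AlgHom.id ℂ D.LeftPoincare) D.ofLeftVector).range.comap
        ((Bialgebra.comulAlgHom ℂ D.LeftPoincare).comp D.ofLeftVector) := by
    refine Algebra.adjoin_le ?_
    rintro _ ⟨i, rfl⟩
    refine ⟨∑ a, D.leftIncl (D.tg i a) ⊗ₜ[ℂ] D.leftX a + D.leftP i ⊗ₜ[ℂ] 1, ?_⟩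
    simp [ofLeftVector_x, comul_leftP]
  exact h hv

theorem incl_mul_leftP_mem (a : Extended A) : ∀ i, D.leftIncl a * D.leftP i ∈
    Submodule.span ℂ {x | ∃ b k, x = D.leftP k * D.leftIncl b} := by
  have gen : ∀ b k, D.leftP k * D.leftIncl b ∈
      Submodule.span ℂ {x | ∃ b k, x = D.leftP k * D.leftIncl b} :=
    fun b k => Submodule.subset_span ⟨b, k, rfl⟩
  refine D.extended_induction (p := fun a => ∀ i, D.leftIncl a * D.leftP i ∈
    Submodule.span ℂ {x | ∃ b k, x = D.leftP k * D.leftIncl b}) a (fun c i => ?_)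
    (fun x y hx hy i => ?_) (fun x y hx hy i => ?_)
    (fun k l i => ?_) (fun i => ?_) (fun i => ?_)
  · rw [AlgHom.commutes, ← Algebra.smul_def]
    exact Submodule.smul_mem _ _ (by simpa using gen 1 i)
  · rw [map_add, add_mul]
    exact Submodule.add_mem _ (hx i) (hy i)
  · rw [map_mul, mul_assoc]
    refine Submodule.span_induction (p := fun z _ => D.leftIncl x * z ∈ _) ?_ (by simp)
      (fun u v _ _ hu hv => by rw [mul_add]; exact Submodule.add_mem _ hu hv)
      (fun c u _ hu => by rw [mul_smul_comm]; exact Submodule.smul_mem _ _ hu) (hy i)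
    rintro _ ⟨b, k, rfl⟩
    rw [← mul_assoc]
    refine Submodule.span_induction (p := fun z _ => z * D.leftIncl b ∈ _) ?_ (by simp)
      (fun u v _ _ hu hv => by rw [add_mul]; exact Submodule.add_mem _ hu hv)
      (fun c u _ hu => by rw [smul_mul_assoc]; exact Submodule.smul_mem _ _ hu) (hx k)
    rintro _ ⟨c, l, rfl⟩
    rw [mul_assoc, ← map_mul]
    exact gen _ _
  · rw [t_mul_leftP]
    exact Submodule.smul_mem _ _ (Submodule.sum_mem _ fun b _ => Submodule.sum_mem _ fun a _ =>
      Submodule.smul_mem _ _ (gen _ _))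
  · rw [g_mul_leftP]
    exact Submodule.smul_mem _ _ (gen _ _)
  · have e : D.leftIncl (Extended.elt 1 (-1)) * D.leftP i =
        D.lam • (D.leftP i * D.leftIncl (Extended.elt 1 (-1))) := by
      have e1 : D.g * Extended.elt 1 (-1) = 1 := by
        rw [g, Extended.elt_mul, one_mul, ← Extended.elt_one]; rfl
      have e2 : Extended.elt 1 (-1) * D.g = 1 := by
        rw [g, Extended.elt_mul, one_mul, ← Extended.elt_one]; rfl
      have h := congrArg (fun z => D.leftIncl (Extended.elt 1 (-1)) * z *
        D.leftIncl (Extended.elt 1 (-1))) (D.g_mul_leftP i)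
      simp only [mul_smul_comm, smul_mul_assoc] at h
      have h1 : D.leftIncl (Extended.elt 1 (-1)) * (D.leftP i * D.leftIncl D.g) *
          D.leftIncl (Extended.elt 1 (-1)) = D.leftIncl (Extended.elt 1 (-1)) * D.leftP i := by
        rw [mul_assoc, mul_assoc, ← map_mul D.leftIncl D.g, e1, map_one, mul_one]
      have h2 : D.leftIncl (Extended.elt 1 (-1)) * (D.leftIncl D.g * D.leftP i) *
          D.leftIncl (Extended.elt 1 (-1)) = D.leftP i * D.leftIncl (Extended.elt 1 (-1)) := by
        rw [← mul_assoc (D.leftIncl _), ← map_mul D.leftIncl _ D.g, e2, map_one, one_mul]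
      rw [h1, h2] at h
      rw [h, smul_smul, mul_inv_cancel₀ D.lam_ne_zero, one_smul]
    rw [e]
    exact Submodule.smul_mem _ _ (gen _ _)

theorem span_ofLeftVector_mul_incl (x : D.LeftPoincare) :
    x ∈ Submodule.span ℂ {y | ∃ a v, y = D.ofLeftVector v * D.leftIncl a} := by
  have gen : ∀ b k, D.ofLeftVector k * D.leftIncl b ∈
      Submodule.span ℂ {y | ∃ a v, y = D.ofLeftVector v * D.leftIncl a} :=
    fun b k => Submodule.subset_span ⟨b, k, rfl⟩
  have hx : x ∈ Algebra.adjoin ℂ (Set.range D.leftIncl ∪ Set.range D.leftP) :=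
    D.adjoin_leftPoincare ▸ Algebra.mem_top
  suffices h : ∀ y ∈ Submodule.span ℂ {y | ∃ a v, y = D.ofLeftVector v * D.leftIncl a},
      y * x ∈ Submodule.span ℂ {y | ∃ a v, y = D.ofLeftVector v * D.leftIncl a} by
    simpa using h 1 (by simpa using gen 1 1)
  induction hx using Algebra.adjoin_induction with
  | mem x hx =>
    intro y hy
    refine Submodule.span_induction (p := fun z _ => z * x ∈ _) ?_ (by simp)
      (fun u v _ _ hu hv => by rw [add_mul]; exact Submodule.add_mem _ hu hv)
      (fun c u _ hu => by rw [smul_mul_assoc]; exact Submodule.smul_mem _ _ hu) hy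
    rintro _ ⟨b, v, rfl⟩
    rcases hx with ⟨a, rfl⟩ | ⟨i, rfl⟩
    · rw [mul_assoc, ← map_mul]
      exact gen _ _
    · rw [mul_assoc]
      refine Submodule.span_induction (p := fun z _ => D.ofLeftVector v * z ∈ _) ?_ (by simp)
        (fun u v _ _ hu hv => by rw [mul_add]; exact Submodule.add_mem _ hu hv)
        (fun c u _ hu => by rw [mul_smul_comm]; exact Submodule.smul_mem _ _ hu)
        (D.incl_mul_leftP_mem b i)
      rintro _ ⟨c, l, rfl⟩
      rw [← mul_assoc, ← ofLeftVector_x, ← map_mul]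
      exact gen _ _
  | algebraMap c =>
    intro y hy
    rw [← Algebra.commutes, ← Algebra.smul_def]
    exact Submodule.smul_mem _ _ hy
  | add a b _ _ ha hb =>
    intro y hy
    rw [mul_add]
    exact Submodule.add_mem _ (ha y hy) (hb y hy)
  | mul a b _ _ ha hb =>
    intro y hy
    rw [← mul_assoc]
    exact hb _ (ha y hy)

theorem leftPoincare_factor (x : D.LeftPoincare) : LinearMap.mul' ℂ D.LeftPoincare
    (map (D.ofLeftVector.toLinearMap ∘ₗ D.leftVectorProj)
      (D.leftIncl.toLinearMap ∘ₗ D.leftExtendedProj.toLinearMap) (comul x)) = x := by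
  have hx := D.span_ofLeftVector_mul_incl x
  induction hx using Submodule.span_induction with
  | zero => simp
  | add a b _ _ ha hb => simp only [map_add, ha, hb]
  | smul c a _ ha => simp only [map_smul, ha]
  | mem x hx =>
    obtain ⟨a, v, rfl⟩ := hx
    have key : ∀ (w : Extended A ⊗[ℂ] Extended A) (z : D.LeftPoincare ⊗[ℂ] D.LeftPoincare),
        map (D.ofLeftVector.toLinearMap ∘ₗ D.leftVectorProj)
          (D.leftIncl.toLinearMap ∘ₗ D.leftExtendedProj.toLinearMap)
          (z * map D.leftIncl.toLinearMap D.leftIncl.toLinearMap w) =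
        map (D.ofLeftVector.toLinearMap ∘ₗ D.leftVectorProj) D.leftIncl.toLinearMap
          (map LinearMap.id D.leftExtendedProj.toLinearMap z) *
        (1 ⊗ₜ D.leftIncl (TensorProduct.lid ℂ _ (LinearMap.rTensor _ counit w))) := by
      intro w z
      induction w using TensorProduct.induction_on with
      | zero => simp
      | add x y hx hy => simp only [map_add, mul_add, tmul_add, hx, hy]
      | tmul x y =>
        induction z using TensorProduct.induction_on with
        | zero => simp
        | add x y hx hy => simp only [map_add, add_mul, hx, hy]
        | tmul u v =>
          simp [leftExtendedProj_incl, leftVectorProj_mul_incl, tmul_smul, smul_tmul']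
    rw [Bialgebra.comul_mul, comul_leftIncl, key, leftExtendedProj_coinvariant]
    simp [leftVectorProj_ofLeftVector]

/-- The left-handed `q`-Poincaré group as a bosonization. -/
def leftBosonization : LeftBosonization (Extended A) D.LeftVector D.LeftPoincare where
  i := D.leftIncl
  σ := D.leftExtendedProj
  j := D.ofLeftVector
  π := D.leftVectorProj
  comul_i := D.comul_leftIncl
  counit_i := D.counit_leftIncl
  comul_σ := D.comul_leftExtendedProj
  counit_σ := D.counit_leftExtendedProj
  σ_i := D.leftExtendedProj_incl
  π_j := D.leftVectorProj_ofLeftVector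
  π_mul_i := D.leftVectorProj_mul_incl
  π_mul x y := by
    rw [leftVectorProj_apply, map_mul, Module.End.mul_apply, leftPoincareMod_ofLeftVector,
      mul_one, leftVectorProj_apply, leftVectorProj_apply, map_mul]
    rfl
  coinv := D.leftExtendedProj_coinvariant
  coideal v := by
    obtain ⟨z, hz⟩ := D.comul_ofLeftVector_mem v
    rw [← hz]
    clear hz
    change TensorProduct.map _ _ (Algebra.TensorProduct.map _ _ z) = Algebra.TensorProduct.map _ _ z
    induction z using TensorProduct.induction_on with
    | zero => simp
    | add x y hx hy => simp only [map_add, hx, hy]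
    | tmul x y => simp [leftVectorProj_ofLeftVector]
  factor := D.leftPoincare_factor

theorem leftBosonization_act : D.leftBosonization.act = D.leftAction := by
  apply TensorProduct.ext'
  intro a v
  rw [LeftBosonization.act_tmul]
  change D.leftVectorProj (D.leftIncl a * D.ofLeftVector v) = _
  rw [leftVectorProj_apply, map_mul, Module.End.mul_apply, leftPoincareMod_ofLeftVector,
    mul_one, leftPoincareMod_incl]

theorem leftBosonization_coact : D.leftBosonization.coact = D.leftCoaction.toLinearMap := by
  ext v
  rw [LeftBosonization.coact_apply]
  change TensorProduct.map D.leftExtendedProj.toLinearMap D.leftVectorProj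
    (comul (D.ofLeftVector v)) = _
  have h : TensorProduct.map D.leftExtendedProj.toLinearMap D.leftVectorProj =
      TensorProduct.map LinearMap.id D.leftVectorProj ∘ₗ
        TensorProduct.map D.leftExtendedProj.toLinearMap LinearMap.id := by
    rw [← TensorProduct.map_comp, LinearMap.comp_id, LinearMap.id_comp]
  rw [h, LinearMap.comp_apply, map_leftExtendedProj_comul_ofLeftVector, AlgHom.toLinearMap_apply]
  generalize D.leftCoaction v = z
  induction z using TensorProduct.induction_on with
  | zero => simp
  | add x y hx hy => simp only [map_add, hx, hy]
  | tmul x y => simp [leftVectorProj_ofLeftVector]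

theorem leftBraiding_tmul (v w : D.LeftVector) : D.leftBraiding (v ⊗ₜ w) =
    LinearMap.rTensor D.LeftVector
      (D.leftAction ∘ₗ (TensorProduct.mk ℂ (Extended A) D.LeftVector).flip w)
      (D.leftCoaction v) := by
  change TensorProduct.lid ℂ _ (TensorProduct.map
    (D.form ∘ₗ (TensorProduct.comm ℂ (Extended A) (Extended A)).toLinearMap)
    (TensorProduct.comm ℂ D.LeftVector D.LeftVector).toLinearMap
    (TensorProduct.tensorTensorTensorComm ℂ (Extended A) D.LeftVector (Extended A)
      D.LeftVector (D.leftCoaction v ⊗ₜ D.leftCoaction w))) = _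
  generalize D.leftCoaction v = z
  induction z using TensorProduct.induction_on with
  | zero => simp
  | add x y hx hy => simp only [map_add, add_tmul, hx, hy]
  | tmul a v =>
    rw [LinearMap.rTensor_tmul, LinearMap.comp_apply, LinearMap.flip_apply,
      TensorProduct.mk_apply, leftAction_tmul]
    generalize D.leftCoaction w = z
    induction z using TensorProduct.induction_on with
    | zero => simp
    | add x y hx hy => simp only [map_add, tmul_add, add_tmul, hx, hy]
    | tmul b w => simp [smul_tmul']

theorem isBraidedLinearCoproduct_left : let := D.leftBosonization.coalgebra
    IsBraidedLinearCoproduct D.leftBraiding D.leftX :=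
  letI := D.leftBosonization.coalgebra
  { comul_one := by
      change TensorProduct.map D.leftVectorProj D.leftVectorProj (comul (D.ofLeftVector 1)) = _
      have h : D.leftVectorProj 1 = 1 := D.leftBosonization.π_one
      rw [map_one, Bialgebra.comul_one, Algebra.TensorProduct.one_def, TensorProduct.map_tmul, h]
    comul_generator := fun i => by
      change TensorProduct.map D.leftVectorProj D.leftVectorProj
        (comul (D.ofLeftVector (D.leftX i))) = _
      have h : D.leftVectorProj 1 = 1 := D.leftBosonization.π_one
      have hp : ∀ j, D.leftVectorProj (D.leftP j) = D.leftX j := fun j => by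
        rw [← ofLeftVector_x, leftVectorProj_ofLeftVector]
      have hi : ∀ a, D.leftVectorProj (D.leftIncl a) =
          counit (R := ℂ) a • (1 : D.LeftVector) := D.leftBosonization.π_i
      rw [ofLeftVector_x, comul_leftP]
      simp [h, hp, hi, counit_tg, ite_smul, ite_tmul, add_comm]
    comul_mul := D.leftBosonization.comulB_mul D.leftBraiding fun v w => by
      rw [leftBosonization_act, leftBosonization_coact]
      exact D.leftBraiding_tmul v w
    counit_one := by
      change counit (R := ℂ) (D.ofLeftVector 1) = 1
      rw [map_one, Bialgebra.counit_one]
    counit_generator := fun i => by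
      change counit (R := ℂ) (D.ofLeftVector (D.leftX i)) = 0
      rw [ofLeftVector_x, counit_leftP]
    counit_mul := fun v w => by
      change counit (R := ℂ) (D.ofLeftVector (v * w)) =
        counit (R := ℂ) (D.ofLeftVector v) * counit (R := ℂ) (D.ofLeftVector w)
      rw [map_mul, Bialgebra.counit_mul] }

open Polynomial in
/-- The grading of the left-handed vector algebra. -/
def leftVectorGrading : D.LeftVector →ₐ[ℂ] D.LeftVector[X] :=
  D.leftVectorLift (fun i => monomial 1 (D.leftX i)) (fun i k => by
    simp only [monomial_mul_monomial]
    rw [← D.leftX_relation i k]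
    simp only [map_sum, smul_monomial])

theorem leftVectorGrading_x (i : ι) :
    D.leftVectorGrading (D.leftX i) = Polynomial.monomial 1 (D.leftX i) :=
  D.leftVectorLift_x _ _ i

theorem leftAction_mem_span_pow (a : Extended A) (d : ℕ) :
    ∀ v ∈ Submodule.span ℂ (Set.range D.leftX) ^ d,
    D.leftAction (a ⊗ₜ v) ∈ Submodule.span ℂ (Set.range D.leftX) ^ d := by
  have h1 : ∀ v ∈ Submodule.span ℂ (Set.range D.leftX), ∀ a,
      D.leftAction (a ⊗ₜ v) ∈ Submodule.span ℂ (Set.range D.leftX) := by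
    intro v hv a
    induction hv using Submodule.span_induction with
    | mem v hv =>
      obtain ⟨i, rfl⟩ := hv
      rw [leftAction_x]
      exact Submodule.sum_mem _ fun b _ => Submodule.smul_mem _ _ (Submodule.subset_span ⟨b, rfl⟩)
    | zero => simp
    | add x y _ _ hx hy => rw [tmul_add, map_add]; exact Submodule.add_mem _ hx hy
    | smul c x _ hx => rw [TensorProduct.tmul_smul, map_smul]; exact Submodule.smul_mem _ _ hx
  intro v hv
  induction hv using Submodule.pow_induction_on_left' generalizing a with
  | algebraMap c =>
    rw [Algebra.algebraMap_eq_smul_one, TensorProduct.tmul_smul, map_smul, leftAction_one, pow_zero]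
    exact Submodule.smul_mem _ _ (Submodule.smul_mem _ _ (Submodule.one_le.mp le_rfl))
  | add x y i _ _ hx hy => rw [tmul_add, map_add]; exact Submodule.add_mem _ (hx a) (hy a)
  | mem_mul m hm i x _ ih =>
    rw [leftAction_mul, pow_succ']
    generalize comul (R := ℂ) a = z
    induction z using TensorProduct.induction_on with
    | zero => simp
    | add x y hx hy => rw [map_add, map_add]; exact Submodule.add_mem _ hx hy
    | tmul b c => exact Submodule.mul_mem_mul (h1 m hm b) (ih c)

theorem g_leftAction_of_mem_span_pow (d : ℕ) :
    ∀ v ∈ Submodule.span ℂ (Set.range D.leftX) ^ d,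
    D.leftAction (D.g ⊗ₜ v) = D.lam⁻¹ ^ d • v := by
  have h1 : ∀ v ∈ Submodule.span ℂ (Set.range D.leftX),
      D.leftAction (D.g ⊗ₜ v) = D.lam⁻¹ • v := by
    intro v hv
    induction hv using Submodule.span_induction with
    | mem v hv => obtain ⟨i, rfl⟩ := hv; exact D.g_leftAction_x i
    | zero => simp
    | add x y _ _ hx hy => rw [tmul_add, map_add, hx, hy, smul_add]
    | smul c x _ hx => rw [TensorProduct.tmul_smul, map_smul, hx, smul_comm]
  intro v hv
  induction hv using Submodule.pow_induction_on_left' with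
  | algebraMap c =>
    rw [Algebra.algebraMap_eq_smul_one, TensorProduct.tmul_smul, map_smul, leftAction_one,
      counit_g, pow_zero, one_smul, one_smul]
  | add x y i _ _ hx hy => rw [tmul_add, map_add, hx, hy, smul_add]
  | mem_mul m hm i x _ ih =>
    rw [leftAction_mul, comul_g]
    simp only [TensorProduct.map_tmul, LinearMap.comp_apply, LinearMap.flip_apply,
      TensorProduct.mk_apply, LinearMap.mul'_apply, h1 m hm, ih, smul_mul_assoc, mul_smul_comm,
      smul_smul, pow_succ]

theorem gradedDual_subset_leftVectorDual : gradedDual D.leftX ⊆ D.leftVectorDual := by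
  intro b hb
  obtain ⟨K, h1, h2, h3, h4⟩ := exists_ideal_of_mem_gradedDual D.adjoin_leftX hb
  exact ⟨K, h1, h2, fun v hv a => h3 (D.leftAction ∘ₗ TensorProduct.mk ℂ _ _ a)
    (D.leftAction_mem_span_pow a) v hv, h4⟩

theorem leftVectorDual_subset_gradedDual (h : ∀ m : ℕ, 0 < m → D.lam ^ m ≠ 1) :
    D.leftVectorDual ⊆ gradedDual D.leftX := by
  rintro b ⟨K, _, h2, h3, h4⟩
  obtain ⟨N, hN⟩ := exists_forall_span_pow_le (c := D.lam⁻¹) (inv_ne_zero D.lam_ne_zero)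
    (fun m hm => by rw [inv_pow]; exact inv_ne_one.mpr (h m hm))
    (D.leftAction ∘ₗ TensorProduct.mk ℂ _ _ D.g) D.g_leftAction_of_mem_span_pow
    (K.restrictScalars ℂ) (fun v hv => h3 v hv D.g)
  exact ⟨N, fun d hd v hv => h4 v (hN d hd hv)⟩

theorem range_left_pair : Set.range D.leftBosonization.retract.pair = D.leftVectorDual := by
  rw [D.leftBosonization.range_pair (Extended.hasAntipode D.hasAntipode), leftBosonization_act]
  rfl

theorem hasAntipode_leftPoincare : HasAntipode D.LeftPoincare := by
  refine D.leftBosonization.hasAntipode (Extended.hasAntipode D.hasAntipode)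
    (D.leftBosonization.isUnit_toConv_j_π D.leftX D.adjoin_leftX D.tg fun k => ?_)
  change comul (R := ℂ) (D.ofLeftVector (D.leftX k)) =
    ∑ a, D.leftIncl (D.tg k a) ⊗ₜ[ℂ] D.ofLeftVector (D.leftX a) +
      D.ofLeftVector (D.leftX k) ⊗ₜ[ℂ] 1
  simp only [ofLeftVector_x, comul_leftP]

theorem leftDualIsSemidirect : D.LeftDualIsSemidirect := by
  have hH := Extended.hasAntipode D.hasAntipode
  have hfin := D.leftBosonization.isFiniteFunctional_comp_j_π hH
  refine ⟨D.leftBosonization.coalgebra, D.leftBosonization.semidirect,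
    D.leftBosonization.retract.CoinvDual, inferInstance, inferInstance,
    (D.leftBosonization.dual hfin).coalgebra,
    (D.leftBosonization.dual hfin).semidirect, D.leftBosonization.retract.pair,
    D.isBraidedLinearCoproduct_left, D.leftBosonization_act, D.leftBosonization_coact,
    fun a v => D.leftBosonization.equiv_tmul v a, D.leftBosonization.retract.pair_injective, ?_,
    D.range_left_pair, ?_, ?_, D.leftBosonization.isDual hfin, D.hasAntipode_leftPoincare,
    FiniteDual.hasAntipode D.hasAntipode_leftPoincare⟩
  · intro v hv
    by_contra hne
    obtain ⟨b, hb, hbv⟩ := exists_mem_gradedDual_ne_zero D.adjoin_leftX D.leftVectorGrading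
      D.leftVectorGrading_x hne
    obtain ⟨c, rfl⟩ := D.range_left_pair ▸ D.gradedDual_subset_leftVectorDual hb
    exact hbv (hv c)
  · rw [range_left_pair]
    exact D.gradedDual_subset_leftVectorDual
  · intro h
    rw [range_left_pair]
    exact (D.leftVectorDual_subset_gradedDual h).antisymm D.gradedDual_subset_leftVectorDual

end QuantumGroupData

end QPoincare
end

noncomputable section

namespace QPoincare

open Coalgebra TensorProduct WithConv

variable {H : Type*} [Ring H] [Bialgebra ℂ H]

/-- The left-hand side of the quasi-commutativity condition, `b₍₁₎ a₍₁₎ r(a₍₂₎ ⊗ b₍₂₎)`. -/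
def mulForm (r : H ⊗[ℂ] H →ₗ[ℂ] ℂ) : H ⊗[ℂ] H →ₗ[ℂ] H :=
  (TensorProduct.rid ℂ H).toLinearMap ∘ₗ TensorProduct.map
      (LinearMap.mul' ℂ H ∘ₗ (TensorProduct.comm ℂ H H).toLinearMap) r ∘ₗ comul

/-- The right-hand side of the quasi-commutativity condition, `r(a₍₁₎ ⊗ b₍₁₎) a₍₂₎ b₍₂₎`. -/
def formMul (r : H ⊗[ℂ] H →ₗ[ℂ] ℂ) : H ⊗[ℂ] H →ₗ[ℂ] H :=
  (TensorProduct.lid ℂ H).toLinearMap ∘ₗ TensorProduct.map r (LinearMap.mul' ℂ H) ∘ₗ comul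

section MatrixTwist

variable {ι : Type*} (r : H ⊗[ℂ] H →ₗ[ℂ] ℂ) (Y : ι → ι → H)

/-- `x ⊗ y ↦ (r(y ⊗ Y^k_l) x)`. -/
def matrixTwist : H ⊗[ℂ] H →ₗ[ℂ] Matrix ι ι H :=
  TensorProduct.lift (LinearMap.mk₂ ℂ (fun x y => Matrix.of fun k l => r (y ⊗ₜ Y k l) • x)
    (fun x x' y => by ext; simp) (fun c x y => by ext; exact smul_comm _ _ _)
    (fun x y y' => by ext; simp [add_tmul, add_smul])
    (fun c x y => by ext; simp [← smul_tmul', mul_smul]))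

variable {r Y}

theorem matrixTwist_tmul (x y : H) (k l : ι) :
    matrixTwist r Y (x ⊗ₜ y) k l = r (y ⊗ₜ Y k l) • x := rfl

theorem matrixTwist_mul [Fintype ι]
    (mul_left : ∀ a b c : H, r ((a * b) ⊗ₜ c) =
      LinearMap.mul' ℂ ℂ (TensorProduct.map (r ∘ₗ TensorProduct.mk ℂ H H a)
        (r ∘ₗ TensorProduct.mk ℂ H H b) (comul c)))
    (hY : ∀ i j, comul (R := ℂ) (Y i j) = ∑ a, Y i a ⊗ₜ[ℂ] Y a j) (z w : H ⊗[ℂ] H) :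
    matrixTwist r Y (z * w) = matrixTwist r Y z * matrixTwist r Y w := by
  induction z using TensorProduct.induction_on with
  | zero => simp
  | add a b ha hb => simp only [add_mul, map_add, ha, hb]
  | tmul x y =>
    induction w using TensorProduct.induction_on with
    | zero => simp
    | add a b ha hb => simp only [mul_add, map_add, ha, hb]
    | tmul x' y' =>
      ext k l
      simp [matrixTwist_tmul, Matrix.mul_apply, mul_left, hY, Finset.sum_smul, smul_smul, mul_comm]

/-- Quasi-commutativity with a matrix of generators, in matrix form. -/
theorem mulForm_tmul_matrix [Fintype ι] (hY : ∀ i j, comul (R := ℂ) (Y i j) = ∑ a, Y i a ⊗ₜ[ℂ] Y a j)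
    (a : H) (k l : ι) :
    mulForm r (a ⊗ₜ Y k l) = (Matrix.of Y * matrixTwist r Y (comul a)) k l := by
  rw [mulForm, LinearMap.comp_apply, LinearMap.comp_apply, TensorProduct.comul_tmul, hY]
  generalize comul (R := ℂ) a = z
  induction z using TensorProduct.induction_on with
  | zero => simp
  | add a b ha hb => simp only [add_tmul, map_add, mul_add, Matrix.add_apply, ha, hb]
  | tmul x y => simp [tmul_sum, Matrix.mul_apply, matrixTwist_tmul]

theorem formMul_tmul_matrix [Fintype ι] (hY : ∀ i j, comul (R := ℂ) (Y i j) = ∑ a, Y i a ⊗ₜ[ℂ] Y a j)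
    (a : H) (k l : ι) :
    formMul r (a ⊗ₜ Y k l) =
      (matrixTwist r Y (TensorProduct.comm ℂ H H (comul a)) * Matrix.of Y) k l := by
  rw [formMul, LinearMap.comp_apply, LinearMap.comp_apply, TensorProduct.comul_tmul, hY]
  generalize comul (R := ℂ) a = z
  induction z using TensorProduct.induction_on with
  | zero => simp
  | add a b ha hb => simp only [add_tmul, map_add, add_mul, Matrix.add_apply, ha, hb]
  | tmul x y => simp [tmul_sum, Matrix.mul_apply, matrixTwist_tmul]

end MatrixTwist

section RightTwist

variable (r : H ⊗[ℂ] H →ₗ[ℂ] ℂ)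

/-- `x ⊗ y ↦ r(- ⊗ y) x`, with values in the opposite algebra. -/
def rightTwist : H ⊗[ℂ] H →ₗ[ℂ] WithConv (H →ₗ[ℂ] Hᵐᵒᵖ) :=
  TensorProduct.lift (LinearMap.mk₂ ℂ (fun x y => toConv
      (LinearMap.toSpanSingleton ℂ Hᵐᵒᵖ (MulOpposite.op x) ∘ₗ r ∘ₗ (TensorProduct.mk ℂ H H).flip y))
    (fun x x' y => by apply ofConv_injective; ext; simp)
    (fun c x y => by
      apply ofConv_injective; ext a; exact smul_comm (r (a ⊗ₜ y)) c (MulOpposite.op x))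
    (fun x y y' => by apply ofConv_injective; ext; simp [add_smul])
    (fun c x y => by apply ofConv_injective; ext; simp [mul_smul]))

variable {r}

theorem rightTwist_tmul (x y a : H) :
    (rightTwist r (x ⊗ₜ y)).ofConv a = r (a ⊗ₜ y) • MulOpposite.op x := rfl

theorem rightTwist_mul
    (mul_right : ∀ a b c : H, r (a ⊗ₜ (b * c)) =
      LinearMap.mul' ℂ ℂ (TensorProduct.map (r ∘ₗ (TensorProduct.mk ℂ H H).flip c)
        (r ∘ₗ (TensorProduct.mk ℂ H H).flip b) (comul a))) (z w : H ⊗[ℂ] H) :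
    rightTwist r (z * w) = rightTwist r w * rightTwist r z := by
  induction z using TensorProduct.induction_on with
  | zero => simp
  | add a b ha hb => simp only [add_mul, mul_add, map_add, ha, hb]
  | tmul x y =>
    induction w using TensorProduct.induction_on with
    | zero => simp
    | add a b ha hb => simp only [add_mul, mul_add, map_add, ha, hb]
    | tmul x' y' =>
      apply ofConv_injective
      ext a
      rw [Algebra.TensorProduct.tmul_mul_tmul, rightTwist_tmul, mul_right, LinearMap.convMul_apply]
      generalize comul (R := ℂ) a = u
      induction u using TensorProduct.induction_on with
      | zero => simp
      | add a b ha hb => simp only [map_add, add_smul, ha, hb]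
      | tmul a b => simp [rightTwist_tmul, smul_smul, mul_comm]

theorem op_mulForm_tmul (a b : H) : MulOpposite.op (mulForm r (a ⊗ₜ b)) =
    (toConv (MulOpposite.opLinearEquiv ℂ).toLinearMap * rightTwist r (comul b)).ofConv a := by
  rw [mulForm, LinearMap.comp_apply, LinearMap.comp_apply, TensorProduct.comul_tmul,
    LinearMap.convMul_apply]
  generalize comul (R := ℂ) a = z
  generalize comul (R := ℂ) b = w
  induction z using TensorProduct.induction_on with
  | zero => simp
  | add a b ha hb => simp only [add_tmul, map_add, MulOpposite.op_add, ha, hb]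
  | tmul x y =>
    induction w using TensorProduct.induction_on with
    | zero => simp
    | add a b ha hb =>
      simp only [tmul_add, map_add, MulOpposite.op_add, ha, hb, ofConv_add, TensorProduct.map_add_right,
        LinearMap.add_apply]
    | tmul x' y' => simp [rightTwist_tmul]

theorem op_formMul_tmul (a b : H) : MulOpposite.op (formMul r (a ⊗ₜ b)) =
    (rightTwist r (TensorProduct.comm ℂ H H (comul b)) *
      toConv (MulOpposite.opLinearEquiv ℂ).toLinearMap).ofConv a := by
  rw [formMul, LinearMap.comp_apply, LinearMap.comp_apply, TensorProduct.comul_tmul,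
    LinearMap.convMul_apply]
  generalize comul (R := ℂ) a = z
  generalize comul (R := ℂ) b = w
  induction z using TensorProduct.induction_on with
  | zero => simp
  | add a b ha hb => simp only [add_tmul, map_add, MulOpposite.op_add, ha, hb]
  | tmul x y =>
    induction w using TensorProduct.induction_on with
    | zero => simp
    | add a b ha hb =>
      simp only [tmul_add, map_add, MulOpposite.op_add, ha, hb, ofConv_add, TensorProduct.map_add_left,
        LinearMap.add_apply]
    | tmul x' y' => simp [rightTwist_tmul]

end RightTwist

theorem comm_mul (z w : H ⊗[ℂ] H) : TensorProduct.comm ℂ H H (z * w) =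
    TensorProduct.comm ℂ H H z * TensorProduct.comm ℂ H H w :=
  map_mul (Algebra.TensorProduct.comm ℂ H H) z w

section Generators

variable {r : H ⊗[ℂ] H →ₗ[ℂ] ℂ}

/-- Quasi-commutativity with a matrix of generators on the right extends to products on the
left. -/
theorem IsSkewPairing.mulForm_eq_of_generators_left (hr : IsSkewPairing r) {ι : Type*} [Fintype ι] [DecidableEq ι]
    {Y : ι → ι → H}
    (hY : ∀ i j, comul (R := ℂ) (Y i j) = ∑ a, Y i a ⊗ₜ[ℂ] Y a j)
    (hY' : ∀ i j, counit (R := ℂ) (Y i j) = if i = j then 1 else 0) {s : Set H}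
    (hs : Algebra.adjoin ℂ s = ⊤)
    (h : ∀ a ∈ s, ∀ k l, mulForm r (a ⊗ₜ Y k l) = formMul r (a ⊗ₜ Y k l)) (a : H) (k l : ι) :
    mulForm r (a ⊗ₜ Y k l) = formMul r (a ⊗ₜ Y k l) := by
  have one : matrixTwist r Y (1 ⊗ₜ 1) = 1 := by
    ext k l
    rw [matrixTwist_tmul, hr.one_left, hY', Matrix.one_apply]
    split_ifs <;> simp
  suffices key : Matrix.of Y * matrixTwist r Y (comul a) =
      matrixTwist r Y (TensorProduct.comm ℂ H H (comul a)) * Matrix.of Y by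
    rw [mulForm_tmul_matrix hY, formMul_tmul_matrix hY, key]
  have ha : a ∈ Algebra.adjoin ℂ s := hs ▸ Algebra.mem_top
  induction ha using Algebra.adjoin_induction with
  | mem a ha =>
    ext k l
    rw [← mulForm_tmul_matrix hY, ← formMul_tmul_matrix hY, h a ha]
  | algebraMap c =>
    rw [Algebra.algebraMap_eq_smul_one, map_smul, Bialgebra.comul_one,
      Algebra.TensorProduct.one_def, map_smul, map_smul, map_smul, TensorProduct.comm_tmul, one,
      mul_smul_comm, smul_mul_assoc, one_mul, mul_one]
  | add x y _ _ hx hy => simp only [map_add, mul_add, add_mul, hx, hy]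
  | mul x y _ _ hx hy =>
    rw [Bialgebra.comul_mul, comm_mul, matrixTwist_mul hr.mul_left hY,
      matrixTwist_mul hr.mul_left hY, ← mul_assoc, hx, mul_assoc, hy, mul_assoc]

/-- Quasi-commutativity extends to products on the right. -/
theorem IsSkewPairing.mulForm_eq_of_generators_right (hr : IsSkewPairing r) {s : Set H}
    (hs : Algebra.adjoin ℂ s = ⊤)
    (h : ∀ b ∈ s, ∀ a, mulForm r (a ⊗ₜ b) = formMul r (a ⊗ₜ b)) : mulForm r = formMul r := by
  have one : rightTwist r (1 ⊗ₜ 1) = 1 := by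
    apply ofConv_injective
    ext a
    rw [rightTwist_tmul, hr.one_right]
    simp [Algebra.algebraMap_eq_smul_one]
  apply TensorProduct.ext'
  intro a b
  suffices key : toConv (MulOpposite.opLinearEquiv ℂ).toLinearMap * rightTwist r (comul b) =
      rightTwist r (TensorProduct.comm ℂ H H (comul b)) *
        toConv (MulOpposite.opLinearEquiv ℂ).toLinearMap by
    apply MulOpposite.op_injective
    rw [op_mulForm_tmul, op_formMul_tmul, key]
  clear a
  have hb : b ∈ Algebra.adjoin ℂ s := hs ▸ Algebra.mem_top
  induction hb using Algebra.adjoin_induction with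
  | mem b hb =>
    apply ofConv_injective
    ext a
    rw [← op_mulForm_tmul, ← op_formMul_tmul, h b hb]
  | algebraMap c =>
    rw [Algebra.algebraMap_eq_smul_one, map_smul, Bialgebra.comul_one,
      Algebra.TensorProduct.one_def, map_smul, map_smul, map_smul, TensorProduct.comm_tmul, one,
      mul_smul_comm, smul_mul_assoc, one_mul, mul_one]
  | add x y _ _ hx hy => simp only [map_add, mul_add, add_mul, hx, hy]
  | mul x y _ _ hx hy =>
    rw [Bialgebra.comul_mul, comm_mul, rightTwist_mul hr.mul_right,
      rightTwist_mul hr.mul_right, ← mul_assoc, hy, mul_assoc, hx, mul_assoc]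

/-- On a Hopf algebra a skew pairing is convolution-invertible. -/
theorem IsSkewPairing.isUnit_toConv (hr : IsSkewPairing r) (hH : HasAntipode H) : IsUnit (toConv r) := by
  obtain ⟨S, hS, hS'⟩ := hH
  have e1 : ∀ (z : H ⊗[ℂ] H) (b : H),
      LinearMap.mul' ℂ ℂ (TensorProduct.map r (r ∘ₗ LinearMap.rTensor H S)
        (TensorProduct.tensorTensorTensorComm ℂ H H H H (z ⊗ₜ comul b))) =
      r (LinearMap.mul' ℂ H (LinearMap.lTensor H S z) ⊗ₜ b) := by
    intro z b
    induction z using TensorProduct.induction_on with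
    | zero => simp
    | add x y hx hy => simp only [add_tmul, map_add, hx, hy]
    | tmul x y =>
      rw [LinearMap.lTensor_tmul, LinearMap.mul'_apply, hr.mul_left]
      generalize comul (R := ℂ) b = w
      induction w using TensorProduct.induction_on with
      | zero => simp
      | add x y hx hy => simp only [tmul_add, map_add, hx, hy]
      | tmul u v => simp
  have e2 : ∀ (z : H ⊗[ℂ] H) (b : H),
      LinearMap.mul' ℂ ℂ (TensorProduct.map (r ∘ₗ LinearMap.rTensor H S) r
        (TensorProduct.tensorTensorTensorComm ℂ H H H H (z ⊗ₜ comul b))) =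
      r (LinearMap.mul' ℂ H (LinearMap.rTensor H S z) ⊗ₜ b) := by
    intro z b
    induction z using TensorProduct.induction_on with
    | zero => simp
    | add x y hx hy => simp only [add_tmul, map_add, hx, hy]
    | tmul x y =>
      rw [LinearMap.rTensor_tmul, LinearMap.mul'_apply, hr.mul_left]
      generalize comul (R := ℂ) b = w
      induction w using TensorProduct.induction_on with
      | zero => simp
      | add x y hx hy => simp only [tmul_add, map_add, hx, hy]
      | tmul u v => simp
  refine ⟨⟨_, toConv (r ∘ₗ LinearMap.rTensor H S), ?_, ?_⟩, rfl⟩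
  · apply ofConv_injective
    apply TensorProduct.ext'
    intro a b
    rw [LinearMap.convMul_apply, TensorProduct.comul_tmul]
    refine (e1 _ _).trans ?_
    rw [show LinearMap.mul' ℂ H (LinearMap.lTensor H S (comul a)) =
      algebraMap ℂ H (counit a) from LinearMap.congr_fun hS' a, Algebra.algebraMap_eq_smul_one,
      ← smul_tmul', map_smul, hr.one_left]
    simp [mul_comm]
  · apply ofConv_injective
    apply TensorProduct.ext'
    intro a b
    rw [LinearMap.convMul_apply, TensorProduct.comul_tmul]
    refine (e2 _ _).trans ?_
    rw [show LinearMap.mul' ℂ H (LinearMap.rTensor H S (comul a)) =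
      algebraMap ℂ H (counit a) from LinearMap.congr_fun hS a, Algebra.algebraMap_eq_smul_one,
      ← smul_tmul', map_smul, hr.one_left]
    simp [mul_comm]

end Generators

section OfAlgHom

variable (ρ : H →ₐ[ℂ] WithConv (H →ₗ[ℂ] ℂ))

/-- The bilinear form of an algebra map to the convolution dual. -/
def formOfAlgHom : H ⊗[ℂ] H →ₗ[ℂ] ℂ :=
  TensorProduct.lift ((WithConv.linearEquiv ℂ (H →ₗ[ℂ] ℂ)).toLinearMap ∘ₗ ρ.toLinearMap)

theorem formOfAlgHom_tmul (a b : H) : formOfAlgHom ρ (a ⊗ₜ b) = (ρ a).ofConv b := rfl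

/-- `x ⊗ y ↦ (b ⊗ c ↦ r(x ⊗ c) r(y ⊗ b))`. -/
def flipPair : H ⊗[ℂ] H →ₗ[ℂ] WithConv (H ⊗[ℂ] H →ₗ[ℂ] ℂ) :=
  TensorProduct.lift (LinearMap.mk₂ ℂ (fun x y => toConv
      (LinearMap.mul' ℂ ℂ ∘ₗ TensorProduct.map (ρ y).ofConv (ρ x).ofConv))
    (fun x x' y => by apply ofConv_injective; ext; simp [mul_add])
    (fun c x y => by apply ofConv_injective; ext; simp; ring)
    (fun x y y' => by apply ofConv_injective; ext; simp [add_mul])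
    (fun c x y => by apply ofConv_injective; ext; simp; ring))

theorem flipPair_tmul (x y b c : H) :
    (flipPair ρ (x ⊗ₜ y)).ofConv (b ⊗ₜ c) = (ρ y).ofConv b * (ρ x).ofConv c := rfl

theorem flipPair_mul (z w : H ⊗[ℂ] H) : flipPair ρ (z * w) = flipPair ρ z * flipPair ρ w := by
  induction z using TensorProduct.induction_on with
  | zero => simp
  | add a b ha hb => simp only [add_mul, map_add, ha, hb]
  | tmul x y =>
    induction w using TensorProduct.induction_on with
    | zero => simp
    | add a b ha hb => simp only [mul_add, map_add, ha, hb]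
    | tmul x' y' =>
      apply ofConv_injective
      apply TensorProduct.ext'
      intro b c
      rw [Algebra.TensorProduct.tmul_mul_tmul, flipPair_tmul, map_mul, map_mul,
        LinearMap.convMul_apply, LinearMap.convMul_apply, LinearMap.convMul_apply,
        TensorProduct.comul_tmul]
      generalize comul (R := ℂ) b = u
      generalize comul (R := ℂ) c = v
      induction u using TensorProduct.induction_on with
      | zero => simp
      | add a b ha hb => simp only [add_tmul, map_add, add_mul, ha, hb]
      | tmul b b' =>
        induction v using TensorProduct.induction_on with
        | zero => simp
        | add a b ha hb => simp only [tmul_add, map_add, mul_add, ha, hb]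
        | tmul c c' =>
          simp only [AlgebraTensorModule.tensorTensorTensorComm_tmul, TensorProduct.map_tmul,
            flipPair_tmul, LinearMap.mul'_apply]
          ring

/-- An algebra map to the convolution dual is a skew pairing if the second property holds on
generators. -/
theorem isSkewPairing_formOfAlgHom {s : Set H} (hs : Algebra.adjoin ℂ s = ⊤)
    (h : ∀ a ∈ s, (ρ a).ofConv 1 = counit (R := ℂ) a ∧
      (ρ a).ofConv ∘ₗ LinearMap.mul' ℂ H = (flipPair ρ (comul a)).ofConv) :
    IsSkewPairing (formOfAlgHom ρ) := by
  have key : ∀ a : H, (ρ a).ofConv 1 = counit (R := ℂ) a ∧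
      toConv ((ρ a).ofConv ∘ₗ LinearMap.mul' ℂ H) = flipPair ρ (comul a) := by
    intro a
    have ha : a ∈ Algebra.adjoin ℂ s := hs ▸ Algebra.mem_top
    induction ha using Algebra.adjoin_induction with
    | mem a ha => exact ⟨(h a ha).1, congrArg toConv (h a ha).2⟩
    | algebraMap c =>
      rw [AlgHom.commutes]
      constructor
      · simp [Algebra.algebraMap_eq_smul_one]
      · apply ofConv_injective
        apply TensorProduct.ext'
        intro x y
        rw [Algebra.algebraMap_eq_smul_one, Algebra.algebraMap_eq_smul_one, map_smul, map_smul,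
          Bialgebra.comul_one, Algebra.TensorProduct.one_def]
        change c * _ = c * (flipPair ρ (1 ⊗ₜ 1)).ofConv (x ⊗ₜ[ℂ] y)
        rw [flipPair_tmul, map_one]
        simp
    | add x y _ _ hx hy =>
      refine ⟨by simp [hx.1, hy.1], ?_⟩
      rw [map_add, map_add, map_add, ← hx.2, ← hy.2]
      rfl
    | mul x y _ _ hx hy =>
      refine ⟨?_, ?_⟩
      · rw [map_mul, LinearMap.convMul_apply, Bialgebra.comul_one, Algebra.TensorProduct.one_def,
          TensorProduct.map_tmul, LinearMap.mul'_apply, hx.1, hy.1, Bialgebra.counit_mul]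
      · rw [Bialgebra.comul_mul, flipPair_mul, ← hx.2, ← hy.2, map_mul]
        apply ofConv_injective
        apply TensorProduct.ext'
        intro b c
        rw [LinearMap.convMul_apply]
        simp only [LinearMap.comp_apply, LinearMap.mul'_apply]
        rw [LinearMap.convMul_apply, Bialgebra.comul_mul, TensorProduct.comul_tmul]
        generalize comul (R := ℂ) b = u
        generalize comul (R := ℂ) c = v
        induction u using TensorProduct.induction_on with
        | zero => simp
        | add a b ha hb => simp only [add_tmul, map_add, add_mul, ha, hb]
        | tmul b b' =>
          induction v using TensorProduct.induction_on with
          | zero => simp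
          | add a b ha hb => simp only [tmul_add, map_add, mul_add, ha, hb]
          | tmul c c' => simp
  refine ⟨fun a => ?_, fun a => (key a).1, fun a b c => ?_, fun a b c => ?_⟩
  · rw [formOfAlgHom_tmul, map_one]
    simp
  · rw [formOfAlgHom_tmul, map_mul, LinearMap.convMul_apply]
    rfl
  · have h2 := LinearMap.congr_fun (congrArg ofConv (key a).2) (b ⊗ₜ c)
    refine h2.trans ?_
    generalize comul (R := ℂ) a = z
    induction z using TensorProduct.induction_on with
    | zero => simp
    | add x y hx hy => simp only [map_add, ofConv_add, LinearMap.add_apply, hx, hy]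
    | tmul x y => rw [flipPair_tmul]; simp [formOfAlgHom_tmul, mul_comm]

end OfAlgHom

section Matrices

variable {ι : Type*} [Fintype ι] {r : H ⊗[ℂ] H →ₗ[ℂ] ℂ}

/-- Quasi-commutativity for two matrices of generators amounts to an `RTT` relation. -/
theorem mulForm_eq_formMul_iff {M : Matrix (ι × ι) (ι × ι) ℂ} {X Y : ι → ι → H}
    (hX : ∀ i j, comul (R := ℂ) (X i j) = ∑ a, X i a ⊗ₜ[ℂ] X a j)
    (hY : ∀ i j, comul (R := ℂ) (Y i j) = ∑ a, Y i a ⊗ₜ[ℂ] Y a j)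
    (h : ∀ i j k l, r (X i j ⊗ₜ Y k l) = M (i, k) (j, l)) :
    (∀ i j k l, mulForm r (X i j ⊗ₜ Y k l) = formMul r (X i j ⊗ₜ Y k l)) ↔
      MatrixRelation M X Y := by
  have e1 : ∀ i j k l, mulForm r (X i j ⊗ₜ Y k l) =
      ∑ a, ∑ b, M (a, b) (j, l) • (Y k b * X i a) := by
    intro i j k l
    rw [mulForm, LinearMap.comp_apply, LinearMap.comp_apply, TensorProduct.comul_tmul, hX, hY]
    simp only [sum_tmul, tmul_sum, map_sum, AlgebraTensorModule.tensorTensorTensorComm_tmul,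
      TensorProduct.map_tmul, h, LinearMap.comp_apply, LinearEquiv.coe_coe, TensorProduct.comm_tmul,
      LinearMap.mul'_apply, TensorProduct.rid_tmul]
    exact Finset.sum_comm
  have e2 : ∀ i j k l, formMul r (X i j ⊗ₜ Y k l) =
      ∑ a, ∑ b, M (i, k) (a, b) • (X a j * Y b l) := by
    intro i j k l
    rw [formMul, LinearMap.comp_apply, LinearMap.comp_apply, TensorProduct.comul_tmul, hX, hY]
    simp only [sum_tmul, tmul_sum, map_sum, AlgebraTensorModule.tensorTensorTensorComm_tmul,
      TensorProduct.map_tmul, h, LinearEquiv.coe_coe, LinearMap.mul'_apply, TensorProduct.lid_tmul]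
    exact Finset.sum_comm
  constructor
  · intro hq i k j l
    rw [← e1, ← e2, hq]
  · intro hq i j k l
    rw [e1, e2]
    exact (hq i k j l).symm

end Matrices

variable {ι : Type*} [Fintype ι] [DecidableEq ι]

/-- A form given on matrices of generators by an `R`-matrix for each pair of them is a dual
quasitriangular structure if the corresponding `RTT` relations hold. -/
theorem isDualQuasitriangular_formOfAlgHom {κ : Type*} (ρ : H →ₐ[ℂ] WithConv (H →ₗ[ℂ] ℂ))
    {X : κ → ι → ι → H}
    (hX : Algebra.adjoin ℂ (Set.range fun p : κ × ι × ι => X p.1 p.2.1 p.2.2) = ⊤)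
    (hΔ : ∀ k i j, comul (R := ℂ) (X k i j) = ∑ a, X k i a ⊗ₜ[ℂ] X k a j)
    (hε : ∀ k i j, counit (R := ℂ) (X k i j) = if i = j then 1 else 0)
    {F : κ → H →ₐ[ℂ] Matrix ι ι ℂ} (hF : ∀ k i j h, (ρ (X k i j)).ofConv h = F k h j i)
    {M : κ → κ → Matrix (ι × ι) (ι × ι) ℂ}
    (hM : ∀ k l i j m n, F k (X l m n) j i = M k l (i, m) (j, n))
    (rel : ∀ k l, MatrixRelation (M k l) (X k) (X l)) (hH : HasAntipode H) :
    IsDualQuasitriangular (formOfAlgHom ρ) := by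
  have hr : IsSkewPairing (formOfAlgHom ρ) := by
    refine isSkewPairing_formOfAlgHom ρ hX ?_
    rintro _ ⟨⟨k, i, j⟩, rfl⟩
    refine ⟨?_, ?_⟩
    · rw [hF, map_one, hε, Matrix.one_apply]
      simp only [eq_comm]
    · apply TensorProduct.ext'
      intro b c
      rw [LinearMap.comp_apply, LinearMap.mul'_apply, hF, map_mul, hΔ, map_sum, ofConv_sum,
        LinearMap.sum_apply, Matrix.mul_apply]
      simp only [flipPair_tmul, hF]
  refine ⟨hr.isUnit_toConv hH, hr.mul_left, hr.mul_right, ?_⟩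
  refine hr.mulForm_eq_of_generators_right hX ?_
  rintro _ ⟨⟨l, m, n⟩, rfl⟩ a
  refine hr.mulForm_eq_of_generators_left (hΔ l) (hε l) hX ?_ a m n
  rintro _ ⟨⟨k, i, j⟩, rfl⟩ m n
  exact (mulForm_eq_formMul_iff (hΔ k) (hΔ l) fun i j m n => by
    rw [formOfAlgHom_tmul, hF, hM]).mpr (rel k l) i j m n

section Kronecker

/-- The Kronecker product as a linear map. -/
def kroneckerLift : Matrix ι ι ℂ ⊗[ℂ] Matrix ι ι ℂ →ₗ[ℂ] Matrix (ι × ι) (ι × ι) ℂ :=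
  TensorProduct.lift (Matrix.kroneckerMapBilinear (LinearMap.mul ℂ ℂ))

theorem kroneckerLift_tmul (A B : Matrix ι ι ℂ) :
    kroneckerLift (A ⊗ₜ[ℂ] B) = Matrix.kronecker A B := rfl

theorem kroneckerLift_mul (z w : Matrix ι ι ℂ ⊗[ℂ] Matrix ι ι ℂ) :
    kroneckerLift (z * w) = kroneckerLift z * kroneckerLift w := by
  induction z using TensorProduct.induction_on with
  | zero => simp
  | add a b ha hb => simp only [add_mul, map_add, ha, hb]
  | tmul x y =>
    induction w using TensorProduct.induction_on with
    | zero => simp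
    | add a b ha hb => simp only [mul_add, map_add, ha, hb]
    | tmul x' y' =>
      rw [Algebra.TensorProduct.tmul_mul_tmul]
      exact Matrix.mul_kronecker_mul _ _ _ _

variable (F G : H →ₐ[ℂ] Matrix ι ι ℂ)

/-- The tensor product of two matrix representations of a bialgebra. -/
def tensorRep : H →ₐ[ℂ] Matrix (ι × ι) (ι × ι) ℂ :=
  AlgHom.ofLinearMap (kroneckerLift ∘ₗ TensorProduct.map F.toLinearMap G.toLinearMap ∘ₗ comul)
    (by
      simp only [LinearMap.comp_apply, Bialgebra.comul_one, Algebra.TensorProduct.one_def,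
        TensorProduct.map_tmul, AlgHom.toLinearMap_apply, map_one, kroneckerLift_tmul]
      exact Matrix.one_kronecker_one)
    (fun x y => by
      simp only [LinearMap.comp_apply, Bialgebra.comul_mul]
      rw [← kroneckerLift_mul]
      exact congrArg kroneckerLift (map_mul (Algebra.TensorProduct.map F G) _ _))

/-- The transposed matrix of coefficients of a representation. -/
def repCoeff (i j : ι) : WithConv (H →ₗ[ℂ] ℂ) :=
  toConv (Matrix.entryLinearMap ℂ ℂ j i ∘ₗ F.toLinearMap)

theorem repCoeff_apply (i j : ι) (h : H) : (repCoeff F i j).ofConv h = F h j i := rfl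

theorem repCoeff_mul_repCoeff (i j k l : ι) (h : H) :
    (repCoeff F i j * repCoeff G k l).ofConv h = tensorRep F G h (j, l) (i, k) := by
  rw [LinearMap.convMul_apply]
  change _ = kroneckerLift (TensorProduct.map F.toLinearMap G.toLinearMap (comul h)) (j, l) (i, k)
  generalize comul (R := ℂ) h = z
  induction z using TensorProduct.induction_on with
  | zero => simp
  | add a b ha hb => simp only [map_add, ha, hb, Matrix.add_apply]
  | tmul x y => simp [repCoeff_apply, kroneckerLift_tmul]

theorem repCoeff_mul_repCoeff_matrix {X : ι → ι → H}
    (hX : ∀ i j, comul (R := ℂ) (X i j) = ∑ a, X i a ⊗ₜ[ℂ] X a j) (i j k l m n : ι) :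
    (repCoeff F i j * repCoeff G k l).ofConv (X m n) = ∑ a, F (X m a) j i * G (X a n) l k := by
  rw [LinearMap.convMul_apply, hX]
  simp [repCoeff_apply]

variable {F G}

/-- An `RTT` relation between matrices of coefficients holds if it holds on generators. -/
theorem matrixRelation_repCoeff {M : Matrix (ι × ι) (ι × ι) ℂ} {s : Set H}
    (hs : Algebra.adjoin ℂ s = ⊤)
    (h : ∀ g ∈ s, ∀ i k j l,
      ∑ a, ∑ b, M (i, k) (a, b) * (repCoeff F a j * repCoeff G b l).ofConv g =
      ∑ a, ∑ b, M (a, b) (j, l) * (repCoeff G k b * repCoeff F i a).ofConv g) :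
    MatrixRelation M (repCoeff F) (repCoeff G) := by
  let N : Matrix (ι × ι) (ι × ι) ℂ := fun x y => M y.swap x
  have e : ∀ g, (∀ i k j l,
      ∑ a, ∑ b, M (i, k) (a, b) * (repCoeff F a j * repCoeff G b l).ofConv g =
      ∑ a, ∑ b, M (a, b) (j, l) * (repCoeff G k b * repCoeff F i a).ofConv g) ↔
      tensorRep F G g * N = N * tensorRep G F g := by
    intro g
    have e1 : ∀ i k j l, (tensorRep F G g * N) (j, l) (k, i) =
        ∑ a, ∑ b, M (i, k) (a, b) * (repCoeff F a j * repCoeff G b l).ofConv g := by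
      intro i k j l
      rw [Matrix.mul_apply, Fintype.sum_prod_type]
      simp only [repCoeff_mul_repCoeff, mul_comm, N, Prod.swap_prod_mk]
    have e2 : ∀ i k j l, (N * tensorRep G F g) (j, l) (k, i) =
        ∑ a, ∑ b, M (a, b) (j, l) * (repCoeff G k b * repCoeff F i a).ofConv g := by
      intro i k j l
      rw [Matrix.mul_apply, Fintype.sum_prod_type, Finset.sum_comm]
      simp only [repCoeff_mul_repCoeff, N, Prod.swap_prod_mk]
    constructor
    · intro h
      ext ⟨j, l⟩ ⟨k, i⟩
      rw [e1, e2, h]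
    · intro h i k j l
      rw [← e1, ← e2, h]
  have key : ∀ g, tensorRep F G g * N = N * tensorRep G F g := by
    intro g
    have hg : g ∈ Algebra.adjoin ℂ s := hs ▸ Algebra.mem_top
    induction hg using Algebra.adjoin_induction with
    | mem g hg => exact (e g).mp (h g hg)
    | algebraMap c => rw [AlgHom.commutes, AlgHom.commutes, Algebra.commutes]
    | add x y _ _ hx hy => rw [map_add, map_add, add_mul, mul_add, hx, hy]
    | mul x y _ _ hx hy => rw [map_mul, map_mul, mul_assoc, hy, ← mul_assoc, hx, mul_assoc]
  intro i k j l
  apply ofConv_injective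
  ext g
  simpa using (e g).mpr (key g) i k j l

/-- A vector invariant under the generators is invariant. -/
theorem sum_repCoeff_mul_repCoeff {w : ι × ι → ℂ} {s : Set H} (hs : Algebra.adjoin ℂ s = ⊤)
    (h : ∀ g ∈ s, ∀ i k, ∑ j, ∑ l, w (j, l) * (repCoeff F i j * repCoeff F k l).ofConv g =
      counit (R := ℂ) g * w (i, k)) (i k : ι) :
    ∑ j, ∑ l, w (j, l) • (repCoeff F i j * repCoeff F k l) = w (i, k) • 1 := by
  have e : ∀ g i k, Matrix.vecMul w (tensorRep F F g) (i, k) =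
      ∑ j, ∑ l, w (j, l) * (repCoeff F i j * repCoeff F k l).ofConv g := by
    intro g i k
    rw [Matrix.vecMul, dotProduct, Fintype.sum_prod_type]
    simp only [repCoeff_mul_repCoeff]
  have key : ∀ g, Matrix.vecMul w (tensorRep F F g) = counit (R := ℂ) g • w := by
    intro g
    have hg : g ∈ Algebra.adjoin ℂ s := hs ▸ Algebra.mem_top
    induction hg using Algebra.adjoin_induction with
    | mem g hg => ext ⟨i, k⟩; rw [e, h g hg]; rfl
    | algebraMap c =>
      rw [AlgHom.commutes, Algebra.algebraMap_eq_smul_one, Algebra.algebraMap_eq_smul_one,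
        map_smul, Bialgebra.counit_one, Matrix.vecMul_smul, Matrix.vecMul_one, smul_eq_mul, mul_one]
    | add x y _ _ hx hy => rw [map_add, map_add, Matrix.vecMul_add, hx, hy, add_smul]
    | mul x y _ _ hx hy =>
      rw [map_mul, ← Matrix.vecMul_vecMul, hx, Matrix.smul_vecMul, hy, smul_smul,
        Bialgebra.counit_mul]
  apply ofConv_injective
  ext g
  have h2 := (e g i k).symm.trans (congrFun (key g) (i, k))
  simp only [ofConv_sum, ofConv_smul, LinearMap.sum_apply, LinearMap.smul_apply, smul_eq_mul]
  rw [h2, LinearMap.convOne_apply]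
  simp [mul_comm]

end Kronecker

end QPoincare
end

noncomputable section

namespace QPoincare

open Coalgebra TensorProduct WithConv

section MatrixRelations

variable {ι : Type*} [Fintype ι] {S : Type*} [Ring S] [Algebra ℂ S]

/-- The relations `M₁₂ s₁ t₂ = t₂ s₁ M₁₂` as an equation of matrices. -/
theorem matrixRelation_iff {M : Matrix (ι × ι) (ι × ι) ℂ} {s t : ι → ι → S} :
    MatrixRelation M s t ↔
      M.map (algebraMap ℂ S) * Matrix.of (fun x y : ι × ι => s x.1 y.1 * t x.2 y.2) =
        Matrix.of (fun x y : ι × ι => t x.2 y.2 * s x.1 y.1) * M.map (algebraMap ℂ S) := by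
  have e1 : ∀ i k j l, ∑ a, ∑ b, M (i, k) (a, b) • (s a j * t b l) =
      (M.map (algebraMap ℂ S) *
        Matrix.of (fun x y : ι × ι => s x.1 y.1 * t x.2 y.2)) (i, k) (j, l) := by
    intro i k j l
    rw [Matrix.mul_apply, Fintype.sum_prod_type]
    simp only [Matrix.map_apply, Matrix.of_apply, Algebra.smul_def]
  have e2 : ∀ i k j l, ∑ a, ∑ b, M (a, b) (j, l) • (t k b * s i a) =
      (Matrix.of (fun x y : ι × ι => t x.2 y.2 * s x.1 y.1) *
        M.map (algebraMap ℂ S)) (i, k) (j, l) := by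
    intro i k j l
    rw [Matrix.mul_apply, Fintype.sum_prod_type]
    simp only [Matrix.map_apply, Matrix.of_apply, Algebra.smul_def, Algebra.commutes]
  constructor
  · intro h
    ext ⟨i, k⟩ ⟨j, l⟩
    rw [← e1, ← e2, h]
  · intro h i k j l
    rw [e1, e2, h]

theorem MatrixRelation.smul {M : Matrix (ι × ι) (ι × ι) ℂ} {s t : ι → ι → S}
    (h : MatrixRelation M s t) (c : ℂ) : MatrixRelation (c • M) s t := by
  intro i k j l
  simp only [Matrix.smul_apply, smul_assoc, ← Finset.smul_sum]
  rw [h]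

variable [DecidableEq ι]

/-- If `M₁₂ s₁ t₂ = t₂ s₁ M₁₂` then `(M⁻¹)₂₁ t₁ s₂ = s₂ t₁ (M⁻¹)₂₁`. -/
theorem MatrixRelation.flip_inv {M N : Matrix (ι × ι) (ι × ι) ℂ} {s t : ι → ι → S}
    (h : MatrixRelation M s t) (hMN : M * N = 1) (hNM : N * M = 1) :
    MatrixRelation (flipLegs N) t s := by
  have h1 := matrixRelation_iff.mp h
  have e1 : M.map (algebraMap ℂ S) * N.map (algebraMap ℂ S) = 1 := by
    rw [← Matrix.map_mul, hMN, Matrix.map_one _ (map_zero _) (map_one _)]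
  have e2 : N.map (algebraMap ℂ S) * M.map (algebraMap ℂ S) = 1 := by
    rw [← Matrix.map_mul, hNM, Matrix.map_one _ (map_zero _) (map_one _)]
  have h2 : Matrix.of (fun x y : ι × ι => s x.1 y.1 * t x.2 y.2) * N.map (algebraMap ℂ S) =
      N.map (algebraMap ℂ S) * Matrix.of (fun x y : ι × ι => t x.2 y.2 * s x.1 y.1) := by
    calc _ = N.map (algebraMap ℂ S) * (M.map (algebraMap ℂ S) *
          Matrix.of (fun x y : ι × ι => s x.1 y.1 * t x.2 y.2)) * N.map (algebraMap ℂ S) := by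
          rw [← mul_assoc, e2, one_mul]
      _ = _ := by rw [h1, mul_assoc, mul_assoc, e1, mul_one]
  intro i k j l
  have h3 := congrFun (congrFun h2.symm (k, i)) (l, j)
  rw [Matrix.mul_apply, Matrix.mul_apply, Fintype.sum_prod_type, Fintype.sum_prod_type] at h3
  rw [Finset.sum_comm]
  refine Eq.trans ?_ (h3.trans ?_)
  · simp only [flipLegs, Matrix.submatrix_apply, Prod.swap_prod_mk, Matrix.map_apply,
      Matrix.of_apply, Algebra.smul_def]
  · rw [Finset.sum_comm]
    simp only [flipLegs, Matrix.submatrix_apply, Prod.swap_prod_mk, Matrix.map_apply,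
      Matrix.of_apply, Algebra.smul_def, Algebra.commutes]

/-- The inverses of matrices with `M₁₂ s₁ t₂ = t₂ s₁ M₁₂` satisfy the same relations in the
opposite algebra. -/
theorem MatrixRelation.op_inv {M : Matrix (ι × ι) (ι × ι) ℂ} {s t s' t' : ι → ι → S}
    (h : MatrixRelation M s t) (hs : Matrix.of s * Matrix.of s' = 1)
    (hs' : Matrix.of s' * Matrix.of s = 1) (ht : Matrix.of t * Matrix.of t' = 1)
    (ht' : Matrix.of t' * Matrix.of t = 1) :
    MatrixRelation M (fun i j => MulOpposite.op (s' i j)) (fun i j => MulOpposite.op (t' i j)) := by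
  let f : (ι → ι → S) → Matrix (ι × ι) (ι × ι) S :=
    fun s x y => if x.2 = y.2 then s x.1 y.1 else 0
  let g : (ι → ι → S) → Matrix (ι × ι) (ι × ι) S :=
    fun s x y => if x.1 = y.1 then s x.2 y.2 else 0
  have ff : ∀ a b, Matrix.of a * Matrix.of b = 1 → f a * f b = 1 := by
    intro a b hab
    ext ⟨i, k⟩ ⟨j, l⟩
    have h1 := congrFun (congrFun hab i) j
    rw [Matrix.mul_apply] at h1
    rw [Matrix.mul_apply, Fintype.sum_prod_type]
    simp only [f, ite_mul, zero_mul, mul_ite, mul_zero]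
    by_cases hk : k = l
    · subst hk
      simpa [Matrix.one_apply] using h1
    · simp [hk]
  have gg : ∀ a b, Matrix.of a * Matrix.of b = 1 → g a * g b = 1 := by
    intro a b hab
    ext ⟨i, k⟩ ⟨j, l⟩
    have h1 := congrFun (congrFun hab k) l
    rw [Matrix.mul_apply] at h1
    rw [Matrix.mul_apply, Fintype.sum_prod_type, Finset.sum_comm]
    simp only [g, ite_mul, zero_mul, mul_ite, mul_zero]
    by_cases hk : i = j
    · subst hk
      simpa [Matrix.one_apply] using h1
    · simp [hk]
  have fg : ∀ a b, f a * g b = Matrix.of (fun x y : ι × ι => a x.1 y.1 * b x.2 y.2) := by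
    intro a b
    ext ⟨i, k⟩ ⟨j, l⟩
    rw [Matrix.mul_apply, Fintype.sum_prod_type]
    simp [f, g]
  have gf : ∀ a b, g b * f a = Matrix.of (fun x y : ι × ι => b x.2 y.2 * a x.1 y.1) := by
    intro a b
    ext ⟨i, k⟩ ⟨j, l⟩
    rw [Matrix.mul_apply, Fintype.sum_prod_type]
    simp [f, g]
  have h1 := matrixRelation_iff.mp h
  rw [← fg, ← gf] at h1
  have h2 : f s' * g t' * M.map (algebraMap ℂ S) = M.map (algebraMap ℂ S) * (g t' * f s') := by
    calc f s' * g t' * M.map (algebraMap ℂ S)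
        = f s' * g t' * (M.map (algebraMap ℂ S) * (f s * g t)) * (g t' * f s') := by
          simp only [mul_assoc]
          rw [← mul_assoc (g t) (g t'), gg _ _ ht, one_mul, ff _ _ hs, mul_one]
      _ = _ := by
          rw [h1]
          simp only [← mul_assoc]
          rw [mul_assoc (f s') (g t') (g t), gg _ _ ht', mul_one, ff _ _ hs', one_mul]
  rw [fg, gf] at h2
  intro i k j l
  have h3 := congrFun (congrFun h2.symm (i, k)) (j, l)
  rw [Matrix.mul_apply, Matrix.mul_apply, Fintype.sum_prod_type, Fintype.sum_prod_type] at h3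
  apply MulOpposite.unop_injective
  simp only [Finset.unop_sum, MulOpposite.unop_smul, MulOpposite.unop_mul, MulOpposite.unop_op]
  refine Eq.trans ?_ (h3.trans ?_)
  · simp only [Matrix.map_apply, Matrix.of_apply, Algebra.smul_def]
  · simp only [Matrix.map_apply, Matrix.of_apply, Algebra.smul_def, Algebra.commutes]

end MatrixRelations

section Antipode

variable {H : Type*} [Ring H] [Bialgebra ℂ H]

/-- An algebra map to the opposite algebra which satisfies the antipode axioms on generators is an
antipode. -/
theorem hasAntipode_of_generators (S : H →ₐ[ℂ] Hᵐᵒᵖ) {s : Set H} (hs : Algebra.adjoin ℂ s = ⊤)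
    (h : ∀ a ∈ s, LinearMap.mul' ℂ H (LinearMap.rTensor H
        ((MulOpposite.opLinearEquiv ℂ).symm.toLinearMap ∘ₗ S.toLinearMap) (comul a)) =
        algebraMap ℂ H (counit a))
    (h' : ∀ a ∈ s, LinearMap.mul' ℂ H (LinearMap.lTensor H
        ((MulOpposite.opLinearEquiv ℂ).symm.toLinearMap ∘ₗ S.toLinearMap) (comul a)) =
        algebraMap ℂ H (counit a)) :
    LinearMap.mul' ℂ H ∘ₗ LinearMap.rTensor H
        ((MulOpposite.opLinearEquiv ℂ).symm.toLinearMap ∘ₗ S.toLinearMap) ∘ₗ comul =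
      Algebra.linearMap ℂ H ∘ₗ counit ∧
    LinearMap.mul' ℂ H ∘ₗ LinearMap.lTensor H
        ((MulOpposite.opLinearEquiv ℂ).symm.toLinearMap ∘ₗ S.toLinearMap) ∘ₗ comul =
      Algebra.linearMap ℂ H ∘ₗ counit := by
  set T : H →ₗ[ℂ] H := (MulOpposite.opLinearEquiv ℂ).symm.toLinearMap ∘ₗ S.toLinearMap with hT
  have T_mul : ∀ x y, T (x * y) = T y * T x := fun x y => by simp [hT]
  have T_one : T 1 = 1 := by simp [hT]
  have e1 : ∀ z w : H ⊗[ℂ] H, ∀ c : ℂ, LinearMap.mul' ℂ H (LinearMap.rTensor H T z) =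
      algebraMap ℂ H c → LinearMap.mul' ℂ H (LinearMap.rTensor H T (z * w)) =
      algebraMap ℂ H c * LinearMap.mul' ℂ H (LinearMap.rTensor H T w) := by
    intro z w c hz
    induction w using TensorProduct.induction_on with
    | zero => simp
    | add a b ha hb => simp only [mul_add, map_add, ha, hb]
    | tmul x y =>
      have e : ∀ z : H ⊗[ℂ] H, LinearMap.mul' ℂ H (LinearMap.rTensor H T (z * (x ⊗ₜ y))) =
          T x * LinearMap.mul' ℂ H (LinearMap.rTensor H T z) * y := by
        intro z
        induction z using TensorProduct.induction_on with
        | zero => simp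
        | add a b ha hb => simp only [add_mul, mul_add, map_add, ha, hb]
        | tmul a b => simp [T_mul, mul_assoc]
      rw [e, hz, ← Algebra.commutes, mul_assoc]
      rfl
  have e2 : ∀ z w : H ⊗[ℂ] H, ∀ c : ℂ, LinearMap.mul' ℂ H (LinearMap.lTensor H T w) =
      algebraMap ℂ H c → LinearMap.mul' ℂ H (LinearMap.lTensor H T (z * w)) =
      LinearMap.mul' ℂ H (LinearMap.lTensor H T z) * algebraMap ℂ H c := by
    intro z w c hw
    induction z using TensorProduct.induction_on with
    | zero => simp
    | add a b ha hb => simp only [add_mul, map_add, ha, hb]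
    | tmul x y =>
      have e : ∀ w : H ⊗[ℂ] H, LinearMap.mul' ℂ H (LinearMap.lTensor H T ((x ⊗ₜ y) * w)) =
          x * LinearMap.mul' ℂ H (LinearMap.lTensor H T w) * T y := by
        intro z
        induction z using TensorProduct.induction_on with
        | zero => simp
        | add a b ha hb => simp only [add_mul, mul_add, map_add, ha, hb]
        | tmul a b => simp [T_mul, mul_assoc]
      rw [e, hw, mul_assoc, Algebra.commutes, ← mul_assoc]
      rfl
  have key : ∀ a : H, LinearMap.mul' ℂ H (LinearMap.rTensor H T (comul a)) =
      algebraMap ℂ H (counit a) ∧ LinearMap.mul' ℂ H (LinearMap.lTensor H T (comul a)) =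
      algebraMap ℂ H (counit a) := by
    intro a
    have ha : a ∈ Algebra.adjoin ℂ s := hs ▸ Algebra.mem_top
    induction ha using Algebra.adjoin_induction with
    | mem a ha => exact ⟨h a ha, h' a ha⟩
    | algebraMap c =>
      simp [Algebra.algebraMap_eq_smul_one, Algebra.TensorProduct.one_def, T_one]
    | add x y _ _ hx hy => simp only [map_add, hx.1, hx.2, hy.1, hy.2, and_self]
    | mul x y _ _ hx hy =>
      rw [Bialgebra.comul_mul, e1 _ _ _ hx.1, e2 _ _ _ hy.2, hx.2, hy.1, Bialgebra.counit_mul,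
        map_mul]
      exact ⟨rfl, rfl⟩
  exact ⟨LinearMap.ext fun a => (key a).1, LinearMap.ext fun a => (key a).2⟩

end Antipode

section SubBialgebra

variable {H : Type*} [Ring H] [Bialgebra ℂ H] {C : Subalgebra ℂ H}
  (hC : ∀ x ∈ C, comul (R := ℂ) x ∈ (Algebra.TensorProduct.map C.val C.val).range)

theorem hasAntipode_subBialgebra {S : H →ₗ[ℂ] H}
    (h : LinearMap.mul' ℂ H ∘ₗ LinearMap.rTensor H S ∘ₗ comul = Algebra.linearMap ℂ H ∘ₗ counit)
    (h' : LinearMap.mul' ℂ H ∘ₗ LinearMap.lTensor H S ∘ₗ comul = Algebra.linearMap ℂ H ∘ₗ counit)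
    (hS : ∀ x ∈ C, S x ∈ C) : let := subBialgebra C hC; HasAntipode C := by
  let := subBialgebra C hC
  let T : C →ₗ[ℂ] C := S.restrict (p := C.toSubmodule) (q := C.toSubmodule) hS
  have e1 : ∀ z : C ⊗[ℂ] C, (LinearMap.mul' ℂ C (LinearMap.rTensor C T z) : H) =
      LinearMap.mul' ℂ H (LinearMap.rTensor H S (Algebra.TensorProduct.map C.val C.val z)) := by
    intro z
    induction z using TensorProduct.induction_on with
    | zero => simp
    | add x y hx hy => simp only [map_add, Subalgebra.coe_add, hx, hy]
    | tmul x y => rfl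
  have e2 : ∀ z : C ⊗[ℂ] C, (LinearMap.mul' ℂ C (LinearMap.lTensor C T z) : H) =
      LinearMap.mul' ℂ H (LinearMap.lTensor H S (Algebra.TensorProduct.map C.val C.val z)) := by
    intro z
    induction z using TensorProduct.induction_on with
    | zero => simp
    | add x y hx hy => simp only [map_add, Subalgebra.coe_add, hx, hy]
    | tmul x y => rfl
  refine ⟨T, LinearMap.ext fun x => Subtype.val_injective ?_,
    LinearMap.ext fun x => Subtype.val_injective ?_⟩
  · refine (e1 _).trans ?_
    change LinearMap.mul' ℂ H (LinearMap.rTensor H S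
      (Algebra.TensorProduct.map C.val C.val (subComul C hC x))) = _
    rw [map_subComul]
    exact LinearMap.congr_fun h (x : H)
  · refine (e2 _).trans ?_
    change LinearMap.mul' ℂ H (LinearMap.lTensor H S
      (Algebra.TensorProduct.map C.val C.val (subComul C hC x))) = _
    rw [map_subComul]
    exact LinearMap.congr_fun h' (x : H)

end SubBialgebra

/-- The restriction of a dual quasitriangular structure to a Hopf subalgebra. -/
theorem IsDualQuasitriangular.comap {H C : Type*} [Ring H] [Bialgebra ℂ H] [Ring C]
    [Bialgebra ℂ C] {r : H ⊗[ℂ] H →ₗ[ℂ] ℂ} (hr : IsDualQuasitriangular r) (f : C →ₐ[ℂ] H)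
    (hf : Function.Injective f)
    (hmap : ∀ x, TensorProduct.map f.toLinearMap f.toLinearMap (comul x) = comul (R := ℂ) (f x))
    (hcounit : ∀ x, counit (R := ℂ) (f x) = counit (R := ℂ) x) (hC : HasAntipode C) :
    IsDualQuasitriangular (r ∘ₗ TensorProduct.map f.toLinearMap f.toLinearMap) := by
  have hsk := hr.isSkewPairing
  have hsk' : IsSkewPairing (r ∘ₗ TensorProduct.map f.toLinearMap f.toLinearMap) := by
    refine ⟨fun a => ?_, fun a => ?_, fun a b c => ?_, fun a b c => ?_⟩
    · simp [hsk.one_left, hcounit]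
    · simp [hsk.one_right, hcounit]
    · simp only [LinearMap.comp_apply, TensorProduct.map_tmul, AlgHom.toLinearMap_apply, map_mul,
        hsk.mul_left, ← hmap]
      generalize comul (R := ℂ) c = z
      induction z using TensorProduct.induction_on with
      | zero => simp
      | add x y hx hy => simp only [map_add, hx, hy]
      | tmul x y => rfl
    · simp only [LinearMap.comp_apply, TensorProduct.map_tmul, AlgHom.toLinearMap_apply, map_mul,
        hsk.mul_right, ← hmap]
      generalize comul (R := ℂ) a = z
      induction z using TensorProduct.induction_on with
      | zero => simp
      | add x y hx hy => simp only [map_add, hx, hy]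
      | tmul x y => rfl
  refine ⟨hsk'.isUnit_toConv hC, hsk'.mul_left, hsk'.mul_right, ?_⟩
  apply TensorProduct.ext'
  intro a b
  apply hf
  have h := LinearMap.congr_fun hr.quasi_comm (f a ⊗ₜ f b)
  simp only [LinearMap.comp_apply, TensorProduct.comul_tmul, ← hmap] at h ⊢
  generalize comul (R := ℂ) a = z at h ⊢
  generalize comul (R := ℂ) b = w at h ⊢
  refine Eq.trans ?_ (h.trans ?_)
  · clear h
    induction z using TensorProduct.induction_on with
    | zero => simp
    | add x y hx hy => simp only [map_add, add_tmul, hx, hy]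
    | tmul x y =>
      induction w using TensorProduct.induction_on with
      | zero => simp
      | add x y hx hy => simp only [map_add, tmul_add, hx, hy]
      | tmul u v => simp
  · clear h
    induction z using TensorProduct.induction_on with
    | zero => simp
    | add x y hx hy => simp only [map_add, add_tmul, hx, hy]
    | tmul x y =>
      induction w using TensorProduct.induction_on with
      | zero => simp
      | add x y hx hy => simp only [map_add, tmul_add, hx, hy]
      | tmul u v => simp

section YangBaxter

variable {ι : Type*} [Fintype ι] [DecidableEq ι]

theorem mul_leg23_apply (X : Matrix (ι × ι × ι) (ι × ι × ι) ℂ) (M : Matrix (ι × ι) (ι × ι) ℂ)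
    (x : ι × ι × ι) (n j l : ι) :
    (X * leg23 M) x (n, j, l) = ∑ a, ∑ b, X x (n, a, b) * M (a, b) (j, l) := by
  simp [Matrix.mul_apply, Fintype.sum_prod_type, leg23]

theorem leg23_mul_apply (X : Matrix (ι × ι × ι) (ι × ι × ι) ℂ) (M : Matrix (ι × ι) (ι × ι) ℂ)
    (m i k : ι) (y : ι × ι × ι) :
    (leg23 M * X) (m, i, k) y = ∑ a, ∑ b, M (i, k) (a, b) * X (m, a, b) y := by
  simp [Matrix.mul_apply, Fintype.sum_prod_type, leg23]

theorem mul_leg12_apply (X : Matrix (ι × ι × ι) (ι × ι × ι) ℂ) (M : Matrix (ι × ι) (ι × ι) ℂ)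
    (x : ι × ι × ι) (n j l : ι) :
    (X * leg12 M) x (n, j, l) = ∑ a, ∑ b, X x (a, b, l) * M (a, b) (n, j) := by
  simp [Matrix.mul_apply, Fintype.sum_prod_type, leg12]

theorem leg12_mul_apply (X : Matrix (ι × ι × ι) (ι × ι × ι) ℂ) (M : Matrix (ι × ι) (ι × ι) ℂ)
    (m i k : ι) (y : ι × ι × ι) :
    (leg12 M * X) (m, i, k) y = ∑ a, ∑ b, M (m, i) (a, b) * X (a, b, k) y := by
  simp [Matrix.mul_apply, Fintype.sum_prod_type, leg12]

variable (R : Matrix (ι × ι) (ι × ι) ℂ) (m i k n j l : ι)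

theorem leg12_mul_leg13_apply : (leg12 R * leg13 R) (m, i, k) (n, j, l) =
    ∑ p, R (m, i) (p, j) * R (p, k) (n, l) := by
  simp [leg12_mul_apply, leg13]

theorem leg13_mul_leg12_apply : (leg13 R * leg12 R) (m, i, k) (n, j, l) =
    ∑ p, R (m, k) (p, l) * R (p, i) (n, j) := by
  simp [mul_leg12_apply, leg13]

theorem leg13_mul_leg23_apply : (leg13 R * leg23 R) (m, i, k) (n, j, l) =
    ∑ p, R (m, k) (n, p) * R (i, p) (j, l) := by
  simp [mul_leg23_apply, leg13]

theorem leg23_mul_leg13_apply : (leg23 R * leg13 R) (m, i, k) (n, j, l) =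
    ∑ p, R (i, k) (j, p) * R (m, p) (n, l) := by
  simp [leg23_mul_apply, leg13]

variable {R} {A : Type*} [Ring A] [Bialgebra ℂ A] {r : A ⊗[ℂ] A →ₗ[ℂ] ℂ} {t : ι → ι → A}
  {M : Matrix (ι × ι) (ι × ι) ℂ} {c : ℂ}

/-- The pairing of `t₁` with the relations `M₂₃ t₂ t₃ = t₃ t₂ M₂₃`. -/
theorem MatrixRelation.leg12_leg13_leg23 (h : MatrixRelation M t t)
    (hΔ : ∀ i j, comul (R := ℂ) (t i j) = ∑ a, t i a ⊗ₜ[ℂ] t a j) (hr : IsSkewPairing r)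
    (hc : c ≠ 0) (hR : ∀ i j k l, r (t i j ⊗ₜ t k l) = c * R (i, k) (j, l)) :
    leg12 R * leg13 R * leg23 M = leg23 M * leg13 R * leg12 R := by
  have h2 : ∀ m n a b i k, r (t m n ⊗ₜ (t a b * t i k)) =
      c ^ 2 * ∑ p, R (m, i) (p, k) * R (p, a) (n, b) := by
    intro m n a b i k
    rw [hr.mul_right, hΔ]
    simp only [map_sum, TensorProduct.map_tmul, LinearMap.comp_apply, LinearMap.flip_apply,
      TensorProduct.mk_apply, LinearMap.mul'_apply, hR, Finset.mul_sum]
    exact Finset.sum_congr rfl fun p _ => by ring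
  ext ⟨m, i, k⟩ ⟨n, j, l⟩
  have h1 := congrArg (fun z => r (t m n ⊗ₜ z)) (h i k j l)
  simp only [tmul_sum, tmul_smul, map_sum, map_smul, h2, smul_eq_mul, mul_left_comm _ (c ^ 2),
    ← Finset.mul_sum] at h1
  rw [mul_leg23_apply, mul_assoc, leg23_mul_apply]
  simp only [leg12_mul_leg13_apply, leg13_mul_leg12_apply]
  simp only [mul_comm _ (M _ _)]
  exact (mul_left_cancel₀ (pow_ne_zero 2 hc) h1).symm

/-- The pairing of the relations `M₁₂ t₁ t₂ = t₂ t₁ M₁₂` with `t₃`. -/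
theorem MatrixRelation.leg23_leg13_leg12 (h : MatrixRelation M t t)
    (hΔ : ∀ i j, comul (R := ℂ) (t i j) = ∑ a, t i a ⊗ₜ[ℂ] t a j) (hr : IsSkewPairing r)
    (hc : c ≠ 0) (hR : ∀ i j k l, r (t i j ⊗ₜ t k l) = c * R (i, k) (j, l)) :
    leg23 R * leg13 R * leg12 M = leg12 M * leg13 R * leg23 R := by
  have h2 : ∀ m n a b i k, r ((t a b * t i k) ⊗ₜ t m n) =
      c ^ 2 * ∑ p, R (a, m) (b, p) * R (i, p) (k, n) := by
    intro m n a b i k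
    rw [hr.mul_left, hΔ]
    simp only [map_sum, TensorProduct.map_tmul, LinearMap.comp_apply,
      TensorProduct.mk_apply, LinearMap.mul'_apply, hR, Finset.mul_sum]
    exact Finset.sum_congr rfl fun p _ => by ring
  ext ⟨i, k, m⟩ ⟨j, l, n⟩
  have h1 := congrArg (fun z => r (z ⊗ₜ t m n)) (h i k j l)
  simp only [sum_tmul, ← smul_tmul', map_sum, map_smul, h2, smul_eq_mul, mul_left_comm _ (c ^ 2),
    ← Finset.mul_sum] at h1
  rw [mul_leg12_apply, mul_assoc, leg12_mul_apply]
  simp only [leg13_mul_leg23_apply, leg23_mul_leg13_apply]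
  simp only [mul_comm _ (M _ _)]
  exact (mul_left_cancel₀ (pow_ne_zero 2 hc) h1).symm

end YangBaxter

end QPoincare
end

noncomputable section

namespace QPoincare

open Coalgebra TensorProduct WithConv

section SlMatrix

theorem slR_apply (q : ℂ) :
    slR q (0, 0) (0, 0) = q ∧ slR q (0, 0) (0, 1) = 0 ∧ slR q (0, 0) (1, 0) = 0 ∧
    slR q (0, 0) (1, 1) = 0 ∧ slR q (0, 1) (0, 0) = 0 ∧ slR q (0, 1) (0, 1) = 1 ∧
    slR q (0, 1) (1, 0) = q - q⁻¹ ∧ slR q (0, 1) (1, 1) = 0 ∧ slR q (1, 0) (0, 0) = 0 ∧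
    slR q (1, 0) (0, 1) = 0 ∧ slR q (1, 0) (1, 0) = 1 ∧ slR q (1, 0) (1, 1) = 0 ∧
    slR q (1, 1) (0, 0) = 0 ∧ slR q (1, 1) (0, 1) = 0 ∧ slR q (1, 1) (1, 0) = 0 ∧
    slR q (1, 1) (1, 1) = q := by
  simp [slR]

theorem slR_mul_slR_inv {q : ℂ} (hq : q ≠ 0) : slR q * slR q⁻¹ = 1 := by
  ext ⟨i, k⟩ ⟨j, l⟩
  rw [Matrix.mul_apply, Fintype.sum_prod_type]
  simp only [Fin.sum_univ_two, Matrix.one_apply]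
  fin_cases i <;> fin_cases k <;> fin_cases j <;> fin_cases l <;> simp [slR_apply, hq]

theorem slR_inv_mul_slR {q : ℂ} (hq : q ≠ 0) : slR q⁻¹ * slR q = 1 := by
  have := slR_mul_slR_inv (inv_ne_zero hq)
  rwa [inv_inv] at this

theorem inv_slR {q : ℂ} (hq : q ≠ 0) : (slR q)⁻¹ = slR q⁻¹ :=
  Matrix.inv_eq_right_inv (slR_mul_slR_inv hq)

/-- The matrices `r(x^i_j ⊗ t^k_l)`, transposed, of the dual quasitriangular structure. -/
def posL (q c : ℂ) (k l : Fin 2) : Matrix (Fin 2) (Fin 2) ℂ :=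
  Matrix.of fun i j => c * slR q (j, k) (i, l)

/-- The matrices `r(t^i_j ⊗ s^k_l)`, transposed, of the dual quasitriangular structure. -/
def negL (q c : ℂ) (k l : Fin 2) : Matrix (Fin 2) (Fin 2) ℂ :=
  Matrix.of fun i j => c⁻¹ * slR q⁻¹ (k, j) (l, i)

variable {q c : ℂ}

theorem matrixRelation_posL (hq : q ≠ 0) : MatrixRelation (slR q) (posL q c) (posL q c) := by
  intro i k j l
  ext m n
  simp only [Fin.sum_univ_two, posL, Matrix.add_apply, Matrix.smul_apply, Matrix.mul_apply,
    Matrix.of_apply, smul_eq_mul]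
  fin_cases i <;> fin_cases k <;> fin_cases j <;> fin_cases l <;> fin_cases m <;> fin_cases n <;>
    simp [slR_apply] <;> field_simp <;> ring

theorem matrixRelation_negL (hq : q ≠ 0) : MatrixRelation (slR q) (negL q c) (negL q c) := by
  intro i k j l
  ext m n
  simp only [Fin.sum_univ_two, negL, Matrix.add_apply, Matrix.smul_apply, Matrix.mul_apply,
    Matrix.of_apply, smul_eq_mul]
  fin_cases i <;> fin_cases k <;> fin_cases j <;> fin_cases l <;> fin_cases m <;> fin_cases n <;>
    simp [slR_apply] <;> field_simp <;> ring

theorem matrixRelation_negL_posL (hq : q ≠ 0) :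
    MatrixRelation (slR q) (negL q c) (posL q c) := by
  intro i k j l
  ext m n
  simp only [Fin.sum_univ_two, negL, posL, Matrix.add_apply, Matrix.smul_apply, Matrix.mul_apply,
    Matrix.of_apply, smul_eq_mul]
  fin_cases i <;> fin_cases k <;> fin_cases j <;> fin_cases l <;> fin_cases m <;> fin_cases n <;>
    simp [slR_apply] <;> (try field_simp) <;> (try ring_nf) <;> (try simp)

/-- The coefficients `L`, `L'` of two representations satisfy the relations `R₁₂ u₁ v₂ = v₂ u₁ R₁₂`
on a matrix of generators. -/
def CoeffRelation (q : ℂ) (L L' : Fin 2 → Fin 2 → Matrix (Fin 2) (Fin 2) ℂ) : Prop :=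
  ∀ m n i k j l, ∑ a, ∑ b, slR q (i, k) (a, b) * ∑ x, L m x j a * L' x n l b =
    ∑ a, ∑ b, slR q (a, b) (j, l) * ∑ x, L' m x b k * L x n a i

theorem coeffRelation_posL (hq : q ≠ 0) : CoeffRelation q (posL q c) (posL q c) := by
  intro m n i k j l
  simp only [Fin.sum_univ_two, posL, Matrix.of_apply]
  fin_cases i <;> fin_cases k <;> fin_cases j <;> fin_cases l <;> fin_cases m <;> fin_cases n <;>
    simp [slR_apply] <;> (try field_simp) <;> (try ring)

theorem coeffRelation_negL (hq : q ≠ 0) : CoeffRelation q (negL q c) (negL q c) := by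
  intro m n i k j l
  simp only [Fin.sum_univ_two, negL, Matrix.of_apply]
  fin_cases i <;> fin_cases k <;> fin_cases j <;> fin_cases l <;> fin_cases m <;> fin_cases n <;>
    simp [slR_apply] <;> (try field_simp) <;> (try ring)

theorem coeffRelation_posL_negL (hq : q ≠ 0) : CoeffRelation q (posL q c) (negL q c) := by
  intro m n i k j l
  simp only [Fin.sum_univ_two, posL, negL, Matrix.of_apply]
  fin_cases i <;> fin_cases k <;> fin_cases j <;> fin_cases l <;> fin_cases m <;> fin_cases n <;>
    simp [slR_apply] <;> (try field_simp) <;> (try ring_nf) <;> (try simp)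

theorem detRelation_posL (hq : q ≠ 0) (hc : c ^ 2 = q⁻¹) : DetRelation q (posL q c) := by
  have h : c * c = q⁻¹ := by rw [← hc, sq]
  have h1 : q * (c * c) = 1 := by rw [h, mul_inv_cancel₀ hq]
  unfold DetRelation
  ext m n
  simp only [posL, Matrix.sub_apply, Matrix.smul_apply, Matrix.mul_apply, Fin.sum_univ_two,
    Matrix.of_apply, smul_eq_mul]
  fin_cases m <;> fin_cases n <;> simp [slR_apply] <;> linear_combination h1

theorem detRelation_negL (hq : q ≠ 0) (hc : c ^ 2 = q⁻¹) : DetRelation q (negL q c) := by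
  have h : c⁻¹ * c⁻¹ = q := by rw [← mul_inv, ← sq, hc, inv_inv]
  have h1 : q⁻¹ * (c⁻¹ * c⁻¹) = 1 := by rw [h, inv_mul_cancel₀ hq]
  unfold DetRelation
  ext m n
  simp only [negL, Matrix.sub_apply, Matrix.smul_apply, Matrix.mul_apply, Fin.sum_univ_two,
    Matrix.of_apply, smul_eq_mul]
  fin_cases m <;> fin_cases n <;> simp [slR_apply] <;> linear_combination h1

end SlMatrix

section Adjugate

variable {S : Type*} [Ring S] [Algebra ℂ S]

/-- The entries of the inverse of a matrix with the relations of `SL_q(2)`. -/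
def adj (q : ℂ) (t : Fin 2 → Fin 2 → S) (i j : Fin 2) : S :=
  !![t 1 1, -q • t 0 1; -q⁻¹ • t 1 0, t 0 0] i j

theorem of_mul_adj {q : ℂ} (hq : q ≠ 0) {t : Fin 2 → Fin 2 → S} (h : MatrixRelation (slR q) t t)
    (hd : DetRelation q t) :
    Matrix.of t * Matrix.of (adj q t) = 1 ∧ Matrix.of (adj q t) * Matrix.of t = 1 ∧
      DetRelation q (fun i j => MulOpposite.op (adj q t i j)) := by
  obtain ⟨r1, r2, r3, r4⟩ := slR_relations h
  have r5 := h 0 1 0 0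
  have r6 := h 0 1 1 1
  simp [slR, Fin.sum_univ_two] at r5 r6
  have hd' : t 0 0 * t 1 1 - q⁻¹ • (t 0 1 * t 1 0) = 1 := hd
  have d : t 0 0 * t 1 1 = 1 + q⁻¹ • (t 0 1 * t 1 0) := by rw [← hd']; abel
  have r5' : t 0 0 * t 1 0 = q⁻¹ • (t 1 0 * t 0 0) := by
    rw [eq_sub_of_add_eq r5]; module
  have r6' : t 0 1 * t 1 1 = q⁻¹ • (t 1 1 * t 0 1) := by
    rw [eq_sub_of_add_eq r6]; module
  rw [d] at r4
  refine ⟨?_, ?_, ?_⟩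
  · ext i j
    fin_cases i <;> fin_cases j <;>
      simp [Matrix.mul_apply, adj, r1, r2, r3, r4, d, smul_smul, hq]
    module
  · ext i j
    fin_cases i <;> fin_cases j <;>
      simp [Matrix.mul_apply, adj, r3, r4, d, r5', r6', smul_smul, hq]
    module
  · apply MulOpposite.unop_injective
    simp [adj, r3, d, smul_smul, hq]

end Adjugate

namespace SpinLorentz

variable {q : ℂ}

/-- The matrices of generators: `s` for `true` and `t` for `false`. -/
def gen (q : ℂ) : Bool → Fin 2 → Fin 2 → SpinLorentz q := fun b => cond b (s q) (t q)

theorem adjoin_gen : Algebra.adjoin ℂ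
    (Set.range fun p : Bool × Fin 2 × Fin 2 => gen q p.1 p.2.1 p.2.2) = ⊤ := by
  have h : (RingQuot.mkAlgHom ℂ (SpinRel q)).range = ⊤ :=
    (AlgHom.range_eq_top _).mpr (RingQuot.mkAlgHom_surjective ℂ _)
  rw [← Algebra.map_top, ← FreeAlgebra.adjoin_range_ι, AlgHom.map_adjoin, ← Set.range_comp] at h
  refine top_le_iff.mp (h.ge.trans (Algebra.adjoin_mono ?_))
  rintro _ ⟨⟨i, j⟩ | ⟨i, j⟩, rfl⟩
  · exact ⟨(false, i, j), rfl⟩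
  · exact ⟨(true, i, j), rfl⟩

variable [NeZero q]

theorem comul_gen (b : Bool) (i j : Fin 2) :
    comul (R := ℂ) (gen q b i j) = ∑ a, gen q b i a ⊗ₜ[ℂ] gen q b a j := by
  cases b
  · exact comul_t i j
  · exact comul_s i j

theorem counit_gen (b : Bool) (i j : Fin 2) :
    counit (R := ℂ) (gen q b i j) = if i = j then 1 else 0 := by
  cases b
  · exact lift_t _ _ _ _ _ _ _ i j
  · exact lift_s _ _ _ _ _ _ _ i j

variable (q) in
/-- The antipode, as an algebra map to the opposite algebra. -/
def antipodeHom : SpinLorentz q →ₐ[ℂ] (SpinLorentz q)ᵐᵒᵖ :=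
  have ht := of_mul_adj (NeZero.ne q) (relation_tt q) (det_t q)
  have hs := of_mul_adj (NeZero.ne q) (relation_ss q) (det_s q)
  lift (fun i j => MulOpposite.op (adj q (t q) i j)) (fun i j => MulOpposite.op (adj q (s q) i j))
    ((relation_tt q).op_inv ht.1 ht.2.1 ht.1 ht.2.1)
    ((relation_ss q).op_inv hs.1 hs.2.1 hs.1 hs.2.1)
    ((relation_st q).op_inv hs.1 hs.2.1 ht.1 ht.2.1) ht.2.2 hs.2.2

theorem antipodeHom_gen (b : Bool) (i j : Fin 2) :
    antipodeHom q (gen q b i j) = MulOpposite.op (adj q (gen q b) i j) := by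
  cases b
  · exact lift_t _ _ _ _ _ _ _ i j
  · exact lift_s _ _ _ _ _ _ _ i j

theorem gen_mul_adj (b : Bool) : Matrix.of (gen q b) * Matrix.of (adj q (gen q b)) = 1 ∧
    Matrix.of (adj q (gen q b)) * Matrix.of (gen q b) = 1 := by
  cases b
  · have h := of_mul_adj (NeZero.ne q) (relation_tt q) (det_t q)
    exact ⟨h.1, h.2.1⟩
  · have h := of_mul_adj (NeZero.ne q) (relation_ss q) (det_s q)
    exact ⟨h.1, h.2.1⟩

variable (q) in
/-- The antipode of `SL_q(2) ⋈ SL_q(2)`. -/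
def antipodeMap : SpinLorentz q →ₗ[ℂ] SpinLorentz q :=
  (MulOpposite.opLinearEquiv ℂ).symm.toLinearMap ∘ₗ (antipodeHom q).toLinearMap

theorem antipodeMap_gen (b : Bool) (i j : Fin 2) :
    antipodeMap q (gen q b i j) = adj q (gen q b) i j := by
  simp [antipodeMap, antipodeHom_gen]

theorem antipodeMap_mul (x y : SpinLorentz q) :
    antipodeMap q (x * y) = antipodeMap q y * antipodeMap q x := by
  simp [antipodeMap]

theorem mul_antipodeMap :
    LinearMap.mul' ℂ _ ∘ₗ LinearMap.rTensor _ (antipodeMap q) ∘ₗ comul =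
      Algebra.linearMap ℂ _ ∘ₗ counit ∧
    LinearMap.mul' ℂ _ ∘ₗ LinearMap.lTensor _ (antipodeMap q) ∘ₗ comul =
      Algebra.linearMap ℂ _ ∘ₗ counit := by
  have one_entry : ∀ i j : Fin 2, algebraMap ℂ (SpinLorentz q) (if i = j then 1 else 0) =
      (1 : Matrix (Fin 2) (Fin 2) (SpinLorentz q)) i j := by
    intro i j
    rw [Matrix.one_apply]
    split_ifs <;> simp
  refine hasAntipode_of_generators (antipodeHom q) adjoin_gen ?_ ?_
  · rintro _ ⟨⟨b, i, j⟩, rfl⟩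
    change LinearMap.mul' ℂ _ (LinearMap.rTensor _ (antipodeMap q) (comul (gen q b i j))) =
      algebraMap ℂ _ (counit (gen q b i j))
    rw [counit_gen, one_entry, ← (gen_mul_adj b).2, Matrix.mul_apply, comul_gen]
    simp only [map_sum, LinearMap.rTensor_tmul, LinearMap.mul'_apply, antipodeMap_gen,
      Matrix.of_apply]
  · rintro _ ⟨⟨b, i, j⟩, rfl⟩
    change LinearMap.mul' ℂ _ (LinearMap.lTensor _ (antipodeMap q) (comul (gen q b i j))) =
      algebraMap ℂ _ (counit (gen q b i j))
    rw [counit_gen, one_entry, ← (gen_mul_adj b).1, Matrix.mul_apply, comul_gen]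
    simp only [map_sum, LinearMap.lTensor_tmul, LinearMap.mul'_apply, antipodeMap_gen,
      Matrix.of_apply]

theorem hasAntipode : HasAntipode (SpinLorentz q) := ⟨antipodeMap q, mul_antipodeMap⟩

end SpinLorentz

end QPoincare
end

noncomputable section

namespace QPoincare

open Coalgebra TensorProduct WithConv

namespace SpinLorentz

variable {q c : ℂ}

variable (q) in
/-- The representations `r(x^i_j ⊗ -)`, transposed, with `x = s` for `true` and `x = t` for
`false`. -/
def rep (hq : q ≠ 0) (hc : c ^ 2 = q⁻¹) : Bool → SpinLorentz q →ₐ[ℂ] Matrix (Fin 2) (Fin 2) ℂ :=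
  fun b => cond b
    (lift (posL q c) (posL q c) (matrixRelation_posL hq) (matrixRelation_posL hq)
      (matrixRelation_posL hq) (detRelation_posL hq hc) (detRelation_posL hq hc))
    (lift (posL q c) (negL q c) (matrixRelation_posL hq) (matrixRelation_negL hq)
      (matrixRelation_negL_posL hq) (detRelation_posL hq hc) (detRelation_negL hq hc))

variable (hq : q ≠ 0) (hc : c ^ 2 = q⁻¹)

variable (q c) in
/-- The values of the representations `rep` on generators. -/
def genL (b b' : Bool) : Fin 2 → Fin 2 → Matrix (Fin 2) (Fin 2) ℂ :=
  cond (!b && b') (negL q c) (posL q c)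

theorem rep_gen (b b' : Bool) (i j : Fin 2) : rep q hq hc b (gen q b' i j) = genL q c b b' i j := by
  have h1 := matrixRelation_posL (c := c) hq
  have h2 := detRelation_posL hq hc
  have h3 := matrixRelation_negL (c := c) hq
  have h4 := detRelation_negL hq hc
  have h5 := matrixRelation_negL_posL (c := c) hq
  cases b <;> cases b'
  · exact lift_t _ _ h1 h3 h5 h2 h4 i j
  · exact lift_s _ _ h1 h3 h5 h2 h4 i j
  · exact lift_t _ _ h1 h1 h1 h2 h2 i j
  · exact lift_s _ _ h1 h1 h1 h2 h2 i j

variable (q c) in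
/-- The matrices `r(x^i_j ⊗ y^k_l)`. -/
def genR (b b' : Bool) : Matrix (Fin 2 × Fin 2) (Fin 2 × Fin 2) ℂ :=
  cond (!b && b') (c⁻¹ • flipLegs (slR q⁻¹)) (c • slR q)

theorem rep_gen_apply (b b' : Bool) (i j m n : Fin 2) :
    rep q hq hc b (gen q b' m n) j i = genR q c b b' (i, m) (j, n) := by
  rw [rep_gen]
  cases b <;> cases b' <;> rfl

theorem matrixRelation_genR (hq : q ≠ 0) (b b' : Bool) :
    MatrixRelation (genR q c b b') (gen q b) (gen q b') := by
  cases b <;> cases b'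
  · exact (relation_tt q).smul c
  · exact ((relation_st q).flip_inv (slR_mul_slR_inv hq) (slR_inv_mul_slR hq)).smul c⁻¹
  · exact (relation_st q).smul c
  · exact (relation_ss q).smul c

variable [NeZero q]

theorem matrixRelation_repCoeff_rep (b b' : Bool) (hb : b' = true → b = true) :
    MatrixRelation (slR q) (repCoeff (rep q hq hc b)) (repCoeff (rep q hq hc b')) := by
  refine matrixRelation_repCoeff adjoin_gen ?_
  rintro _ ⟨⟨d, m, n⟩, rfl⟩ i k j l
  simp only [repCoeff_mul_repCoeff_matrix (X := gen q d) _ _ (comul_gen d), rep_gen]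
  have h1 := coeffRelation_posL (c := c) hq
  have h2 := coeffRelation_negL (c := c) hq
  have h3 := coeffRelation_posL_negL (c := c) hq
  revert hb
  cases b <;> cases b' <;> intro hb <;> cases d <;> simp at hb
  · exact h1 m n i k j l
  · exact h2 m n i k j l
  · exact h1 m n i k j l
  · exact h3 m n i k j l
  · exact h1 m n i k j l
  · exact h1 m n i k j l

theorem detRelation_repCoeff_rep (b : Bool) : DetRelation q (repCoeff (rep q hq hc b)) := by
  have h := sum_repCoeff_mul_repCoeff (F := rep q hq hc b)
    (w := fun x => if x = (0, 1) then 1 else if x = (1, 0) then - q⁻¹ else 0) adjoin_gen (by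
      rintro _ ⟨⟨d, m, n⟩, rfl⟩ i k
      simp only [repCoeff_mul_repCoeff_matrix (X := gen q d) _ _ (comul_gen d), counit_gen, rep_gen]
      have h : c * c = q⁻¹ := by rw [← hc, sq]
      have h1 : q * (c * c) = 1 := by rw [h, mul_inv_cancel₀ hq]
      have h' : c⁻¹ * c⁻¹ = q := by rw [← mul_inv, ← sq, hc, inv_inv]
      have h2 : q⁻¹ * (c⁻¹ * c⁻¹) = 1 := by rw [h', inv_mul_cancel₀ hq]
      have hneg : genL q c b d = negL q c ∨ genL q c b d = posL q c := by
        cases b <;> cases d <;> simp [genL]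
      rcases hneg with e | e <;> rw [e] <;>
      fin_cases i <;> fin_cases k <;> fin_cases m <;> fin_cases n <;>
      simp [slR_apply, posL, negL] <;>
      first
      | linear_combination h1
      | linear_combination h2
      | linear_combination q⁻¹ * h1
      | linear_combination q⁻¹ * h2
      | (field_simp; ring)) 0 1
  simp [Fin.sum_univ_two] at h
  rw [DetRelation, ← h]
  abel

variable (q) in
/-- The dual quasitriangular structure of `SL_q(2) ⋈ SL_q(2)`, as an algebra map to the convolution
algebra. -/
def rHom : SpinLorentz q →ₐ[ℂ] WithConv (SpinLorentz q →ₗ[ℂ] ℂ) :=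
  lift (repCoeff (rep q hq hc false)) (repCoeff (rep q hq hc true))
    (matrixRelation_repCoeff_rep hq hc false false (fun h => h))
    (matrixRelation_repCoeff_rep hq hc true true (fun h => h))
    (matrixRelation_repCoeff_rep hq hc true false (fun _ => rfl))
    (detRelation_repCoeff_rep hq hc false) (detRelation_repCoeff_rep hq hc true)

theorem rHom_gen (b : Bool) (i j : Fin 2) :
    rHom q hq hc (gen q b i j) = repCoeff (rep q hq hc b) i j := by
  have h1 := matrixRelation_repCoeff_rep hq hc false false (fun h => h)
  have h2 := matrixRelation_repCoeff_rep hq hc true true (fun h => h)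
  have h3 := matrixRelation_repCoeff_rep hq hc true false (fun _ => rfl)
  have h4 := detRelation_repCoeff_rep hq hc false
  have h5 := detRelation_repCoeff_rep hq hc true
  cases b
  · exact lift_t _ _ h1 h2 h3 h4 h5 i j
  · exact lift_s _ _ h1 h2 h3 h4 h5 i j

theorem isDualQuasitriangular_rHom : IsDualQuasitriangular (formOfAlgHom (rHom q hq hc)) := by
  refine isDualQuasitriangular_formOfAlgHom (F := rep q hq hc) (X := gen q) (M := genR q c) _ adjoin_gen comul_gen
    counit_gen (fun b i j _ => ?_) (fun b b' => rep_gen_apply hq hc b b')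
    (matrixRelation_genR hq) hasAntipode
  rw [rHom_gen]
  rfl

theorem formOfAlgHom_rHom_gen (b b' : Bool) (i j k l : Fin 2) :
    formOfAlgHom (rHom q hq hc) (gen q b i j ⊗ₜ gen q b' k l) = genR q c b b' (i, k) (j, l) := by
  rw [formOfAlgHom_tmul, rHom_gen, repCoeff_apply, rep_gen_apply]

end SpinLorentz

end QPoincare
end

noncomputable section

namespace QPoincare

open Coalgebra TensorProduct WithConv

section PermMatrix

theorem permMatrix_eq {ι : Type*} [DecidableEq ι] : permMatrix ι = (1 : Matrix (ι × ι) (ι × ι) ℂ).submatrix Prod.swap id := by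
  ext x y
  rw [Matrix.submatrix_apply, Matrix.one_apply, permMatrix]
  simp [Prod.ext_iff, and_comm]

variable {ι : Type*} [Fintype ι] [DecidableEq ι] {S : Type*} [Ring S] [Algebra ℂ S]

theorem permMatrix_mul_apply (M : Matrix (ι × ι) (ι × ι) ℂ) (x y : ι × ι) :
    (permMatrix ι * M) x y = M x.swap y := by
  rw [permMatrix_eq, Matrix.mul_apply]
  simp [Matrix.one_apply]

theorem mul_permMatrix_apply (M : Matrix (ι × ι) (ι × ι) ℂ) (x y : ι × ι) :
    (M * permMatrix ι) x y = M x y.swap := by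
  rw [permMatrix_eq, Matrix.mul_apply]
  simp only [Matrix.submatrix_apply, Matrix.one_apply, id_eq, mul_ite, mul_one, mul_zero]
  rw [Finset.sum_eq_single y.swap]
  · simp
  · intro b _ hb
    rw [if_neg]
    rintro rfl
    simp at hb
  · simp

theorem permMatrix_mul_self : permMatrix ι * permMatrix ι = 1 := by
  ext x y
  rw [permMatrix_mul_apply, permMatrix_eq, Matrix.submatrix_apply, Prod.swap_swap, id]

theorem flipLegs_eq (M : Matrix (ι × ι) (ι × ι) ℂ) :
    flipLegs M = permMatrix ι * M * permMatrix ι := by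
  ext x y
  rw [mul_permMatrix_apply, permMatrix_mul_apply]
  rfl

/-- The relations `M₁₂ t₁ t₂ = t₂ t₁ M₁₂` say that `P M` commutes with `t₁ t₂`. -/
theorem matrixRelation_self_iff {M : Matrix (ι × ι) (ι × ι) ℂ} {t : ι → ι → S} :
    MatrixRelation M t t ↔ Commute ((permMatrix ι * M).map (algebraMap ℂ S))
      (Matrix.of fun x y : ι × ι => t x.1 y.1 * t x.2 y.2) := by
  rw [matrixRelation_iff, Commute, SemiconjBy, ← Matrix.ext_iff, ← Matrix.ext_iff]
  rw [← (Equiv.prodComm ι ι).forall_congr_right]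
  refine forall_congr' fun x => forall_congr' fun y => ?_
  rw [Matrix.mul_apply, Matrix.mul_apply, Matrix.mul_apply, Matrix.mul_apply]
  simp only [Matrix.map_apply, permMatrix_mul_apply, Matrix.of_apply, Equiv.prodComm_apply,
    Prod.fst_swap, Prod.snd_swap]
  rw [← (Equiv.prodComm ι ι).sum_comp
    (fun z => t x.1 z.1 * t x.2 z.2 * algebraMap ℂ S (M z.swap y))]
  rfl

theorem MatrixRelation.mul_eq {M N : Matrix (ι × ι) (ι × ι) ℂ} {s t : ι → ι → S}
    (h : MatrixRelation M s t) (hMN : M * N = 1) (i j k l : ι) :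
    t k l * s i j = ∑ y, ∑ x, (M (i, k) x * N y (j, l)) • (s x.1 y.1 * t x.2 y.2) := by
  have h1 := matrixRelation_iff.mp h
  have e1 : M.map (algebraMap ℂ S) * N.map (algebraMap ℂ S) = 1 := by
    rw [← Matrix.map_mul, hMN, Matrix.map_one _ (map_zero _) (map_one _)]
  have h2 := congrArg (· * N.map (algebraMap ℂ S)) h1
  simp only [mul_assoc, e1, mul_one] at h2
  have h3 := congrFun (congrFun h2.symm (i, k)) (j, l)
  rw [← mul_assoc, Matrix.mul_apply] at h3
  refine h3.trans (Finset.sum_congr rfl fun y _ => ?_)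
  rw [Matrix.mul_apply, Finset.sum_mul]
  refine Finset.sum_congr rfl fun x _ => ?_
  rw [Matrix.map_apply, Matrix.map_apply, Matrix.of_apply, ← Algebra.commutes, ← mul_assoc,
    ← map_mul, mul_comm (N _ _), ← Algebra.smul_def]

end PermMatrix

section LorentzAntipode

variable {q : ℂ}

theorem adj_eq {S : Type*} [Ring S] [Algebra ℂ S] (t : Fin 2 → Fin 2 → S) (i j : Fin 2) :
    ∃ c : ℂ, adj q t i j = c • t (1 - j) (1 - i) := by
  fin_cases i <;> fin_cases j
  · exact ⟨1, by simp [adj]⟩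
  · exact ⟨-q, by simp [adj]⟩
  · exact ⟨-q⁻¹, by simp [adj]⟩
  · exact ⟨1, by simp [adj]⟩

theorem adjoin_lorentzMatrix : Algebra.adjoin ℂ (Set.range
    fun p : (Fin 2 × Fin 2) × (Fin 2 × Fin 2) => lorentzMatrix q p.1 p.2) = ⊤ := by
  have h := Algebra.adjoin_adjoin_coe_preimage (R := ℂ) (s := Set.range
    fun p : (Fin 2 × Fin 2) × (Fin 2 × Fin 2) => vectorMatrix q p.1 p.2)
  refine Eq.trans (congrArg _ ?_) h
  ext x
  constructor
  · rintro ⟨p, rfl⟩; exact ⟨p, rfl⟩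
  · rintro ⟨p, hp⟩; exact ⟨p, Subtype.ext hp⟩

variable [NeZero q]

open SpinLorentz in
theorem antipodeMap_mem_lorentz (x : SpinLorentz q) (hx : x ∈ lorentzSubalgebra q) :
    antipodeMap q x ∈ lorentzSubalgebra q := by
  induction hx using Algebra.adjoin_induction with
  | algebraMap c =>
    have : antipodeMap q (algebraMap ℂ _ c) = algebraMap ℂ _ c := by simp [antipodeMap]
    rw [this]
    exact Subalgebra.algebraMap_mem _ c
  | add x y _ _ hx hy => rw [map_add]; exact add_mem hx hy
  | mul x y _ _ hx hy => rw [antipodeMap_mul]; exact mul_mem hy hx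
  | mem x hx =>
    obtain ⟨⟨i, j⟩, rfl⟩ := hx
    have ht := gen_mul_adj (q := q) false
    have hs := gen_mul_adj (q := q) true
    have h := ((relation_st q).op_inv hs.1 hs.2 ht.1 ht.2).mul_eq
      (slR_mul_slR_inv (NeZero.ne q)) i.2 j.2 i.1 j.1
    have h' := congrArg MulOpposite.unop h
    simp only [Finset.unop_sum, MulOpposite.unop_smul, MulOpposite.unop_mul,
      MulOpposite.unop_op] at h'
    have e : antipodeMap q (vectorMatrix q i j) =
        adj q (gen q true) i.2 j.2 * adj q (gen q false) i.1 j.1 := by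
      rw [vectorMatrix, antipodeMap_mul]
      exact congrArg₂ _ (antipodeMap_gen true _ _) (antipodeMap_gen false _ _)
    change antipodeMap q (vectorMatrix q i j) ∈ _
    rw [e, h']
    refine sum_mem fun y _ => sum_mem fun x _ => Subalgebra.smul_mem _ ?_ _
    obtain ⟨a, ha⟩ := adj_eq (q := q) (gen q false) x.2 y.2
    obtain ⟨b, hb⟩ := adj_eq (q := q) (gen q true) x.1 y.1
    rw [ha, hb, smul_mul_smul_comm]
    exact Subalgebra.smul_mem _ (Algebra.subset_adjoin
      (Set.mem_range_self ((1 - y.2, 1 - y.1), (1 - x.2, 1 - x.1)))) _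

theorem hasAntipode_lorentzGroup : HasAntipode (LorentzGroup q) :=
  hasAntipode_subBialgebra (comul_mem_lorentz q) SpinLorentz.mul_antipodeMap.1
    SpinLorentz.mul_antipodeMap.2 antipodeMap_mem_lorentz

theorem comul_lorentzMatrix (i j : Fin 2 × Fin 2) :
    comul (R := ℂ) (lorentzMatrix q i j) = ∑ a, lorentzMatrix q i a ⊗ₜ[ℂ] lorentzMatrix q a j := by
  apply tensor_val_injective
  refine (map_subComul _ (comul_mem_lorentz q) _).trans ?_
  simp only [map_sum, Algebra.TensorProduct.map_tmul]
  exact comul_vectorMatrix q i j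

theorem counit_lorentzMatrix (i j : Fin 2 × Fin 2) :
    counit (R := ℂ) (lorentzMatrix q i j) = if i = j then 1 else 0 := by
  change counit (R := ℂ) (vectorMatrix q i j) = _
  rw [vectorMatrix, Bialgebra.counit_mul]
  refine (congrArg₂ _ (SpinLorentz.counit_gen false _ _)
    (SpinLorentz.counit_gen true _ _)).trans ?_
  by_cases h1 : i.1 = j.1 <;> by_cases h2 : i.2 = j.2 <;> simp [Prod.ext_iff, h1, h2]

end LorentzAntipode

section LorentzForm

variable {q c : ℂ} [NeZero q] (hc : c ^ 2 = q⁻¹)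

/-- The dual quasitriangular structure of `SO_q(1,3)`. -/
def lorentzForm : LorentzGroup q ⊗[ℂ] LorentzGroup q →ₗ[ℂ] ℂ :=
  formOfAlgHom (SpinLorentz.rHom q (NeZero.ne q) hc) ∘ₗ
    TensorProduct.map (lorentzSubalgebra q).val.toLinearMap (lorentzSubalgebra q).val.toLinearMap

theorem isDualQuasitriangular_lorentzForm : IsDualQuasitriangular (A := LorentzGroup q) (lorentzForm (q := q) hc) := by
  refine (SpinLorentz.isDualQuasitriangular_rHom (NeZero.ne q) hc).comap
    (lorentzSubalgebra q).val Subtype.val_injective ?_ ?_ hasAntipode_lorentzGroup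
  · exact fun x => map_subComul _ (comul_mem_lorentz q) x
  · exact fun x => rfl

open SpinLorentz in
theorem lorentzForm_lorentzMatrix (i j k l : Fin 2 × Fin 2) :
    lorentzForm hc (lorentzMatrix q i j ⊗ₜ lorentzMatrix q k l) = q⁻¹ * lorentzR q (i, k) (j, l) := by
  have hq := NeZero.ne q
  set r := formOfAlgHom (rHom q hq hc) with hr
  have hd : IsDualQuasitriangular r := isDualQuasitriangular_rHom hq hc
  have e1 : ∀ b (i j : Fin 2) (k l : Fin 2 × Fin 2), r (gen q b i j ⊗ₜ vectorMatrix q k l) =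
      ∑ m, genR q c b true (i, k.2) (m, l.2) * genR q c b false (m, k.1) (j, l.1) := by
    intro b i j k l
    rw [vectorMatrix, hd.mul_right, comul_gen]
    simp only [map_sum, TensorProduct.map_tmul, LinearMap.mul'_apply, LinearMap.comp_apply,
      LinearMap.flip_apply, TensorProduct.mk_apply]
    exact Finset.sum_congr rfl fun m _ => congrArg₂ _
      (formOfAlgHom_rHom_gen hq hc b true i m k.2 l.2)
      (formOfAlgHom_rHom_gen hq hc b false m j k.1 l.1)
  have e2 : lorentzForm hc (lorentzMatrix q i j ⊗ₜ lorentzMatrix q k l) =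
      ∑ m, r (gen q false i.1 j.1 ⊗ₜ vectorMatrix q k m) *
        r (gen q true i.2 j.2 ⊗ₜ vectorMatrix q m l) := by
    change r (vectorMatrix q i j ⊗ₜ vectorMatrix q k l) = _
    rw [vectorMatrix, hd.mul_left, comul_vectorMatrix]
    simp only [map_sum, TensorProduct.map_tmul, LinearMap.mul'_apply, LinearMap.comp_apply,
      TensorProduct.mk_apply]
    rfl
  have hc0 : c ≠ 0 := by
    rintro rfl
    exact inv_ne_zero hq (by simpa using hc.symm)
  have hc1 : c⁻¹ * c * c * c = q⁻¹ := by rw [← hc]; field_simp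
  rw [e2, lorentzR, ← hc1, inv_slR hq]
  simp only [e1, Fintype.sum_prod_type, genR, Bool.not_false, Bool.not_true, Bool.false_and,
    Bool.true_and, cond_true, cond_false, Matrix.smul_apply, smul_eq_mul, flipLegs,
    Matrix.submatrix_apply, Prod.swap_prod_mk, Fin.sum_univ_two]
  ring

theorem relation_lorentzR (hc : c ^ 2 = q⁻¹) :
    MatrixRelation (lorentzR q) (lorentzMatrix q) (lorentzMatrix q) := by
  have hd := isDualQuasitriangular_lorentzForm (q := q) hc
  have h := (mulForm_eq_formMul_iff (H := LorentzGroup q) (r := lorentzForm (q := q) hc) (M := q⁻¹ • lorentzR q)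
    (comul_lorentzMatrix (q := q)) (comul_lorentzMatrix (q := q)) (fun i j k l => by
      rw [lorentzForm_lorentzMatrix, Matrix.smul_apply, smul_eq_mul])).mp
    (fun i j k l => LinearMap.congr_fun hd.quasi_comm _)
  have := h.smul q
  rwa [smul_smul, mul_inv_cancel₀ (NeZero.ne q), one_smul] at this

end LorentzForm

end QPoincare
end

noncomputable section

namespace QPoincare

open Coalgebra TensorProduct WithConv

section Braid

variable {A : Type*} [Ring A] [Algebra ℂ A]

/-- If commuting `X` and `Y` have eigenvalues among `q`, `-q⁻¹`, then `XY` has eigenvalues among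
`-1`, `q⁻²` and `q²`. -/
theorem cubic_of_commute {q : ℂ} (hq : q ≠ 0) {X Y : A} (hXY : X * Y = Y * X)
    (hX : X * X = (q - q⁻¹) • X + 1) (hY : Y * Y = (q - q⁻¹) • Y + 1) :
    (X * Y + 1) * ((X * Y - (q ^ 2)⁻¹ • 1) * (X * Y - q ^ 2 • 1)) = 0 := by
  set Z := X * Y with hZ
  have h1 : Z * X = (q - q⁻¹) • Z + Y := by
    rw [hZ, mul_assoc, ← hXY, ← mul_assoc, hX, add_mul, smul_mul_assoc, one_mul]
  have h2 : Z * Y = (q - q⁻¹) • Z + X := by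
    rw [hZ, mul_assoc, hY, mul_add, mul_smul_comm, mul_one]
  have h3 : Z * Z = (q - q⁻¹) ^ 2 • Z + (q - q⁻¹) • (X + Y) + 1 := by
    conv_lhs => rw [hZ, ← hZ, ← mul_assoc, h1, add_mul, smul_mul_assoc, h2, hY]
    module
  have h4 : (Z - (q ^ 2)⁻¹ • 1) * (Z - q ^ 2 • 1) =
      (-2 : ℂ) • Z + (q - q⁻¹) • (X + Y) + (2 : ℂ) • 1 := by
    simp only [sub_mul, mul_sub, h3, smul_mul_assoc, mul_smul_comm, one_mul, mul_one]
    match_scalars <;> (try field_simp) <;> ring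
  rw [h4]
  simp only [add_mul, mul_add, mul_smul_comm, h3, h1, h2, one_mul, mul_one]
  match_scalars <;> ring

theorem MatrixRelation.of_permMatrix_mul {ι : Type*} [Fintype ι] [DecidableEq ι]
    {M N : Matrix (ι × ι) (ι × ι) ℂ} {t : ι → ι → A} (h : MatrixRelation M t t) {a b c : ℂ}
    (hN : permMatrix ι * N =
      1 + c • ((permMatrix ι * M - a • 1) * (permMatrix ι * M - b • 1))) :
    MatrixRelation N t t := by
  rw [matrixRelation_self_iff] at h ⊢
  let φ : Matrix (ι × ι) (ι × ι) ℂ →ₐ[ℂ] Matrix (ι × ι) (ι × ι) A :=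
    (Algebra.ofId ℂ A).mapMatrix
  have e : ∀ X : Matrix (ι × ι) (ι × ι) ℂ, X.map (algebraMap ℂ A) = φ X := fun _ => rfl
  rw [e] at h ⊢
  rw [hN]
  simp only [map_add, map_one, map_smul, map_mul, map_sub] at h ⊢
  have h' : ∀ z : ℂ, Commute (φ (permMatrix ι) * φ M - z • 1)
      (Matrix.of fun x y : ι × ι => t x.1 y.1 * t x.2 y.2) :=
    fun z => h.sub_left ((Commute.one_left _).smul_left z)
  exact (Commute.one_left _).add_left (((h' _).mul_left (h' _)).smul_left c)

end Braid

section LorentzMatrix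

open scoped Kronecker

/-- A matrix acting on the inner two tensor factors. -/
def midLegs (N : Matrix (Fin 2 × Fin 2) (Fin 2 × Fin 2) ℂ) :
    Matrix ((Fin 2 × Fin 2) × (Fin 2 × Fin 2)) ((Fin 2 × Fin 2) × (Fin 2 × Fin 2)) ℂ :=
  fun x y => if x.1.1 = y.1.1 ∧ x.2.2 = y.2.2 then N (x.1.2, x.2.1) (y.1.2, y.2.1) else 0

theorem midLegs_mul (M N : Matrix (Fin 2 × Fin 2) (Fin 2 × Fin 2) ℂ) :
    midLegs (M * N) = midLegs M * midLegs N := by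
  ext ⟨⟨a, b⟩, ⟨c, d⟩⟩ ⟨⟨a', b'⟩, ⟨c', d'⟩⟩
  simp only [midLegs, Matrix.mul_apply, Fintype.sum_prod_type]
  by_cases h1 : a = a' <;> by_cases h2 : d = d' <;>
    simp [h1, h2, ite_and, -Fin.sum_univ_two]

theorem midLegs_one : midLegs 1 = 1 := by
  ext ⟨⟨a, b⟩, ⟨c, d⟩⟩ ⟨⟨a', b'⟩, ⟨c', d'⟩⟩
  simp only [midLegs, Matrix.one_apply, Prod.mk.injEq, ← ite_and]
  congr 1
  simp only [eq_iff_iff]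
  tauto

/-- `R̂ = P R` for `SL_q(2)`. -/
def slBraid (q : ℂ) : Matrix (Fin 2 × Fin 2) (Fin 2 × Fin 2) ℂ := permMatrix (Fin 2) * slR q

/-- The inverse of `R̂`. -/
def slBraidInv (q : ℂ) : Matrix (Fin 2 × Fin 2) (Fin 2 × Fin 2) ℂ :=
  slR q⁻¹ * permMatrix (Fin 2)

variable {q : ℂ}

theorem slBraid_mul_inv (hq : q ≠ 0) : slBraid q * slBraidInv q = 1 := by
  rw [slBraid, slBraidInv, mul_assoc, ← mul_assoc (slR q), slR_mul_slR_inv hq, one_mul,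
    permMatrix_mul_self]

theorem slBraid_inv_mul (hq : q ≠ 0) : slBraidInv q * slBraid q = 1 := by
  rw [slBraid, slBraidInv, mul_assoc, ← mul_assoc (permMatrix _), permMatrix_mul_self, one_mul,
    slR_inv_mul_slR hq]

theorem slBraid_mul_self (hq : q ≠ 0) :
    slBraid q * slBraid q = (q - q⁻¹) • slBraid q + 1 := by
  ext ⟨i, k⟩ ⟨j, l⟩
  rw [Matrix.mul_apply, Fintype.sum_prod_type]
  simp only [slBraid, Fin.sum_univ_two, Matrix.add_apply, Matrix.smul_apply, Matrix.one_apply,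
    permMatrix_mul_apply, Prod.swap_prod_mk, smul_eq_mul]
  fin_cases i <;> fin_cases k <;> fin_cases j <;> fin_cases l <;> simp [slR_apply] <;>
    (try field_simp) <;> (try ring)

theorem midLegs_mul_apply (N : Matrix (Fin 2 × Fin 2) (Fin 2 × Fin 2) ℂ)
    (M : Matrix ((Fin 2 × Fin 2) × (Fin 2 × Fin 2)) ((Fin 2 × Fin 2) × (Fin 2 × Fin 2)) ℂ)
    (x y : (Fin 2 × Fin 2) × (Fin 2 × Fin 2)) : (midLegs N * M) x y =
      ∑ b, ∑ a, N (x.1.2, x.2.1) (b, a) * M ((x.1.1, b), (a, x.2.2)) y := by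
  simp [Matrix.mul_apply, Fintype.sum_prod_type, midLegs, ite_and, -Fin.sum_univ_two]

theorem mul_midLegs_apply (N : Matrix (Fin 2 × Fin 2) (Fin 2 × Fin 2) ℂ)
    (M : Matrix ((Fin 2 × Fin 2) × (Fin 2 × Fin 2)) ((Fin 2 × Fin 2) × (Fin 2 × Fin 2)) ℂ)
    (x y : (Fin 2 × Fin 2) × (Fin 2 × Fin 2)) : (M * midLegs N) x y =
      ∑ b, ∑ a, M x ((y.1.1, b), (a, y.2.2)) * N (b, a) (y.1.2, y.2.1) := by
  simp [Matrix.mul_apply, Fintype.sum_prod_type, midLegs, ite_and, -Fin.sum_univ_two]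

theorem permMatrix_mul_lorentzR (hq : q ≠ 0) :
    permMatrix (Fin 2 × Fin 2) * lorentzR q =
      midLegs (slBraidInv q) * (slBraid q ⊗ₖ slBraid q) * midLegs (slBraid q) := by
  ext x y
  rw [permMatrix_mul_apply, lorentzR, mul_assoc, midLegs_mul_apply, inv_slR hq]
  simp only [mul_midLegs_apply, slBraid, slBraidInv, permMatrix_mul_apply, mul_permMatrix_apply,
    Matrix.kroneckerMap_apply, Prod.fst_swap, Prod.snd_swap, Prod.swap_prod_mk,
    Fin.sum_univ_two]
  ring

theorem exists_permMatrix_mul_lorentzR (hq : q ≠ 0) :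
    ∃ X Y : Matrix ((Fin 2 × Fin 2) × (Fin 2 × Fin 2)) ((Fin 2 × Fin 2) × (Fin 2 × Fin 2)) ℂ,
      permMatrix (Fin 2 × Fin 2) * lorentzR q = X * Y ∧ X * Y = Y * X ∧
      X * X = (q - q⁻¹) • X + 1 ∧ Y * Y = (q - q⁻¹) • Y + 1 := by
  set U := midLegs (slBraid q)
  set V := midLegs (slBraidInv q)
  have hVU : V * U = 1 := by rw [← midLegs_mul, slBraid_inv_mul hq, midLegs_one]
  have hUV : U * V = 1 := by rw [← midLegs_mul, slBraid_mul_inv hq, midLegs_one]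
  set K := slBraid q ⊗ₖ (1 : Matrix (Fin 2 × Fin 2) (Fin 2 × Fin 2) ℂ) with hK
  set L := (1 : Matrix (Fin 2 × Fin 2) (Fin 2 × Fin 2) ℂ) ⊗ₖ slBraid q with hL
  have hKL : K * L = slBraid q ⊗ₖ slBraid q := by
    rw [hK, hL, ← Matrix.mul_kronecker_mul, one_mul, mul_one]
  have hLK : L * K = slBraid q ⊗ₖ slBraid q := by
    rw [hK, hL, ← Matrix.mul_kronecker_mul, one_mul, mul_one]
  have hKK : K * K = (q - q⁻¹) • K + 1 := by
    rw [hK, ← Matrix.mul_kronecker_mul, one_mul, slBraid_mul_self hq, Matrix.add_kronecker,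
      Matrix.smul_kronecker, Matrix.one_kronecker_one]
  have hLL : L * L = (q - q⁻¹) • L + 1 := by
    rw [hL, ← Matrix.mul_kronecker_mul, one_mul, slBraid_mul_self hq, Matrix.kronecker_add,
      Matrix.kronecker_smul, Matrix.one_kronecker_one]
  have conj : ∀ M N, V * M * U * (V * N * U) = V * (M * N) * U := fun M N => by
    rw [mul_assoc (V * M), mul_assoc V N, ← mul_assoc U, hUV, one_mul]
    simp only [mul_assoc]
  refine ⟨V * K * U, V * L * U, ?_, ?_, ?_, ?_⟩
  · rw [conj, hKL, permMatrix_mul_lorentzR hq]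
  · rw [conj, conj, hKL, hLK]
  · rw [conj, hKK, mul_add, add_mul, mul_one, hVU, mul_smul_comm, smul_mul_assoc]
  · rw [conj, hLL, mul_add, add_mul, mul_one, hVU, mul_smul_comm, smul_mul_assoc]

theorem isUnit_permMatrix {ι : Type*} [Fintype ι] [DecidableEq ι] : IsUnit (permMatrix ι) :=
  IsUnit.of_mul_eq_one _ permMatrix_mul_self

theorem isUnit_lorentzR (hq : q ≠ 0) : IsUnit (lorentzR q) := by
  obtain ⟨X, Y, h, -, hX, hY⟩ := exists_permMatrix_mul_lorentzR hq
  have key : ∀ X : Matrix ((Fin 2 × Fin 2) × (Fin 2 × Fin 2)) ((Fin 2 × Fin 2) × (Fin 2 × Fin 2)) ℂ,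
      X * X = (q - q⁻¹) • X + 1 → IsUnit X := by
    intro X hX
    refine IsUnit.of_mul_eq_one (X - (q - q⁻¹) • 1) ?_
    rw [mul_sub, hX, mul_smul_comm, mul_one]
    abel
  have e : lorentzR q = permMatrix _ * (X * Y) := by
    rw [← h, ← mul_assoc, permMatrix_mul_self, one_mul]
  rw [e]
  exact isUnit_permMatrix.mul ((key X hX).mul (key Y hY))

variable (q) (μ : ℂ)

theorem permMatrix_mul_lorentzR' : permMatrix (Fin 2 × Fin 2) * lorentzR' q μ =
    1 + μ • ((permMatrix (Fin 2 × Fin 2) * lorentzR q - (q ^ 2)⁻¹ • 1) *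
      (permMatrix (Fin 2 × Fin 2) * lorentzR q - q ^ 2 • 1)) := by
  rw [lorentzR', mul_add, permMatrix_mul_self, mul_smul_comm, mul_assoc, ← mul_assoc (permMatrix _),
    permMatrix_mul_self, one_mul]

theorem lorentz_hecke (hq : q ≠ 0) : (permMatrix (Fin 2 × Fin 2) * lorentzR q + 1) *
    (permMatrix (Fin 2 × Fin 2) * lorentzR' q μ - 1) = 0 := by
  obtain ⟨X, Y, h, hXY, hX, hY⟩ := exists_permMatrix_mul_lorentzR hq
  rw [permMatrix_mul_lorentzR', add_sub_cancel_left, mul_smul_comm, h,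
    cubic_of_commute hq hXY hX hY, smul_zero]

theorem lorentz_flip_comm :
    flipLegs (lorentzR q) * lorentzR' q μ = flipLegs (lorentzR' q μ) * lorentzR q := by
  rw [flipLegs_eq, flipLegs_eq, mul_assoc _ _ (lorentzR' q μ), mul_assoc _ _ (lorentzR q),
    permMatrix_mul_lorentzR']
  set Z := permMatrix (Fin 2 × Fin 2) * lorentzR q
  have h : Commute Z ((Z - (q ^ 2)⁻¹ • 1) * (Z - q ^ 2 • 1)) :=
    ((Commute.refl Z).sub_right ((Commute.one_right Z).smul_right _)).mul_right
      ((Commute.refl Z).sub_right ((Commute.one_right Z).smul_right _))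
  exact (Commute.one_right Z).add_right (h.smul_right μ)

theorem relation_lorentzR' {S : Type*} [Ring S] [Algebra ℂ S]
    {t : Fin 2 × Fin 2 → Fin 2 × Fin 2 → S} (h : MatrixRelation (lorentzR q) t t) :
    MatrixRelation (lorentzR' q μ) t t :=
  h.of_permMatrix_mul (permMatrix_mul_lorentzR' q μ)

end LorentzMatrix

/-- `SO_q(1,3)` with the matrices `R`, `R'`, and a dual quasitriangular structure. -/
def lorentzData (q μ c : ℂ) [NeZero q] (hc : c ^ 2 = q⁻¹) (hμ : IsUnit (lorentzR' q μ)) :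
    QuantumGroupData (Fin 2 × Fin 2) (LorentzGroup q) :=
  have hd := isDualQuasitriangular_lorentzForm (q := q) hc
  have hR := relation_lorentzR (q := q) hc
  have hq : q⁻¹ ≠ 0 := inv_ne_zero (NeZero.ne q)
  have hr := lorentzForm_lorentzMatrix (q := q) hc
  { R := lorentzR q
    R' := lorentzR' q μ
    isUnit_R := isUnit_lorentzR (NeZero.ne q)
    isUnit_R' := hμ
    yangBaxter := hR.leg12_leg13_leg23 comul_lorentzMatrix hd.isSkewPairing hq hr
    mixed_left := (relation_lorentzR' q μ hR).leg12_leg13_leg23 comul_lorentzMatrix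
      hd.isSkewPairing hq hr
    mixed_right := (relation_lorentzR' q μ hR).leg23_leg13_leg12 comul_lorentzMatrix
      hd.isSkewPairing hq hr
    hecke := lorentz_hecke q μ (NeZero.ne q)
    flip_comm := lorentz_flip_comm q μ
    hasAntipode := hasAntipode_lorentzGroup
    t := lorentzMatrix q
    generates := adjoin_lorentzMatrix
    comul_t := comul_lorentzMatrix
    counit_t := counit_lorentzMatrix
    relation_R := hR
    relation_R' := relation_lorentzR' q μ hR
    r := lorentzForm hc
    dualQuasitriangular := hd
    lam := q⁻¹
    lam_ne_zero := hq
    r_t := hr }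

end QPoincare
end

theorem corollary9 :
    (∀ (ι : Type*) [Fintype ι] [DecidableEq ι] (A : Type*) [Ring A] [Bialgebra ℂ A]
      (D : QPoincare.QuantumGroupData ι A), D.DualIsSemidirect ∧ D.LeftDualIsSemidirect) ∧
    (∀ (q μ : ℂ) [NeZero q], μ ≠ 0 → IsUnit (QPoincare.lorentzR' q μ) →
      ∃ D : QPoincare.QuantumGroupData (Fin 2 × Fin 2) (QPoincare.LorentzGroup q),
        D.R = QPoincare.lorentzR q ∧ D.R' = QPoincare.lorentzR' q μ ∧ D.lam = q⁻¹ ∧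
        D.t = QPoincare.lorentzMatrix q ∧ D.DualIsSemidirect ∧ D.LeftDualIsSemidirect) := by
  refine ⟨fun ι _ _ A _ _ D => ⟨D.dualIsSemidirect, D.leftDualIsSemidirect⟩,
    fun q μ _ _ hR => ?_⟩
  obtain ⟨c, hc⟩ := IsAlgClosed.exists_pow_nat_eq q⁻¹ two_pos
  let D := QPoincare.lorentzData q μ c hc hR
  exact ⟨D, rfl, rfl, rfl, rfl, D.dualIsSemidirect, D.leftDualIsSemidirect⟩
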